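/- Rings are associative, not necessarily unital. An \emph{odd form ring} $(R,\Delta)$ consists of a ring $R$ with an involution $x\mapsto\bar x$, a group $\Delta$ (operation $\dotplus$, inverse $\dotminus$, neutral element $\dot 0$), a right action $(u,a)\mapsto u\cdot a$ of the multiplicative semigroup of $R$ on $\Delta$ by endomorphisms, and maps $\phi\colon R\to\Delta$, $\pi,\rho\colon\Delta\to R$ such that for all $u,v\in\Delta$, $a,b\in R$: $\pi(u\dotplus v)=\pi(u)+\pi(v)$; $\pi(u\cdot a)=\pi(u)a$; $\phi(a+b)=\phi(a)\dotplus\phi(b)$; $\phi(b)\cdot a=\phi(\bar a b a)$; $\rho(u\dotplus v)=\rho(u)-\overline{\pi(u)}\pi(v)+\rho(v)$; $\rho(u\cdot a)=\bar a\rho(u)a$; $\rho(u)+\overline{\rho(u)}+\overline{\pi(u)}\pi(u)=0$; $\pi(\phi(a))=0$; $\rho(\phi(a))=a-\bar a$; $[u,v]=\phi(-\overline{\pi(u)}\pi(v))$; $\phi(a)=\dot 0$ if $a=\bar a$; $u\cdot(a+b)=u\cdot a\dotplus\phi(\bar b\rho(u)a)\dotplus u\cdot b$. Here and below $[x,y]=xyx^{-1}y^{-1}$.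 The \emph{unitary group} $U(R,\Delta)$ is the set of $g=(\beta(g),\gamma(g))\in R\times\Delta$ such that $\alpha(g)=\beta(g)+1$ (in the unitalization $R\rtimes\mathbb Z$ of $R$) is invertible with inverse $\overline{\alpha(g)}$, $\pi(\gamma(g))=\beta(g)$ and $\rho(\gamma(g))=\overline{\beta(g)}$; the group operation is $\alpha(gh)=\alpha(g)\alpha(h)$, $\gamma(gh)=\gamma(g)\cdot\alpha(h)\dotplus\gamma(h)$, where $u\cdot(b+1)=u\cdot b\dotplus\phi(\rho(u)b)\dotplus u$. A \emph{hyperbolic pair} is $\eta=(e_{-\eta},e_\eta,q_{-\eta},q_\eta)$ with orthogonal idempotents $e_{-\eta}=\overline{e_\eta}$, $e_\eta$ in $R$ and $q_{\pm\eta}\in\Delta$ such that $\pi(q_{\pm\eta})=e_{\pm\eta}$, $\rho(q_{\pm\eta})=0$, $q_{\pm\eta}=q_{\pm\eta}\cdot e_{\pm\eta}$; put $e_{|\eta|}=e_\eta+e_{-\eta}$ and let $-\eta$ be the pair with the signs exchanged. For $u\in\Delta\cdot e_\eta$ with $e_{|\eta|}\pi(u)=0$ the transvection $T^\eta(u)\in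 U(R,\Delta)$ is given by $\beta=\rho(u)+\pi(u)-\overline{\pi(u)}$, $\gamma=u\dotplus q_{-\eta}\cdot(\rho(u)-\overline{\pi(u)})\dotminus\phi(\rho(u)+\pi(u))$. For $a\in(e_\eta Re_\eta)^*$ with inverse $a^{-1}$ in the ring $e_\eta R e_\eta$ the dilation $D^\eta(a)\in U(R,\Delta)$ is given by $\beta=a+\overline{a^{-1}}-e_{|\eta|}$, $\gamma=q_{-\eta}\cdot(\overline{a^{-1}}-e_{-\eta})\dotplus q_\eta\cdot(a-e_\eta)\dotminus\phi(a-e_\eta)$. An \emph{orthogonal hyperbolic family of rank $n$} is a family $\eta_1,\dots,\eta_n$ of hyperbolic pairs such that the idempotents $e_{|\eta_i|}$ are pairwise orthogonal and pairwise Morita equivalent ($e,f$ are Morita equivalent if $e\in RfR$ and $f\in ReR$). Put $\eta_{-i}=-\eta_i$, write $e_i,q_i$ for $e_{\eta_i},q_{\eta_i}$ ($0<|i|\le n$), and let $e=\sum_{i=1}^n e_{|\eta_i|}$, $R_{ij}=e_iRe_j$, $\Delta^0_i=\{u\in\Delta\cdot e_i\mid e\,\pi(u)=0\}$. The elementary transvections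 are $T_{ij}(a)=T^{\eta_j}(q_i\cdot a)$ for $a\in R_{ij}$, $i\ne\pm j$, and $T_i(u)=T^{\eta_i}(u)$ for $u\in\Delta^0_i$. The \emph{diagonal group} $D(R,\Delta)\le U(R,\Delta)$ is generated by all $D_i(a)=D^{\eta_i}(a)$, $a\in R_{ii}^*$, and all $D_0(g)=g$ with $g\in U(R,\Delta)$, $\beta(g)e=0=e\beta(g)$, $\gamma(g)\cdot e=\dot 0$. The \emph{Steinberg group} $\mathrm{StU}(R,\Delta)$ has generators $X_{ij}(a)$ ($0<|i|,|j|\le n$, $i\ne\pm j$, $a\in R_{ij}$) and $X_i(u)$ ($0<|i|\le n$, $u\in\Delta^0_i$) and relations $X_{ij}(a)=X_{-j,-i}(-\bar a)$; $X_{ij}(a)X_{ij}(b)=X_{ij}(a+b)$; $X_i(u)X_i(v)=X_i(u\dotplus v)$; $[X_{ij}(a),X_{kl}(b)]=1$ for $i\ne l\ne -j\ne -k\ne i$; $[X_{ij}(a),X_{jk}(b)]=X_{ik}(ab)$ for $i\ne\pm k$; $[X_{ij}(a),X_{j,-i}(b)]=X_{-i}(\phi(ab))$; $[X_i(u),X_j(v)]=X_{-i,j}(-\overline{\pi(u)}\pi(v))$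 for $i\ne\pm j$; $[X_i(u),X_{jk}(a)]=1$ for $j\ne i\ne -k$; $[X_i(u),X_{ij}(a)]=X_{-i,j}(\rho(u)a)\,X_j(\dotminus(u\cdot(-a)))$. A ring $A$ is \emph{semi-local} if $A/J(A)$ is a unital semisimple ring, where $J(A)$ is the set of elements that generate two-sided ideals consisting of quasi-invertible elements ($x$ is quasi-invertible if it is invertible for the operation $x\circ y=xy+x+y$). A \emph{crossed module} is a group homomorphism $d\colon H\to G$ with an action of $G$ on $H$ by automorphisms such that $d({}^gh)=g\,d(h)\,g^{-1}$ and ${}^{d(h)}h'=hh'h^{-1}$. \textbf{Theorem.} Let $(R,\Delta)$ be an odd form ring with an orthogonal hyperbolic family of rank $n\ge 3$. Suppose that $R$ is semi-local. Then there are a (unique) homomorphism $\mathrm{st}\colon\mathrm{StU}(R,\Delta)\to U(R,\Delta)$ with $X_{ij}(a)\mapsto T_{ij}(a)$, $X_i(u)\mapsto T_i(u)$, and a (unique) action of $D(R,\Delta)$ on $\mathrm{StU}(R,\Delta)$ by automorphisms such that, for all non-zero indices, ${}^{D_i(a)}X_{jk}(b)=X_{jk}(b)$ for $j\ne\pm i\ne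 k$; ${}^{D_0(g)}X_{ij}(a)=X_{ij}(a)$; ${}^{D_i(a)}X_{ij}(b)=X_{ij}(ab)$; ${}^{D_i(a)}X_j(u)=X_j(u)$ for $i\ne\pm j$; ${}^{D_0(g)}X_i(u)=X_i(\gamma(g)\cdot\pi(u)\dotplus u)$; ${}^{D_i(a)}X_i(u)=X_i(u\cdot a^{-1})$. Moreover, there is a unique action of $U(R,\Delta)$ on $\mathrm{StU}(R,\Delta)$ by automorphisms making $\mathrm{st}$ a crossed module, and it is consistent with the action of $\mathrm{StU}(R,\Delta)\rtimes D(R,\Delta)$ (in which the first factor acts by conjugation): for $h\in\mathrm{StU}(R,\Delta)$ and $d\in D(R,\Delta)$ the element $\mathrm{st}(h)\,d\in U(R,\Delta)$ acts on $\mathrm{StU}(R,\Delta)$ as $x\mapsto h\,({}^dx)\,h^{-1}$. -/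

import Mathlib

universe u v

set_option linter.unusedSimpArgs false

/-- An odd form ring `(R, Δ)`: `R` is a non-unital ring with involution `star`, `Δ` is a (not
necessarily commutative) group written additively, the multiplicative semigroup of `R` acts on `Δ`
from the right by endomorphisms (`act`), and `φ`, `π`, `ρ` are the structure maps. -/
structure OddFormRing (R : Type u) (Δ : Type v) [NonUnitalRing R] [StarRing R] [AddGroup Δ] where
  act : Δ → R → Δ
  φ : R → Δ
  π : Δ → R
  ρ : Δ → R
  add_act : ∀ u v a, act (u + v) a = act u a + act v a
  act_mul : ∀ u a b, act u (a * b) = act (act u a) b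
  π_add : ∀ u v, π (u + v) = π u + π v
  π_act : ∀ u a, π (act u a) = π u * a
  φ_add : ∀ a b, φ (a + b) = φ a + φ b
  φ_act : ∀ a b, act (φ b) a = φ (star a * b * a)
  ρ_add : ∀ u v, ρ (u + v) = ρ u - star (π u) * π v + ρ v
  ρ_act : ∀ u a, ρ (act u a) = star a * ρ u * a
  ρ_add_star : ∀ u, ρ u + star (ρ u) + star (π u) * π u = 0
  π_φ : ∀ a, π (φ a) = 0
  ρ_φ : ∀ a, ρ (φ a) = a - star a
  commutator : ∀ u v, u + v + -u + -v = φ (-(star (π u) * π v))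
  φ_eq_zero : ∀ a, a = star a → φ a = 0
  act_add : ∀ u a b, act u (a + b) = act u a + φ (star b * ρ u * a) + act u b

namespace OddFormRing

variable {R : Type u} {Δ : Type v} [NonUnitalRing R] [StarRing R] [AddGroup Δ]
variable (O : OddFormRing R Δ)

/-! ### Elementary consequences of the axioms -/

theorem φ_zero : O.φ 0 = 0 := O.φ_eq_zero 0 (by simp)

theorem π_zero : O.π 0 = 0 := by simpa using O.π_add 0 0

theorem ρ_zero : O.ρ 0 = 0 := by simpa [O.π_zero] using O.ρ_add 0 0

theorem act_zero (u : Δ) : O.act u 0 = 0 := by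
  simpa [O.φ_zero] using O.act_add u 0 0

theorem zero_act (a : R) : O.act 0 a = 0 := by simpa using O.add_act 0 0 a

theorem π_neg (u : Δ) : O.π (-u) = -O.π u := by
  have h := O.π_add u (-u)
  rw [add_neg_cancel, O.π_zero] at h
  exact (neg_eq_of_add_eq_zero_right h.symm).symm

theorem ρ_neg (u : Δ) : O.ρ (-u) = star (O.ρ u) := by
  have h := O.ρ_add u (-u)
  have h' := O.ρ_add_star u
  rw [add_neg_cancel, O.ρ_zero, O.π_neg, mul_neg, sub_neg_eq_add] at h
  have : O.ρ u + star (O.π u) * O.π u + O.ρ (-u)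
      = O.ρ u + star (O.π u) * O.π u + star (O.ρ u) := by
    rw [← h, ← h']; abel
  exact add_left_cancel this

theorem φ_neg (a : R) : O.φ (-a) = -O.φ a := by
  have h := O.φ_add a (-a)
  rw [add_neg_cancel, O.φ_zero] at h
  exact (neg_eq_of_add_eq_zero_right h.symm).symm

theorem φ_star (a : R) : O.φ (star a) = -O.φ a := by
  have h := O.φ_add a (star a)
  rw [O.φ_eq_zero (a + star a) (by simp [add_comm])] at h
  exact (neg_eq_of_add_eq_zero_right h.symm).symm

theorem add_eq (u v : Δ) : u + v = O.φ (-(star (O.π u) * O.π v)) + v + u := by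
  rw [← O.commutator]; simp [add_assoc]

theorem φ_comm (a : R) (u : Δ) : O.φ a + u = u + O.φ a := by
  rw [O.add_eq (O.φ a) u, O.π_φ]; simp [O.φ_zero]

theorem neg_act (u : Δ) (a : R) : O.act (-u) a = -O.act u a := by
  have h := O.add_act u (-u) a
  rw [add_neg_cancel, O.zero_act] at h
  exact (neg_eq_of_add_eq_zero_right h.symm).symm

/-- The action of `b ∈ R`, as an endomorphism of `Δ`. -/
def actHom (b : R) : Δ →+ Δ where
  toFun u := O.act u b
  map_zero' := O.zero_act b
  map_add' u v := O.add_act u v b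

/-- The first structure map `π`, as a homomorphism. -/
def πHom : Δ →+ R where
  toFun := O.π
  map_zero' := O.π_zero
  map_add' := O.π_add

/-- The element `u · (b + 1)`, where `b + 1` lies in the unitalization of `R`. -/
def act1 (u : Δ) (b : R) : Δ := O.act u b + O.φ (O.ρ u * b) + u

theorem act1_zero (u : Δ) : O.act1 u 0 = u := by
  simp [act1, O.act_zero, O.φ_zero]

theorem zero_act1 (a : R) : O.act1 0 a = 0 := by
  simp [act1, O.zero_act, O.ρ_zero, O.φ_zero]

theorem add_φ (u : Δ) (a : R) : u + O.φ a = O.φ a + u := (O.φ_comm a u).symm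

theorem add_φ_add (u : Δ) (a : R) (w : Δ) : u + (O.φ a + w) = O.φ a + (u + w) := by
  rw [← add_assoc, O.add_φ, add_assoc]

theorem φ_add_φ (a b : R) : O.φ a + O.φ b = O.φ (a + b) := (O.φ_add a b).symm

theorem φ_add_φ_add (a b : R) (w : Δ) : O.φ a + (O.φ b + w) = O.φ (a + b) + w := by
  rw [O.φ_add, add_assoc]

theorem add_act1 (u v : Δ) (b : R) : O.act1 (u + v) b = O.act1 u b + O.act1 v b := by
  unfold act1
  have h : ∀ w, u + (O.act v b + w)
      = O.φ (-(star (O.π u) * (O.π v * b))) + (O.act v b + (u + w)) := by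
    intro w
    rw [← add_assoc, O.add_eq u, O.π_act]; simp only [add_assoc]
  rw [O.add_act]
  generalize O.act u b = x at *
  generalize O.act v b = y at *
  simp only [add_assoc, O.add_φ_add u, O.add_φ_add x, O.add_φ_add y, h,
    O.φ_add_φ_add, O.ρ_add]
  congr 2
  noncomm_ring

theorem π_act1 (u : Δ) (b : R) : O.π (O.act1 u b) = O.π u * b + O.π u := by
  simp [act1, O.π_add, O.π_act, O.π_φ]

theorem ρ_act1 (u : Δ) (b : R) :
    O.ρ (O.act1 u b) = star b * O.ρ u * b + star b * O.ρ u + O.ρ u * b + O.ρ u := by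
  have h : star (O.π u) * O.π u = -O.ρ u - star (O.ρ u) := by
    rw [eq_comm, ← sub_eq_zero, ← neg_eq_zero, ← O.ρ_add_star u]; abel
  simp only [act1, O.ρ_add, O.ρ_act, O.ρ_φ, O.π_add, O.π_act, O.π_φ, star_mul,
    mul_zero, add_zero, mul_assoc, h, mul_sub, mul_neg]
  abel

theorem act1_act1 (u : Δ) (a b : R) :
    O.act1 (O.act1 u a) b = O.act1 u (a * b + a + b) := by
  have h : ∀ w, O.act u b + (O.act u a + w)
      = O.φ (star b * (O.ρ u * a) + star b * (star (O.ρ u) * a))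
        + (O.act u a + (O.act u b + w)) := by
    intro w
    have h : star (O.π u) * O.π u = -O.ρ u - star (O.ρ u) := by
      rw [eq_comm, ← sub_eq_zero, ← neg_eq_zero, ← O.ρ_add_star u]; abel
    have : -(star (O.π u * b) * (O.π u * a))
        = star b * (O.ρ u * a) + star b * (star (O.ρ u) * a) := by
      rw [star_mul, mul_assoc, ← mul_assoc (star (O.π u)), h]; noncomm_ring
    rw [← add_assoc, O.add_eq (O.act u b), O.π_act, O.π_act, this]; simp only [add_assoc]
  have h2 : O.φ (star b * (star (O.ρ u) * a)) = O.φ (-(star a * (O.ρ u * b))) := by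
    rw [O.φ_neg, ← O.φ_star]; simp [mul_assoc]
  have e1 : O.act1 (O.act1 u a) b = O.act (O.act1 u a) b + O.φ (O.ρ (O.act1 u a) * b)
      + O.act1 u a := rfl
  rw [e1, O.ρ_act1]
  unfold act1
  rw [O.add_act, O.add_act, O.φ_act, ← O.act_mul, O.act_add u (a * b + a), O.act_add u (a * b)]
  generalize O.act u (a * b) = z at *
  generalize O.act u a = x at *
  generalize O.act u b = y at *
  simp only [O.φ_add] at h
  simp only [h2] at h
  simp only [add_assoc, O.add_φ_add x, O.add_φ_add y, O.add_φ_add z, h,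
    O.φ_add_φ_add]
  congr 2
  simp only [star_add, star_mul, mul_add, add_mul, mul_assoc]
  abel

theorem neg_act1 (u : Δ) (b : R) : O.act1 (-u) b = -O.act1 u b := by
  have h := O.add_act1 u (-u) b
  rw [add_neg_cancel, O.zero_act1] at h
  exact (neg_eq_of_add_eq_zero_right h.symm).symm

/-! ### The unitary group -/

/-- Elements of the unitary group `U(R, Δ)`. With `α = β + 1`, the first two conditions say that
`α` is invertible with inverse `star α`. -/
@[ext]
structure Unitary where
  β : R
  γ : Δ
  β_mul_star : β + star β + β * star β = 0
  star_β_mul : β + star β + star β * β = 0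
  π_γ : O.π γ = β
  ρ_γ : O.ρ γ = star β

namespace Unitary

variable {O}

/-- The group operation of `U(R, Δ)`: `α (g h) = α g * α h` and `γ (g h) = γ g · α h + γ h`. -/
instance : Mul O.Unitary where
  mul g h :=
    { β := g.β * h.β + g.β + h.β
      γ := O.act1 g.γ h.β + h.γ
      β_mul_star := by
        have h1 := g.β_mul_star
        have h2 := h.β_mul_star
        simp only [star_add, star_mul]
        have : g.β * h.β + g.β + h.β + (star h.β * star g.β + star g.β + star h.β)
          + (g.β * h.β + g.β + h.β) * (star h.β * star g.β + star g.β + star h.β)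
          = (g.β + star g.β + g.β * star g.β) + (h.β + star h.β + h.β * star h.β)
            + g.β * (h.β + star h.β + h.β * star h.β)
            + (h.β + star h.β + h.β * star h.β) * star g.β
            + g.β * (h.β + star h.β + h.β * star h.β) * star g.β := by
          simp only [mul_add, add_mul, mul_assoc]; abel
        rw [this, h1, h2]; simp
      star_β_mul := by
        have h1 := g.star_β_mul
        have h2 := h.star_β_mul
        simp only [star_add, star_mul]
        have : g.β * h.β + g.β + h.β + (star h.β * star g.β + star g.β + star h.β)
          + (star h.β * star g.β + star g.β + star h.β) * (g.β * h.β + g.β + h.β)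
          = (h.β + star h.β + star h.β * h.β) + (g.β + star g.β + star g.β * g.β)
            + star h.β * (g.β + star g.β + star g.β * g.β)
            + (g.β + star g.β + star g.β * g.β) * h.β
            + star h.β * (g.β + star g.β + star g.β * g.β) * h.β := by
          simp only [mul_add, add_mul, mul_assoc]; abel
        rw [this, h1, h2]; simp
      π_γ := by rw [O.π_add, O.π_act1, g.π_γ, h.π_γ]
      ρ_γ := by
        rw [O.ρ_add, O.π_act1, O.ρ_act1, g.π_γ, h.π_γ, g.ρ_γ, h.ρ_γ]
        simp only [star_add, star_mul, add_mul, mul_assoc]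
        abel }

instance : One O.Unitary where
  one :=
    { β := 0
      γ := 0
      β_mul_star := by simp
      star_β_mul := by simp
      π_γ := O.π_zero
      ρ_γ := by simp [O.ρ_zero] }

instance : Inv O.Unitary where
  inv g :=
    { β := star g.β
      γ := -O.act1 g.γ (star g.β)
      β_mul_star := by rw [star_star, add_comm (star g.β)]; exact g.star_β_mul
      star_β_mul := by rw [star_star, add_comm (star g.β)]; exact g.β_mul_star
      π_γ := by
        rw [O.π_neg, O.π_act1, g.π_γ, neg_eq_iff_add_eq_zero, ← g.β_mul_star]; abel
      ρ_γ := by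
        rw [O.ρ_neg, O.ρ_act1, g.ρ_γ]
        have h := g.β_mul_star
        have h3 : g.β * star g.β = -g.β - star g.β := by
          rw [eq_comm, ← sub_eq_zero, ← neg_eq_zero, ← h]; abel
        have h4 : star g.β * star g.β = star (g.β * g.β) := by simp
        simp only [star_add, star_mul, star_star, mul_assoc, h3]
        simp only [star_sub, star_neg, star_star, mul_sub, mul_neg, h3]
        abel }

theorem mul_β (g h : O.Unitary) : (g * h).β = g.β * h.β + g.β + h.β := rfl
theorem mul_γ (g h : O.Unitary) : (g * h).γ = O.act1 g.γ h.β + h.γ := rfl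
theorem one_β : (1 : O.Unitary).β = 0 := rfl
theorem one_γ : (1 : O.Unitary).γ = 0 := rfl
theorem inv_β (g : O.Unitary) : (g⁻¹).β = star g.β := rfl
theorem inv_γ (g : O.Unitary) : (g⁻¹).γ = -O.act1 g.γ (star g.β) := rfl

instance : Group O.Unitary :=
  Group.ofLeftAxioms
    (by
      intro a b c
      ext
      · simp only [mul_β, add_mul, mul_add, mul_assoc]; abel
      · simp only [mul_γ, mul_β, O.add_act1, O.act1_act1, add_assoc])
    (by
      intro a
      ext
      · simp [mul_β, one_β]
      · simp [mul_γ, one_γ, O.zero_act1])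
    (by
      intro a
      ext
      · rw [mul_β, inv_β, one_β, ← a.star_β_mul]; abel
      · have h : star a.β * a.β + star a.β + a.β = 0 := by rw [← a.star_β_mul]; abel
        rw [mul_γ, inv_γ, one_γ, O.neg_act1, O.act1_act1, h, O.act1_zero, neg_add_cancel])

end Unitary

/-! ### Hyperbolic pairs -/

/-- A hyperbolic pair `η = (e', e, q', q)`, where `e = e_η`, `q = q_η`, `e' = e_{-η}`,
`q' = q_{-η}`. -/
structure HyperbolicPair where
  e : R
  e' : R
  q : Δ
  q' : Δ
  idem : IsIdempotentElem e
  mul_e' : e * e' = 0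
  e'_mul : e' * e = 0
  e'_eq : e' = star e
  π_q : O.π q = e
  π_q' : O.π q' = e'
  ρ_q : O.ρ q = 0
  ρ_q' : O.ρ q' = 0
  q_act : q = O.act q e
  q'_act : q' = O.act q' e'

namespace HyperbolicPair

variable {O}
variable (η : O.HyperbolicPair)

/-- The opposite hyperbolic pair `-η`. -/
instance : Neg O.HyperbolicPair where
  neg η :=
    { e := η.e'
      e' := η.e
      q := η.q'
      q' := η.q
      idem := by
        have h : star (η.e * η.e) = star η.e := congrArg star η.idem.eq
        rw [star_mul, ← η.e'_eq] at h
        exact h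
      mul_e' := η.e'_mul
      e'_mul := η.mul_e'
      e'_eq := by rw [η.e'_eq, star_star]
      π_q := η.π_q'
      π_q' := η.π_q
      ρ_q := η.ρ_q'
      ρ_q' := η.ρ_q
      q_act := η.q'_act
      q'_act := η.q_act }

/-- The idempotent `e_{|η|} = e_η + e_{-η}`. -/
def eAbs : R := η.e + η.e'

theorem star_e : star η.e = η.e' := η.e'_eq.symm

theorem star_e' : star η.e' = η.e := by rw [η.e'_eq, star_star]

theorem idem' : IsIdempotentElem η.e' := (-η).idem

theorem e_mul_eAbs : η.e * η.eAbs = η.e := by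
  rw [eAbs, mul_add, η.idem.eq, η.mul_e', add_zero]

theorem eAbs_mul_e : η.eAbs * η.e = η.e := by
  rw [eAbs, add_mul, η.idem.eq, η.e'_mul, add_zero]

theorem e'_mul_eAbs : η.e' * η.eAbs = η.e' := by
  rw [eAbs, mul_add, η.idem'.eq, η.e'_mul, zero_add]

theorem eAbs_mul_e' : η.eAbs * η.e' = η.e' := by
  rw [eAbs, add_mul, η.idem'.eq, η.mul_e', zero_add]

/-- The subgroup of all `u ∈ Δ · e_η` such that `e_{|η|} π(u) = 0`. -/
def unip : AddSubgroup Δ :=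
  (O.actHom η.e).range ⊓ ((AddMonoidHom.mulLeft η.eAbs).comp O.πHom).ker

theorem mem_unip {u : Δ} : u ∈ η.unip ↔ (∃ v, O.act v η.e = u) ∧ η.eAbs * O.π u = 0 := Iff.rfl

theorem transvection_aux (u : η.unip) :
    (O.ρ u + O.π u - star (O.π u)) * star (O.ρ u + O.π u - star (O.π u))
        = star (O.π u) * O.π u ∧
      star (O.ρ u + O.π u - star (O.π u)) * (O.ρ u + O.π u - star (O.π u))
        = star (O.π u) * O.π u ∧ η.e' * (O.ρ u - star (O.π u)) = O.ρ u - star (O.π u) ∧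
      star (O.π u) * (O.ρ u - star (O.π u)) = 0 := by
  obtain ⟨u, hu⟩ := u
  obtain ⟨⟨v, rfl⟩, h0⟩ := η.mem_unip.1 hu
  have pe : O.π (O.act v η.e) * η.e = O.π (O.act v η.e) := by
    rw [O.π_act, mul_assoc, η.idem.eq]
  have re : O.ρ (O.act v η.e) * η.e = O.ρ (O.act v η.e) := by
    rw [O.ρ_act, mul_assoc, η.idem.eq]
  have er : η.e' * O.ρ (O.act v η.e) = O.ρ (O.act v η.e) := by
    rw [O.ρ_act, η.star_e, ← mul_assoc, ← mul_assoc, η.idem'.eq]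
  have ep : η.e * O.π (O.act v η.e) = 0 := by
    have := congrArg (η.e * ·) h0
    simpa only [← mul_assoc, η.e_mul_eAbs, mul_zero] using this
  have ep' : η.e' * O.π (O.act v η.e) = 0 := by
    have := congrArg (η.e' * ·) h0
    simpa only [← mul_assoc, η.e'_mul_eAbs, mul_zero] using this
  simp only
  generalize O.π (O.act v η.e) = p at *
  generalize O.ρ (O.act v η.e) = r at *
  have es : η.e' * star p = star p := by rw [← η.star_e, ← star_mul, pe]
  have er' : η.e' * star r = star r := by rw [← η.star_e, ← star_mul, re]
  have re' : star r * η.e = star r := by rw [← η.star_e', ← star_mul, er]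
  have se' : star p * η.e' = 0 := by rw [← η.star_e, ← star_mul, ep, star_zero]
  have x1 : ∀ x y, x * η.e = x → η.e' * y = y → x * y = 0 := by
    intro x y hx hy
    rw [← hx, ← hy, mul_assoc, ← mul_assoc η.e, η.mul_e', zero_mul, mul_zero]
  have x2 : ∀ x, x * η.e = x → x * p = 0 := by
    intro x hx
    rw [← hx, mul_assoc, ep, mul_zero]
  have x3 : ∀ y, η.e' * y = y → star p * y = 0 := by
    intro y hy
    rw [← hy, ← mul_assoc, se', zero_mul]
  refine ⟨?_, ?_, ?_, ?_⟩
  · simp only [star_add, star_sub, star_star, mul_add, mul_sub, add_mul, sub_mul,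
      x1 r _ re er', x1 r _ re es, x2 r re, x1 p _ pe er', x1 p _ pe es, x2 p pe, x3 _ er', x3 _ es]
    abel
  · simp only [star_add, star_sub, star_star, mul_add, mul_sub, add_mul, sub_mul,
      x1 _ r re' er, x1 _ _ re' es, x2 _ re', x1 p _ pe er, x1 p _ pe es, x2 p pe, x3 _ er, x3 _ es]
    abel
  · rw [mul_sub, er, es]
  · rw [mul_sub, x3 _ er, x3 _ es, sub_zero]

/-- The transvection `T^η(u) ∈ U(R, Δ)`. -/
def transvection (u : η.unip) : O.Unitary where
  β := O.ρ u + O.π u - star (O.π u)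
  γ := u + O.act η.q' (O.ρ u - star (O.π u)) + -O.φ (O.ρ u + O.π u)
  β_mul_star := by
    rw [(η.transvection_aux u).1, ← O.ρ_add_star u, star_sub, star_add, star_star]; abel
  star_β_mul := by
    rw [(η.transvection_aux u).2.1, ← O.ρ_add_star u, star_sub, star_add, star_star]; abel
  π_γ := by
    rw [O.π_add, O.π_add, O.π_act, η.π_q', (η.transvection_aux u).2.2.1, O.π_neg, O.π_φ]; abel
  ρ_γ := by
    rw [O.ρ_add, O.ρ_add, O.π_add, O.π_neg, O.π_φ, O.π_act, η.π_q', (η.transvection_aux u).2.2.1,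
      (η.transvection_aux u).2.2.2, O.ρ_act, η.ρ_q', O.ρ_neg, O.ρ_φ]
    simp only [star_add, star_sub, star_star, neg_zero, mul_zero, zero_mul]
    abel

theorem dilation_aux (a : (η.idem.Corner)ˣ) :
    ((a : η.idem.Corner).1 + star (a⁻¹ : (η.idem.Corner)ˣ).1.1 - η.eAbs)
        * star ((a : η.idem.Corner).1 + star (a⁻¹ : (η.idem.Corner)ˣ).1.1 - η.eAbs)
      = -((a : η.idem.Corner).1 + star (a⁻¹ : (η.idem.Corner)ˣ).1.1 - η.eAbs)
        - star ((a : η.idem.Corner).1 + star (a⁻¹ : (η.idem.Corner)ˣ).1.1 - η.eAbs) ∧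
    star ((a : η.idem.Corner).1 + star (a⁻¹ : (η.idem.Corner)ˣ).1.1 - η.eAbs)
        * ((a : η.idem.Corner).1 + star (a⁻¹ : (η.idem.Corner)ˣ).1.1 - η.eAbs)
      = -((a : η.idem.Corner).1 + star (a⁻¹ : (η.idem.Corner)ˣ).1.1 - η.eAbs)
        - star ((a : η.idem.Corner).1 + star (a⁻¹ : (η.idem.Corner)ˣ).1.1 - η.eAbs) ∧
    η.e * (a : η.idem.Corner).1 = (a : η.idem.Corner).1 ∧
    (a⁻¹ : (η.idem.Corner)ˣ).1.1 * η.e = (a⁻¹ : (η.idem.Corner)ˣ).1.1 ∧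
    (a⁻¹ : (η.idem.Corner)ˣ).1.1 * (a : η.idem.Corner).1 = η.e := by
  have h1 : (a : η.idem.Corner).1 * (a⁻¹ : (η.idem.Corner)ˣ).1.1 = η.e :=
    congrArg Subtype.val a.mul_inv
  have h2 : (a⁻¹ : (η.idem.Corner)ˣ).1.1 * (a : η.idem.Corner).1 = η.e :=
    congrArg Subtype.val a.inv_mul
  have h3 := (Subsemigroup.mem_corner_iff η.idem).1 (a : η.idem.Corner).2
  have h4 := (Subsemigroup.mem_corner_iff η.idem).1 (a⁻¹ : (η.idem.Corner)ˣ).1.2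
  generalize (a : η.idem.Corner).1 = x at *
  generalize (a⁻¹ : (η.idem.Corner)ˣ).1.1 = y at *
  have sxe : star x * η.e' = star x := by rw [← η.star_e, ← star_mul, h3.1]
  have esx : η.e' * star x = star x := by rw [← η.star_e, ← star_mul, h3.2]
  have sye : star y * η.e' = star y := by rw [← η.star_e, ← star_mul, h4.1]
  have esy : η.e' * star y = star y := by rw [← η.star_e, ← star_mul, h4.2]
  have s1 : star y * star x = η.e' := by rw [← star_mul, h1, η.star_e]
  have s2 : star x * star y = η.e' := by rw [← star_mul, h2, η.star_e]
  have x1 : ∀ z w, z * η.e = z → η.e' * w = w → z * w = 0 := by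
    intro z w hz hw
    rw [← hz, ← hw, mul_assoc, ← mul_assoc η.e, η.mul_e', zero_mul, mul_zero]
  have x2 : ∀ z w, z * η.e' = z → η.e * w = w → z * w = 0 := by
    intro z w hz hw
    rw [← hz, ← hw, mul_assoc, ← mul_assoc η.e', η.e'_mul, zero_mul, mul_zero]
  refine ⟨?_, ?_, h3.1, h4.2, h2⟩
  · simp only [eAbs, star_add, star_sub, star_star, mul_add, mul_sub, add_mul, sub_mul, η.star_e,
      η.star_e', h1, s1, h3.1, h3.2, h4.1, h4.2, sxe, esx, sye, esy, η.idem.eq, η.idem'.eq,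
      η.mul_e', η.e'_mul, x1 _ _ h3.2 esx, x1 _ _ h3.2 η.idem'.eq, x2 _ _ sye h4.1,
      x2 _ _ sye η.idem.eq, x1 _ _ η.idem.eq esx, x2 _ _ η.idem'.eq h4.1]
    abel
  · simp only [eAbs, star_add, star_sub, star_star, mul_add, mul_sub, add_mul, sub_mul, η.star_e,
      η.star_e', h2, s2, h3.1, h3.2, h4.1, h4.2, sxe, esx, sye, esy, η.idem.eq, η.idem'.eq,
      η.mul_e', η.e'_mul, x2 _ _ sxe h3.1, x2 _ _ sxe η.idem.eq, x1 _ _ h4.2 esy,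
      x1 _ _ h4.2 η.idem'.eq, x1 _ _ η.idem.eq esy, x2 _ _ η.idem'.eq h3.1]
    abel

/-- The elementary dilation `D^η(a) ∈ U(R, Δ)` for `a` invertible in the ring `e_η R e_η`. -/
def dilation (a : (η.idem.Corner)ˣ) : O.Unitary where
  β := (a : η.idem.Corner).1 + star (a⁻¹ : (η.idem.Corner)ˣ).1.1 - η.eAbs
  γ := O.act η.q' (star (a⁻¹ : (η.idem.Corner)ˣ).1.1 - η.e')
    + O.act η.q ((a : η.idem.Corner).1 - η.e) + -O.φ ((a : η.idem.Corner).1 - η.e)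
  β_mul_star := by
    rw [(η.dilation_aux a).1]; abel
  star_β_mul := by
    rw [(η.dilation_aux a).2.1]; abel
  π_γ := by
    have h1 := (η.dilation_aux a).2.2.1
    have h2 : η.e' * star (a⁻¹ : (η.idem.Corner)ˣ).1.1 = star (a⁻¹ : (η.idem.Corner)ˣ).1.1 := by
      rw [← η.star_e, ← star_mul, (η.dilation_aux a).2.2.2.1]
    rw [O.π_add, O.π_add, O.π_act, O.π_act, O.π_neg, O.π_φ, η.π_q, η.π_q', mul_sub, mul_sub, h1, h2,
      η.idem.eq, η.idem'.eq, eAbs]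
    abel
  ρ_γ := by
    obtain ⟨-, -, h1, h2, h3⟩ := η.dilation_aux a
    rw [O.ρ_add, O.ρ_add, O.π_neg, O.π_φ, O.π_act, O.π_act, η.π_q, η.π_q', O.ρ_act, O.ρ_act,
      η.ρ_q, η.ρ_q', O.ρ_neg, O.ρ_φ]
    simp only [star_add, star_sub, star_mul, star_star, neg_zero, mul_zero, zero_mul, sub_mul,
      mul_sub, η.star_e, η.star_e', h1, h2, h3, η.idem.eq, eAbs]
    abel

end HyperbolicPair

/-- Idempotents `e`, `f` are Morita equivalent: `e ∈ R f R` and `f ∈ R e R`. -/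
def MoritaEquivalent {R : Type u} [NonUnitalRing R] (e f : R) : Prop :=
  e ∈ AddSubgroup.closure {x : R | ∃ a b, x = a * f * b} ∧
    f ∈ AddSubgroup.closure {x : R | ∃ a b, x = a * e * b}

/-- An orthogonal hyperbolic family `η_1, …, η_n` of rank `n`. -/
structure OrthogonalHyperbolicFamily (n : ℕ) where
  pair : Fin n → O.HyperbolicPair
  orthogonal : ∀ i j, i ≠ j → (pair i).eAbs * (pair j).eAbs = 0
  morita : ∀ i j, MoritaEquivalent (pair i).eAbs (pair j).eAbs

/-- The non-zero indices `-n, …, -1, 1, …, n`: the index `±k` is given by the position of `k` in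
`1, …, n` and the truth value of "the sign is positive". -/
@[ext]
structure SignedIndex (n : ℕ) where
  idx : Fin n
  pos : Bool

namespace SignedIndex

variable {n : ℕ}

instance : InvolutiveNeg (SignedIndex n) where
  neg i := ⟨i.idx, !i.pos⟩
  neg_neg i := by ext <;> simp

/-- The relation `i ≠ ±j`. -/
def Apart (i j : SignedIndex n) : Prop := i ≠ j ∧ i ≠ -j

theorem Apart.symm {i j : SignedIndex n} (h : Apart i j) : Apart j i :=
  ⟨h.1.symm, fun h' => h.2 (by rw [h', neg_neg])⟩

theorem Apart.neg_left {i j : SignedIndex n} (h : Apart i j) : Apart (-i) j :=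
  ⟨fun h' => h.2 (by rw [← h', neg_neg]), fun h' => h.1 (neg_injective h')⟩

theorem Apart.neg_right {i j : SignedIndex n} (h : Apart i j) : Apart i (-j) :=
  h.symm.neg_left.symm

end SignedIndex

namespace OrthogonalHyperbolicFamily

open SignedIndex
open scoped commutatorElement

variable {O} {n : ℕ}
variable (F : O.OrthogonalHyperbolicFamily n)

/-- The hyperbolic pair `η_i`, where `η_{-k} = -η_k`. -/
def η (i : SignedIndex n) : O.HyperbolicPair := if i.pos then F.pair i.idx else -F.pair i.idx

/-- The idempotent `e_i`. -/
def e (i : SignedIndex n) : R := (F.η i).e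

/-- The element `q_i`. -/
def q (i : SignedIndex n) : Δ := (F.η i).q

/-- The idempotent `e_{|1|} + … + e_{|n|}`. -/
def eTot : R := ∑ k, (F.pair k).eAbs

theorem e_idem (i : SignedIndex n) : F.e i * F.e i = F.e i := (F.η i).idem

theorem star_e (i : SignedIndex n) : star (F.e i) = F.e (-i) := by
  obtain ⟨k, _ | _⟩ := i
  · exact (-F.pair k).star_e
  · exact (F.pair k).star_e

theorem eAbs_η (i : SignedIndex n) : (F.η i).eAbs = (F.pair i.idx).eAbs := by
  obtain ⟨k, _ | _⟩ := i
  · exact add_comm _ _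
  · rfl

theorem eAbs_mul_eTot (i : SignedIndex n) : (F.η i).eAbs * F.eTot = (F.η i).eAbs := by
  rw [eAbs_η, eTot, Finset.mul_sum, Finset.sum_eq_single i.idx]
  · rw [HyperbolicPair.eAbs, mul_add, ← HyperbolicPair.eAbs, HyperbolicPair.eAbs_mul_e,
      HyperbolicPair.eAbs_mul_e', HyperbolicPair.eAbs]
  · intro j _ h
    exact F.orthogonal _ _ h.symm
  · simp

theorem eAbs_mul_e {i j : SignedIndex n} (h : Apart i j) : (F.η j).eAbs * F.e i = 0 := by
  have hij : j.idx ≠ i.idx := by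
    intro h'
    obtain ⟨k, a⟩ := i
    obtain ⟨l, b⟩ := j
    obtain rfl : l = k := h'
    obtain ⟨h1, h2⟩ := h
    cases a <;> cases b <;> first | exact h1 rfl | exact h2 rfl
  rw [e, ← (F.η i).eAbs_mul_e, ← mul_assoc, eAbs_η, eAbs_η, F.orthogonal _ _ hij, zero_mul]

/-- The Peirce component `R_{ij} = e_i R e_j`. -/
def ring (i j : SignedIndex n) : AddSubgroup R where
  carrier := {a | ∃ r, a = F.e i * r * F.e j}
  add_mem' := by
    rintro _ _ ⟨r, rfl⟩ ⟨s, rfl⟩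
    exact ⟨r + s, by rw [mul_add, add_mul]⟩
  zero_mem' := ⟨0, by simp⟩
  neg_mem' := by
    rintro _ ⟨r, rfl⟩
    exact ⟨-r, by simp⟩

/-- The group `Δ⁰_i` of all `u ∈ Δ · e_i` such that `(e_{|1|} + … + e_{|n|}) π(u) = 0`. -/
def form (i : SignedIndex n) : AddSubgroup Δ :=
  (O.actHom (F.e i)).range ⊓ ((AddMonoidHom.mulLeft F.eTot).comp O.πHom).ker

theorem mem_ring {i j : SignedIndex n} {a : R} :
    a ∈ F.ring i j ↔ F.e i * a = a ∧ a * F.e j = a := by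
  constructor
  · rintro ⟨r, rfl⟩
    constructor
    · rw [← mul_assoc, ← mul_assoc, F.e_idem]
    · rw [mul_assoc, F.e_idem]
  · rintro ⟨h1, h2⟩
    exact ⟨a, by rw [h1, h2]⟩

theorem mem_form {i : SignedIndex n} {u : Δ} :
    u ∈ F.form i ↔ O.act u (F.e i) = u ∧ F.eTot * O.π u = 0 := by
  refine and_congr_left fun _ => ⟨?_, fun h => ⟨u, h⟩⟩
  rintro ⟨v, rfl⟩
  change O.act (O.act v _) _ = O.act v _
  rw [← O.act_mul, F.e_idem]

theorem mul_mem {i j k : SignedIndex n} {a b : R} (ha : a ∈ F.ring i j) (hb : b ∈ F.ring j k) :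
    a * b ∈ F.ring i k := by
  rw [mem_ring] at *
  exact ⟨by rw [← mul_assoc, ha.1], by rw [mul_assoc, hb.2]⟩

theorem star_mem {i j : SignedIndex n} {a : R} (ha : a ∈ F.ring i j) :
    star a ∈ F.ring (-j) (-i) := by
  rw [mem_ring] at *
  exact ⟨by rw [← F.star_e, ← star_mul, ha.2], by rw [← F.star_e, ← star_mul, ha.1]⟩

theorem φ_mem {i : SignedIndex n} {a : R} (ha : a ∈ F.ring (-i) i) : O.φ a ∈ F.form i := by
  rw [mem_ring] at ha
  rw [mem_form, O.φ_act, O.π_φ, F.star_e, ha.1, ha.2]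
  simp

theorem π_mul_e {i : SignedIndex n} {u : Δ} (hu : u ∈ F.form i) : O.π u * F.e i = O.π u := by
  rw [← O.π_act, (F.mem_form.1 hu).1]

theorem star_π_mul_π_mem {i j : SignedIndex n} {u v : Δ} (hu : u ∈ F.form i)
    (hv : v ∈ F.form j) : star (O.π u) * O.π v ∈ F.ring (-i) j := by
  rw [mem_ring]
  constructor
  · rw [← mul_assoc, ← F.star_e, ← star_mul, F.π_mul_e hu]
  · rw [mul_assoc, F.π_mul_e hv]

theorem ρ_mem {i : SignedIndex n} {u : Δ} (hu : u ∈ F.form i) : O.ρ u ∈ F.ring (-i) i := by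
  refine ⟨O.ρ u, ?_⟩
  rw [← F.star_e, ← O.ρ_act, (F.mem_form.1 hu).1]

theorem act_mem {i j : SignedIndex n} {u : Δ} {a : R} (hu : u ∈ F.form i) (ha : a ∈ F.ring i j) :
    O.act u a ∈ F.form j := by
  rw [mem_form] at *
  rw [mem_ring] at ha
  exact ⟨by rw [← O.act_mul, ha.2], by rw [O.π_act, ← mul_assoc, hu.2, zero_mul]⟩

theorem form_le_unip (i : SignedIndex n) : F.form i ≤ (F.η i).unip := by
  rintro u ⟨h1, h2⟩
  refine ⟨h1, ?_⟩
  change F.eTot * O.π u = 0 at h2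
  change (F.η i).eAbs * O.π u = 0
  rw [← F.eAbs_mul_eTot, mul_assoc, h2, mul_zero]

theorem q_act_mem_unip {i j : SignedIndex n} (h : Apart i j) {a : R} (ha : a ∈ F.ring i j) :
    O.act (F.q i) a ∈ (F.η j).unip := by
  rw [mem_ring] at ha
  refine ⟨⟨O.act (F.q i) a, ?_⟩, ?_⟩
  · change O.act (O.act (F.q i) a) (F.e j) = _
    rw [← O.act_mul, ha.2]
  · change (F.η j).eAbs * O.π (O.act (F.q i) a) = 0
    rw [O.π_act, q, (F.η i).π_q, ← mul_assoc]
    exact (congrArg (· * a) (F.eAbs_mul_e h)).trans (zero_mul a)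

/-! ### Elementary transvections and dilations -/

/-- The elementary transvection `T_{ij}(a) = T^{η_j}(q_i · a)` for `a ∈ R_{ij}`, `i ≠ ±j`. -/
def T2 (i j : SignedIndex n) (h : Apart i j) (a : F.ring i j) : O.Unitary :=
  (F.η j).transvection ⟨O.act (F.q i) a, F.q_act_mem_unip h a.2⟩

/-- The elementary transvection `T_i(u) = T^{η_i}(u)` for `u ∈ Δ⁰_i`. -/
def T1 (i : SignedIndex n) (u : F.form i) : O.Unitary :=
  (F.η i).transvection ⟨u, F.form_le_unip i u.2⟩

/-- The elementary dilation `D_i(a)` for `a` invertible in `R_{ii} = e_i R e_i`. -/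
def D (i : SignedIndex n) (a : ((F.η i).idem.Corner)ˣ) : O.Unitary := (F.η i).dilation a

/-- The set `D_0(*)`: the smaller unitary group orthogonal to `η_1 ⊕ … ⊕ η_n`, i.e. all `g` with
`β(g) e = 0 = e β(g)` and `γ(g) · e = 0` for `e = e_{|1|} + … + e_{|n|}`. -/
def D0 : Set O.Unitary :=
  {g | g.β * F.eTot = 0 ∧ F.eTot * g.β = 0 ∧ O.act g.γ F.eTot = 0}

/-- The diagonal subgroup of `U(R, Δ)`, generated by all `D_i(a)` and by `D_0(*)`. -/
def diag : Subgroup O.Unitary :=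
  Subgroup.closure ({g | ∃ i a, g = F.D i a} ∪ F.D0)

/-- `D_i(a)` as an element of the diagonal subgroup. -/
def diagD (i : SignedIndex n) (a : ((F.η i).idem.Corner)ˣ) : F.diag :=
  ⟨F.D i a, Subgroup.subset_closure (Or.inl ⟨i, a, rfl⟩)⟩

/-- `D_0(g) = g` as an element of the diagonal subgroup. -/
def diagD0 (g : O.Unitary) (hg : g ∈ F.D0) : F.diag :=
  ⟨g, Subgroup.subset_closure (Or.inr hg)⟩

/-! ### The Steinberg group -/

/-- Generators of the unitary Steinberg group: the symbols `X_{ij}(a)` (`short`) for `i ≠ ±j`,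
`a ∈ R_{ij}`, and `X_i(u)` (`ultra`) for `u ∈ Δ⁰_i`. -/
inductive StGen : Type (max u v)
  | short (i j : SignedIndex n) (h : Apart i j) (a : F.ring i j) : StGen
  | ultra (i : SignedIndex n) (u : F.form i) : StGen

/-- The symbol `X_{ij}(a)` in the free group. -/
def x2 (i j : SignedIndex n) (h : Apart i j) (a : F.ring i j) : FreeGroup F.StGen :=
  FreeGroup.of (.short i j h a)

/-- The symbol `X_i(u)` in the free group. -/
def x1 (i : SignedIndex n) (u : F.form i) : FreeGroup F.StGen :=
  FreeGroup.of (.ultra i u)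

/-- The Steinberg relations: `StRel w` means that `w = 1` is one of the defining relations. -/
inductive StRel : FreeGroup F.StGen → Prop
  | st0 (i j : SignedIndex n) (h : Apart i j) (a : F.ring i j) :
      StRel (F.x2 i j h a *
        (F.x2 (-j) (-i) h.symm.neg_left.neg_right ⟨-star (a : R), neg_mem (F.star_mem a.2)⟩)⁻¹)
  | st1 (i j : SignedIndex n) (h : Apart i j) (a b : F.ring i j) :
      StRel (F.x2 i j h a * F.x2 i j h b * (F.x2 i j h (a + b))⁻¹)
  | st2 (i : SignedIndex n) (u v : F.form i) :
      StRel (F.x1 i u * F.x1 i v * (F.x1 i (u + v))⁻¹)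
  | st3 (i j k l : SignedIndex n) (hij : Apart i j) (hkl : Apart k l)
      (h1 : i ≠ l) (h2 : l ≠ -j) (h3 : -j ≠ -k) (h4 : -k ≠ i)
      (a : F.ring i j) (b : F.ring k l) :
      StRel ⁅F.x2 i j hij a, F.x2 k l hkl b⁆
  | st4 (i j k : SignedIndex n) (hij : Apart i j) (hjk : Apart j k) (hik : Apart i k)
      (a : F.ring i j) (b : F.ring j k) :
      StRel (⁅F.x2 i j hij a, F.x2 j k hjk b⁆ *
        (F.x2 i k hik ⟨(a : R) * b, F.mul_mem a.2 b.2⟩)⁻¹)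
  | st5 (i j : SignedIndex n) (h : Apart i j) (a : F.ring i j) (b : F.ring j (-i)) :
      StRel (⁅F.x2 i j h a, F.x2 j (-i) h.symm.neg_right b⁆ *
        (F.x1 (-i) ⟨O.φ ((a : R) * b),
          F.φ_mem (i := -i) (by rw [neg_neg]; exact F.mul_mem a.2 b.2)⟩)⁻¹)
  | st6 (i j : SignedIndex n) (h : Apart i j) (u : F.form i) (v : F.form j) :
      StRel (⁅F.x1 i u, F.x1 j v⁆ *
        (F.x2 (-i) j h.neg_left
          ⟨-(star (O.π u) * O.π v), neg_mem (F.star_π_mul_π_mem u.2 v.2)⟩)⁻¹)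
  | st7 (i j k : SignedIndex n) (hjk : Apart j k) (h1 : j ≠ i) (h2 : i ≠ -k)
      (u : F.form i) (a : F.ring j k) :
      StRel ⁅F.x1 i u, F.x2 j k hjk a⁆
  | st8 (i j : SignedIndex n) (h : Apart i j) (u : F.form i) (a : F.ring i j) :
      StRel (⁅F.x1 i u, F.x2 i j h a⁆ *
        (F.x2 (-i) j h.neg_left ⟨O.ρ u * a, F.mul_mem (F.ρ_mem u.2) a.2⟩ *
          F.x1 j ⟨-O.act u (-a), neg_mem (F.act_mem u.2 (neg_mem a.2))⟩)⁻¹)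

/-- The odd unitary Steinberg group `StU(R, Δ)`. -/
abbrev StU : Type (max u v) := PresentedGroup {w | F.StRel w}

/-- The generator `X_{ij}(a)` of the Steinberg group. -/
def X2 (i j : SignedIndex n) (h : Apart i j) (a : F.ring i j) : F.StU :=
  PresentedGroup.of (.short i j h a)

/-- The generator `X_i(u)` of the Steinberg group. -/
def X1 (i : SignedIndex n) (u : F.form i) : F.StU :=
  PresentedGroup.of (.ultra i u)

/-- `st` is the canonical map `StU(R, Δ) → U(R, Δ)`, i.e. the homomorphism sending the generators
to the elementary transvections. -/
def IsCanonicalMap (st : F.StU →* O.Unitary) : Prop :=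
  (∀ i j h a, st (F.X2 i j h a) = F.T2 i j h a) ∧ ∀ i u, st (F.X1 i u) = F.T1 i u

theorem val_mem_ring (i : SignedIndex n) (a : (F.η i).idem.Corner) : a.1 ∈ F.ring i i :=
  F.mem_ring.2 ((Subsemigroup.mem_corner_iff (F.η i).idem).1 a.2)

theorem D0_mem_form {g : O.Unitary} (hg : g ∈ F.D0) {i : SignedIndex n} {u : Δ}
    (hu : u ∈ F.form i) : O.act g.γ (O.π u) + u ∈ F.form i := by
  refine add_mem (F.mem_form.2 ⟨?_, ?_⟩) hu
  · rw [← O.act_mul, F.π_mul_e hu]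
  · rw [O.π_act, g.π_γ, ← mul_assoc, hg.2.1, zero_mul]

/-- `ad` is the canonical action of the diagonal subgroup on the Steinberg group, i.e. the action
by automorphisms with the prescribed values on the generators. -/
structure IsDiagonalAction (ad : F.diag →* MulAut F.StU) : Prop where
  ad1 : ∀ (i j k : SignedIndex n) (hjk : Apart j k) (a : ((F.η i).idem.Corner)ˣ) (b : F.ring j k),
    Apart j i → Apart i k → ad (F.diagD i a) (F.X2 j k hjk b) = F.X2 j k hjk b
  ad2 : ∀ (g : O.Unitary) (hg : g ∈ F.D0) (i j : SignedIndex n) (h : Apart i j) (a : F.ring i j),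
    ad (F.diagD0 g hg) (F.X2 i j h a) = F.X2 i j h a
  ad3 : ∀ (i j : SignedIndex n) (h : Apart i j) (a : ((F.η i).idem.Corner)ˣ) (b : F.ring i j),
    ad (F.diagD i a) (F.X2 i j h b)
      = F.X2 i j h ⟨(a : (F.η i).idem.Corner).1 * b, F.mul_mem (F.val_mem_ring i a) b.2⟩
  ad4 : ∀ (i j : SignedIndex n) (a : ((F.η i).idem.Corner)ˣ) (u : F.form j),
    Apart i j → ad (F.diagD i a) (F.X1 j u) = F.X1 j u
  ad5 : ∀ (g : O.Unitary) (hg : g ∈ F.D0) (i : SignedIndex n) (u : F.form i),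
    ad (F.diagD0 g hg) (F.X1 i u)
      = F.X1 i ⟨O.act g.γ (O.π u) + u, F.D0_mem_form hg u.2⟩
  ad6 : ∀ (i : SignedIndex n) (a : ((F.η i).idem.Corner)ˣ) (u : F.form i),
    ad (F.diagD i a) (F.X1 i u)
      = F.X1 i ⟨O.act u (a⁻¹ : ((F.η i).idem.Corner)ˣ).1.1,
          F.act_mem u.2 (F.val_mem_ring i (a⁻¹ : ((F.η i).idem.Corner)ˣ).1)⟩

end OrthogonalHyperbolicFamily

end OddFormRing

/-- The homomorphism `d : H → G` with the action `act` of `G` on `H` by automorphisms is a crossed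
module. -/
def IsCrossedModule {H G : Type*} [Group H] [Group G] (d : H →* G) (act : G →* MulAut H) : Prop :=
  (∀ g h, d (act g h) = g * d h * g⁻¹) ∧ ∀ h h', act (d h) h' = h * h' * h⁻¹

/-- The Jacobson radical of a non-unital ring: the set of elements that generate two-sided ideals
of quasi-invertible elements. -/
def jacobsonRadical (A : Type u) [NonUnitalRing A] : Set A :=
  {a | ∀ x ∈ TwoSidedIdeal.span {a}, IsQuasiregular x}

/-- A non-unital ring `A` is semi-local if its factor-ring by the Jacobson radical is a unital
semi-simple ring. The factor-ring is given as a surjective image with kernel the radical. -/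
def IsSemiLocalNonUnital (A : Type u) [NonUnitalRing A] : Prop :=
  ∃ (S : Type u) (_ : Ring S) (_ : IsSemisimpleRing S) (f : A →ₙ+* S),
    Function.Surjective f ∧ ∀ a, f a = 0 ↔ a ∈ jacobsonRadical A

/-! ### The action of the unitary group on `Δ`, and transvections -/

namespace OddFormRing

variable {R : Type u} {Δ : Type v} [NonUnitalRing R] [StarRing R] [AddGroup Δ]
variable (O : OddFormRing R Δ)

/-! ### Computations in `Δ` -/

/-! The group `U(R, Δ)` acts on `Δ` by `u ↦ γ(g)·π(u) + u` and preserves both `ρ` and the hermitian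
pairing `star (π u) * π v`. In this action a transvection `T^η(u)` fixes `q_{-η}` and is determined
by the image of `q_η`. Conjugates and commutators of transvections are therefore computable
(`tr_conj`, `T_commutator_of_fix`), and the Steinberg relations hold for them (`rels_T`); this gives
`st`.

Let L = `levi` be the subgroup preserving every line `q_k R`. It normalizes the root subgroups of U,
and `st` is injective on root subgroups and on unipotent radicals (`st_radical_injective`). Hence L
acts on the Steinberg group by transport of parameters (`leviAd`), compatibly with `st`. The
diagonal group lies in L, and its prescribed action is the restriction of `leviAd`. A crossed module
is obtained by letting `st x * l` act as conjugation by `x` after `leviAd l`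
(`exists_isCrossedModule`). Two facts are needed: (a) U = st(StU)·L; (b) if `st x` lies in L, then
`x` conjugates in the way `leviAd (st x)` prescribes, that is, `x` lies in `nice`. Uniqueness and
agreement with the diagonal action come from perfectness (`commutator_StU`): the kernel of a crossed
module is central, so two homomorphisms from a perfect group with the same image downstairs coincide
(`IsCrossedModule.hom_ext`).

Facts (a) and (b) are proved for a smaller family. Forgetting the last hyperbolic pair enlarges the
ultrashort root subgroups and L, but does not change the Steinberg group as long as at least two
pairs remain (`exists_equiv_init`). The difficulty there is to find lifts of the forgotten root
elements `X_{±z}(w)`. They are built from commutators of remaining generators, and Morita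
equivalence glues these local formulas into homomorphisms (`exists_isLiftφ`, `exists_isLiftForm`).
So a crossed module can be carried upwards in the rank, and the starting point is a rank two family
that sits inside a rank three one and still has a spare pair z available.

In rank two, (b) follows from a Gauss decomposition StU = B·B⁻·B·`nice` (`mem_gaussCell`). The cell
of a Borel subgroup B is contained in the cell of B reflected in a simple root, by an identity
inside the group of that root and its opposite. Hence all Borel subgroups have the same cell; it is
stable under left multiplication by all of them, so it is everything. If `x = u v w h` maps into L,
uniqueness of the decomposition gives `u v w = 1`, so `x = h` is in `nice`. Semi-locality enters
only in the rank one identities and in (a): multiplication by a suitable transvection makes a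
diagonal coefficient of a unitary element invertible (`exists_big_cell`, `exists_short_cell`). The
reason is that over a semisimple ring a non-invertible coefficient can be enlarged as long as the
available corrections do not all vanish on its kernel (`exists_corner_unit`). -/

theorem act_add_of_ρ_eq_zero {u : Δ} (h : O.ρ u = 0) (a b : R) :
    O.act u (a + b) = O.act u a + O.act u b := by
  rw [O.act_add, h, mul_zero, zero_mul, O.φ_zero, add_zero]

theorem act_neg_of_ρ_eq_zero {u : Δ} (h : O.ρ u = 0) (a : R) : O.act u (-a) = -O.act u a := by
  have h1 := O.act_add_of_ρ_eq_zero h a (-a)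
  rw [add_neg_cancel, O.act_zero] at h1
  exact (neg_eq_of_add_eq_zero_right h1.symm).symm

/-- The `X_j`-term in the relation for `[X_i(u), X_{ij}(a)]` has this shape; it differs from `act u
a` only by a central `φ`-term, coming from the failure of `act u` to be additive. -/
theorem neg_act_neg (u : Δ) (a : R) :
    -O.act u (-a) = O.act u a + -O.φ (star a * O.ρ u * a) := by
  have h := O.act_add u a (-a)
  rw [add_neg_cancel, O.act_zero, star_neg, neg_mul, neg_mul, O.φ_neg] at h
  exact (eq_neg_of_add_eq_zero_left h.symm).symm

theorem add_comm_of_star_π_mul_π {u v : Δ} (h : star (O.π u) * O.π v = 0) : u + v = v + u := by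
  rw [O.add_eq u v, h, neg_zero, O.φ_zero, zero_add]

theorem act1_act (u : Δ) (c b : R) : O.act1 (O.act u c) b = O.act u (c * b + c) := by
  rw [O.act_add, O.act_mul, act1, O.ρ_act, mul_assoc (star c * O.ρ u) c b]

theorem act_act1 (u : Δ) (b c : R) : O.act (O.act1 u b) c = O.act u (b * c + c) := by
  rw [O.act_add, act1, O.add_act, O.add_act, O.φ_act, O.act_mul, mul_assoc, mul_assoc, mul_assoc]

theorem act1_φ (x b : R) :
    O.act1 (O.φ x) b = O.φ (star b * x * b + x * b + star b * x + x) := by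
  have h : O.φ (star b * x) = -O.φ (star x * b) := by
    rw [← O.φ_star, star_mul, star_star]
  rw [act1, O.φ_act, O.ρ_φ, sub_mul, sub_eq_add_neg, O.φ_add (x * b), O.φ_neg, O.φ_add,
    O.φ_add, O.φ_add, h]
  simp only [add_assoc]

namespace Unitary

variable {O}

/-- Since `β = π ∘ γ`, identities in the unitary group need only be checked on the `Δ`-component. -/
theorem ext_γ {g h : O.Unitary} (hγ : g.γ = h.γ) : g = h :=
  Unitary.ext (by rw [← g.π_γ, hγ, h.π_γ]) hγ

/-- The action of the unitary group on `Δ`. -/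
def app (g : O.Unitary) (u : Δ) : Δ := O.act g.γ (O.π u) + u

theorem π_app (g : O.Unitary) (u : Δ) : O.π (g.app u) = g.β * O.π u + O.π u := by
  rw [app, O.π_add, O.π_act, g.π_γ]

theorem ρ_app (g : O.Unitary) (u : Δ) : O.ρ (g.app u) = O.ρ u := by
  rw [app, O.ρ_add, O.ρ_act, O.π_act, g.π_γ, g.ρ_γ, star_mul, mul_assoc]
  abel

/-- Two `φ`-terms cancel: the defect of additivity of `act γ`, and the commutator of `u` with
`γ·π(v)`. They agree because `ρ γ = star β`. -/
theorem app_add (g : O.Unitary) (u v : Δ) : g.app (u + v) = g.app u + g.app v := by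
  have h : ∀ w, u + (O.act g.γ (O.π v) + w)
      = O.φ (-(star (O.π u) * (g.β * O.π v))) + (O.act g.γ (O.π v) + (u + w)) := by
    intro w
    rw [← add_assoc, O.add_eq u, O.π_act, g.π_γ]; simp only [add_assoc]
  have h2 : O.φ (star (O.π v) * star g.β * O.π u) = O.φ (-(star (O.π u) * (g.β * O.π v))) := by
    rw [O.φ_neg, ← O.φ_star]; simp [mul_assoc]
  simp only [app, O.π_add, O.act_add, g.ρ_γ, add_assoc, h, h2, O.add_φ_add]

theorem app_act (g : O.Unitary) (u : Δ) (a : R) : g.app (O.act u a) = O.act (g.app u) a := by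
  rw [app, app, O.add_act, O.π_act, O.act_mul]

theorem app_mul (g h : O.Unitary) (u : Δ) : (g * h).app u = g.app (h.app u) := by
  rw [app, mul_γ, O.add_act, O.act_act1, add_assoc, app, π_app]
  rfl

theorem app_one (u : Δ) : (1 : O.Unitary).app u = u := by
  rw [app, one_γ, O.zero_act, zero_add]

theorem app_inv_app (g : O.Unitary) (u : Δ) : g⁻¹.app (g.app u) = u := by
  rw [← app_mul, inv_mul_cancel, app_one]

theorem app_app_inv (g : O.Unitary) (u : Δ) : g.app (g⁻¹.app u) = u := by
  rw [← app_mul, mul_inv_cancel, app_one]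

theorem app_injective (g : O.Unitary) {u v : Δ} (h : g.app u = g.app v) : u = v := by
  rw [← g.app_inv_app u, h, app_inv_app]

/-- Unitarity proper: the pairing on `Δ` is invariant because `star α * α = 1`. -/
theorem star_π_app_mul_π_app (g : O.Unitary) (u v : Δ) :
    star (O.π (g.app u)) * O.π (g.app v) = star (O.π u) * O.π v := by
  have h := congrArg (fun x => star (O.π u) * x * O.π v) g.star_β_mul
  simp only [mul_add, add_mul, mul_zero, zero_mul] at h
  simp only [π_app, star_add, star_mul, mul_add, add_mul, mul_assoc] at h ⊢
  rw [← sub_eq_zero, ← h]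
  abel

/-- `b α(g) = e` as soon as `α(g) e' = e' (star b)`. -/
theorem mul_β_add (g : O.Unitary) {e' b : R} (h : g.β * e' + e' = star b) :
    b * g.β + b = star e' := by
  have h' : star e' * star g.β + star e' = b := by
    rw [← star_star b, ← h, star_add, star_mul]
  have h2 := congrArg (fun x => star e' * x) g.star_β_mul
  simp only [mul_add, mul_zero] at h2
  rw [← h', add_mul, ← sub_eq_zero, ← h2, mul_assoc]
  abel

end Unitary

/-! ### Transvections -/

namespace HyperbolicPair

variable {O}
variable (η : O.HyperbolicPair)

theorem mem_unip_iff {u : Δ} :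
    u ∈ η.unip ↔ O.act u η.e = u ∧ η.e * O.π u = 0 ∧ η.e' * O.π u = 0 := by
  constructor
  · rintro ⟨⟨v, rfl⟩, h⟩
    change O.act (O.act v η.e) η.e = O.act v η.e ∧ η.e * O.π (O.act v η.e) = 0 ∧
      η.e' * O.π (O.act v η.e) = 0
    change η.eAbs * O.π (O.act v η.e) = 0 at h
    refine ⟨?_, ?_, ?_⟩
    · rw [← O.act_mul, η.idem.eq]
    · have := congrArg (η.e * ·) h
      simpa only [← mul_assoc, η.e_mul_eAbs, mul_zero] using this
    · have := congrArg (η.e' * ·) h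
      simpa only [← mul_assoc, η.e'_mul_eAbs, mul_zero] using this
  · rintro ⟨h1, h2, h3⟩
    refine ⟨⟨u, h1⟩, ?_⟩
    change η.eAbs * O.π u = 0
    rw [eAbs, add_mul, h2, h3, add_zero]

section

variable {η} {u : Δ} (hu : u ∈ η.unip)
include hu

theorem act_e : O.act u η.e = u := (η.mem_unip_iff.1 hu).1
theorem e_mul_π : η.e * O.π u = 0 := (η.mem_unip_iff.1 hu).2.1
theorem e'_mul_π : η.e' * O.π u = 0 := (η.mem_unip_iff.1 hu).2.2
theorem π_mul_e : O.π u * η.e = O.π u := by rw [← O.π_act, act_e hu]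
theorem ρ_mul_e : O.ρ u * η.e = O.ρ u := by
  rw [← act_e hu, O.ρ_act, mul_assoc _ η.e η.e, η.idem.eq]
theorem e'_mul_ρ : η.e' * O.ρ u = O.ρ u := by
  rw [← act_e hu, O.ρ_act, η.star_e, mul_assoc, ← mul_assoc η.e' η.e', η.idem'.eq]
theorem star_π_mul_e : star (O.π u) * η.e = 0 := by
  rw [← η.star_e', ← star_mul, e'_mul_π hu, star_zero]
theorem star_π_mul_e' : star (O.π u) * η.e' = 0 := by
  rw [← η.star_e, ← star_mul, e_mul_π hu, star_zero]
theorem e'_mul_star_π : η.e' * star (O.π u) = star (O.π u) := by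
  rw [← η.star_e, ← star_mul, π_mul_e hu]

end

open scoped Classical in
/-- The transvection `T^η(u)`, extended by `1` to all `u ∈ Δ`. -/
noncomputable def tr (u : Δ) : O.Unitary :=
  if h : u ∈ η.unip then η.transvection ⟨u, h⟩ else 1

variable {η}

theorem tr_of_mem {u : Δ} (h : u ∈ η.unip) : η.tr u = η.transvection ⟨u, h⟩ := dif_pos h

theorem tr_β {u : Δ} (h : u ∈ η.unip) : (η.tr u).β = O.ρ u + O.π u - star (O.π u) := by
  rw [tr_of_mem h]; rfl

theorem tr_γ {u : Δ} (h : u ∈ η.unip) :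
    (η.tr u).γ = u + O.act η.q' (O.ρ u - star (O.π u)) + -O.φ (O.ρ u + O.π u) := by
  rw [tr_of_mem h]; rfl

theorem act_zero_of_mul {u : Δ} {e a : R} (h : O.act u e = u) (h' : e * a = 0) : O.act u a = 0 := by
  rw [← h, ← O.act_mul, h', O.act_zero]

/-- The values of a transvection in terms of `γ`. -/
theorem act_tr_γ {u : Δ} (h : u ∈ η.unip) (a : R) :
    O.act (η.tr u).γ a = O.act u a + O.act η.q' (O.ρ u * a - star (O.π u) * a)
      + -O.φ (star a * (O.ρ u + O.π u) * a) := by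
  rw [tr_γ h, O.add_act, O.add_act, O.neg_act, O.φ_act, ← O.act_mul, sub_mul]

/-- Compared through `γ`. The element `β (tr v)` is annihilated by `e_η` from the left, so among the
products with the data of `u` only `star (π u) * π v` survives, and this is the cross term of `ρ (u
+ v)`. -/
theorem tr_add {u v : Δ} (hu : u ∈ η.unip) (hv : v ∈ η.unip) :
    η.tr (u + v) = η.tr u * η.tr v := by
  apply Unitary.ext_γ
  have eb : η.e * (O.ρ v + O.π v - star (O.π v)) = 0 := by
    rw [mul_sub, mul_add, e_mul_π hv, ← e'_mul_ρ hv, ← e'_mul_star_π hv, ← mul_assoc, ← mul_assoc,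
      η.mul_e']
    simp
  have ρb : O.ρ u * (O.ρ v + O.π v - star (O.π v)) = 0 := by
    rw [← ρ_mul_e hu, mul_assoc, eb, mul_zero]
  have πb : O.π u * (O.ρ v + O.π v - star (O.π v)) = 0 := by
    rw [← π_mul_e hu, mul_assoc, eb, mul_zero]
  have sπb : star (O.π u) * (O.ρ v + O.π v - star (O.π v)) = star (O.π u) * O.π v := by
    rw [mul_sub, mul_add, ← e'_mul_ρ hv, ← e'_mul_star_π hv, ← mul_assoc, ← mul_assoc,
      star_π_mul_e' hu]
    simp
  have sρb : star (O.ρ u) * (O.ρ v + O.π v - star (O.π v)) = 0 := by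
    have : star (O.ρ u) * η.e = star (O.ρ u) := by
      rw [← η.star_e', ← star_mul, e'_mul_ρ hu]
    rw [← this, mul_assoc, eb, mul_zero]
  -- Multiples of `q_{-η}` are orthogonal to `u` and `v`, hence commute with them in `Δ`.
  have c1 : ∀ x w, O.act η.q' x + (u + w) = u + (O.act η.q' x + w) := by
    intro x w
    rw [← add_assoc, ← add_assoc]; congr 1
    symm
    apply O.add_comm_of_star_π_mul_π
    rw [O.π_act, η.π_q', ← mul_assoc, star_π_mul_e' hu, zero_mul]
  have c2 : ∀ x w, O.act η.q' x + (v + w) = v + (O.act η.q' x + w) := by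
    intro x w
    rw [← add_assoc, ← add_assoc]; congr 1
    symm
    apply O.add_comm_of_star_π_mul_π
    rw [O.π_act, η.π_q', ← mul_assoc, star_π_mul_e' hv, zero_mul]
  rw [tr_γ (add_mem hu hv), Unitary.mul_γ, act1, act_tr_γ hu, (η.tr u).ρ_γ, tr_β hu, tr_β hv,
    tr_γ hu, tr_γ hv, act_zero_of_mul (act_e hu) eb, mul_assoc (star _) (O.ρ u + O.π u),
    add_mul (O.ρ u) (O.π u) (O.ρ v + O.π v - star (O.π v)), ρb, πb, sπb, star_sub (O.ρ u + O.π u),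
    star_add (O.ρ u), star_star, sub_mul _ (O.π u), add_mul (star (O.ρ u)), sρb, πb, sπb, O.ρ_add,
    O.π_add, star_add]
  have e1 : O.ρ u - star (O.π u) * O.π v + O.ρ v - (star (O.π u) + star (O.π v))
      = (0 - star (O.π u) * O.π v) + ((O.ρ u - star (O.π u)) + (O.ρ v - star (O.π v))) := by abel
  have c3 : ∀ x y w, O.act η.q' x + (O.act η.q' y + w) = O.act η.q' (x + y) + w := by
    intro x y w
    rw [O.act_add_of_ρ_eq_zero η.ρ_q', add_assoc]
  rw [e1]
  simp only [← O.φ_neg, add_assoc, add_zero, zero_add, mul_zero, neg_zero, O.φ_zero, c1, c2, c3,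
    O.add_φ_add u, O.add_φ_add v, O.add_φ_add (O.act _ _), O.add_φ, O.φ_add_φ_add, O.φ_add_φ, sub_zero]
  congr 2
  · abel
  · rw [← O.act_add_of_ρ_eq_zero η.ρ_q', add_assoc]

theorem tr_zero : η.tr 0 = 1 := by
  have h := tr_add (zero_mem η.unip) (zero_mem η.unip)
  rw [add_zero] at h
  exact left_eq_mul.1 h

theorem tr_neg {u : Δ} (hu : u ∈ η.unip) : η.tr (-u) = (η.tr u)⁻¹ := by
  rw [eq_inv_iff_mul_eq_one, ← tr_add (neg_mem hu) hu, neg_add_cancel, tr_zero]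

theorem tr_app_q' {u : Δ} (hu : u ∈ η.unip) : (η.tr u).app η.q' = η.q' := by
  have h1 : O.ρ u * η.e' = 0 := by rw [← ρ_mul_e hu, mul_assoc, η.mul_e', mul_zero]
  have h2 : O.π u * η.e' = 0 := by rw [← π_mul_e hu, mul_assoc, η.mul_e', mul_zero]
  rw [Unitary.app, act_tr_γ hu, η.π_q', act_zero_of_mul (act_e hu) η.mul_e', mul_assoc, add_mul,
    h1, h2, star_π_mul_e' hu]
  simp [O.act_zero, O.φ_zero]

/-- This single vector determines the transvection: `u` is recovered from it, which yields
injectivity of `tr` and, read backwards, transitivity on vectors opposite to `q_{-η}`. -/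
theorem tr_app_q {u : Δ} (hu : u ∈ η.unip) :
    (η.tr u).app η.q = u + O.act η.q' (O.ρ u) + -O.φ (O.ρ u) + η.q := by
  rw [Unitary.app, act_tr_γ hu, η.π_q, act_e hu, mul_assoc, add_mul, ρ_mul_e hu, π_mul_e hu,
    star_π_mul_e hu, sub_zero, η.star_e, mul_add, e'_mul_ρ hu, e'_mul_π hu, add_zero]

/-- A transvection fixes every vector orthogonal to everything in sight. -/
theorem tr_app_of_mul {u : Δ} (hu : u ∈ η.unip) {x : Δ} (h1 : η.e * O.π x = 0)
    (h2 : star (O.π u) * O.π x = 0) : (η.tr u).app x = x := by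
  have h3 : O.ρ u * O.π x = 0 := by rw [← ρ_mul_e hu, mul_assoc, h1, mul_zero]
  have h4 : O.π u * O.π x = 0 := by rw [← π_mul_e hu, mul_assoc, h1, mul_zero]
  rw [Unitary.app, act_tr_γ hu, act_zero_of_mul (act_e hu) h1, mul_assoc, add_mul, h3, h4, h2]
  simp [O.act_zero, O.φ_zero]

/-- If a transvection sends `q_η` to a multiple of `q_η`, then it is trivial. -/
theorem eq_zero_of_tr_app_q {u : Δ} (hu : u ∈ η.unip) {a : R}
    (h : (η.tr u).app η.q = O.act η.q a) : u = 0 := by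
  rw [tr_app_q hu] at h
  have hp := congrArg O.π h
  simp only [O.π_add, O.π_act, η.π_q', O.π_neg, O.π_φ, η.π_q, neg_zero, add_zero,
    e'_mul_ρ hu] at hp
  -- The idempotents separate the components of the equation under `π`: `e_η` gives `e_η = e_η a`,
  -- and `e_{-η}` gives `ρ u = 0`. What remains is `u + q_η = q_η`.
  have h1 := congrArg (η.e * ·) hp
  simp only [mul_add, e_mul_π hu, zero_add, η.idem.eq] at h1
  rw [← e'_mul_ρ hu, ← mul_assoc, η.mul_e', zero_mul, zero_add, ← mul_assoc, η.idem.eq] at h1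
  have h2 := congrArg (η.e' * ·) hp
  simp only [mul_add, e'_mul_π hu, zero_add, η.e'_mul, e'_mul_ρ hu, add_zero] at h2
  rw [← mul_assoc, η.e'_mul, zero_mul] at h2
  have h3 : O.act η.q a = η.q := by
    rw [η.q_act, ← O.act_mul, ← h1]
  rw [h3, h2, O.act_zero, O.φ_zero] at h
  simpa using h

theorem tr_injective {u v : Δ} (hu : u ∈ η.unip) (hv : v ∈ η.unip) (h : η.tr u = η.tr v) :
    u = v := by
  have h1 : η.tr (u + -v) = 1 := by rw [tr_add hu (neg_mem hv), tr_neg hv, h, mul_inv_cancel]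
  have h2 : u + -v = 0 := by
    refine eq_zero_of_tr_app_q (add_mem hu (neg_mem hv)) (a := η.e) ?_
    rw [h1, Unitary.app_one, ← η.q_act]
  exact eq_of_add_neg_eq_zero h2

/-- The conjugate of a transvection by an element preserving the lines of `q_η` and `q_{-η}`. -/
theorem tr_conj {g : O.Unitary} {a b : R} (hab : a * b = η.e) (hq : g.app η.q = O.act η.q a)
    (hbe : b * η.e = b) (hq' : g.app η.q' = O.act η.q' (star b))
    {u : Δ} (hu : u ∈ η.unip) :
    O.act (g.app u) b ∈ η.unip ∧ g * η.tr u * g⁻¹ = η.tr (O.act (g.app u) b) := by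
  have sbe : η.e' * star b = star b := by rw [← η.star_e, ← star_mul, hbe]
  have hα' : g.β * η.e' + η.e' = star b := by
    have := congrArg O.π hq'
    rwa [Unitary.π_app, O.π_act, η.π_q', sbe] at this
  have hbα : b * g.β + b = η.e := by rw [g.mul_β_add hα', η.star_e']
  have hα : g.β * η.e + η.e = η.e * a := by
    have := congrArg O.π hq
    rwa [Unitary.π_app, O.π_act, η.π_q] at this
  -- The pairing is invariant, so `g.app u` is orthogonal to the images of both `q_η` and `q_{-η}`;
  -- the coefficients `a` and `b` are then cancelled in `n1` and `n2`.
  have key : ∀ (v w : Δ), star (O.π v) * O.π w = 0 → star (O.π (g.app v)) * O.π (g.app w) = 0 :=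
    fun v w h => by rw [g.star_π_app_mul_π_app, h]
  have m1 : star (a) * η.e' * O.π (g.app u) = 0 := by
    have := key η.q u (by rw [η.π_q, η.star_e, e'_mul_π hu])
    rwa [hq, O.π_act, η.π_q, star_mul, η.star_e] at this
  have m2 : b * η.e * O.π (g.app u) = 0 := by
    have := key η.q' u (by rw [η.π_q', η.star_e', e_mul_π hu])
    rwa [hq', O.π_act, η.π_q', star_mul, star_star, η.star_e'] at this
  have n1 : η.e' * O.π (g.app u) = 0 := by
    have h : star b * star a = η.e' := by rw [← star_mul, hab, η.star_e]
    rw [← η.idem'.eq]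
    nth_rw 1 [← h]
    rw [mul_assoc, mul_assoc, ← mul_assoc (star a), m1, mul_zero]
  have n2 : η.e * O.π (g.app u) = 0 := by
    rw [← η.idem.eq]
    nth_rw 1 [← hab]
    rw [mul_assoc, mul_assoc, ← mul_assoc b, m2, mul_zero]
  have hu' : O.act (g.app u) b ∈ η.unip := by
    rw [mem_unip_iff, ← O.act_mul, hbe, O.π_act, ← mul_assoc, n2, ← mul_assoc, n1, zero_mul]
    exact ⟨rfl, rfl, rfl⟩
  refine ⟨hu', ?_⟩
  rw [mul_inv_eq_iff_eq_mul]
  apply Unitary.ext_γ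
  set s := O.ρ u - star (O.π u) with hs
  have es : η.e' * s = s := by rw [hs, mul_sub, e'_mul_ρ hu, e'_mul_star_π hu]
  have eq's : g.app (O.act η.q' s) = O.act η.q' (star b * s) := by
    rw [Unitary.app_act, hq', O.act_mul]
  -- the left hand side
  have L : (g * η.tr u).γ = g.app u + g.app (O.act η.q' s) + (-O.φ (O.ρ u + O.π u)) + g.γ := by
    have c1 : ∀ w, g.γ + (u + w) = O.φ (-(star g.β * O.π u)) + (u + (g.γ + w)) := by
      intro w
      rw [← add_assoc, O.add_eq g.γ u, g.π_γ]; simp only [add_assoc]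
    have c2 : ∀ w, g.γ + (O.act η.q' s + w)
        = O.φ (-(star g.β * s)) + (O.act η.q' s + (g.γ + w)) := by
      intro w
      rw [← add_assoc, O.add_eq g.γ, g.π_γ, O.π_act, η.π_q', es]; simp only [add_assoc]
    have c2' : g.γ + O.act η.q' s = O.φ (-(star g.β * s)) + (O.act η.q' s + g.γ) := by
      simpa using c2 0
    have c3 : ∀ w, O.act g.γ s + (u + w)
        = O.φ (-(star s * star g.β * O.π u)) + (u + (O.act g.γ s + w)) := by
      intro w
      rw [← add_assoc, O.add_eq (O.act g.γ s) u, O.π_act, g.π_γ, star_mul]; simp only [add_assoc]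
    have hβ : O.ρ u + O.π u - star (O.π u) = O.π u + s := by rw [hs]; abel
    rw [Unitary.mul_γ, act1, tr_β hu, tr_γ hu, g.ρ_γ, ← hs, hβ, O.act_add, Unitary.app,
      Unitary.app, O.π_act, η.π_q', es, g.ρ_γ]
    simp only [← O.φ_neg, add_assoc, c1, c2, c2', c3, O.add_φ_add u, O.add_φ_add g.γ,
      O.add_φ_add (O.act _ _), O.add_φ, O.φ_add_φ_add, O.φ_add_φ]
    congr 2
    simp only [mul_add]
    abel
  -- On the other side `γ` of the transvection is acted on by `α g`. The three equalities `l1`,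
  -- `l2`, `l3` match its three summands with those in `L`, each time by absorbing `α g` through
  -- `hbα`.
  rw [L, Unitary.mul_γ, tr_γ hu', O.add_act1, O.add_act1, O.neg_act1, O.act1_act, O.act1_act,
    O.act1_φ, hbα, eq's]
  have l1 : O.act (g.app u) η.e = g.app u := by rw [← Unitary.app_act, act_e hu]
  have hab' : star g.β * star b + star b = η.e' := by
    rw [← η.star_e, ← hbα, star_add, star_mul]
  have gg : ∀ x, star (O.π u) * star g.β * (g.β * x) + star (O.π u) * star g.β * x
      + star (O.π u) * (g.β * x) = 0 := by
    intro x
    have := congrArg (fun y => star (O.π u) * y * x) g.star_β_mul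
    simp only [mul_add, add_mul, mul_assoc, mul_zero, zero_mul] at this ⊢
    rw [← this]; abel
  have l2 : (O.ρ (O.act (g.app u) b) - star (O.π (O.act (g.app u) b))) * g.β +
      (O.ρ (O.act (g.app u) b) - star (O.π (O.act (g.app u) b))) = star b * s := by
    have h1 : star b * O.ρ u * b * g.β + star b * O.ρ u * b = star b * O.ρ u := by
      rw [mul_assoc, ← mul_add, hbα, mul_assoc, ρ_mul_e hu]
    have h2 : star (O.π (O.act (g.app u) b)) * g.β + star (O.π (O.act (g.app u) b))
        = star b * star (O.π u) := by
      have := congrArg (fun y => star b * star (O.π u) * y) g.star_β_mul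
      simp only [mul_add, mul_zero] at this
      rw [O.π_act, Unitary.π_app, star_mul, star_add, star_mul]
      simp only [mul_add, add_mul, mul_assoc] at this ⊢
      rw [← sub_eq_zero, ← this]; abel
    rw [sub_mul, O.ρ_act, Unitary.ρ_app, hs, mul_sub, ← h2]
    nth_rw 3 [← h1]
    abel
  have l3 : star g.β * (O.ρ (O.act (g.app u) b) + O.π (O.act (g.app u) b)) * g.β +
      (O.ρ (O.act (g.app u) b) + O.π (O.act (g.app u) b)) * g.β +
      star g.β * (O.ρ (O.act (g.app u) b) + O.π (O.act (g.app u) b)) +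
      (O.ρ (O.act (g.app u) b) + O.π (O.act (g.app u) b)) = O.ρ u + O.π u := by
    have h1 : (O.ρ (O.act (g.app u) b) + O.π (O.act (g.app u) b)) * g.β +
        (O.ρ (O.act (g.app u) b) + O.π (O.act (g.app u) b))
        = star b * O.ρ u + g.β * O.π u + O.π u := by
      have h11 : O.ρ (O.act (g.app u) b) + O.π (O.act (g.app u) b)
          = (star b * O.ρ u + g.β * O.π u + O.π u) * b := by
        rw [O.ρ_act, Unitary.ρ_app, O.π_act, Unitary.π_app]; noncomm_ring
      have h12 : (star b * O.ρ u + g.β * O.π u + O.π u) * η.e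
          = star b * O.ρ u + g.β * O.π u + O.π u := by
        simp only [add_mul, mul_assoc, ρ_mul_e hu, π_mul_e hu]
      rw [h11, mul_assoc, ← mul_add, hbα, h12]
    have h2 : star g.β * (O.ρ (O.act (g.app u) b) + O.π (O.act (g.app u) b)) * g.β +
        star g.β * (O.ρ (O.act (g.app u) b) + O.π (O.act (g.app u) b))
        = star g.β * (star b * O.ρ u + g.β * O.π u + O.π u) := by
      rw [mul_assoc, ← mul_add, h1]
    have h3 : star g.β * (star b * O.ρ u) + star b * O.ρ u = O.ρ u := by
      rw [← mul_assoc, ← add_mul, hab', e'_mul_ρ hu]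
    have h4 : star g.β * (g.β * O.π u) + star g.β * O.π u + g.β * O.π u = 0 := by
      have := congrArg (fun y => y * O.π u) g.star_β_mul
      simp only [add_mul, mul_assoc, zero_mul] at this
      rw [← this]; abel
    calc _ = (star g.β * (O.ρ (O.act (g.app u) b) + O.π (O.act (g.app u) b)) * g.β +
        star g.β * (O.ρ (O.act (g.app u) b) + O.π (O.act (g.app u) b))) +
        ((O.ρ (O.act (g.app u) b) + O.π (O.act (g.app u) b)) * g.β +
        (O.ρ (O.act (g.app u) b) + O.π (O.act (g.app u) b))) := by abel
      _ = (star g.β * (star b * O.ρ u) + star b * O.ρ u)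
        + (star g.β * (g.β * O.π u) + star g.β * O.π u + g.β * O.π u) + O.π u := by
          rw [h1, h2, mul_add, mul_add]; abel
      _ = _ := by rw [h3, h4, add_zero]
  rw [l1, l2, l3]

/-- Transitivity of the transvections on vectors opposite to `q_{-η}`. -/
theorem exists_tr_app_q {x : Δ} (hx : O.act x η.e = x) (h1 : η.e * O.π x = η.e)
    (h0 : O.ρ x = 0) :
    ∃ u ∈ η.unip, (η.tr u).app η.q = x ∧
      O.π u = O.π x - η.e - η.e' * O.π x := by
  set c := η.e' * O.π x with hc
  have hce : c * η.e = c := by rw [hc, mul_assoc, ← O.π_act, hx]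
  have hec : η.e' * c = c := by rw [hc, ← mul_assoc, η.idem'.eq]
  -- The formula of `tr_app_q` solved for `u`, with `c` standing in for `ρ u`. That `ρ u` really
  -- equals `c` is forced later by `ρ x = 0`.
  set u := x + -η.q + O.φ c + -O.act η.q' c with hu
  have hφ : O.act (O.φ c) η.e = O.φ c := by
    rw [O.φ_act, η.star_e, hec, hce]
  have hπ : O.π u = O.π x - η.e - c := by
    rw [hu]
    simp only [O.π_add, O.π_neg, O.π_φ, O.π_act, η.π_q, η.π_q', hec]
    abel
  have hmem : u ∈ η.unip := by
    rw [mem_unip_iff]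
    refine ⟨?_, ?_, ?_⟩
    · rw [hu]
      simp only [O.add_act, O.neg_act, hφ, ← O.act_mul, hce, hx]
      rw [← η.q_act]
    · rw [hπ, mul_sub, mul_sub, h1, η.idem.eq, ← hec, ← mul_assoc, η.mul_e']; simp
    · rw [hπ, mul_sub, mul_sub, η.e'_mul, hec, hc]; simp
  have hx' : x = u + O.act η.q' c + -O.φ c + η.q := by
    rw [hu]; simp [add_assoc]
  have hρ : O.ρ u = c := by
    have h2 := h0
    rw [hx'] at h2
    simp only [O.ρ_add, O.π_add, O.π_neg, O.π_φ, O.π_act, η.π_q, η.π_q', hec, O.ρ_act, η.ρ_q,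
      η.ρ_q', O.ρ_neg, O.ρ_φ, star_add, star_sub, star_star, neg_zero, add_zero, mul_zero,
      zero_mul, add_mul, star_π_mul_e hmem] at h2
    have h3 : star (O.π u) * c = 0 := by rw [← hec, ← mul_assoc, star_π_mul_e' hmem, zero_mul]
    have h4 : star c * η.e = star c := by
      rw [← η.star_e', ← star_mul, hec]
    rw [h3, h4] at h2
    rw [← sub_eq_zero, ← h2]
    abel
  refine ⟨u, hmem, ?_, hπ⟩
  rw [tr_app_q hmem, hρ, ← hx']

end HyperbolicPair

end OddFormRing

/-! ### Steinberg relations for transvections and the canonical map -/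

namespace OddFormRing

variable {R : Type u} {Δ : Type v} [NonUnitalRing R] [StarRing R] [AddGroup Δ]

namespace SignedIndex

variable {n : ℕ}

theorem neg_ne_self (i : SignedIndex n) : -i ≠ i := by
  obtain ⟨k, b⟩ := i
  intro h
  have : (!b) = b := congrArg SignedIndex.pos h
  cases b <;> simp at this

theorem ne_neg_self (i : SignedIndex n) : i ≠ -i := (neg_ne_self i).symm

theorem apart_iff_idx {i j : SignedIndex n} : Apart i j ↔ i.idx ≠ j.idx := by
  obtain ⟨k, a⟩ := i
  obtain ⟨l, b⟩ := j
  constructor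
  · rintro ⟨h1, h2⟩ (h : k = l)
    subst h
    cases a <;> cases b <;> first | exact h1 rfl | exact h2 rfl
  · intro h
    exact ⟨fun h' => h (congrArg SignedIndex.idx h'), fun h' => h (by
      have := congrArg SignedIndex.idx h'; exact this)⟩

theorem Apart.neg_neg {i j : SignedIndex n} (h : Apart i j) : Apart (-i) (-j) :=
  h.neg_left.neg_right

theorem Apart.swap {i j : SignedIndex n} (h : Apart i j) : Apart (-j) (-i) := h.symm.neg_neg

theorem eq_or_eq_neg {i j : SignedIndex n} (h : ¬Apart i j) : i = j ∨ i = -j := by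
  unfold Apart at h
  tauto

end SignedIndex

namespace OrthogonalHyperbolicFamily

open SignedIndex
open scoped commutatorElement

variable {O : OddFormRing R Δ} {n : ℕ} (F : O.OrthogonalHyperbolicFamily n)

/-! ### Peirce decomposition -/

theorem η_neg (i : SignedIndex n) : F.η (-i) = -F.η i := by
  obtain ⟨k, _ | _⟩ := i <;> rfl

theorem e'_η (i : SignedIndex n) : (F.η i).e' = F.e (-i) := by rw [e, η_neg]; rfl

theorem q'_η (i : SignedIndex n) : (F.η i).q' = F.q (-i) := by rw [q, η_neg]; rfl

theorem e_η (i : SignedIndex n) : (F.η i).e = F.e i := rfl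

theorem q_η (i : SignedIndex n) : (F.η i).q = F.q i := rfl

theorem π_q (i : SignedIndex n) : O.π (F.q i) = F.e i := (F.η i).π_q

theorem ρ_q (i : SignedIndex n) : O.ρ (F.q i) = 0 := (F.η i).ρ_q

theorem q_act_e (i : SignedIndex n) : O.act (F.q i) (F.e i) = F.q i := (F.η i).q_act.symm

theorem e_mul_e {i j : SignedIndex n} (h : i ≠ j) : F.e i * F.e j = 0 := by
  by_cases h' : i = -j
  · subst h'
    rw [← F.e'_η]
    exact (F.η j).e'_mul
  · have := congrArg (F.e i * ·) (F.eAbs_mul_e (i := j) (j := i) (⟨h.symm, fun h'' => h' (by rw [h'', neg_neg])⟩))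
    simpa only [← mul_assoc, e, HyperbolicPair.e_mul_eAbs, mul_zero] using this

variable {F}

theorem e_mul {i j : SignedIndex n} {a : R} (ha : a ∈ F.ring i j) : F.e i * a = a :=
  (F.mem_ring.1 ha).1

theorem mul_e {i j : SignedIndex n} {a : R} (ha : a ∈ F.ring i j) : a * F.e j = a :=
  (F.mem_ring.1 ha).2

theorem e_mul_eq_zero {i j k : SignedIndex n} {a : R} (ha : a ∈ F.ring i j) (h : k ≠ i) :
    F.e k * a = 0 := by
  rw [← e_mul ha, ← mul_assoc, F.e_mul_e h, zero_mul]

theorem mul_e_eq_zero {i j k : SignedIndex n} {a : R} (ha : a ∈ F.ring i j) (h : j ≠ k) :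
    a * F.e k = 0 := by
  rw [← mul_e ha, mul_assoc, F.e_mul_e h, mul_zero]

theorem mul_eq_zero {i j k l : SignedIndex n} {a b : R} (ha : a ∈ F.ring i j)
    (hb : b ∈ F.ring k l) (h : j ≠ k) : a * b = 0 := by
  rw [← e_mul hb, ← mul_assoc, mul_e_eq_zero ha h, zero_mul]

theorem star_mem_right {i j : SignedIndex n} {a : R} (ha : a ∈ F.ring (-i) j) :
    star a ∈ F.ring (-j) i := by
  have := F.star_mem ha
  rwa [neg_neg] at this

theorem e_mem (i : SignedIndex n) : F.e i ∈ F.ring i i :=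
  F.mem_ring.2 ⟨F.e_idem i, F.e_idem i⟩

theorem e_mul_eTot (i : SignedIndex n) : F.e i * F.eTot = F.e i := by
  have := congrArg (F.e i * ·) (F.eAbs_mul_eTot i)
  simpa only [← mul_assoc, e, HyperbolicPair.e_mul_eAbs] using this

theorem eTot_eq : F.eTot = ∑ k : Fin n, (F.e ⟨k, true⟩ + F.e ⟨k, false⟩) := rfl

theorem mem_form_iff {i : SignedIndex n} {u : Δ} :
    u ∈ F.form i ↔ O.act u (F.e i) = u ∧ ∀ k, F.e k * O.π u = 0 := by
  rw [mem_form]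
  refine and_congr_right fun _ => ⟨fun h k => ?_, fun h => ?_⟩
  · rw [← e_mul_eTot, mul_assoc, h, mul_zero]
  · rw [eTot_eq, Finset.sum_mul]
    exact Finset.sum_eq_zero fun k _ => by rw [add_mul, h, h, add_zero]

theorem form_act {i : SignedIndex n} {u : Δ} (hu : u ∈ F.form i) : O.act u (F.e i) = u :=
  (mem_form_iff.1 hu).1

theorem e_mul_π {i : SignedIndex n} {u : Δ} (hu : u ∈ F.form i) (k : SignedIndex n) :
    F.e k * O.π u = 0 := (mem_form_iff.1 hu).2 k

theorem star_π_mul_e {i : SignedIndex n} {u : Δ} (hu : u ∈ F.form i) (k : SignedIndex n) :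
    star (O.π u) * F.e k = 0 := by
  rw [← neg_neg k, ← F.star_e, ← star_mul, e_mul_π hu, star_zero]

theorem star_π_mul {i : SignedIndex n} {u : Δ} (hu : u ∈ F.form i) {j k : SignedIndex n} {a : R}
    (ha : a ∈ F.ring j k) : star (O.π u) * a = 0 := by
  rw [← e_mul ha, ← mul_assoc, star_π_mul_e hu, zero_mul]

theorem mul_π {i : SignedIndex n} {u : Δ} (hu : u ∈ F.form i) {j k : SignedIndex n} {a : R}
    (ha : a ∈ F.ring j k) : a * O.π u = 0 := by
  rw [← mul_e ha, mul_assoc, e_mul_π hu, mul_zero]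

theorem π_mul_eq_zero {i : SignedIndex n} {u : Δ} (hu : u ∈ F.form i) {j k : SignedIndex n} {a : R}
    (ha : a ∈ F.ring j k) (h : i ≠ j) : O.π u * a = 0 := by
  rw [← F.π_mul_e hu, mul_assoc, e_mul_eq_zero ha h, mul_zero]

theorem act_eq_zero {u : Δ} {i : SignedIndex n} {a : R} (hu : O.act u (F.e i) = u)
    (ha : F.e i * a = 0) : O.act u a = 0 := by
  rw [← hu, ← O.act_mul, ha, O.act_zero]

theorem π_q_act {i j : SignedIndex n} {a : R} (ha : a ∈ F.ring i j) :
    O.π (O.act (F.q i) a) = a := by rw [O.π_act, F.π_q, e_mul ha]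

theorem ρ_q_act (i : SignedIndex n) (a : R) : O.ρ (O.act (F.q i) a) = 0 := by
  rw [O.ρ_act, F.ρ_q, mul_zero, zero_mul]

theorem mem_unip_iff {i : SignedIndex n} {u : Δ} :
    u ∈ (F.η i).unip ↔ O.act u (F.e i) = u ∧ F.e i * O.π u = 0 ∧ F.e (-i) * O.π u = 0 := by
  rw [HyperbolicPair.mem_unip_iff, e'_η]; rfl

theorem form_mem_unip {i : SignedIndex n} {u : Δ} (hu : u ∈ F.form i) : u ∈ (F.η i).unip :=
  F.form_le_unip i hu

theorem φ_mem_form {i : SignedIndex n} {a : R} (ha : a ∈ F.ring (-i) i) : O.φ a ∈ F.form i :=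
  F.φ_mem ha

theorem φ_mem_form' {i : SignedIndex n} {a : R} (ha : a ∈ F.ring i (-i)) :
    O.φ a ∈ F.form (-i) := F.φ_mem (by rwa [neg_neg])

/-! ### Transvections of the family -/

variable (F)

/-- The transvection `T^{η_i}(u)`, extended by `1`. -/
noncomputable def T (i : SignedIndex n) (u : Δ) : O.Unitary := (F.η i).tr u

/-- The elementary transvection `T_{ij}(a)`, extended by `1`. -/
noncomputable def t2 (i j : SignedIndex n) (a : R) : O.Unitary := F.T j (O.act (F.q i) a)

variable {F}

theorem t2_def (i j : SignedIndex n) (a : R) : F.t2 i j a = F.T j (O.act (F.q i) a) := rfl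

theorem T_add {i : SignedIndex n} {u v : Δ} (hu : u ∈ (F.η i).unip) (hv : v ∈ (F.η i).unip) :
    F.T i (u + v) = F.T i u * F.T i v := HyperbolicPair.tr_add hu hv

theorem T_zero (i : SignedIndex n) : F.T i 0 = 1 := HyperbolicPair.tr_zero

theorem T_neg {i : SignedIndex n} {u : Δ} (hu : u ∈ (F.η i).unip) : F.T i (-u) = (F.T i u)⁻¹ :=
  HyperbolicPair.tr_neg hu

theorem T_injective {i : SignedIndex n} {u v : Δ} (hu : u ∈ (F.η i).unip)
    (hv : v ∈ (F.η i).unip) (h : F.T i u = F.T i v) : u = v := HyperbolicPair.tr_injective hu hv h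

theorem T_app_q_neg {i : SignedIndex n} {u : Δ} (hu : u ∈ (F.η i).unip) :
    (F.T i u).app (F.q (-i)) = F.q (-i) := by
  rw [← q'_η]; exact HyperbolicPair.tr_app_q' hu

theorem T_app_of_mul {i : SignedIndex n} {u : Δ} (hu : u ∈ (F.η i).unip) {x : Δ}
    (h1 : F.e i * O.π x = 0) (h2 : star (O.π u) * O.π x = 0) : (F.T i u).app x = x :=
  HyperbolicPair.tr_app_of_mul hu h1 h2

theorem act_T_γ {i : SignedIndex n} {u : Δ} (hu : u ∈ (F.η i).unip) (a : R) :
    O.act (F.T i u).γ a = O.act u a + O.act (F.q (-i)) (O.ρ u * a - star (O.π u) * a)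
      + -O.φ (star a * (O.ρ u + O.π u) * a) := by
  rw [← q'_η]; exact HyperbolicPair.act_tr_γ hu a

theorem q_act_unip {i j : SignedIndex n} (h : Apart i j) {a : R} (ha : a ∈ F.ring i j) :
    O.act (F.q i) a ∈ (F.η j).unip := F.q_act_mem_unip h ha

theorem act_t2_γ {i j : SignedIndex n} (h : Apart i j) {a : R} (ha : a ∈ F.ring i j) (b : R) :
    O.act (F.t2 i j a).γ b = O.act (F.q i) (a * b) + O.act (F.q (-j)) (-(star a * b))
      + -O.φ (star b * a * b) := by
  rw [t2, act_T_γ (q_act_unip h ha), ρ_q_act, π_q_act ha, ← O.act_mul, zero_mul, zero_add, zero_sub]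

theorem T_app_q_of_form {i k : SignedIndex n} {u : Δ} (hu : u ∈ F.form i) (h : i ≠ k) :
    (F.T i u).app (F.q k) = F.q k := by
  apply T_app_of_mul (form_mem_unip hu)
  · rw [π_q, F.e_mul_e h]
  · rw [π_q, star_π_mul_e hu]

theorem t2_app_q {i j k : SignedIndex n} (h : Apart i j) {a : R} (ha : a ∈ F.ring i j)
    (h1 : j ≠ k) (h2 : -i ≠ k) : (F.t2 i j a).app (F.q k) = F.q k := by
  apply T_app_of_mul (q_act_unip h ha)
  · rw [π_q, F.e_mul_e h1]
  · rw [π_q_act ha, π_q, mul_e_eq_zero (F.star_mem ha) h2]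

theorem T_conj {g : O.Unitary} {i : SignedIndex n} {a b : R}
    (hb : b ∈ F.ring i i) (hab : a * b = F.e i) (hq : g.app (F.q i) = O.act (F.q i) a)
    (hq' : g.app (F.q (-i)) = O.act (F.q (-i)) (star b)) {u : Δ} (hu : u ∈ (F.η i).unip) :
    O.act (g.app u) b ∈ (F.η i).unip ∧ g * F.T i u * g⁻¹ = F.T i (O.act (g.app u) b) := by
  rw [← q'_η] at hq'
  exact HyperbolicPair.tr_conj hab hq (mul_e hb) hq' hu

theorem T_conj_of_fix {g : O.Unitary} {i : SignedIndex n} (hq : g.app (F.q i) = F.q i)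
    (hq' : g.app (F.q (-i)) = F.q (-i)) {u : Δ} (hu : u ∈ (F.η i).unip) :
    g.app u ∈ (F.η i).unip ∧ g * F.T i u * g⁻¹ = F.T i (g.app u) := by
  have h := T_conj (e_mem i) (F.e_idem i) (by rw [hq, q_act_e])
    (by rw [hq', F.star_e, q_act_e]) hu
  rwa [← g.app_act, (mem_unip_iff.1 hu).1] at h

/-- If `g` fixes `q_{±i}`, conjugation by `g` only moves the parameter `u` to `g.app u`, which is
`u` preceded by the increment `γ(g)·π(u)`. Together with `T_commutator_same` this computes every
commutator needed for the Steinberg relations. -/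
theorem T_commutator_of_fix {g : O.Unitary} {i : SignedIndex n} (hq : g.app (F.q i) = F.q i)
    (hq' : g.app (F.q (-i)) = F.q (-i)) {u : Δ} (hu : u ∈ (F.η i).unip) :
    ⁅g, F.T i u⁆ = F.T i (O.act g.γ (O.π u)) := by
  obtain ⟨h1, h2⟩ := T_conj_of_fix hq hq' hu
  have h3 : O.act g.γ (O.π u) ∈ (F.η i).unip := by
    have : g.app u + -u ∈ (F.η i).unip := add_mem h1 (neg_mem hu)
    rwa [Unitary.app, add_assoc, add_neg_cancel, add_zero] at this
  rw [commutatorElement_def, h2, Unitary.app, T_add h3 hu, mul_inv_cancel_right]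

theorem T_commutator_same {i : SignedIndex n} {u v : Δ} (hu : u ∈ (F.η i).unip)
    (hv : v ∈ (F.η i).unip) :
    ⁅F.T i u, F.T i v⁆ = F.T i (O.φ (-(star (O.π u) * O.π v))) := by
  rw [commutatorElement_def, ← T_neg hu, ← T_neg hv, ← T_add hu hv,
    ← T_add (add_mem hu hv) (neg_mem hu),
    ← T_add (add_mem (add_mem hu hv) (neg_mem hu)) (neg_mem hv), O.commutator]

variable (F)

/-! ### Steinberg relations -/

/-- The Steinberg relations for two families of elements of a group. -/
structure Rels {G : Type*} [Group G] (y1 : SignedIndex n → Δ → G)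
    (y2 : SignedIndex n → SignedIndex n → R → G) : Prop where
  r0 : ∀ {i j a}, Apart i j → a ∈ F.ring i j → y2 i j a = y2 (-j) (-i) (-star a)
  r1 : ∀ {i j a b}, Apart i j → a ∈ F.ring i j → b ∈ F.ring i j →
    y2 i j (a + b) = y2 i j a * y2 i j b
  r2 : ∀ {i u v}, u ∈ F.form i → v ∈ F.form i → y1 i (u + v) = y1 i u * y1 i v
  r3 : ∀ {i j k l a b}, Apart i j → Apart k l → i ≠ l → l ≠ -j → j ≠ k → -k ≠ i →
    a ∈ F.ring i j → b ∈ F.ring k l → ⁅y2 i j a, y2 k l b⁆ = 1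
  r4 : ∀ {i j k a b}, Apart i j → Apart j k → Apart i k → a ∈ F.ring i j → b ∈ F.ring j k →
    ⁅y2 i j a, y2 j k b⁆ = y2 i k (a * b)
  r5 : ∀ {i j a b}, Apart i j → a ∈ F.ring i j → b ∈ F.ring j (-i) →
    ⁅y2 i j a, y2 j (-i) b⁆ = y1 (-i) (O.φ (a * b))
  r6 : ∀ {i j u v}, Apart i j → u ∈ F.form i → v ∈ F.form j →
    ⁅y1 i u, y1 j v⁆ = y2 (-i) j (-(star (O.π u) * O.π v))
  r7 : ∀ {i j k u a}, Apart j k → j ≠ i → i ≠ -k → u ∈ F.form i → a ∈ F.ring j k →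
    ⁅y1 i u, y2 j k a⁆ = 1
  r8 : ∀ {i j u a}, Apart i j → u ∈ F.form i → a ∈ F.ring i j →
    ⁅y1 i u, y2 i j a⁆ = y2 (-i) j (O.ρ u * a) * y1 j (-O.act u (-a))

variable {F} in
/-- The homomorphism from the Steinberg group given by elements satisfying the relations. -/
def Rels.lift {G : Type*} [Group G] {y1 : SignedIndex n → Δ → G}
    {y2 : SignedIndex n → SignedIndex n → R → G} (h : F.Rels y1 y2) : F.StU →* G :=
  PresentedGroup.toGroup (f := fun x => match x with
    | .short i j _ a => y2 i j a
    | .ultra i u => y1 i u) (by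
      intro r hr
      cases hr with
      | st0 i j hij a =>
        simp only [x2, map_mul, map_inv, FreeGroup.lift_apply_of]
        rw [mul_inv_eq_one]; exact h.r0 hij a.2
      | st1 i j hij a b =>
        simp only [x2, map_mul, map_inv, FreeGroup.lift_apply_of]
        rw [mul_inv_eq_one]; exact (h.r1 hij a.2 b.2).symm
      | st2 i u v =>
        simp only [x1, map_mul, map_inv, FreeGroup.lift_apply_of]
        rw [mul_inv_eq_one]; exact (h.r2 u.2 v.2).symm
      | st3 i j k l hij hkl h1 h2 h3 h4 a b =>
        simp only [x2, map_commutatorElement, FreeGroup.lift_apply_of]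
        exact h.r3 hij hkl h1 h2 (fun h' => h3 (by rw [h'])) h4 a.2 b.2
      | st4 i j k hij hjk hik a b =>
        simp only [x2, map_mul, map_inv, map_commutatorElement, FreeGroup.lift_apply_of]
        rw [mul_inv_eq_one]; exact h.r4 hij hjk hik a.2 b.2
      | st5 i j hij a b =>
        simp only [x1, x2, map_mul, map_inv, map_commutatorElement, FreeGroup.lift_apply_of]
        rw [mul_inv_eq_one]; exact h.r5 hij a.2 b.2
      | st6 i j hij u v =>
        simp only [x1, x2, map_mul, map_inv, map_commutatorElement, FreeGroup.lift_apply_of]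
        rw [mul_inv_eq_one]; exact h.r6 hij u.2 v.2
      | st7 i j k hjk h1 h2 u a =>
        simp only [x1, x2, map_commutatorElement, FreeGroup.lift_apply_of]
        exact h.r7 hjk h1 h2 u.2 a.2
      | st8 i j hij u a =>
        simp only [x1, x2, map_mul, map_inv, map_commutatorElement, FreeGroup.lift_apply_of]
        rw [mul_inv_eq_one]; exact h.r8 hij u.2 a.2)

open scoped Classical in
/-- The generator `X_i(u)` of the Steinberg group, extended by `1`. -/
noncomputable def S1 (i : SignedIndex n) (u : Δ) : F.StU :=
  if h : u ∈ F.form i then F.X1 i ⟨u, h⟩ else 1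

open scoped Classical in
/-- The generator `X_{ij}(a)` of the Steinberg group, extended by `1`. -/
noncomputable def S2 (i j : SignedIndex n) (a : R) : F.StU :=
  if h : Apart i j ∧ a ∈ F.ring i j then F.X2 i j h.1 ⟨a, h.2⟩ else 1

variable {F}

theorem S1_of_mem {i : SignedIndex n} {u : Δ} (h : u ∈ F.form i) : F.S1 i u = F.X1 i ⟨u, h⟩ :=
  dif_pos h

theorem S2_of_mem {i j : SignedIndex n} {a : R} (h : Apart i j) (ha : a ∈ F.ring i j) :
    F.S2 i j a = F.X2 i j h ⟨a, ha⟩ := dif_pos ⟨h, ha⟩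

theorem Rels.lift_S1 {G : Type*} [Group G] {y1 : SignedIndex n → Δ → G}
    {y2 : SignedIndex n → SignedIndex n → R → G} (h : F.Rels y1 y2) {i : SignedIndex n} {u : Δ}
    (hu : u ∈ F.form i) : h.lift (F.S1 i u) = y1 i u := by
  rw [S1_of_mem hu]; exact PresentedGroup.toGroup.of _

theorem Rels.lift_S2 {G : Type*} [Group G] {y1 : SignedIndex n → Δ → G}
    {y2 : SignedIndex n → SignedIndex n → R → G} (h : F.Rels y1 y2) {i j : SignedIndex n} {a : R}
    (hij : Apart i j) (ha : a ∈ F.ring i j) : h.lift (F.S2 i j a) = y2 i j a := by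
  rw [S2_of_mem hij ha]; exact PresentedGroup.toGroup.of _

variable (F) in
theorem rels_S : F.Rels F.S1 F.S2 where
  r0 := by
    intro i j a h ha
    rw [S2_of_mem h ha, S2_of_mem h.swap (neg_mem (F.star_mem ha)), ← mul_inv_eq_one]
    exact PresentedGroup.one_of_mem (rels := {w | F.StRel w}) (StRel.st0 i j h ⟨a, ha⟩)
  r1 := by
    intro i j a b h ha hb
    rw [S2_of_mem h ha, S2_of_mem h hb, S2_of_mem h (add_mem ha hb), eq_comm, ← mul_inv_eq_one]
    exact PresentedGroup.one_of_mem (rels := {w | F.StRel w}) (StRel.st1 i j h ⟨a, ha⟩ ⟨b, hb⟩)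
  r2 := by
    intro i u v hu hv
    rw [S1_of_mem hu, S1_of_mem hv, S1_of_mem (add_mem hu hv), eq_comm, ← mul_inv_eq_one]
    exact PresentedGroup.one_of_mem (rels := {w | F.StRel w}) (StRel.st2 i ⟨u, hu⟩ ⟨v, hv⟩)
  r3 := by
    intro i j k l a b hij hkl h1 h2 h3 h4 ha hb
    rw [S2_of_mem hij ha, S2_of_mem hkl hb]
    exact PresentedGroup.one_of_mem (rels := {w | F.StRel w})
      (StRel.st3 i j k l hij hkl h1 h2 (fun h => h3 (neg_injective h)) h4 ⟨a, ha⟩ ⟨b, hb⟩)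
  r4 := by
    intro i j k a b hij hjk hik ha hb
    rw [S2_of_mem hij ha, S2_of_mem hjk hb, S2_of_mem hik (F.mul_mem ha hb), ← mul_inv_eq_one]
    exact PresentedGroup.one_of_mem (rels := {w | F.StRel w})
      (StRel.st4 i j k hij hjk hik ⟨a, ha⟩ ⟨b, hb⟩)
  r5 := by
    intro i j a b h ha hb
    rw [S2_of_mem h ha, S2_of_mem h.symm.neg_right hb, S1_of_mem (φ_mem_form' (F.mul_mem ha hb)),
      ← mul_inv_eq_one]
    exact PresentedGroup.one_of_mem (rels := {w | F.StRel w}) (StRel.st5 i j h ⟨a, ha⟩ ⟨b, hb⟩)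
  r6 := by
    intro i j u v h hu hv
    rw [S1_of_mem hu, S1_of_mem hv, S2_of_mem h.neg_left (neg_mem (F.star_π_mul_π_mem hu hv)),
      ← mul_inv_eq_one]
    exact PresentedGroup.one_of_mem (rels := {w | F.StRel w}) (StRel.st6 i j h ⟨u, hu⟩ ⟨v, hv⟩)
  r7 := by
    intro i j k u a h h1 h2 hu ha
    rw [S1_of_mem hu, S2_of_mem h ha]
    exact PresentedGroup.one_of_mem (rels := {w | F.StRel w})
      (StRel.st7 i j k h h1 h2 ⟨u, hu⟩ ⟨a, ha⟩)
  r8 := by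
    intro i j u a h hu ha
    rw [S1_of_mem hu, S2_of_mem h ha, S2_of_mem h.neg_left (F.mul_mem (F.ρ_mem hu) ha),
      S1_of_mem (neg_mem (F.act_mem hu (neg_mem ha))), ← mul_inv_eq_one]
    exact PresentedGroup.one_of_mem (rels := {w | F.StRel w}) (StRel.st8 i j h ⟨u, hu⟩ ⟨a, ha⟩)

variable (F) in
-- Each commutator falls under one of two patterns, possibly after rewriting a factor by the swap
-- relation: both factors are transvections for the same pair, or the left one fixes `q_{±j}` for
-- the pair of the right one.
theorem rels_T : F.Rels F.T F.t2 := by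
  have r0 : ∀ {i j a}, Apart i j → a ∈ F.ring i j → F.t2 i j a = F.t2 (-j) (-i) (-star a) := by
    intro i j a h ha
    have hs := neg_mem (F.star_mem ha)
    -- This expression for `γ` is symmetric under `(i, j, a) ↦ (-j, -i, -star a)`, up to the order
    -- of two commuting summands.
    have hE : ∀ {i j : SignedIndex n} {a : R}, Apart i j → a ∈ F.ring i j →
        (F.t2 i j a).γ = O.act (F.q i) a + O.act (F.q (-j)) (-star a) + -O.φ a := by
      intro i j a h ha
      rw [t2, T, HyperbolicPair.tr_γ (q_act_unip h ha), ρ_q_act, π_q_act ha, q'_η, zero_add,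
        zero_sub]
    apply Unitary.ext_γ
    rw [hE h ha, hE h.swap hs, neg_neg, star_neg, star_star, neg_neg, O.φ_neg, O.φ_star]
    rw [neg_neg (-O.φ a)]
    congr 1
    apply O.add_comm_of_star_π_mul_π
    rw [π_q_act ha, π_q_act hs, mul_neg, mul_eq_zero (F.star_mem ha) (F.star_mem ha), neg_zero]
    exact h.neg_neg.1
  refine ⟨r0, ?_, ?_, ?_, ?_, ?_, ?_, ?_, ?_⟩
  · intro i j a b h ha hb
    rw [t2, O.act_add_of_ρ_eq_zero (F.ρ_q i), T_add (q_act_unip h ha) (q_act_unip h hb)]; rfl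
  · intro i u v hu hv
    exact T_add (form_mem_unip hu) (form_mem_unip hv)
  · have same : ∀ {i j k : SignedIndex n} {a b : R}, Apart i j → Apart k j → -k ≠ i →
        a ∈ F.ring i j → b ∈ F.ring k j → ⁅F.t2 i j a, F.t2 k j b⁆ = 1 := by
      intro i j k a b hij hkj h4 ha hb
      rw [t2, t2, T_commutator_same (q_act_unip hij ha) (q_act_unip hkj hb), π_q_act ha,
        π_q_act hb, mul_eq_zero (F.star_mem ha) hb (fun h => h4 (by rw [← h, neg_neg])), neg_zero,
        O.φ_zero, T_zero]
    intro i j k l a b hij hkl h1 h2 h3 h4 ha hb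
    -- Only for `l = j` and `l = -i` does the left factor move one of `q_{±l}`; the second case is
    -- turned into the first by the swap relation.
    by_cases h5 : j = l
    · subst h5; exact same hij hkl h4 ha hb
    by_cases h6 : l = -i
    · subst h6
      rw [r0 hij ha]
      exact same hij.swap hkl (fun h => h3 (neg_injective h).symm) (neg_mem (F.star_mem ha)) hb
    · rw [t2_def k l, T_commutator_of_fix (t2_app_q hij ha h5 (Ne.symm h6))
        (t2_app_q hij ha (fun h => h2 (by rw [h, neg_neg])) (fun h => h1 (neg_injective h)))
        (q_act_unip hkl hb), π_q_act hb, act_t2_γ hij ha, mul_assoc (star b), mul_eq_zero ha hb h3,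
        mul_eq_zero (F.star_mem ha) hb (fun h => h4 (by rw [← h, neg_neg]))]
      simp [O.act_zero, O.φ_zero, T_zero]
  · intro i j k a b hij hjk hik ha hb
    have hjk' : j ≠ -k := hjk.2
    rw [t2_def j k, T_commutator_of_fix (t2_app_q hij ha hjk.1 hik.neg_left.1)
      (t2_app_q hij ha hjk.2 hik.neg_neg.1) (q_act_unip hjk hb), π_q_act hb,
      act_t2_γ hij ha, mul_eq_zero (F.star_mem ha) hb hij.neg_left.1,
      mul_assoc (star b), mul_eq_zero (F.star_mem hb) (F.mul_mem ha hb) hij.symm.neg_left.1]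
    simp only [neg_zero, O.act_zero, O.φ_zero, add_zero]
    rfl
  · intro i j a b hij ha hb
    rw [r0 hij ha, t2, t2, T_commutator_same (q_act_unip hij.swap (neg_mem (F.star_mem ha)))
      (q_act_unip hij.symm.neg_right hb), π_q_act (neg_mem (F.star_mem ha)), π_q_act hb, star_neg,
      star_star, neg_mul, neg_neg]
  · intro i j u v hij hu hv
    rw [T_commutator_of_fix (T_app_q_of_form hu hij.1) (T_app_q_of_form hu hij.2)
      (form_mem_unip hv), act_T_γ (form_mem_unip hu)]
    have h1 : F.e i * O.π v = 0 := e_mul_π hv i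
    have h2 : O.ρ u * O.π v = 0 := mul_π hv (F.ρ_mem hu)
    have h3 : O.π u * O.π v = 0 := by rw [← F.π_mul_e hu, mul_assoc, h1, mul_zero]
    rw [act_eq_zero (form_act hu) h1, h2, mul_assoc, add_mul, h2, h3]
    simp only [zero_add, zero_sub, mul_zero, O.φ_zero, neg_zero, add_zero]
    rfl
  · intro i j k u a hjk h1 h2 hu ha
    by_cases h3 : k = i
    · subst h3
      rw [t2, T_commutator_same (form_mem_unip hu) (q_act_unip hjk ha), π_q_act ha,
        star_π_mul hu ha, neg_zero, O.φ_zero, T_zero]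
    · have h4 : F.e i * a = 0 := e_mul_eq_zero ha (Ne.symm h1)
      rw [t2, T_commutator_of_fix (T_app_q_of_form hu (Ne.symm h3)) (T_app_q_of_form hu h2)
        (q_act_unip hjk ha), π_q_act ha, act_T_γ (form_mem_unip hu), star_π_mul hu ha,
        mul_eq_zero (F.ρ_mem hu) ha (Ne.symm h1), act_eq_zero (form_act hu) h4, mul_assoc, add_mul,
        mul_eq_zero (F.ρ_mem hu) ha (Ne.symm h1), π_mul_eq_zero hu ha (Ne.symm h1)]
      simp [O.act_zero, O.φ_zero, T_zero]
  · intro i j u a hij hu ha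
    have m1 : O.act u a ∈ F.form j := F.act_mem hu ha
    have m2 : O.ρ u * a ∈ F.ring (-i) j := F.mul_mem (F.ρ_mem hu) ha
    have m3 : star a * O.ρ u * a ∈ F.ring (-j) j := by
      rw [mul_assoc]; exact F.mul_mem (F.star_mem ha) m2
    have h1 : star a * O.π u = 0 := mul_π hu (F.star_mem ha)
    rw [t2_def i j, T_commutator_of_fix (T_app_q_of_form hu hij.1) (T_app_q_of_form hu hij.2)
      (q_act_unip hij ha), π_q_act ha, act_T_γ (form_mem_unip hu), star_π_mul hu ha, sub_zero,
      mul_add, h1, add_zero, t2, ← T_add (q_act_unip hij.neg_left m2)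
        (form_mem_unip (neg_mem (F.act_mem hu (neg_mem ha)))), O.neg_act_neg, ← add_assoc]
    congr 2
    apply O.add_comm_of_star_π_mul_π
    rw [π_q_act m2, O.π_act, star_mul, mul_assoc, star_π_mul hu m2, mul_zero]

variable (F) in
/-- The canonical map from the Steinberg group to the unitary group. -/
noncomputable def st : F.StU →* O.Unitary := F.rels_T.lift

theorem st_S1 {i : SignedIndex n} {u : Δ} (hu : u ∈ F.form i) : F.st (F.S1 i u) = F.T i u :=
  F.rels_T.lift_S1 hu

theorem st_S2 {i j : SignedIndex n} {a : R} (h : Apart i j) (ha : a ∈ F.ring i j) :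
    F.st (F.S2 i j a) = F.t2 i j a := F.rels_T.lift_S2 h ha

theorem T1_eq (i : SignedIndex n) (u : F.form i) : F.T1 i u = F.T i u :=
  (HyperbolicPair.tr_of_mem (form_mem_unip u.2)).symm

theorem T2_eq (i j : SignedIndex n) (h : Apart i j) (a : F.ring i j) :
    F.T2 i j h a = F.t2 i j a :=
  (HyperbolicPair.tr_of_mem (q_act_unip h a.2)).symm

theorem X1_eq (i : SignedIndex n) (u : F.form i) : F.X1 i u = F.S1 i u := (S1_of_mem u.2).symm

theorem X2_eq (i j : SignedIndex n) (h : Apart i j) (a : F.ring i j) :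
    F.X2 i j h a = F.S2 i j a := (S2_of_mem h a.2).symm

variable (F) in
theorem isCanonicalMap_st : F.IsCanonicalMap F.st :=
  ⟨fun i j h a => by rw [X2_eq, T2_eq, st_S2 h a.2], fun i u => by rw [X1_eq, T1_eq, st_S1 u.2]⟩

theorem closure_S : Subgroup.closure
    ({x | ∃ i u, u ∈ F.form i ∧ x = F.S1 i u} ∪
      {x | ∃ i j a, Apart i j ∧ a ∈ F.ring i j ∧ x = F.S2 i j a}) = ⊤ := by
  rw [eq_top_iff, ← PresentedGroup.closure_range_of, Subgroup.closure_le]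
  rintro _ ⟨x, rfl⟩
  apply Subgroup.subset_closure
  cases x with
  | short i j h a => exact Or.inr ⟨i, j, a, h, a.2, X2_eq i j h a⟩
  | ultra i u => exact Or.inl ⟨i, u, u.2, X1_eq i u⟩

/-- Induction over the Steinberg group: a subgroup containing the generators is everything. -/
theorem eq_top_of_generators (P : Subgroup F.StU) (h1 : ∀ {i u}, u ∈ F.form i → F.S1 i u ∈ P)
    (h2 : ∀ {i j a}, Apart i j → a ∈ F.ring i j → F.S2 i j a ∈ P) : P = ⊤ := by
  rw [eq_top_iff, ← closure_S, Subgroup.closure_le]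
  rintro x (⟨i, u, hu, rfl⟩ | ⟨i, j, a, h, ha, rfl⟩)
  · exact h1 hu
  · exact h2 h ha

theorem hom_ext {G : Type*} [Group G] {f g : F.StU →* G}
    (h1 : ∀ {i u}, u ∈ F.form i → f (F.S1 i u) = g (F.S1 i u))
    (h2 : ∀ {i j a}, Apart i j → a ∈ F.ring i j → f (F.S2 i j a) = g (F.S2 i j a)) : f = g :=
  MonoidHom.eq_of_eqOn_dense closure_S (by
    rintro x (⟨i, u, hu, rfl⟩ | ⟨i, j, a, h, ha, rfl⟩)
    · exact h1 hu
    · exact h2 h ha)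

end OrthogonalHyperbolicFamily

end OddFormRing

/-! ### Root subgroups, unipotent radicals and the Levi subgroup -/

theorem Subgroup.le_normalizer_of_conj_mem {G : Type*} [Group G] {A N : Subgroup G}
    (h : ∀ a ∈ A, ∀ x ∈ N, a * x * a⁻¹ ∈ N) : A ≤ Subgroup.normalizer (N : Set G) := by
  intro a ha
  rw [Subgroup.mem_normalizer_iff]
  intro x
  refine ⟨fun hx => h a ha x hx, fun hx => ?_⟩
  have := h a⁻¹ (inv_mem ha) _ hx
  simpa [mul_assoc] using this

theorem Subgroup.conj_mem_of_le_normalizer {G : Type*} [Group G] {A N : Subgroup G}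
    (h : A ≤ Subgroup.normalizer (N : Set G)) {a x : G} (ha : a ∈ A) (hx : x ∈ N) :
    a * x * a⁻¹ ∈ N :=
  (Subgroup.mem_normalizer_iff.1 (h ha) x).1 hx

theorem Subgroup.exists_mul_of_mem_sup {G : Type*} [Group G] {A N : Subgroup G}
    (h : A ≤ Subgroup.normalizer (N : Set G)) {x : G} (hx : x ∈ A ⊔ N) :
    ∃ a ∈ A, ∃ y ∈ N, x = a * y := by
  let P : Subgroup G :=
    { carrier := {x | ∃ a ∈ A, ∃ y ∈ N, x = a * y}
      one_mem' := ⟨1, one_mem _, 1, one_mem _, by simp⟩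
      mul_mem' := by
        rintro _ _ ⟨a, ha, y, hy, rfl⟩ ⟨b, hb, z, hz, rfl⟩
        refine ⟨a * b, mul_mem ha hb, b⁻¹ * y * b⁻¹⁻¹ * z,
          mul_mem (conj_mem_of_le_normalizer h (inv_mem hb) hy) hz, by group⟩
      inv_mem' := by
        rintro _ ⟨a, ha, y, hy, rfl⟩
        exact ⟨a⁻¹, inv_mem ha, a * y⁻¹ * a⁻¹, conj_mem_of_le_normalizer h ha (inv_mem hy),
          by group⟩ }
  have : A ⊔ N ≤ P := sup_le (fun a ha => ⟨a, ha, 1, one_mem _, by simp⟩)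
    (fun y hy => ⟨1, one_mem _, y, hy, by simp⟩)
  exact this hx

namespace OddFormRing

variable {R : Type u} {Δ : Type v} [NonUnitalRing R] [StarRing R] [AddGroup Δ]

namespace OrthogonalHyperbolicFamily

open SignedIndex
open scoped commutatorElement

variable {O : OddFormRing R Δ} {n : ℕ} (F : O.OrthogonalHyperbolicFamily n)

/-! ### Spanning -/

variable {F}

/-- Morita equivalence writes `e_{|i|}` as a sum of products through `e_{|p|} = e_p + e_{-p}`;
cutting by `e_i` on both sides puts the factors into Peirce components. Any pair may thus serve as
an intermediate index. -/
theorem e_mem_span (i : SignedIndex n) (p : Fin n) :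
    F.e i ∈ AddSubgroup.closure {z : R | ∃ k : SignedIndex n, k.idx = p ∧
      ∃ x ∈ F.ring i k, ∃ y ∈ F.ring k i, z = x * y} := by
  have h := (F.morita i.idx p).1
  have h1 : F.e i = F.e i * (F.pair i.idx).eAbs * F.e i := by
    rw [← F.eAbs_η, e, HyperbolicPair.e_mul_eAbs, (F.η i).idem.eq]
  rw [h1]
  refine AddSubgroup.closure_induction (p := fun z _ => F.e i * z * F.e i ∈ _) ?_ ?_ ?_ ?_ h
  · rintro _ ⟨a, b, rfl⟩
    have h2 : F.e i * (a * (F.pair p).eAbs * b) * F.e i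
        = (F.e i * a * F.e ⟨p, true⟩) * (F.e ⟨p, true⟩ * b * F.e i)
          + (F.e i * a * F.e ⟨p, false⟩) * (F.e ⟨p, false⟩ * b * F.e i) := by
      have h3 : ∀ k, F.e k * (F.e k * (b * F.e i)) = F.e k * (b * F.e i) := fun k => by
        rw [← mul_assoc, F.e_idem]
      have h4 : (F.pair p).eAbs = F.e ⟨p, true⟩ + F.e ⟨p, false⟩ := rfl
      simp only [h4, mul_add, add_mul, mul_assoc, h3]
    rw [h2]
    refine add_mem (AddSubgroup.subset_closure ?_) (AddSubgroup.subset_closure ?_)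
    · exact ⟨⟨p, true⟩, rfl, _, ⟨a, rfl⟩, _, ⟨b, rfl⟩, rfl⟩
    · exact ⟨⟨p, false⟩, rfl, _, ⟨a, rfl⟩, _, ⟨b, rfl⟩, rfl⟩
  · rw [mul_zero, zero_mul]; exact zero_mem _
  · intro x y _ _ hx hy
    rw [mul_add, add_mul]; exact add_mem hx hy
  · intro x _ hx
    rw [mul_neg, neg_mul]; exact neg_mem hx

theorem mem_span {i j : SignedIndex n} (p : Fin n) {a : R} (ha : a ∈ F.ring i j) :
    a ∈ AddSubgroup.closure {z : R | ∃ k : SignedIndex n, k.idx = p ∧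
      ∃ x ∈ F.ring i k, ∃ y ∈ F.ring k j, z = x * y} := by
  rw [← e_mul ha]
  refine AddSubgroup.closure_induction (p := fun z _ => z * a ∈ _) ?_ ?_ ?_ ?_ (e_mem_span i p)
  · rintro _ ⟨k, hk, x, hx, y, hy, rfl⟩
    exact AddSubgroup.subset_closure ⟨k, hk, x, hx, y * a, F.mul_mem hy ha, by rw [mul_assoc]⟩
  · rw [zero_mul]; exact zero_mem _
  · intro x y _ _ hx hy
    rw [add_mul]; exact add_mem hx hy
  · intro x _ hx
    rw [neg_mul]; exact neg_mem hx

/-- Induction principle for the Peirce components. -/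
theorem ring_induction {i j : SignedIndex n} (p : Fin n) {P : R → Prop}
    (h0 : P 0) (hadd : ∀ a b, a ∈ F.ring i j → b ∈ F.ring i j → P a → P b → P (a + b))
    (hmul : ∀ k x y, k.idx = p → x ∈ F.ring i k → y ∈ F.ring k j → P (x * y)) {a : R}
    (ha : a ∈ F.ring i j) : P a := by
  -- The predicate is carried together with its negative, since `P` itself is not assumed stable
  -- under negation; the sign of a product is absorbed into its first factor.
  suffices h : a ∈ F.ring i j ∧ P a ∧ P (-a) from h.2.1
  refine AddSubgroup.closure_induction (p := fun z _ => z ∈ F.ring i j ∧ P z ∧ P (-z))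
    ?_ ?_ ?_ ?_ (mem_span p ha)
  · rintro _ ⟨k, hk, x, hx, y, hy, rfl⟩
    refine ⟨F.mul_mem hx hy, hmul k x y hk hx hy, ?_⟩
    rw [← neg_mul]
    exact hmul k _ y hk (neg_mem hx) hy
  · exact ⟨zero_mem _, h0, by rwa [neg_zero]⟩
  · rintro x y _ _ ⟨hx1, hx2, hx3⟩ ⟨hy1, hy2, hy3⟩
    refine ⟨add_mem hx1 hy1, hadd _ _ hx1 hy1 hx2 hy2, ?_⟩
    rw [neg_add]
    exact hadd _ _ (neg_mem hx1) (neg_mem hy1) hx3 hy3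
  · rintro x _ ⟨hx1, hx2, hx3⟩
    exact ⟨neg_mem hx1, hx3, by rwa [neg_neg]⟩

/-- Induction principle for the groups `Δ⁰_i`. -/
theorem form_le_of_act {i : SignedIndex n} (p : Fin n) {Q : AddSubgroup Δ}
    (hφ : ∀ c ∈ F.ring (-i) i, O.φ c ∈ Q)
    (hact : ∀ k u a, k.idx = p → u ∈ F.form k → a ∈ F.ring k i → O.act u a ∈ Q) :
    F.form i ≤ Q := by
  intro u hu
  -- Writing `u = u·e_i` and expanding `e_i` through the pair `p`: the action fails to be additive
  -- only by `φ`-terms, which `hφ` controls.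
  rw [← form_act hu]
  refine ring_induction p (P := fun a => O.act u a ∈ Q) ?_ ?_ ?_ (e_mem i)
  · rw [O.act_zero]; exact zero_mem _
  · intro a b ha hb h1 h2
    rw [O.act_add]
    refine add_mem (add_mem h1 (hφ _ ?_)) h2
    rw [mul_assoc]
    exact F.mul_mem (F.star_mem hb) (F.mul_mem (F.ρ_mem hu) ha)
  · intro k x y hk hx hy
    rw [O.act_mul]
    exact hact k _ _ hk (F.act_mem hu hx) hy

/-! ### Root subgroups of the Steinberg group -/

theorem S1_add {i : SignedIndex n} {u v : Δ} (hu : u ∈ F.form i) (hv : v ∈ F.form i) :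
    F.S1 i (u + v) = F.S1 i u * F.S1 i v := F.rels_S.r2 hu hv

/-- With the default value `1`, additivity and the swap relation hold for all pairs of indices, so
side conditions disappear from the calculus. -/
theorem S2_of_not_apart {i j : SignedIndex n} (h : ¬Apart i j) (a : R) : F.S2 i j a = 1 :=
  dif_neg fun h' => h h'.1

theorem S2_add {i j : SignedIndex n} {a b : R} (ha : a ∈ F.ring i j) (hb : b ∈ F.ring i j) :
    F.S2 i j (a + b) = F.S2 i j a * F.S2 i j b := by
  by_cases h : Apart i j
  · exact F.rels_S.r1 h ha hb
  · rw [S2_of_not_apart h, S2_of_not_apart h, S2_of_not_apart h, one_mul]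

theorem S1_zero (i : SignedIndex n) : F.S1 i 0 = 1 := by
  have h := S1_add (zero_mem (F.form i)) (zero_mem (F.form i))
  rw [add_zero] at h
  exact left_eq_mul.1 h

theorem S2_zero (i j : SignedIndex n) : F.S2 i j 0 = 1 := by
  have h := S2_add (zero_mem (F.ring i j)) (zero_mem (F.ring i j))
  rw [add_zero] at h
  exact left_eq_mul.1 h

theorem S1_neg {i : SignedIndex n} {u : Δ} (hu : u ∈ F.form i) : F.S1 i (-u) = (F.S1 i u)⁻¹ := by
  rw [eq_inv_iff_mul_eq_one, ← S1_add (neg_mem hu) hu, neg_add_cancel, S1_zero]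

theorem S2_neg {i j : SignedIndex n} {a : R} (ha : a ∈ F.ring i j) :
    F.S2 i j (-a) = (F.S2 i j a)⁻¹ := by
  rw [eq_inv_iff_mul_eq_one, ← S2_add (neg_mem ha) ha, neg_add_cancel, S2_zero]

theorem S2_swap {i j : SignedIndex n} {a : R} (ha : a ∈ F.ring i j) :
    F.S2 i j a = F.S2 (-j) (-i) (-star a) := by
  by_cases h : Apart i j
  · exact F.rels_S.r0 h ha
  · rw [S2_of_not_apart h, S2_of_not_apart fun h' => h (by simpa using h'.swap)]

variable (F)

/-- The root subgroup `X_i`. -/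
def root1 (i : SignedIndex n) : Subgroup F.StU where
  carrier := {x | ∃ u ∈ F.form i, x = F.S1 i u}
  one_mem' := ⟨0, zero_mem _, (S1_zero i).symm⟩
  mul_mem' := by
    rintro _ _ ⟨u, hu, rfl⟩ ⟨v, hv, rfl⟩
    exact ⟨u + v, add_mem hu hv, (S1_add hu hv).symm⟩
  inv_mem' := by
    rintro _ ⟨u, hu, rfl⟩
    exact ⟨-u, neg_mem hu, (S1_neg hu).symm⟩

/-- The root subgroup `X_{ij}`. -/
def root2 (i j : SignedIndex n) : Subgroup F.StU where
  carrier := {x | ∃ a ∈ F.ring i j, x = F.S2 i j a}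
  one_mem' := ⟨0, zero_mem _, (S2_zero i j).symm⟩
  mul_mem' := by
    rintro _ _ ⟨u, hu, rfl⟩ ⟨v, hv, rfl⟩
    exact ⟨u + v, add_mem hu hv, (S2_add hu hv).symm⟩
  inv_mem' := by
    rintro _ ⟨u, hu, rfl⟩
    exact ⟨-u, neg_mem hu, (S2_neg hu).symm⟩

variable {F}

theorem S1_mem {i : SignedIndex n} {u : Δ} (hu : u ∈ F.form i) : F.S1 i u ∈ F.root1 i :=
  ⟨u, hu, rfl⟩

theorem S2_mem {i j : SignedIndex n} {a : R} (ha : a ∈ F.ring i j) : F.S2 i j a ∈ F.root2 i j :=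
  ⟨a, ha, rfl⟩

theorem root2_swap (i j : SignedIndex n) : F.root2 i j = F.root2 (-j) (-i) := by
  have h : ∀ i j, F.root2 i j ≤ F.root2 (-j) (-i) := by
    rintro i j _ ⟨a, ha, rfl⟩
    rw [S2_swap ha]
    exact S2_mem (neg_mem (F.star_mem ha))
  refine le_antisymm (h i j) ?_
  have := h (-j) (-i)
  rwa [neg_neg, neg_neg] at this

/-! ### Unipotent radicals -/

variable (F)

/-- The group of all `u ∈ Δ · e_j` such that `e_k π(u) = 0` for `k ≠ ±i`. -/
def coarse (i j : SignedIndex n) : AddSubgroup Δ where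
  carrier := {u | O.act u (F.e j) = u ∧ ∀ k, Apart i k → F.e k * O.π u = 0}
  zero_mem' := ⟨O.zero_act _, fun k _ => by rw [O.π_zero, mul_zero]⟩
  add_mem' := by
    rintro u v ⟨h1, h2⟩ ⟨h3, h4⟩
    exact ⟨by rw [O.add_act, h1, h3], fun k hk => by rw [O.π_add, mul_add, h2 k hk, h4 k hk, add_zero]⟩
  neg_mem' := by
    rintro u ⟨h1, h2⟩
    exact ⟨by rw [O.neg_act, h1], fun k hk => by rw [O.π_neg, mul_neg, h2 k hk, neg_zero]⟩

/-- The component of `u` orthogonal to `η_i`. -/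
def res (i : SignedIndex n) (u : Δ) : Δ :=
  -O.act (F.q (-i)) (F.e (-i) * O.π u) + (-O.act (F.q i) (F.e i * O.π u) + u)

/-- The element of the Steinberg group lifting `T^{η_j}(u)` for `u ∈ F.coarse i j`. -/
noncomputable def Sc (i j : SignedIndex n) (u : Δ) : F.StU :=
  F.S2 i j (F.e i * O.π u) * F.S2 (-i) j (F.e (-i) * O.π u) * F.S1 j (F.res i u)

variable {F}

theorem mem_coarse {i j : SignedIndex n} {u : Δ} :
    u ∈ F.coarse i j ↔ O.act u (F.e j) = u ∧ ∀ k, Apart i k → F.e k * O.π u = 0 := Iff.rfl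

theorem form_le_coarse (i j : SignedIndex n) : F.form j ≤ F.coarse i j := fun _ hu =>
  ⟨form_act hu, fun k _ => e_mul_π hu k⟩

theorem q_act_mem_coarse {i j : SignedIndex n} {a : R} (ha : a ∈ F.ring i j) :
    O.act (F.q i) a ∈ F.coarse i j := by
  refine ⟨by rw [← O.act_mul, mul_e ha], fun k hk => ?_⟩
  rw [π_q_act ha, e_mul_eq_zero ha (Ne.symm hk.1)]

theorem q_neg_act_mem_coarse {i j : SignedIndex n} {a : R} (ha : a ∈ F.ring (-i) j) :
    O.act (F.q (-i)) a ∈ F.coarse i j := by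
  refine ⟨by rw [← O.act_mul, mul_e ha], fun k hk => ?_⟩
  rw [π_q_act ha, e_mul_eq_zero ha (Ne.symm hk.neg_left.1)]

theorem coarse_mem_unip {i j : SignedIndex n} (h : Apart i j) {u : Δ} (hu : u ∈ F.coarse i j) :
    u ∈ (F.η j).unip :=
  mem_unip_iff.2 ⟨hu.1, hu.2 j h, hu.2 (-j) h.neg_right⟩

theorem act_mem_coarse {z i j : SignedIndex n} {u : Δ} {a : R} (hu : u ∈ F.coarse z i)
    (ha : a ∈ F.ring i j) : O.act u a ∈ F.coarse z j := by
  refine ⟨by rw [← O.act_mul, mul_e ha], fun k hk => ?_⟩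
  rw [O.π_act, ← mul_assoc, hu.2 k hk, zero_mul]

theorem coarse_π_mul_e {i j : SignedIndex n} {u : Δ} (hu : u ∈ F.coarse i j) :
    O.π u * F.e j = O.π u := by rw [← O.π_act, hu.1]

theorem e_mul_π_mem {i j : SignedIndex n} {u : Δ} (hu : u ∈ F.coarse i j) (k : SignedIndex n) :
    F.e k * O.π u ∈ F.ring k j :=
  ⟨O.π u, by rw [mul_assoc, coarse_π_mul_e hu]⟩

theorem res_mem {i j : SignedIndex n} {u : Δ} (hu : u ∈ F.coarse i j) : F.res i u ∈ F.form j := by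
  have m1 := e_mul_π_mem hu i
  have m2 := e_mul_π_mem hu (-i)
  have hπ : O.π (F.res i u) = -(F.e (-i) * O.π u) + (-(F.e i * O.π u) + O.π u) := by
    rw [res, O.π_add, O.π_add, O.π_neg, O.π_neg, π_q_act m1, π_q_act m2]
  refine mem_form_iff.2 ⟨?_, fun k => ?_⟩
  · rw [res, O.add_act, O.add_act, O.neg_act, O.neg_act, hu.1, ← O.act_mul, ← O.act_mul, mul_e m1,
      mul_e m2]
  · rw [hπ, mul_add, mul_add, mul_neg, mul_neg, ← mul_assoc, ← mul_assoc]
    by_cases h1 : k = i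
    · subst h1
      rw [F.e_mul_e (ne_neg_self k), F.e_idem]; simp
    by_cases h2 : k = -i
    · subst h2
      rw [F.e_mul_e (neg_ne_self i), F.e_idem]; simp
    · rw [F.e_mul_e h1, F.e_mul_e h2, hu.2 k ⟨Ne.symm h1, fun h => h2 (by rw [h, neg_neg])⟩]; simp

/-- The decomposition of a coarse parameter along `q_i`, `q_{-i}` and the orthogonal rest. The order
of the summands matters, as `Δ` need not be commutative, and it is the order used in `Sc`. -/
theorem eq_add_res (i : SignedIndex n) (u : Δ) :
    u = O.act (F.q i) (F.e i * O.π u) + O.act (F.q (-i)) (F.e (-i) * O.π u) + F.res i u := by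
  rw [res]; simp [add_assoc]

theorem res_eq_of_eq {i j : SignedIndex n} {a b : R} {w : Δ} (ha : a ∈ F.ring i j)
    (hb : b ∈ F.ring (-i) j) (hw : w ∈ F.form j) {u : Δ}
    (h : u = O.act (F.q i) a + O.act (F.q (-i)) b + w) :
    u ∈ F.coarse i j ∧ F.e i * O.π u = a ∧ F.e (-i) * O.π u = b ∧ F.res i u = w := by
  have hπ : O.π u = a + b + O.π w := by
    rw [h, O.π_add, O.π_add, π_q_act ha, π_q_act hb]
  have h1 : F.e i * O.π u = a := by
    rw [hπ, mul_add, mul_add, e_mul ha, e_mul_eq_zero hb (ne_neg_self i), e_mul_π hw]; simp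
  have h2 : F.e (-i) * O.π u = b := by
    rw [hπ, mul_add, mul_add, e_mul hb, e_mul_eq_zero ha (neg_ne_self i), e_mul_π hw]; simp
  refine ⟨?_, h1, h2, ?_⟩
  · rw [h]
    exact add_mem (add_mem (q_act_mem_coarse ha) (q_neg_act_mem_coarse hb)) (form_le_coarse i j hw)
  · rw [res, h1, h2, h]; simp [add_assoc]

theorem Sc_form {i j : SignedIndex n} {u : Δ} (hu : u ∈ F.form j) : F.Sc i j u = F.S1 j u := by
  obtain ⟨-, h1, h2, h3⟩ := res_eq_of_eq (i := i) (zero_mem (F.ring i j)) (zero_mem (F.ring (-i) j))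
    hu (u := u) (by rw [O.act_zero, O.act_zero]; simp)
  rw [Sc, h1, h2, h3, S2_zero, S2_zero, one_mul, one_mul]

theorem Sc_q_act {i j : SignedIndex n} {a : R} (ha : a ∈ F.ring i j) :
    F.Sc i j (O.act (F.q i) a) = F.S2 i j a := by
  obtain ⟨-, h1, h2, h3⟩ := res_eq_of_eq (i := i) ha (zero_mem (F.ring (-i) j))
    (zero_mem (F.form j)) (u := O.act (F.q i) a) (by rw [O.act_zero]; simp)
  rw [Sc, h1, h2, h3, S2_zero, S1_zero, mul_one, mul_one]

theorem Sc_q_neg_act {i j : SignedIndex n} {a : R} (ha : a ∈ F.ring (-i) j) :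
    F.Sc i j (O.act (F.q (-i)) a) = F.S2 (-i) j a := by
  obtain ⟨-, h1, h2, h3⟩ := res_eq_of_eq (i := i) (zero_mem (F.ring i j)) ha
    (zero_mem (F.form j)) (u := O.act (F.q (-i)) a) (by rw [O.act_zero]; simp)
  rw [Sc, h1, h2, h3, S2_zero, S1_zero, mul_one, one_mul]

theorem st_Sc {i j : SignedIndex n} (h : Apart i j) {u : Δ} (hu : u ∈ F.coarse i j) :
    F.st (F.Sc i j u) = F.T j u := by
  have m1 := e_mul_π_mem hu i
  have m2 := e_mul_π_mem hu (-i)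
  have m3 := res_mem hu
  rw [Sc, map_mul, map_mul, st_S2 h m1, st_S2 h.neg_left m2, st_S1 m3, t2, t2,
    ← T_add (q_act_unip h m1) (q_act_unip h.neg_left m2),
    ← T_add (add_mem (q_act_unip h m1) (q_act_unip h.neg_left m2)) (form_mem_unip m3),
    ← eq_add_res]

theorem S1_S2_comm {i j k : SignedIndex n} {u : Δ} {a : R} (h1 : j ≠ i) (h2 : i ≠ -k)
    (hu : u ∈ F.form i) (ha : a ∈ F.ring j k) : F.S1 i u * F.S2 j k a = F.S2 j k a * F.S1 i u := by
  by_cases h : Apart j k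
  · exact commutatorElement_eq_one_iff_mul_comm.1 (F.rels_S.r7 h h1 h2 hu ha)
  · rw [S2_of_not_apart h, mul_one, one_mul]

theorem S2_S2_same {i j : SignedIndex n} (h : Apart i j) {a b : R} (ha : a ∈ F.ring i j)
    (hb : b ∈ F.ring (-i) j) : ⁅F.S2 (-i) j b, F.S2 i j a⁆ = F.S1 j (O.φ (-(star b * a))) := by
  have h1 := F.rels_S.r5 (i := -j) (j := i) h.symm.neg_left
    (neg_mem (star_mem_right hb)) (by rwa [neg_neg])
  rw [neg_neg] at h1
  rw [S2_swap hb, neg_neg, h1, neg_mul]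

/-- Reordering a product of six root elements meets a single non-trivial commutator, of
`X_{-i,j}(b)` with `X_{ij}(a')`, equal to `X_j(φ(-b̄ a'))`. The same `φ`-term arises when the six
summands are reordered in `Δ`. So `Sc` is a homomorphism from the coarse group. -/
theorem Sc_add {i j : SignedIndex n} (h : Apart i j) {u v : Δ} (hu : u ∈ F.coarse i j)
    (hv : v ∈ F.coarse i j) : F.Sc i j (u + v) = F.Sc i j u * F.Sc i j v := by
  have a1 := e_mul_π_mem hu i
  have b1 := e_mul_π_mem hu (-i)
  have w1 := res_mem hu
  have a2 := e_mul_π_mem hv i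
  have b2 := e_mul_π_mem hv (-i)
  have w2 := res_mem hv
  have e1 := eq_add_res (F := F) i u
  have e2 := eq_add_res (F := F) i v
  simp only [Sc] at *
  generalize F.res i u = w at *
  generalize F.e i * O.π u = a at *
  generalize F.e (-i) * O.π u = b at *
  generalize F.res i v = w' at *
  generalize F.e i * O.π v = a' at *
  generalize F.e (-i) * O.π v = b' at *
  have hc : -(star b * a') ∈ F.ring (-j) j := neg_mem (F.mul_mem (star_mem_right b1) a2)
  have e3 : u + v = O.act (F.q i) (a + a') + O.act (F.q (-i)) (b + b')
      + (O.φ (-(star b * a')) + w + w') := by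
    have c1 : ∀ x, w + (O.act (F.q i) a' + x) = O.act (F.q i) a' + (w + x) := by
      intro x
      rw [← add_assoc, ← add_assoc]
      congr 1
      apply O.add_comm_of_star_π_mul_π
      rw [π_q_act a2, star_π_mul w1 a2]
    have c2 : ∀ x, w + (O.act (F.q (-i)) b' + x) = O.act (F.q (-i)) b' + (w + x) := by
      intro x
      rw [← add_assoc, ← add_assoc]
      congr 1
      apply O.add_comm_of_star_π_mul_π
      rw [π_q_act b2, star_π_mul w1 b2]
    have c3 : ∀ x, O.act (F.q (-i)) b + (O.act (F.q i) a' + x)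
        = O.φ (-(star b * a')) + (O.act (F.q i) a' + (O.act (F.q (-i)) b + x)) := by
      intro x
      rw [← add_assoc, O.add_eq (O.act (F.q (-i)) b) (O.act (F.q i) a'), π_q_act b1, π_q_act a2]
      simp only [add_assoc]
    nth_rw 1 [e1, e2]
    rw [O.act_add_of_ρ_eq_zero (F.ρ_q i), O.act_add_of_ρ_eq_zero (F.ρ_q (-i))]
    simp only [add_assoc, c1, c2, c3, O.add_φ_add (O.act _ _)]
  obtain ⟨-, h1, h2, h3⟩ := res_eq_of_eq (add_mem a1 a2) (add_mem b1 b2)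
    (add_mem (add_mem (φ_mem_form hc) w1) w2) e3
  rw [h1, h2, h3, S2_add a1 a2, S2_add b1 b2, S1_add (add_mem (φ_mem_form hc) w1) w2,
    S1_add (φ_mem_form hc) w1]
  have d1 := S2_S2_same h a2 b1
  have d2 : F.S1 j w * F.S2 i j a' = F.S2 i j a' * F.S1 j w :=
    S1_S2_comm h.1 (ne_neg_self j) w1 a2
  have d3 : F.S1 j w * F.S2 (-i) j b' = F.S2 (-i) j b' * F.S1 j w :=
    S1_S2_comm h.neg_left.1 (ne_neg_self j) w1 b2
  have d4 : F.S1 j (O.φ (-(star b * a'))) * F.S2 (-i) j (b + b')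
      = F.S2 (-i) j (b + b') * F.S1 j (O.φ (-(star b * a'))) :=
    S1_S2_comm h.neg_left.1 (ne_neg_self j) (φ_mem_form hc) (add_mem b1 b2)
  have d5 : F.S1 j (O.φ (-(star b * a'))) * F.S2 i j a'
      = F.S2 i j a' * F.S1 j (O.φ (-(star b * a'))) :=
    S1_S2_comm h.1 (ne_neg_self j) (φ_mem_form hc) a2
  rw [S2_add b1 b2] at d4
  rw [commutatorElement_def, mul_inv_eq_iff_eq_mul, mul_inv_eq_iff_eq_mul] at d1
  calc _ = F.S2 i j a * F.S2 i j a' * (F.S2 (-i) j b * F.S2 (-i) j b' *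
        F.S1 j (O.φ (-(star b * a')))) * F.S1 j w * F.S1 j w' := by simp only [mul_assoc]
    _ = F.S2 i j a * (F.S1 j (O.φ (-(star b * a'))) * F.S2 i j a' * F.S2 (-i) j b) *
        (F.S1 j w * F.S2 (-i) j b') * F.S1 j w' := by
          rw [← d4, d5, d3]; simp only [mul_assoc]
    _ = F.S2 i j a * F.S2 (-i) j b * (F.S1 j w * F.S2 i j a') * F.S2 (-i) j b' * F.S1 j w' := by
          rw [← d1, d2]; simp only [mul_assoc]
    _ = _ := by simp only [mul_assoc]

theorem Sc_zero (i j : SignedIndex n) : F.Sc i j 0 = 1 := by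
  rw [Sc_form (zero_mem _), S1_zero]

theorem Sc_neg {i j : SignedIndex n} (h : Apart i j) {u : Δ} (hu : u ∈ F.coarse i j) :
    F.Sc i j (-u) = (F.Sc i j u)⁻¹ := by
  rw [eq_inv_iff_mul_eq_one, ← Sc_add h (neg_mem hu) hu, neg_add_cancel, Sc_zero]

/-- The subgroup generated by `X_j`, `X_{ij}`, and `X_{-i,j}`. -/
noncomputable def radical {i j : SignedIndex n} (h : Apart i j) : Subgroup F.StU where
  carrier := {x | ∃ u ∈ F.coarse i j, x = F.Sc i j u}
  one_mem' := ⟨0, zero_mem _, (Sc_zero i j).symm⟩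
  mul_mem' := by
    rintro _ _ ⟨u, hu, rfl⟩ ⟨v, hv, rfl⟩
    exact ⟨u + v, add_mem hu hv, (Sc_add h hu hv).symm⟩
  inv_mem' := by
    rintro _ ⟨u, hu, rfl⟩
    exact ⟨-u, neg_mem hu, (Sc_neg h hu).symm⟩

theorem root1_le_radical {i j : SignedIndex n} (h : Apart i j) : F.root1 j ≤ radical h := by
  rintro _ ⟨u, hu, rfl⟩
  exact ⟨u, form_le_coarse i j hu, (Sc_form hu).symm⟩

theorem root2_le_radical {i j : SignedIndex n} (h : Apart i j) : F.root2 i j ≤ radical h := by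
  rintro _ ⟨a, ha, rfl⟩
  exact ⟨_, q_act_mem_coarse ha, (Sc_q_act ha).symm⟩

theorem root2_neg_le_radical {i j : SignedIndex n} (h : Apart i j) :
    F.root2 (-i) j ≤ radical h := by
  rintro _ ⟨a, ha, rfl⟩
  exact ⟨_, q_neg_act_mem_coarse ha, (Sc_q_neg_act ha).symm⟩

theorem radical_le {i j : SignedIndex n} (h : Apart i j) {P : Subgroup F.StU}
    (h1 : F.root1 j ≤ P) (h2 : F.root2 i j ≤ P) (h3 : F.root2 (-i) j ≤ P) : radical h ≤ P := by
  rintro _ ⟨u, hu, rfl⟩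
  exact MulMemClass.mul_mem (MulMemClass.mul_mem (h2 (S2_mem (e_mul_π_mem hu i))) (h3 (S2_mem (e_mul_π_mem hu (-i)))))
    (h1 (S1_mem (res_mem hu)))

theorem radical_eq_sup {i j : SignedIndex n} (h : Apart i j) :
    radical (F := F) h = F.root1 j ⊔ F.root2 i j ⊔ F.root2 (-i) j := by
  apply le_antisymm
  · exact radical_le h (le_sup_left.trans le_sup_left) (le_sup_right.trans le_sup_left) le_sup_right
  · exact sup_le (sup_le (root1_le_radical h) (root2_le_radical h)) (root2_neg_le_radical h)

theorem radical_neg {i j : SignedIndex n} (h : Apart i j) :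
    radical (F := F) h.neg_left = radical h := by
  rw [radical_eq_sup, radical_eq_sup, neg_neg, sup_right_comm]

/-- The radical is parametrized by `coarse i j`, and the composition with `st` is `u ↦ T_j(u)`,
which is injective. This is the means of pulling identities back from U to the Steinberg group. -/
theorem st_radical_injective {i j : SignedIndex n} (h : Apart i j) {x : F.StU}
    (hx : x ∈ radical h) (h1 : F.st x = 1) : x = 1 := by
  obtain ⟨u, hu, rfl⟩ := hx
  rw [st_Sc h hu, ← T_zero (F := F) j] at h1
  rw [T_injective (coarse_mem_unip h hu) (zero_mem _) h1, Sc_zero]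

theorem root1_le_normalizer_radical {i j : SignedIndex n} (h : Apart i j) :
    F.root1 i ≤ Subgroup.normalizer (radical (F := F) h : Set F.StU) := by
  apply Subgroup.le_normalizer_of_conj_mem
  rintro _ ⟨u, hu, rfl⟩ x hx
  suffices radical h ≤ (radical h).comap (MulAut.conj (F.S1 i u)).toMonoidHom from this hx
  have key : ∀ y, y ∈ radical (F := F) h → ⁅F.S1 i u, y⁆ ∈ radical (F := F) h →
      y ∈ (radical h).comap (MulAut.conj (F.S1 i u)).toMonoidHom := by
    intro y hy hy2
    have := MulMemClass.mul_mem hy2 hy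
    rwa [commutatorElement_def, inv_mul_cancel_right] at this
  apply radical_le
  · rintro _ ⟨v, hv, rfl⟩
    refine key _ (root1_le_radical h (S1_mem hv)) ?_
    rw [F.rels_S.r6 h hu hv]
    exact root2_neg_le_radical h (S2_mem (neg_mem (F.star_π_mul_π_mem hu hv)))
  · rintro _ ⟨a, ha, rfl⟩
    refine key _ (root2_le_radical h (S2_mem ha)) ?_
    rw [F.rels_S.r8 h hu ha]
    exact MulMemClass.mul_mem (root2_neg_le_radical h (S2_mem (F.mul_mem (F.ρ_mem hu) ha)))
      (root1_le_radical h (S1_mem (neg_mem (F.act_mem hu (neg_mem ha)))))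
  · rintro _ ⟨a, ha, rfl⟩
    refine key _ (root2_neg_le_radical h (S2_mem ha)) ?_
    rw [commutatorElement_eq_one_iff_mul_comm.2 (S1_S2_comm (neg_ne_self i) h.2 hu ha)]
    exact one_mem _

theorem root1_neg_le_normalizer_radical {i j : SignedIndex n} (h : Apart i j) :
    F.root1 (-i) ≤ Subgroup.normalizer (radical (F := F) h : Set F.StU) := by
  rw [← radical_neg h]
  exact root1_le_normalizer_radical h.neg_left

/-! ### The Levi subgroup -/

variable (F)

/-- `g` preserves the line generated by `q_k`. -/
def LeviAt (g : O.Unitary) (k : SignedIndex n) : Prop :=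
  ∃ a ∈ F.ring k k, ∃ b ∈ F.ring k k, a * b = F.e k ∧ b * a = F.e k ∧
    g.app (F.q k) = O.act (F.q k) a

variable {F}

theorem LeviAt.mul {g h : O.Unitary} {k : SignedIndex n} (hg : F.LeviAt g k) (hh : F.LeviAt h k) :
    F.LeviAt (g * h) k := by
  obtain ⟨a, ha, b, hb, h1, h2, h3⟩ := hg
  obtain ⟨a', ha', b', hb', h1', h2', h3'⟩ := hh
  refine ⟨a * a', F.mul_mem ha ha', b' * b, F.mul_mem hb' hb, ?_, ?_, ?_⟩
  · rw [mul_assoc, ← mul_assoc a', h1', ← mul_assoc, mul_e ha, h1]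
  · rw [mul_assoc, ← mul_assoc b, h2, ← mul_assoc, mul_e hb', h2']
  · rw [Unitary.app_mul, h3', Unitary.app_act, h3, O.act_mul]

theorem LeviAt.inv {g : O.Unitary} {k : SignedIndex n} (hg : F.LeviAt g k) :
    F.LeviAt g⁻¹ k := by
  obtain ⟨a, ha, b, hb, h1, h2, h3⟩ := hg
  refine ⟨b, hb, a, ha, h2, h1, ?_⟩
  apply g.app_injective
  rw [Unitary.app_app_inv, Unitary.app_act, h3, ← O.act_mul, h1, F.q_act_e]

theorem LeviAt.of_fix {g : O.Unitary} {k : SignedIndex n} (h : g.app (F.q k) = F.q k) :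
    F.LeviAt g k :=
  ⟨F.e k, e_mem k, F.e k, e_mem k, F.e_idem k, F.e_idem k, by rw [h, F.q_act_e]⟩

variable (F) in
/-- The subgroup of all elements preserving the lines generated by all `q_k`. -/
def levi : Subgroup O.Unitary where
  carrier := {g | ∀ k, F.LeviAt g k}
  one_mem' := fun _ => LeviAt.of_fix (Unitary.app_one _)
  mul_mem' := fun hg hh k => (hg k).mul (hh k)
  inv_mem' := fun hg k => (hg k).inv

/-- The pairing of `q_k` with `q_{-k}` is the idempotent `e_{-k}`; its invariance forces the
coefficient on `q_{-k}` to be the conjugate of the inverse coefficient on `q_k`. -/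
theorem LeviAt.data {g : O.Unitary} {k : SignedIndex n} (h : F.LeviAt g k)
    (h' : F.LeviAt g (-k)) : ∃ a ∈ F.ring k k, ∃ b ∈ F.ring k k, a * b = F.e k ∧ b * a = F.e k ∧
      g.app (F.q k) = O.act (F.q k) a ∧ g.app (F.q (-k)) = O.act (F.q (-k)) (star b) := by
  obtain ⟨a, ha, b, hb, h1, h2, h3⟩ := h
  obtain ⟨a', ha', -, -, -, -, h3'⟩ := h'
  refine ⟨a, ha, b, hb, h1, h2, h3, ?_⟩
  have h4 := g.star_π_app_mul_π_app (F.q k) (F.q (-k))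
  rw [h3, h3', π_q_act ha, π_q_act ha', π_q, π_q, F.star_e, F.e_idem] at h4
  have h5 : star b * star a = F.e (-k) := by rw [← star_mul, h1, F.star_e]
  have h6 : a' = star b := by
    rw [← e_mul ha', ← h5, mul_assoc, h4, mul_e (F.star_mem hb)]
  rw [h3', h6]

/-- The equation `e_k π(u) = 0` says that `u` is orthogonal to `q_{-k}`, so it is inherited by
`g.app u` when `g` preserves the line of `q_{-k}`. -/
theorem LeviAt.e_mul_π_app {g : O.Unitary} {k : SignedIndex n} (h : F.LeviAt g (-k)) {u : Δ}
    (hu : F.e k * O.π u = 0) : F.e k * O.π (g.app u) = 0 := by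
  obtain ⟨a, ha, b, hb, h1, h2, h3⟩ := h
  have h4 := g.star_π_app_mul_π_app (F.q (-k)) u
  rw [h3, π_q_act ha, π_q, F.star_e, neg_neg, hu] at h4
  have h5 : star b * star a = F.e k := by rw [← star_mul, h1, F.star_e, neg_neg]
  rw [← h5, mul_assoc, h4, mul_zero]

theorem levi_conj_T {g : O.Unitary} (hg : g ∈ F.levi) {i : SignedIndex n} {u : Δ}
    (hu : u ∈ F.form i) : ∃ u' ∈ F.form i, g * F.T i u * g⁻¹ = F.T i u' := by
  obtain ⟨a, ha, b, hb, h1, h2, h3, h4⟩ := (hg i).data (hg (-i))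
  refine ⟨_, mem_form_iff.2 ⟨?_, fun k => ?_⟩, (T_conj hb h1 h3 h4 (form_mem_unip hu)).2⟩
  · rw [← O.act_mul, mul_e hb]
  · rw [O.π_act, ← mul_assoc, (hg (-k)).e_mul_π_app (e_mul_π hu k), zero_mul]

theorem levi_conj_t2 {g : O.Unitary} (hg : g ∈ F.levi) {i j : SignedIndex n} {a : R}
    (h : Apart i j) (ha : a ∈ F.ring i j) : ∃ a' ∈ F.ring i j, g * F.t2 i j a * g⁻¹ = F.t2 i j a' := by
  obtain ⟨x, hx, b, hb, h1, h2, h3, h4⟩ := (hg j).data (hg (-j))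
  obtain ⟨y, hy, c, hc, h1', h2', h3', h4'⟩ := (hg i).data (hg (-i))
  refine ⟨y * a * b, F.mul_mem (F.mul_mem hy ha) hb, ?_⟩
  rw [t2, (T_conj hb h1 h3 h4 (q_act_unip h ha)).2, Unitary.app_act, h3', ← O.act_mul,
    ← O.act_mul, t2, mul_assoc]

theorem t2_injective {i j : SignedIndex n} (h : Apart i j) {a b : R} (ha : a ∈ F.ring i j)
    (hb : b ∈ F.ring i j) (h1 : F.t2 i j a = F.t2 i j b) : a = b := by
  have := T_injective (q_act_unip h ha) (q_act_unip h hb) h1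
  rw [← π_q_act ha, this, π_q_act hb]

variable (F)

open scoped Classical in
/-- The preimage of an element of the root subgroup `T_i`. -/
noncomputable def param1 (i : SignedIndex n) (g : O.Unitary) : Δ :=
  if h : ∃ u ∈ F.form i, g = F.T i u then h.choose else 0

open scoped Classical in
/-- The preimage of an element of the root subgroup `T_{ij}`. -/
noncomputable def param2 (i j : SignedIndex n) (g : O.Unitary) : R :=
  if h : ∃ a ∈ F.ring i j, g = F.t2 i j a then h.choose else 0

variable {F}

theorem param1_T {i : SignedIndex n} {u : Δ} (hu : u ∈ F.form i) : F.param1 i (F.T i u) = u := by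
  have h : ∃ v ∈ F.form i, F.T i u = F.T i v := ⟨u, hu, rfl⟩
  rw [param1, dif_pos h]
  exact (T_injective (form_mem_unip hu) (form_mem_unip h.choose_spec.1) h.choose_spec.2).symm

theorem param2_t2 {i j : SignedIndex n} (hij : Apart i j) {a : R} (ha : a ∈ F.ring i j) :
    F.param2 i j (F.t2 i j a) = a := by
  have h : ∃ v ∈ F.ring i j, F.t2 i j a = F.t2 i j v := ⟨a, ha, rfl⟩
  rw [param2, dif_pos h]
  exact (t2_injective hij ha h.choose_spec.1 h.choose_spec.2).symm

/-- Conjugation by `g` permutes each root subgroup of U, and the new parameters are unique. The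
equations between them needed for the Steinberg relations hold because the relations hold in U and
can be conjugated there. -/
theorem rels_levi {g : O.Unitary} (hg : g ∈ F.levi) :
    F.Rels (fun i u => F.S1 i (F.param1 i (g * F.T i u * g⁻¹)))
      (fun i j a => F.S2 i j (F.param2 i j (g * F.t2 i j a * g⁻¹))) := by
  have p1 : ∀ {i u}, u ∈ F.form i → ∃ u' ∈ F.form i, F.T i u' = g * F.T i u * g⁻¹ ∧
      F.param1 i (g * F.T i u * g⁻¹) = u' := by
    intro i u hu
    obtain ⟨u', hu', h⟩ := levi_conj_T hg hu
    exact ⟨u', hu', h.symm, by rw [h, param1_T hu']⟩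
  have p2 : ∀ {i j a}, Apart i j → a ∈ F.ring i j →
      ∃ a' ∈ F.ring i j, F.t2 i j a' = g * F.t2 i j a * g⁻¹ ∧
        F.param2 i j (g * F.t2 i j a * g⁻¹) = a' := by
    intro i j a hij ha
    obtain ⟨u', hu', h⟩ := levi_conj_t2 hg hij ha
    exact ⟨u', hu', h.symm, by rw [h, param2_t2 hij hu']⟩
  have cj : ∀ x y : O.Unitary, ⁅g * x * g⁻¹, g * y * g⁻¹⁆ = g * ⁅x, y⁆ * g⁻¹ := fun x y => by
    simp only [commutatorElement_def]; group
  refine ⟨?_, ?_, ?_, ?_, ?_, ?_, ?_, ?_, ?_⟩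
  · intro i j a h ha
    obtain ⟨a', ha', e1, e2⟩ := p2 h ha
    obtain ⟨b', hb', e3, e4⟩ := p2 h.swap (neg_mem (F.star_mem ha))
    rw [e2, e4, F.rels_S.r0 h ha']
    congr 1
    apply t2_injective h.swap (neg_mem (F.star_mem ha')) hb'
    rw [e3, ← F.rels_T.r0 h ha', e1, F.rels_T.r0 h ha]
  · intro i j a b h ha hb
    obtain ⟨a', ha', e1, e2⟩ := p2 h ha
    obtain ⟨b', hb', e3, e4⟩ := p2 h hb
    obtain ⟨c', hc', e5, e6⟩ := p2 h (add_mem ha hb)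
    rw [e2, e4, e6, ← F.rels_S.r1 h ha' hb']
    congr 1
    apply t2_injective h hc' (add_mem ha' hb')
    rw [e5, F.rels_T.r1 h ha' hb', F.rels_T.r1 h ha hb, e1, e3]; group
  · intro i u v hu hv
    obtain ⟨a', ha', e1, e2⟩ := p1 hu
    obtain ⟨b', hb', e3, e4⟩ := p1 hv
    obtain ⟨c', hc', e5, e6⟩ := p1 (add_mem hu hv)
    rw [e2, e4, e6, ← F.rels_S.r2 ha' hb']
    congr 1
    apply T_injective (form_mem_unip hc') (form_mem_unip (add_mem ha' hb'))
    rw [e5, F.rels_T.r2 ha' hb', F.rels_T.r2 hu hv, e1, e3]; group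
  · intro i j k l a b hij hkl h1 h2 h3 h4 ha hb
    obtain ⟨a', ha', e1, e2⟩ := p2 hij ha
    obtain ⟨b', hb', e3, e4⟩ := p2 hkl hb
    rw [e2, e4, F.rels_S.r3 hij hkl h1 h2 h3 h4 ha' hb']
  · intro i j k a b hij hjk hik ha hb
    obtain ⟨a', ha', e1, e2⟩ := p2 hij ha
    obtain ⟨b', hb', e3, e4⟩ := p2 hjk hb
    obtain ⟨c', hc', e5, e6⟩ := p2 hik (F.mul_mem ha hb)
    rw [e2, e4, e6, F.rels_S.r4 hij hjk hik ha' hb']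
    congr 1
    apply t2_injective hik (F.mul_mem ha' hb') hc'
    rw [e5, ← F.rels_T.r4 hij hjk hik ha' hb', ← F.rels_T.r4 hij hjk hik ha hb, e1, e3, cj]
  · intro i j a b hij ha hb
    obtain ⟨a', ha', e1, e2⟩ := p2 hij ha
    obtain ⟨b', hb', e3, e4⟩ := p2 hij.symm.neg_right hb
    obtain ⟨c', hc', e5, e6⟩ := p1 (φ_mem_form' (F.mul_mem ha hb))
    rw [e2, e4, e6, F.rels_S.r5 hij ha' hb']
    congr 1
    apply T_injective (form_mem_unip (φ_mem_form' (F.mul_mem ha' hb'))) (form_mem_unip hc')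
    rw [e5, ← F.rels_T.r5 hij ha' hb', ← F.rels_T.r5 hij ha hb, e1, e3, cj]
  · intro i j u v hij hu hv
    obtain ⟨a', ha', e1, e2⟩ := p1 hu
    obtain ⟨b', hb', e3, e4⟩ := p1 hv
    obtain ⟨c', hc', e5, e6⟩ := p2 hij.neg_left (neg_mem (F.star_π_mul_π_mem hu hv))
    rw [e2, e4, e6, F.rels_S.r6 hij ha' hb']
    congr 1
    apply t2_injective hij.neg_left (neg_mem (F.star_π_mul_π_mem ha' hb')) hc'
    rw [e5, ← F.rels_T.r6 hij ha' hb', ← F.rels_T.r6 hij hu hv, e1, e3, cj]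
  · intro i j k u a hjk h1 h2 hu ha
    obtain ⟨a', ha', e1, e2⟩ := p1 hu
    obtain ⟨b', hb', e3, e4⟩ := p2 hjk ha
    rw [e2, e4, F.rels_S.r7 hjk h1 h2 ha' hb']
  · intro i j u a hij hu ha
    have m1 := F.mul_mem (F.ρ_mem hu) ha
    have m2 := neg_mem (F.act_mem hu (neg_mem ha))
    obtain ⟨a', ha', e1, e2⟩ := p1 hu
    obtain ⟨b', hb', e3, e4⟩ := p2 hij ha
    obtain ⟨c', hc', e5, e6⟩ := p2 hij.neg_left m1
    obtain ⟨d', hd', e7, e8⟩ := p1 m2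
    have m1' := F.mul_mem (F.ρ_mem ha') hb'
    have m2' := neg_mem (F.act_mem ha' (neg_mem hb'))
    rw [e2, e4, e6, e8, F.rels_S.r8 hij ha' hb']
    -- Here the right-hand side has two factors, so injectivity on a single root subgroup is not
    -- enough; both sides lie in a radical, on which `st` is injective.
    rw [← mul_inv_eq_one]
    apply st_radical_injective hij
    · refine MulMemClass.mul_mem (MulMemClass.mul_mem ?_ ?_) (inv_mem (MulMemClass.mul_mem ?_ ?_))
      · exact root2_neg_le_radical hij (S2_mem m1')
      · exact root1_le_radical hij (S1_mem m2')
      · exact root2_neg_le_radical hij (S2_mem hc')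
      · exact root1_le_radical hij (S1_mem hd')
    · rw [map_mul, map_inv, map_mul, map_mul, st_S2 hij.neg_left m1', st_S1 m2',
        st_S2 hij.neg_left hc', st_S1 hd', ← F.rels_T.r8 hij ha' hb', e1, e3, cj,
        F.rels_T.r8 hij hu ha, e5, e7]
      group

/-- The endomorphism of the Steinberg group lifting the conjugation by `g`. -/
noncomputable def leviEnd (g : F.levi) : F.StU →* F.StU := (rels_levi g.2).lift

theorem leviEnd_S1 (g : F.levi) {i : SignedIndex n} {u u' : Δ} (hu : u ∈ F.form i)
    (hu' : u' ∈ F.form i) (h : g * F.T i u * (g : O.Unitary)⁻¹ = F.T i u') :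
    leviEnd g (F.S1 i u) = F.S1 i u' := by
  rw [leviEnd, Rels.lift_S1 _ hu, h, param1_T hu']

theorem leviEnd_S2 (g : F.levi) {i j : SignedIndex n} (hij : Apart i j) {a a' : R}
    (ha : a ∈ F.ring i j) (ha' : a' ∈ F.ring i j)
    (h : g * F.t2 i j a * (g : O.Unitary)⁻¹ = F.t2 i j a') :
    leviEnd g (F.S2 i j a) = F.S2 i j a' := by
  rw [leviEnd, Rels.lift_S2 _ hij ha, h, param2_t2 hij ha']

theorem st_leviEnd (g : F.levi) (x : F.StU) :
    F.st (leviEnd g x) = g * F.st x * (g : O.Unitary)⁻¹ := by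
  have : F.st.comp (leviEnd g) = (MulAut.conj (g : O.Unitary)).toMonoidHom.comp F.st := by
    apply hom_ext
    · intro i u hu
      obtain ⟨u', hu', h⟩ := levi_conj_T g.2 hu
      simp only [MonoidHom.comp_apply, leviEnd_S1 g hu hu' h, st_S1 hu', st_S1 hu]
      exact h.symm
    · intro i j a hij ha
      obtain ⟨u', hu', h⟩ := levi_conj_t2 g.2 hij ha
      simp only [MonoidHom.comp_apply, leviEnd_S2 g hij ha hu' h, st_S2 hij hu', st_S2 hij ha]
      exact h.symm
  exact DFunLike.congr_fun this x

theorem leviEnd_one : leviEnd (1 : F.levi) = MonoidHom.id F.StU := by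
  apply hom_ext
  · intro i u hu
    rw [leviEnd_S1 1 hu hu (by simp)]; rfl
  · intro i j a hij ha
    rw [leviEnd_S2 1 hij ha ha (by simp)]; rfl

theorem leviEnd_mul (g h : F.levi) : leviEnd (g * h) = (leviEnd g).comp (leviEnd h) := by
  apply hom_ext
  · intro i u hu
    obtain ⟨u', hu', e⟩ := levi_conj_T h.2 hu
    obtain ⟨u'', hu'', e'⟩ := levi_conj_T g.2 hu'
    rw [MonoidHom.comp_apply, leviEnd_S1 h hu hu' e, leviEnd_S1 g hu' hu'' e',
      leviEnd_S1 (g * h) hu hu'']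
    rw [← e', ← e]; simp [mul_assoc]
  · intro i j a hij ha
    obtain ⟨u', hu', e⟩ := levi_conj_t2 h.2 hij ha
    obtain ⟨u'', hu'', e'⟩ := levi_conj_t2 g.2 hij hu'
    rw [MonoidHom.comp_apply, leviEnd_S2 h hij ha hu' e, leviEnd_S2 g hij hu' hu'' e',
      leviEnd_S2 (g * h) hij ha hu'']
    rw [← e', ← e]; simp [mul_assoc]

variable (F) in
/-- The action of the Levi subgroup on the Steinberg group. -/
noncomputable def leviAd : F.levi →* MulAut F.StU where
  toFun g :=
    { toFun := leviEnd g
      invFun := leviEnd g⁻¹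
      left_inv := fun x => by
        rw [← MonoidHom.comp_apply, ← leviEnd_mul, inv_mul_cancel, leviEnd_one]; rfl
      right_inv := fun x => by
        rw [← MonoidHom.comp_apply, ← leviEnd_mul, mul_inv_cancel, leviEnd_one]; rfl
      map_mul' := fun x y => map_mul _ x y }
  map_one' := by
    ext x
    change leviEnd 1 x = x
    rw [leviEnd_one]; rfl
  map_mul' g h := by
    ext x
    change leviEnd (g * h) x = leviEnd g (leviEnd h x)
    rw [leviEnd_mul]; rfl

theorem leviAd_S1 (g : F.levi) {i : SignedIndex n} {u u' : Δ} (hu : u ∈ F.form i)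
    (hu' : u' ∈ F.form i) (h : g * F.T i u * (g : O.Unitary)⁻¹ = F.T i u') :
    F.leviAd g (F.S1 i u) = F.S1 i u' := leviEnd_S1 g hu hu' h

theorem leviAd_S2 (g : F.levi) {i j : SignedIndex n} (hij : Apart i j) {a a' : R}
    (ha : a ∈ F.ring i j) (ha' : a' ∈ F.ring i j)
    (h : g * F.t2 i j a * (g : O.Unitary)⁻¹ = F.t2 i j a') :
    F.leviAd g (F.S2 i j a) = F.S2 i j a' := leviEnd_S2 g hij ha ha' h

theorem st_leviAd (g : F.levi) (x : F.StU) :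
    F.st (F.leviAd g x) = g * F.st x * (g : O.Unitary)⁻¹ := st_leviEnd g x

theorem leviAd_root1 (g : F.levi) {i : SignedIndex n} {x : F.StU} (hx : x ∈ F.root1 i) :
    F.leviAd g x ∈ F.root1 i := by
  obtain ⟨u, hu, rfl⟩ := hx
  obtain ⟨u', hu', h⟩ := levi_conj_T g.2 hu
  rw [leviAd_S1 g hu hu' h]
  exact S1_mem hu'

theorem leviAd_root2 (g : F.levi) {i j : SignedIndex n} {x : F.StU} (hx : x ∈ F.root2 i j) :
    F.leviAd g x ∈ F.root2 i j := by
  obtain ⟨u, hu, rfl⟩ := hx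
  by_cases h : Apart i j
  · obtain ⟨u', hu', h'⟩ := levi_conj_t2 g.2 h hu
    rw [leviAd_S2 g h hu hu' h']
    exact S2_mem hu'
  · rw [S2_of_not_apart h, map_one]
    exact one_mem _

theorem leviAd_radical (g : F.levi) {i j : SignedIndex n} (h : Apart i j) {x : F.StU}
    (hx : x ∈ radical h) : F.leviAd g x ∈ radical h := by
  suffices radical h ≤ (radical h).comap (F.leviAd g).toMonoidHom from this hx
  apply radical_le
  · exact fun x hx => root1_le_radical h (leviAd_root1 g hx)
  · exact fun x hx => root2_le_radical h (leviAd_root2 g hx)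
  · exact fun x hx => root2_neg_le_radical h (leviAd_root2 g hx)

/-! ### Elements acting through the Levi subgroup -/

variable (F) in
/-- The subgroup of all elements of the Steinberg group with the image in the Levi subgroup acting
by conjugation in the expected way. -/
def nice : Subgroup F.StU where
  carrier := {h | ∃ hh : F.st h ∈ F.levi, ∀ x, F.leviAd ⟨F.st h, hh⟩ x = h * x * h⁻¹}
  one_mem' := by
    refine ⟨by rw [map_one]; exact one_mem _, fun x => ?_⟩
    have : (⟨F.st 1, by rw [map_one]; exact one_mem _⟩ : F.levi) = 1 := Subtype.ext (map_one _)
    rw [this, map_one]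
    simp
  mul_mem' := by
    rintro g h ⟨g1, g2⟩ ⟨h1, h2⟩
    refine ⟨by rw [map_mul]; exact MulMemClass.mul_mem g1 h1, fun x => ?_⟩
    have : (⟨F.st (g * h), by rw [map_mul]; exact MulMemClass.mul_mem g1 h1⟩ : F.levi)
        = ⟨F.st g, g1⟩ * ⟨F.st h, h1⟩ := Subtype.ext (map_mul _ _ _)
    rw [this, map_mul, MulAut.mul_apply, h2, g2]
    group
  inv_mem' := by
    rintro g ⟨g1, g2⟩
    refine ⟨by rw [map_inv]; exact inv_mem g1, fun x => ?_⟩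
    have : (⟨F.st g⁻¹, by rw [map_inv]; exact inv_mem g1⟩ : F.levi)
        = ⟨F.st g, g1⟩⁻¹ := Subtype.ext (map_inv _ _)
    rw [this, map_inv, MulAut.inv_apply, MulEquiv.symm_apply_eq, g2]
    group

/-- The subgroup on which `h` acts in the expected way. -/
noncomputable def niceLocus {h : F.StU} (hh : F.st h ∈ F.levi) : Subgroup F.StU :=
  (F.leviAd ⟨F.st h, hh⟩).toMonoidHom.eqLocus (MulAut.conj h).toMonoidHom

theorem mem_niceLocus {h : F.StU} {hh : F.st h ∈ F.levi} {x : F.StU} :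
    x ∈ niceLocus hh ↔ F.leviAd ⟨F.st h, hh⟩ x = h * x * h⁻¹ := Iff.rfl

theorem mem_nice_of_eq_top {h : F.StU} (hh : F.st h ∈ F.levi) (h1 : niceLocus hh = ⊤) :
    h ∈ F.nice := ⟨hh, fun x => by
      have : x ∈ niceLocus hh := h1 ▸ Subgroup.mem_top x
      exact this⟩

/-- If `st` is injective on a subgroup normalized by `h` and by the Levi subgroup, then `h` acts
on it in the expected way. -/
theorem le_niceLocus {h : F.StU} (hh : F.st h ∈ F.levi) {N : Subgroup F.StU}
    (h1 : ∀ x ∈ N, F.st x = 1 → x = 1) (h2 : ∀ x ∈ N, h * x * h⁻¹ ∈ N)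
    (h3 : ∀ g x, x ∈ N → F.leviAd g x ∈ N) : N ≤ niceLocus hh := by
  intro x hx
  rw [mem_niceLocus, ← mul_inv_eq_one]
  apply h1 _ (MulMemClass.mul_mem (h3 _ x hx) (inv_mem (h2 x hx)))
  rw [map_mul, st_leviAd, map_inv, map_mul, map_mul, map_inv, mul_inv_cancel]

theorem nice_conj {h : F.StU} (hh : h ∈ F.nice) {N : Subgroup F.StU}
    (h3 : ∀ g x, x ∈ N → F.leviAd g x ∈ N) {x : F.StU} (hx : x ∈ N) : h * x * h⁻¹ ∈ N := by
  obtain ⟨h1, h2⟩ := hh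
  rw [← h2]
  exact h3 _ _ hx

theorem st_root2_injective {i j : SignedIndex n} {x : F.StU} (hx : x ∈ F.root2 i j)
    (h1 : F.st x = 1) : x = 1 := by
  by_cases h : Apart i j
  · exact st_radical_injective h (root2_le_radical h hx) h1
  · obtain ⟨a, ha, rfl⟩ := hx
    exact S2_of_not_apart h a

/-- The subgroup generated by everything except one pair of opposite ultrashort roots. -/
theorem eq_top_of_apart {i j : SignedIndex n} (hij : Apart i j) {P : Subgroup F.StU}
    (h1 : ∀ k, Apart i k → F.root1 k ≤ P)
    (h2 : ∀ k l, Apart k l → F.root2 k l ≤ P) : P = ⊤ := by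
  have key : ∀ i, Apart i j → (∀ k, Apart i k → F.root1 k ≤ P) →
      ∀ u ∈ F.form i, F.S1 i u ∈ P := by
    intro i hij h1
    let Q : AddSubgroup Δ :=
      { carrier := {u | u ∈ F.form i ∧ F.S1 i u ∈ P}
        zero_mem' := ⟨zero_mem _, by rw [S1_zero]; exact one_mem _⟩
        add_mem' := by
          rintro u v ⟨hu, hu'⟩ ⟨hv, hv'⟩
          exact ⟨add_mem hu hv, by rw [S1_add hu hv]; exact MulMemClass.mul_mem hu' hv'⟩
        neg_mem' := by
          rintro u ⟨hu, hu'⟩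
          exact ⟨neg_mem hu, by rw [S1_neg hu]; exact inv_mem hu'⟩ }
    suffices h : F.form i ≤ Q from fun u hu => (h hu).2
    apply form_le_of_act j.idx
    · intro c hc
      refine ring_induction j.idx (P := fun c => O.φ c ∈ Q) ?_ ?_ ?_ hc
      · rw [O.φ_zero]; exact zero_mem _
      · intro a b _ _ ha hb
        rw [O.φ_add]; exact add_mem ha hb
      · intro k x y hk hx hy
        have hik : Apart (-i) k := Apart.neg_left (apart_iff_idx.2 (by rw [hk]; exact apart_iff_idx.1 hij))
        refine ⟨φ_mem_form (F.mul_mem hx hy), ?_⟩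
        have h5 := F.rels_S.r5 hik hx (b := y) (by rwa [neg_neg])
        rw [neg_neg] at h5
        rw [← h5]
        have m1 := h2 _ _ hik (S2_mem hx)
        have m2 := h2 _ _ (by simpa using hik.symm.neg_right) (S2_mem hy)
        exact MulMemClass.mul_mem (MulMemClass.mul_mem (MulMemClass.mul_mem m1 m2) (inv_mem m1)) (inv_mem m2)
    · intro k u a hk hu ha
      have hki : Apart k i := apart_iff_idx.2 (by rw [hk]; exact (apart_iff_idx.1 hij).symm)
      have m := F.act_mem hu ha
      refine ⟨m, ?_⟩
      -- Taken at `-a`, the relation contains exactly `X_i(-u·a)` and is solved for it; the other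
      -- factors avoid `X_{±i}`.
      have h8 := F.rels_S.r8 hki hu (neg_mem ha)
      rw [neg_neg, S1_neg m, eq_mul_inv_iff_mul_eq, ← eq_inv_mul_iff_mul_eq] at h8
      rw [h8]
      have m1 := h1 _ hki.symm (S1_mem hu)
      have m2 := h2 _ _ hki (S2_mem (neg_mem ha))
      exact MulMemClass.mul_mem (inv_mem (MulMemClass.mul_mem (MulMemClass.mul_mem (MulMemClass.mul_mem m1 m2) (inv_mem m1)) (inv_mem m2)))
        (h2 _ _ hki.neg_left (S2_mem (F.mul_mem (F.ρ_mem hu) (neg_mem ha))))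
  apply eq_top_of_generators
  · intro k u hu
    by_cases hk : Apart i k
    · exact h1 k hk (S1_mem hu)
    · rcases eq_or_eq_neg hk with rfl | rfl
      · exact key _ hij h1 u hu
      · exact key k (by simpa using hij.neg_left)
          (fun l hl => h1 l hl.neg_left) u hu
  · intro k l a hkl ha
    exact h2 k l hkl (S2_mem ha)

/-- Elements of the group generated by two opposite ultrashort root subgroups are nice as soon as
their images lie in the Levi subgroup. -/
theorem mem_nice_of_mem_sup_root1 {i j : SignedIndex n} (hij : Apart i j) {h : F.StU}
    (hh : F.st h ∈ F.levi) (hm : h ∈ F.root1 i ⊔ F.root1 (-i)) : h ∈ F.nice := by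
  apply mem_nice_of_eq_top hh
  -- Each such radical is normalized by `X_i` and `X_{-i}`, is stable under the Levi action, and is
  -- embedded by `st`, so the two actions agree on it.
  have key : ∀ k (hk : Apart i k), radical hk ≤ niceLocus hh := by
    intro k hk
    apply le_niceLocus
    · exact fun x hx => st_radical_injective hk hx
    · intro x hx
      have := (sup_le (root1_le_normalizer_radical hk) (root1_neg_le_normalizer_radical hk)) hm
      exact (Subgroup.mem_normalizer_iff.1 this x).1 hx
    · exact fun g x hx => leviAd_radical g hk hx
  -- The root subgroups `X_{±i}` themselves are not tested: there `st` is not known to be injective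
  -- on anything normalized by `h`. They are generated by the rest.
  apply eq_top_of_apart hij
  · exact fun k hk => (root1_le_radical hk).trans (key k hk)
  · intro k l hkl
    by_cases hk : Apart i k
    · by_cases hl : Apart i l
      · apply le_niceLocus
        · exact fun x hx => st_root2_injective hx
        · rintro _ ⟨a, ha, rfl⟩
          have : F.root1 i ⊔ F.root1 (-i) ≤ Subgroup.centralizer {F.S2 k l a} := by
            apply sup_le
            · rintro _ ⟨u, hu, rfl⟩
              rw [Subgroup.mem_centralizer_singleton_iff]
              exact (S1_S2_comm hk.symm.1 hl.2 hu ha)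
            · rintro _ ⟨u, hu, rfl⟩
              rw [Subgroup.mem_centralizer_singleton_iff]
              exact (S1_S2_comm hk.symm.2 hl.neg_neg.1 hu ha)
          have h2 := Subgroup.mem_centralizer_singleton_iff.1 (this hm)
          rw [h2, mul_inv_cancel_right]
          exact S2_mem ha
        · exact fun g x hx => leviAd_root2 g hx
      · rw [root2_swap]
        rcases eq_or_eq_neg hl with rfl | rfl
        · exact (root2_neg_le_radical hk.neg_right).trans (key _ hk.neg_right)
        · exact (root2_le_radical hk.neg_right).trans (key _ hk.neg_right)
    · rcases eq_or_eq_neg hk with rfl | rfl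
      · exact (root2_le_radical hkl).trans (key _ hkl)
      · have h3 : Apart k l := hkl
        exact (root2_neg_le_radical (i := -k) hkl.neg_left |>.trans' (by rw [neg_neg])).trans (key l hkl.neg_left)

end OrthogonalHyperbolicFamily

end OddFormRing

/-! ### Elimination of the last hyperbolic pair -/

open scoped commutatorElement in
theorem commutatorElement_mul_left_of_commute {G : Type*} [Group G] {a b c : G}
    (h : Commute a ⁅b, c⁆) : ⁅a * b, c⁆ = ⁅b, c⁆ * ⁅a, c⁆ := by
  rw [commutatorElement_mul_left_eq_conj_mul, h.eq, mul_inv_cancel_right]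

open scoped commutatorElement in
theorem commutatorElement_mul_right_of_commute {G : Type*} [Group G] {a b c : G}
    (h : Commute b ⁅a, c⁆) : ⁅a, b * c⁆ = ⁅a, b⁆ * ⁅a, c⁆ := by
  rw [commutatorElement_mul_right_eq_mul_conj, mul_assoc _ b, h.eq, ← mul_assoc,
    mul_inv_cancel_right]

namespace OddFormRing

variable {R : Type u} {Δ : Type v} [NonUnitalRing R] [StarRing R] [AddGroup Δ]

namespace SignedIndex

variable {m : ℕ}

/-- The inclusion of the indices of the first `m` pairs. -/
def up (i : SignedIndex m) : SignedIndex (m + 1) := ⟨i.idx.castSucc, i.pos⟩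

/-- The partial inverse of `up`. -/
def down? (k : SignedIndex (m + 1)) : Option (SignedIndex m) :=
  if h : k.idx = Fin.last m then none else some ⟨k.idx.castPred h, k.pos⟩

/-- The index belongs to the last pair. -/
def IsLast (k : SignedIndex (m + 1)) : Prop := k.idx = Fin.last m

theorem up_neg (i : SignedIndex m) : up (-i) = -up i := rfl

theorem IsLast.neg {k : SignedIndex (m + 1)} (h : IsLast k) : IsLast (-k) := h

theorem exists_up_or_isLast (k : SignedIndex (m + 1)) : (∃ i, k = up i) ∨ IsLast k := by
  obtain ⟨k, s⟩ := k
  induction k using Fin.lastCases with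
  | last => exact Or.inr rfl
  | cast k => exact Or.inl ⟨⟨k, s⟩, rfl⟩

theorem down?_up (i : SignedIndex m) : down? (up i) = some i := by
  simp [down?, up]

theorem IsLast.down? {k : SignedIndex (m + 1)} (h : IsLast k) : down? k = none := dif_pos h

theorem up_apart_iff {i j : SignedIndex m} : Apart (up i) (up j) ↔ Apart i j := by
  simp [apart_iff_idx, up]

theorem Apart.up {i j : SignedIndex m} (h : Apart i j) : Apart (up i) (up j) := up_apart_iff.2 h

theorem up_injective : Function.Injective (up (m := m)) := by
  intro i j h
  have := congrArg SignedIndex.down? h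
  simpa [down?_up] using this

theorem up_ne {i j : SignedIndex m} (h : i ≠ j) : up i ≠ up j := fun h' => h (up_injective h')

theorem IsLast.apart {k : SignedIndex (m + 1)} (h : IsLast k) (i : SignedIndex m) :
    Apart k (up i) := by
  rw [apart_iff_idx, h]
  exact (Fin.castSucc_lt_last _).ne'

theorem IsLast.apart' {k : SignedIndex (m + 1)} (h : IsLast k) (i : SignedIndex m) :
    Apart (up i) k := (h.apart i).symm

theorem IsLast.eq_or {k l : SignedIndex (m + 1)} (h : IsLast k) (h' : IsLast l) :
    k = l ∨ k = -l := eq_or_eq_neg (by rw [apart_iff_idx, h, h']; simp)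

theorem exists_apart (hm : 2 ≤ m) (i : SignedIndex m) : ∃ j, Apart i j := by
  by_cases h : i.idx = ⟨0, by omega⟩
  · exact ⟨⟨⟨1, by omega⟩, true⟩, by rw [apart_iff_idx, h]; simp⟩
  · exact ⟨⟨⟨0, by omega⟩, true⟩, by rwa [apart_iff_idx]⟩

end SignedIndex

namespace OrthogonalHyperbolicFamily

open SignedIndex
open scoped commutatorElement

variable {O : OddFormRing R Δ} {m : ℕ} (F : O.OrthogonalHyperbolicFamily (m + 1))

/-- The family without the last pair. -/
def init : O.OrthogonalHyperbolicFamily m where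
  pair k := F.pair k.castSucc
  orthogonal i j h := F.orthogonal _ _ (by simpa using h)
  morita _ _ := F.morita _ _

variable {F}

/-- Forgetting the pair of `z` drops the condition of orthogonality to `q_{±z}`: the ultrashort
parameters of the smaller family are the coarse parameters of the larger one, and radicals become
root subgroups. -/
theorem init_form {z : SignedIndex (m + 1)} (hz : IsLast z) (i : SignedIndex m) :
    F.init.form i = F.coarse z (up i) := by
  ext u
  rw [mem_form_iff, mem_coarse]
  refine and_congr Iff.rfl ⟨fun h k hk => ?_, fun h k => h (up k) (hz.apart k)⟩
  obtain ⟨k, rfl⟩ | h' := exists_up_or_isLast k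
  · exact h k
  · obtain rfl | rfl := hz.eq_or h'
    · exact absurd rfl hk.1
    · exact absurd rfl hk.2

theorem coarse_induction {i j : SignedIndex (m + 1)} {P : Δ → Prop}
    (hadd : ∀ u v, u ∈ F.coarse i j → v ∈ F.coarse i j → P u → P v → P (u + v))
    (h1 : ∀ a ∈ F.ring i j, P (O.act (F.q i) a)) (h2 : ∀ a ∈ F.ring (-i) j, P (O.act (F.q (-i)) a))
    (h3 : ∀ w ∈ F.form j, P w) {u : Δ} (hu : u ∈ F.coarse i j) : P u := by
  rw [eq_add_res (F := F) i u]
  have a1 := e_mul_π_mem hu i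
  have a2 := e_mul_π_mem hu (-i)
  have a3 := res_mem hu
  exact hadd _ _ (add_mem (q_act_mem_coarse a1) (q_neg_act_mem_coarse a2)) (form_le_coarse _ _ a3)
    (hadd _ _ (q_act_mem_coarse a1) (q_neg_act_mem_coarse a2) (h1 _ a1) (h2 _ a2)) (h3 _ a3)

theorem Sc_S2_comm {z i j k : SignedIndex (m + 1)} (hi : Apart z i) (hj : Apart z j)
    (hk : Apart z k) (hjk : Apart j k)
    (h1 : j ≠ i) (h2 : i ≠ -k) {u : Δ} {a : R} (hu : u ∈ F.coarse z i) (ha : a ∈ F.ring j k) :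
    Commute (F.Sc z i u) (F.S2 j k a) := by
  refine coarse_induction (P := fun u => Commute (F.Sc z i u) (F.S2 j k a)) ?_ ?_ ?_ ?_ hu
  · intro u v hu hv h3 h4
    rw [Sc_add hi hu hv]
    exact h3.mul_left h4
  · intro b hb
    rw [Sc_q_act hb]
    exact commutatorElement_eq_one_iff_commute.1
      (F.rels_S.r3 hi hjk hk.1 (fun h => h2 (by rw [h, neg_neg])) h1.symm (hj.neg_right.1.symm) hb ha)
  · intro b hb
    rw [Sc_q_neg_act hb]
    exact commutatorElement_eq_one_iff_commute.1
      (F.rels_S.r3 hi.neg_left hjk hk.neg_left.1 (fun h => h2 (by rw [h, neg_neg])) h1.symm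
        (hj.neg_left.neg_right.1.symm) hb ha)
  · intro w hw
    rw [Sc_form hw]
    exact S1_S2_comm h1 h2 hw ha

theorem star_π_mul_π_coarse {z i j : SignedIndex (m + 1)} {u v : Δ} (hu : u ∈ F.coarse z i)
    (hv : v ∈ F.coarse z j) : -(star (O.π u) * O.π v) ∈ F.ring (-i) j := by
  refine neg_mem (F.mem_ring.2 ⟨?_, ?_⟩)
  · rw [← mul_assoc, ← F.star_e, ← star_mul, coarse_π_mul_e hu]
  · rw [mul_assoc, coarse_π_mul_e hv]

theorem S2_S2_neg {k i j : SignedIndex (m + 1)} (hi : Apart k i) (hj : Apart k j) (hij : Apart i j)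
    {c b : R} (hc : c ∈ F.ring k i) (hb : b ∈ F.ring (-k) j) :
    ⁅F.S2 k i c, F.S2 (-k) j b⁆ = F.S2 (-i) j (-(star c * b)) := by
  rw [S2_swap hc, F.rels_S.r4 hi.swap hj.neg_left hij.neg_left (neg_mem (F.star_mem hc)) hb,
    neg_mul]

theorem S2_S2_comm {k i j : SignedIndex (m + 1)} (hi : Apart k i) (hj : Apart k j)
    (hij : Apart i j) {c b : R} (hc : c ∈ F.ring k i) (hb : b ∈ F.ring k j) :
    ⁅F.S2 k i c, F.S2 k j b⁆ = F.S2 (-i) j (-(star c * b)) := by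
  rw [F.rels_S.r3 hi hj hj.1 hij.neg_left.1.symm hi.1.symm (neg_ne_self k) hc hb,
    mul_eq_zero (F.star_mem hc) hb (neg_ne_self k), neg_zero, S2_zero]

theorem S1_S2_π {i j k : SignedIndex (m + 1)} (hi : Apart k i) (hij : Apart i j)
    {w : Δ} {b : R} (hw : w ∈ F.form i) (hb : b ∈ F.ring k j) :
    ⁅F.S1 i w, F.S2 k j b⁆ = F.S2 (-i) j (-(star (O.π w) * b)) := by
  rw [commutatorElement_eq_one_iff_mul_comm.2 (S1_S2_comm hi.1 hij.2 hw hb), star_π_mul hw hb,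
    neg_zero, S2_zero]

theorem S2_S1_π {i j k : SignedIndex (m + 1)} (hj : Apart k j) (hij : Apart i j)
    {w : Δ} {c : R} (hw : w ∈ F.form j) (hc : c ∈ F.ring k i) :
    ⁅F.S2 k i c, F.S1 j w⁆ = F.S2 (-i) j (-(star c * O.π w)) := by
  rw [← commutatorElement_inv,
    commutatorElement_eq_one_iff_mul_comm.2 (S1_S2_comm hj.1 hij.symm.2 hw hc), 
    mul_π hw (F.star_mem hc), neg_zero, S2_zero, inv_one]

/-- Both sides are biadditive, the commutator because its values commute with both factors
(`Sc_S2_comm`). It remains to compare them on three kinds of generators in each variable. -/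
theorem Sc_Sc {z i j : SignedIndex (m + 1)} (hi : Apart z i) (hj : Apart z j) (hij : Apart i j)
    {u v : Δ} (hu : u ∈ F.coarse z i) (hv : v ∈ F.coarse z j) :
    ⁅F.Sc z i u, F.Sc z j v⁆ = F.S2 (-i) j (-(star (O.π u) * O.π v)) := by
  have hadd : ∀ u u' v, u ∈ F.coarse z i → u' ∈ F.coarse z i → v ∈ F.coarse z j →
      ⁅F.Sc z i u, F.Sc z j v⁆ = F.S2 (-i) j (-(star (O.π u) * O.π v)) →
      ⁅F.Sc z i u', F.Sc z j v⁆ = F.S2 (-i) j (-(star (O.π u') * O.π v)) →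
      ⁅F.Sc z i (u + u'), F.Sc z j v⁆ = F.S2 (-i) j (-(star (O.π (u + u')) * O.π v)) := by
    intro u u' v hu hu' hv h3 h4
    have h5 := Sc_S2_comm hi hi.neg_right hj hij.neg_left (neg_ne_self i) hij.2 hu
      (star_π_mul_π_coarse hu' hv)
    rw [← h4] at h5
    rw [Sc_add hi hu hu', commutatorElement_mul_left_of_commute h5, h3, h4,
      ← S2_add (star_π_mul_π_coarse hu' hv) (star_π_mul_π_coarse hu hv), O.π_add]
    congr 1
    rw [star_add]; noncomm_ring
  refine coarse_induction (P := fun v => ⁅F.Sc z i u, F.Sc z j v⁆ =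
    F.S2 (-i) j (-(star (O.π u) * O.π v))) ?_ ?_ ?_ ?_ hv
  · intro v v' hv hv' h3 h4
    have h5 := Sc_S2_comm hj hi.neg_right hj hij.neg_left hij.neg_left.1 j.ne_neg_self hv
      (star_π_mul_π_coarse hu hv')
    rw [← h4] at h5
    rw [Sc_add hj hv hv', commutatorElement_mul_right_of_commute h5, h3, h4,
      ← S2_add (star_π_mul_π_coarse hu hv) (star_π_mul_π_coarse hu hv'), O.π_add]
    congr 1
    noncomm_ring
  · intro b hb
    refine coarse_induction (P := fun u => ⁅F.Sc z i u, _⁆ =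
      F.S2 (-i) j (-(star (O.π u) * O.π _))) ?_ ?_ ?_ ?_ hu
    · exact fun u u' hu hu' => hadd u u' _ hu hu' (q_act_mem_coarse hb)
    all_goals
      intro c hc
      rw [Sc_q_act hb, π_q_act hb]
    · rw [Sc_q_act hc, π_q_act hc, S2_S2_comm hi hj hij hc hb]
    · have := S2_S2_neg hi.neg_left hj.neg_left hij hc (b := b) (by rwa [neg_neg])
      rw [neg_neg] at this
      rw [Sc_q_neg_act hc, π_q_act hc, this]
    · rw [Sc_form hc, S1_S2_π hi hij hc hb]
  · intro b hb
    refine coarse_induction (P := fun u => ⁅F.Sc z i u, _⁆ =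
      F.S2 (-i) j (-(star (O.π u) * O.π _))) ?_ ?_ ?_ ?_ hu
    · exact fun u u' hu hu' => hadd u u' _ hu hu' (q_neg_act_mem_coarse hb)
    all_goals
      intro c hc
      rw [Sc_q_neg_act hb, π_q_act hb]
    · rw [Sc_q_act hc, π_q_act hc, S2_S2_neg hi hj hij hc hb]
    · rw [Sc_q_neg_act hc, π_q_act hc, S2_S2_comm hi.neg_left hj.neg_left hij hc hb]
    · rw [Sc_form hc, S1_S2_π hi.neg_left hij hc hb]
  · intro b hb
    refine coarse_induction (P := fun u => ⁅F.Sc z i u, _⁆ =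
      F.S2 (-i) j (-(star (O.π u) * O.π _))) ?_ ?_ ?_ ?_ hu
    · exact fun u u' hu hu' => hadd u u' _ hu hu' (form_le_coarse _ _ hb)
    all_goals
      intro c hc
      rw [Sc_form hb]
    · rw [Sc_q_act hc, π_q_act hc, S2_S1_π hj hij hb hc]
    · rw [Sc_q_neg_act hc, π_q_act hc, S2_S1_π hj.neg_left hij hb hc]
    · rw [Sc_form hc, F.rels_S.r6 hij hc hb]

theorem ρ_mem_coarse {z i : SignedIndex (m + 1)} {u : Δ} (hu : u ∈ F.coarse z i) :
    O.ρ u ∈ F.ring (-i) i :=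
  ⟨O.ρ u, by rw [← F.star_e, ← O.ρ_act, hu.1]⟩

/-- Induction on `u`. In passing to `u + u'` the left side is twisted by conjugation with `Sc z i
u`; the commutator this creates is given by `Sc_Sc` and equals the cross term of `ρ (u + u')`. -/
theorem Sc_S2 {z i j : SignedIndex (m + 1)} (hi : Apart z i) (hj : Apart z j) (hij : Apart i j)
    {u : Δ} {a : R} (hu : u ∈ F.coarse z i) (ha : a ∈ F.ring i j) :
    ⁅F.Sc z i u, F.S2 i j a⁆ = F.S2 (-i) j (O.ρ u * a) * F.Sc z j (-O.act u (-a)) := by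
  refine coarse_induction (P := fun u => ⁅F.Sc z i u, F.S2 i j a⁆ =
    F.S2 (-i) j (O.ρ u * a) * F.Sc z j (-O.act u (-a))) ?_ ?_ ?_ ?_ hu
  · intro u u' hu hu' h3 h4
    have hv := neg_mem (act_mem_coarse hu (neg_mem ha))
    have hv' := neg_mem (act_mem_coarse hu' (neg_mem ha))
    have m1 := F.mul_mem (ρ_mem_coarse hu) ha
    have m2 := F.mul_mem (ρ_mem_coarse hu') ha
    have c1 := Sc_S2_comm hi hi.neg_right hj hij.neg_left (neg_ne_self i) hij.2 hu m2
    have c2 := Sc_Sc hi hj hij hu hv'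
    have c3 : ∀ {c}, c ∈ F.ring (-i) j → Commute (F.Sc z j (-O.act u' (-a))) (F.S2 (-i) j c) :=
      fun hc => Sc_S2_comm hj hi.neg_right hj hij.neg_left hij.neg_left.1 j.ne_neg_self hv' hc
    have m3 := star_π_mul_π_coarse hu hv'
    have e1 : F.Sc z j (-O.act (u + u') (-a))
        = F.Sc z j (-O.act u' (-a)) * F.Sc z j (-O.act u (-a)) := by
      rw [← Sc_add hj hv' hv, O.add_act, neg_add_rev]
    have e2 : F.S2 (-i) j (O.ρ (u + u') * a) = F.S2 (-i) j (O.ρ u' * a) *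
        F.S2 (-i) j (-(star (O.π u) * O.π (-O.act u' (-a)))) * F.S2 (-i) j (O.ρ u * a) := by
      rw [← S2_add m2 m3, ← S2_add (add_mem m2 m3) m1, O.ρ_add, O.π_neg, O.π_act]
      congr 1
      noncomm_ring
    rw [Sc_add hi hu hu', commutatorElement_mul_left_eq_conj_mul, h3, h4, e1, e2]
    rw [← mul_assoc (F.Sc z i u), c1.eq]
    have e3 : F.Sc z i u * F.Sc z j (-O.act u' (-a)) * (F.Sc z i u)⁻¹ =
        F.S2 (-i) j (-(star (O.π u) * O.π (-O.act u' (-a)))) * F.Sc z j (-O.act u' (-a)) := by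
      rw [← c2, commutatorElement_def]; group
    calc _ = F.S2 (-i) j (O.ρ u' * a) *
          (F.Sc z i u * F.Sc z j (-O.act u' (-a)) * (F.Sc z i u)⁻¹) *
          F.S2 (-i) j (O.ρ u * a) * F.Sc z j (-O.act u (-a)) := by group
      _ = F.S2 (-i) j (O.ρ u' * a) * F.S2 (-i) j (-(star (O.π u) * O.π (-O.act u' (-a)))) *
          (F.Sc z j (-O.act u' (-a)) * F.S2 (-i) j (O.ρ u * a)) * F.Sc z j (-O.act u (-a)) := by
        rw [e3]; group
      _ = _ := by rw [(c3 m1).eq]; group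
  · intro b hb
    rw [Sc_q_act hb, ρ_q_act, zero_mul, S2_zero, one_mul, O.act_neg_of_ρ_eq_zero (ρ_q_act _ _), neg_neg,
      ← O.act_mul, Sc_q_act (F.mul_mem hb ha), F.rels_S.r4 hi hij hj hb ha]
  · intro b hb
    rw [Sc_q_neg_act hb, ρ_q_act, zero_mul, S2_zero, one_mul, O.act_neg_of_ρ_eq_zero (ρ_q_act _ _),
      neg_neg, ← O.act_mul, Sc_q_neg_act (F.mul_mem hb ha),
      F.rels_S.r4 hi.neg_left hij hj.neg_left hb ha]
  · intro w hw
    rw [Sc_form hw, Sc_form (neg_mem (F.act_mem hw (neg_mem ha))), F.rels_S.r8 hij hw ha]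

/-- These are the images of the generators under the homomorphism from the Steinberg group of the
smaller family to that of the larger one. -/
theorem rels_init {z : SignedIndex (m + 1)} (hz : IsLast z) :
    F.init.Rels (fun i u => F.Sc z (up i) u) (fun i j a => F.S2 (up i) (up j) a) where
  r0 h ha := F.rels_S.r0 h.up ha
  r1 h ha hb := F.rels_S.r1 h.up ha hb
  r2 hu hv := by
    rw [init_form hz] at hu hv
    exact Sc_add (hz.apart _) hu hv
  r3 h h' h1 h2 h3 h4 ha hb :=
    F.rels_S.r3 h.up h'.up (up_ne h1) (up_ne h2) (up_ne h3) (up_ne h4) ha hb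
  r4 h h' h'' ha hb := F.rels_S.r4 h.up h'.up h''.up ha hb
  r5 {i j a b} h ha hb := by
    rw [Sc_form]
    · exact F.rels_S.r5 h.up ha hb
    · exact φ_mem_form' (i := up i) (F.mul_mem (j := up j) ha hb)
  r6 h hu hv := by
    rw [init_form hz] at hu hv
    exact Sc_Sc (hz.apart _) (hz.apart _) h.up hu hv
  r7 {i j k u a} h h1 h2 hu ha := by
    rw [init_form hz] at hu
    exact commutatorElement_eq_one_iff_commute.2
      (Sc_S2_comm (hz.apart _) (hz.apart _) (hz.apart _) h.up (up_ne h1)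
        (up_ne (j := -k) h2) hu ha)
  r8 h hu ha := by
    rw [init_form hz] at hu
    exact Sc_S2 (hz.apart _) (hz.apart _) h.up hu ha

end OrthogonalHyperbolicFamily

end OddFormRing

section

open scoped commutatorElement

variable {G : Type*} [Group G]

/-- What the Hall–Witt identity leaves when one of its commutators is trivial. It turns
associativity of the product in `R` into an identity between lifts. -/
theorem commutatorElement_assoc_of_commute {x y w : G} (h1 : Commute x w)
    (h2 : Commute ⁅y, w⁆ ⁅x, y⁆) (h3 : Commute ⁅y, w⁆ ⁅x, ⁅y, w⁆⁆) :
    ⁅⁅x, y⁆, w⁆ = ⁅x, ⁅y, w⁆⁆ := by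
  have e3 := h3.inv_left.eq
  have e2 := h2.inv_left.eq
  have hk : ⁅y, w⁆ = y * w * y⁻¹ * w⁻¹ := rfl
  have hk' : w * y⁻¹ = y⁻¹ * ⁅y, w⁆ * w := by rw [hk]; group
  have hk2 : y⁻¹ * w = y⁻¹ * ⁅y, w⁆⁻¹ * y * w * y⁻¹ := by rw [hk]; group
  generalize ⁅y, w⁆ = k at *
  have h1' : w * x⁻¹ = x⁻¹ * w := h1.inv_left.eq.symm
  calc ⁅⁅x, y⁆, w⁆ = ⁅x, y⁆ * (w * y) * x * y⁻¹ * x⁻¹ * w⁻¹ := by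
        simp only [commutatorElement_def]; group
    _ = (⁅x, y⁆ * k⁻¹) * y * (w * x) * y⁻¹ * x⁻¹ * w⁻¹ := by
        have : w * y = k⁻¹ * y * w := by
          have := congrArg (y * · * y) hk2
          simpa [mul_assoc] using this
        rw [this]; group
    _ = k⁻¹ * x * y * x⁻¹ * x * (w * y⁻¹) * x⁻¹ * w⁻¹ := by
        rw [← e2, ← h1.eq, commutatorElement_def]; group
    _ = k⁻¹ * x * k * (w * x⁻¹) * w⁻¹ := by rw [hk']; group
    _ = k⁻¹ * ⁅x, k⁆ * k := by rw [h1', commutatorElement_def]; group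
    _ = ⁅x, k⁆ := by rw [e3]; group

end

namespace OddFormRing

variable {R : Type u} {Δ : Type v} [NonUnitalRing R] [StarRing R] [AddGroup Δ]

namespace OrthogonalHyperbolicFamily

open SignedIndex
open scoped commutatorElement

variable {O : OddFormRing R Δ} {m : ℕ} (F : O.OrthogonalHyperbolicFamily (m + 1))

/-! ### Generators over the family without the last pair -/

/-- The element `X_{zi}(b)` in the Steinberg group of the family without the last pair. -/
noncomputable def lastL (z : SignedIndex (m + 1)) (i : SignedIndex m) (b : R) : F.init.StU :=
  F.init.S1 i (O.act (F.q z) b)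

/-- The element `X_{iz}(a)` in the Steinberg group of the family without the last pair. -/
noncomputable def lastR (i : SignedIndex m) (z : SignedIndex (m + 1)) (a : R) : F.init.StU :=
  F.lastL (-z) (-i) (-star a)

variable {F} {z : SignedIndex (m + 1)}

theorem form_le_init (i : SignedIndex m) : F.form (up i) ≤ F.init.form i := by
  rw [init_form (z := ⟨Fin.last m, true⟩) rfl]
  exact form_le_coarse _ _

theorem q_act_mem_init (hz : IsLast z) {i : SignedIndex m} {b : R} (hb : b ∈ F.ring z (up i)) :
    O.act (F.q z) b ∈ F.init.form i := by
  rw [init_form hz]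
  exact q_act_mem_coarse hb

theorem lastR_mem {i : SignedIndex m} {a : R} (ha : a ∈ F.ring (up i) z) :
    -star a ∈ F.ring (-z) (up (-i)) := neg_mem (F.star_mem ha)

theorem lastL_add (hz : IsLast z) {i : SignedIndex m} {b c : R} (hb : b ∈ F.ring z (up i))
    (hc : c ∈ F.ring z (up i)) : F.lastL z i (b + c) = F.lastL z i b * F.lastL z i c := by
  rw [lastL, O.act_add_of_ρ_eq_zero (F.ρ_q z),
    S1_add (q_act_mem_init hz hb) (q_act_mem_init hz hc)]
  rfl

theorem lastL_zero (i : SignedIndex m) : F.lastL z i 0 = 1 := by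
  rw [lastL, O.act_zero, S1_zero]

theorem lastL_neg (hz : IsLast z) {i : SignedIndex m} {b : R} (hb : b ∈ F.ring z (up i)) :
    F.lastL z i (-b) = (F.lastL z i b)⁻¹ := by
  rw [lastL, O.act_neg_of_ρ_eq_zero (F.ρ_q z), S1_neg (q_act_mem_init hz hb)]
  rfl

theorem lastR_add (hz : IsLast z) {i : SignedIndex m} {b c : R} (hb : b ∈ F.ring (up i) z)
    (hc : c ∈ F.ring (up i) z) : F.lastR i z (b + c) = F.lastR i z b * F.lastR i z c := by
  rw [lastR, star_add, neg_add, lastL_add hz.neg (lastR_mem hb) (lastR_mem hc)]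
  rfl

theorem lastR_zero (i : SignedIndex m) : F.lastR i z 0 = 1 := by
  rw [lastR, star_zero, neg_zero, lastL_zero]

theorem lastR_neg (hz : IsLast z) {i : SignedIndex m} {b : R} (hb : b ∈ F.ring (up i) z) :
    F.lastR i z (-b) = (F.lastR i z b)⁻¹ := by
  rw [lastR, star_neg, lastL_neg hz.neg (lastR_mem hb)]
  rfl

theorem st_lastL (hz : IsLast z) {i : SignedIndex m} {b : R} (hb : b ∈ F.ring z (up i)) :
    F.init.st (F.lastL z i b) = F.t2 z (up i) b := st_S1 (q_act_mem_init hz hb)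

theorem st_lastR (hz : IsLast z) {i : SignedIndex m} {a : R} (ha : a ∈ F.ring (up i) z) :
    F.init.st (F.lastR i z a) = F.t2 (up i) z a := by
  rw [lastR, st_lastL hz.neg (lastR_mem ha), F.rels_T.r0 (hz.apart' i) ha]
  rfl

theorem lastL_mem_root1 (hz : IsLast z) {i : SignedIndex m} {b : R} (hb : b ∈ F.ring z (up i)) :
    F.lastL z i b ∈ F.init.root1 i := S1_mem (q_act_mem_init hz hb)

theorem lastR_mem_root1 (hz : IsLast z) {i : SignedIndex m} {a : R} (ha : a ∈ F.ring (up i) z) :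
    F.lastR i z a ∈ F.init.root1 (-i) := lastL_mem_root1 hz.neg (lastR_mem ha)

/-- Elements of opposite-free root subgroups commute if the values of `π` are orthogonal. -/
theorem S1_S1_commute {n : ℕ} {F : O.OrthogonalHyperbolicFamily n} {i j : SignedIndex n}
    (hij : i ≠ -j) {u v : Δ} (hu : u ∈ F.form i)
    (hv : v ∈ F.form j) (h : star (O.π u) * O.π v = 0) : Commute (F.S1 i u) (F.S1 j v) := by
  by_cases h' : Apart i j
  · apply commutatorElement_eq_one_iff_commute.1
    rw [F.rels_S.r6 h' hu hv, h, neg_zero, S2_zero]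
  · obtain rfl | h'' := eq_or_eq_neg h'
    · rw [commute_iff_eq, ← S1_add hu hv, ← S1_add hv hu, O.add_comm_of_star_π_mul_π h]
    · exact absurd h'' hij

theorem lastL_lastL (hz : IsLast z) {i j : SignedIndex m} (hij : i ≠ -j) {b c : R}
    (hb : b ∈ F.ring z (up i)) (hc : c ∈ F.ring z (up j)) :
    Commute (F.lastL z i b) (F.lastL z j c) := by
  apply S1_S1_commute hij (q_act_mem_init hz hb) (q_act_mem_init hz hc)
  rw [π_q_act hb, π_q_act hc, mul_eq_zero (F.star_mem hb) hc (neg_ne_self z)]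

theorem S1_lastL (hz : IsLast z) {i j : SignedIndex m} (hij : i ≠ -j) {u : Δ} {c : R}
    (hu : u ∈ F.form (up i)) (hc : c ∈ F.ring z (up j)) :
    Commute (F.init.S1 i u) (F.lastL z j c) := by
  apply S1_S1_commute hij (form_le_init i hu) (q_act_mem_init hz hc)
  rw [π_q_act hc, star_π_mul hu hc]

theorem lastL_S2_comm (hz : IsLast z) {i j k : SignedIndex m} (h1 : j ≠ i) (h2 : i ≠ -k)
    {b a : R} (hb : b ∈ F.ring z (up i)) (ha : a ∈ F.ring (up j) (up k)) :
    Commute (F.lastL z i b) (F.init.S2 j k a) :=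
  S1_S2_comm h1 h2 (q_act_mem_init hz hb) ha

theorem lastL_S2 (hz : IsLast z) {i j : SignedIndex m} (hij : Apart i j)
    {b a : R} (hb : b ∈ F.ring z (up i)) (ha : a ∈ F.ring (up i) (up j)) :
    ⁅F.lastL z i b, F.init.S2 i j a⁆ = F.lastL z j (b * a) := by
  rw [lastL, F.init.rels_S.r8 hij (q_act_mem_init hz hb) ha, ρ_q_act, zero_mul, S2_zero, one_mul,
    O.act_neg_of_ρ_eq_zero (ρ_q_act _ _), neg_neg, ← O.act_mul]
  rfl

theorem S2_lastR (hz : IsLast z) {i j : SignedIndex m} (hij : Apart i j)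
    {a c : R} (ha : a ∈ F.ring (up i) (up j)) (hc : c ∈ F.ring (up j) z) :
    ⁅F.init.S2 i j a, F.lastR j z c⁆ = F.lastR i z (a * c) := by
  have ha' : a ∈ F.init.ring i j := ha
  rw [S2_swap ha', lastR, ← commutatorElement_inv,
    lastL_S2 hz.neg hij.swap (lastR_mem hc) (neg_mem (F.star_mem ha)),
    ← lastL_neg hz.neg (F.mul_mem (lastR_mem hc) (neg_mem (F.star_mem ha))), lastR, star_mul]
  congr 1
  noncomm_ring

theorem S2_lastR_comm (hz : IsLast z) {i j k : SignedIndex m} (h1 : k ≠ i) (h2 : j ≠ -i)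
    {a c : R} (ha : a ∈ F.ring (up j) (up k)) (hc : c ∈ F.ring (up i) z) :
    Commute (F.init.S2 j k a) (F.lastR i z c) :=
  (lastL_S2_comm hz.neg h2 (fun h => h1 (neg_injective h).symm) (lastR_mem hc) ha).symm

theorem lastR_lastR (hz : IsLast z) {i j : SignedIndex m} (hij : i ≠ -j) {b c : R}
    (hb : b ∈ F.ring (up i) z) (hc : c ∈ F.ring (up j) z) :
    Commute (F.lastR i z b) (F.lastR j z c) :=
  lastL_lastL hz.neg (fun h => hij (neg_injective h)) (lastR_mem hb) (lastR_mem hc)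

theorem lastL_lastR (hz : IsLast z) {i j : SignedIndex m} (hij : i ≠ j) {b c : R}
    (hb : b ∈ F.ring (-z) (up i)) (hc : c ∈ F.ring (up j) z) :
    Commute (F.lastL (-z) i b) (F.lastR j z c) :=
  lastL_lastL hz.neg (by rwa [neg_neg]) hb (lastR_mem hc)

theorem S1_lastR (hz : IsLast z) {i j : SignedIndex m} (hij : i ≠ j) {u : Δ} {c : R}
    (hu : u ∈ F.form (up i)) (hc : c ∈ F.ring (up j) z) :
    Commute (F.init.S1 i u) (F.lastR j z c) :=
  S1_lastL hz.neg (by rwa [neg_neg]) hu (lastR_mem hc)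

theorem lastL_eq_lastR (i : SignedIndex m) (b : R) :
    F.lastL (-z) i b = F.lastR (-i) z (-star b) := by
  rw [lastR, star_neg, star_star, neg_neg, neg_neg]

/-! ### Lifts of the long root subgroup -/

variable (F) in
/-- `y` is a lift of `T_z(w)` acting on the Steinberg group of the smaller family in the
expected way. -/
def Lift (z : SignedIndex (m + 1)) (w : Δ) (y : F.init.StU) : Prop :=
  w ∈ F.form z ∧ F.init.st y = F.T z w ∧ y ∈ F.init.nice

theorem T_mem_levi_init (hz : IsLast z) {w : Δ} (hw : w ∈ F.form z) : F.T z w ∈ F.init.levi :=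
  fun k => LeviAt.of_fix (F := F.init) (T_app_q_of_form hw (hz.apart k).1)

theorem Lift.mul {w w' : Δ} {y y' : F.init.StU} (h : F.Lift z w y) (h' : F.Lift z w' y') :
    F.Lift z (w + w') (y * y') :=
  ⟨add_mem h.1 h'.1, by rw [map_mul, h.2.1, h'.2.1, T_add (form_mem_unip h.1) (form_mem_unip h'.1)],
    MulMemClass.mul_mem h.2.2 h'.2.2⟩

theorem Lift.one : F.Lift z 0 1 := ⟨zero_mem _, by rw [map_one, T_zero], one_mem _⟩

/-- `T_z(w)` fixes all `q_k` with `k ≠ ±z`, so it lies in the Levi subgroup of the smaller family.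
The condition `2 ≤ m` supplies the second index needed for niceness. -/
theorem Lift.of_mem (hm : 2 ≤ m) (hz : IsLast z) {w : Δ} {y : F.init.StU} (hw : w ∈ F.form z)
    (h1 : F.init.st y = F.T z w) {i : SignedIndex m}
    (h : y ∈ F.init.root1 i ⊔ F.init.root1 (-i)) : F.Lift z w y := by
  obtain ⟨j, hj⟩ := exists_apart hm i
  exact ⟨hw, h1, mem_nice_of_mem_sup_root1 hj (h1 ▸ T_mem_levi_init hz hw) h⟩

/-- Because `y` is in `nice`, its conjugation action is dictated by `T_z(w)` in U, where it is
known. Relations between `y` and the generators thus come from U, however `y` was constructed. -/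
theorem Lift.commutator_S1 (hz : IsLast z) {w : Δ} {y : F.init.StU} (h : F.Lift z w y)
    {i : SignedIndex m} {v : Δ} (hv : v ∈ F.init.form i) :
    ⁅y, F.init.S1 i v⁆ = F.init.S1 i (O.act (F.T z w).γ (O.π v)) := by
  obtain ⟨hw, h1, h2, h3⟩ := h
  have e1 : (F.T z w).app (F.q (up i)) = F.q (up i) := T_app_q_of_form hw (hz.apart i).1
  have e2 : (F.T z w).app (F.q (-up i)) = F.q (-up i) :=
    T_app_q_of_form hw (hz.apart (-i)).1
  have hv' : v ∈ (F.η (up i)).unip := form_mem_unip (F := F.init) hv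
  have e3 : (F.T z w).app v ∈ F.init.form i := by
    rw [mem_form_iff] at hv ⊢
    refine ⟨by rw [← Unitary.app_act, hv.1], fun k => ?_⟩
    have h5 : F.init.LeviAt (F.T z w) (-k) := T_mem_levi_init hz hw (-k)
    exact h5.e_mul_π_app (hv.2 k)
  have e4 := (T_conj_of_fix e1 e2 hv').2
  have e5 : F.init.leviAd ⟨_, h2⟩ (F.init.S1 i v) = F.init.S1 i ((F.T z w).app v) :=
    leviAd_S1 _ hv e3 (by dsimp only; rw [h1]; exact e4)
  have e6 : O.act (F.T z w).γ (O.π v) = (F.T z w).app v + -v := by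
    rw [Unitary.app, add_neg_cancel_right]
  rw [commutatorElement_def, ← h3, e5, e6, S1_add e3 (neg_mem hv), S1_neg hv]

theorem Lift.commute_S2 (hz : IsLast z) {w : Δ} {y : F.init.StU} (h : F.Lift z w y)
    {i j : SignedIndex m} (hij : Apart i j) {a : R} (ha : a ∈ F.ring (up i) (up j)) :
    Commute y (F.init.S2 i j a) := by
  obtain ⟨hw, h1, h2, h3⟩ := h
  have e1 : (F.T z w).app (F.q (up j)) = F.q (up j) := T_app_q_of_form hw (hz.apart j).1
  have e2 : (F.T z w).app (F.q (-up j)) = F.q (-up j) := T_app_q_of_form hw (hz.apart (-j)).1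
  have e0 : (F.T z w).app (F.q (up i)) = F.q (up i) := T_app_q_of_form hw (hz.apart i).1
  have hv' := q_act_unip hij.up ha
  have e4 := (T_conj_of_fix e1 e2 hv').2
  rw [Unitary.app_act, e0] at e4
  have e5 : F.init.leviAd ⟨_, h2⟩ (F.init.S2 i j a) = F.init.S2 i j a :=
    leviAd_S2 _ hij ha ha (by dsimp only; rw [h1]; exact e4)
  rw [h3] at e5
  exact mul_inv_eq_iff_eq_mul.1 e5

/-- The vector `q_{-z}·b` has no component along `e_z` and is orthogonal to `w`, so `T_z(w)` fixes
it. -/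
theorem Lift.commute_lastL (hz : IsLast z) {w : Δ} {y : F.init.StU} (h : F.Lift z w y)
    {i : SignedIndex m} {b : R} (hb : b ∈ F.ring (-z) (up i)) : Commute y (F.lastL (-z) i b) := by
  apply commutatorElement_eq_one_iff_commute.1
  rw [lastL, h.commutator_S1 hz (q_act_mem_init hz.neg hb), π_q_act hb,
    act_T_γ (form_mem_unip h.1), act_eq_zero (form_act h.1) (e_mul_eq_zero hb (ne_neg_self z)),
    mul_eq_zero (F.ρ_mem h.1) hb (ne_neg_self z), star_π_mul h.1 hb, mul_assoc, add_mul,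
    mul_eq_zero (F.ρ_mem h.1) hb (ne_neg_self z), π_mul_eq_zero h.1 hb (ne_neg_self z)]
  simp [O.act_zero, O.φ_zero, S1_zero]

theorem Lift.commute_lastR (hz : IsLast z) {w : Δ} {y : F.init.StU} (h : F.Lift z w y)
    {i : SignedIndex m} {a : R} (ha : a ∈ F.ring (up i) z) : Commute y (F.lastR i z a) :=
  h.commute_lastL hz (lastR_mem ha)

theorem Lift.commutator_form (hz : IsLast z) {w : Δ} {y : F.init.StU} (h : F.Lift z w y)
    {i : SignedIndex m} {u : Δ} (hu : u ∈ F.form (up i)) :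
    ⁅y, F.init.S1 i u⁆ = F.lastL (-z) i (-(star (O.π w) * O.π u)) := by
  have h5 : O.π w * O.π u = 0 := by
    rw [← F.π_mul_e h.1, mul_assoc (O.π w), e_mul_π hu z, mul_zero]
  rw [h.commutator_S1 hz (form_le_init i hu), act_T_γ (form_mem_unip h.1),
    act_eq_zero (form_act h.1) (e_mul_π hu z), mul_π hu (F.ρ_mem h.1), mul_assoc, add_mul,
    mul_π hu (F.ρ_mem h.1), h5, lastL]
  simp [O.φ_zero]

end OrthogonalHyperbolicFamily

end OddFormRing

namespace OddFormRing

variable {R : Type u} {Δ : Type v} [NonUnitalRing R] [StarRing R] [AddGroup Δ]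

namespace OrthogonalHyperbolicFamily

open SignedIndex
open scoped commutatorElement

variable {O : OddFormRing R Δ} {m : ℕ} (F : O.OrthogonalHyperbolicFamily (m + 1))

/-- The lift `[X_{-z,i}(b), X_{iz}(a)]` of `T_z(φ(b a))`. -/
noncomputable def liftφ (z : SignedIndex (m + 1)) (i : SignedIndex m) (b a : R) : F.init.StU :=
  ⁅F.lastL (-z) i b, F.lastR i z a⁆

variable {F} {z : SignedIndex (m + 1)}

theorem liftφ_zero_right {i : SignedIndex m} (b : R) : F.liftφ z i b 0 = 1 := by
  rw [liftφ, lastR_zero, commutatorElement_one_right]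

theorem liftφ_star (i : SignedIndex m) (b a : R) :
    F.liftφ z (-i) (-star a) (-star b) = (F.liftφ z i b a)⁻¹ := by
  rw [liftφ, liftφ, commutatorElement_inv, ← lastL_eq_lastR]
  rfl

section

variable (hm : 2 ≤ m) (hz : IsLast z)

include hz in
theorem lift_liftφ (hm : 2 ≤ m) {i : SignedIndex m} {b a : R} (hb : b ∈ F.ring (-z) (up i))
    (ha : a ∈ F.ring (up i) z) : F.Lift z (O.φ (b * a)) (F.liftφ z i b a) := by
  have ha' : a ∈ F.ring (up i) (-(-z)) := by rwa [neg_neg]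
  have h5 := F.rels_T.r5 (hz.neg.apart i) hb ha'
  rw [neg_neg] at h5
  refine Lift.of_mem hm hz (φ_mem_form (F.mul_mem hb ha)) ?_ (i := i) ?_
  · rw [liftφ, map_commutatorElement, st_lastL hz.neg hb, st_lastR hz ha, h5]
  · have h1 := Subgroup.mem_sup_left (T := F.init.root1 (-i)) (lastL_mem_root1 hz.neg hb)
    have h2 := Subgroup.mem_sup_right (S := F.init.root1 i) (lastR_mem_root1 hz ha)
    exact MulMemClass.mul_mem (MulMemClass.mul_mem (MulMemClass.mul_mem h1 h2) (inv_mem h1)) (inv_mem h2)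

include hm hz

theorem liftφ_add_left {i : SignedIndex m} {b b' a : R} (hb : b ∈ F.ring (-z) (up i))
    (hb' : b' ∈ F.ring (-z) (up i)) (ha : a ∈ F.ring (up i) z) :
    F.liftφ z i (b + b') a = F.liftφ z i b' a * F.liftφ z i b a := by
  rw [liftφ, lastL_add hz.neg hb hb']
  exact commutatorElement_mul_left_of_commute
    ((lift_liftφ hz hm hb' ha).commute_lastL hz hb).symm

theorem liftφ_add_right {i : SignedIndex m} {b a a' : R} (hb : b ∈ F.ring (-z) (up i))
    (ha : a ∈ F.ring (up i) z) (ha' : a' ∈ F.ring (up i) z) :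
    F.liftφ z i b (a + a') = F.liftφ z i b a * F.liftφ z i b a' := by
  rw [liftφ, lastR_add hz ha ha']
  exact commutatorElement_mul_right_of_commute
    ((lift_liftφ hz hm hb ha').commute_lastR hz ha).symm

omit hm in
theorem Lift.commute_liftφ {w : Δ} {y : F.init.StU} (h : F.Lift z w y) {i : SignedIndex m} {b a : R}
    (hb : b ∈ F.ring (-z) (up i)) (ha : a ∈ F.ring (up i) z) : Commute y (F.liftφ z i b a) := by
  have h1 := h.commute_lastL hz hb
  have h2 := h.commute_lastR hz ha
  exact ((h1.mul_right h2).mul_right h1.inv_right).mul_right h2.inv_right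

/-- The commutator associativity for `x = X_{-z,j}(b)`, `y = X_{ji}(c)`, `w = X_{iz}(a)`: the lift
of `φ(bca)` does not depend on where the product is split. -/
theorem liftφ_assoc {i j : SignedIndex m} (hij : Apart i j) {b c a : R}
    (hb : b ∈ F.ring (-z) (up j)) (hc : c ∈ F.ring (up j) (up i)) (ha : a ∈ F.ring (up i) z) :
    F.liftφ z i (b * c) a = F.liftφ z j b (c * a) := by
  have hca := F.mul_mem hc ha
  have e1 := lastL_S2 hz.neg hij.symm hb hc
  have e2 := S2_lastR hz hij.symm hc ha
  have h3 := (lift_liftφ hz hm hb hca).commute_lastR hz hca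
  rw [liftφ, liftφ, ← e1, ← e2]
  apply commutatorElement_assoc_of_commute
  · exact lastL_lastR hz hij.1.symm hb ha
  · rw [e1, e2]
    exact (lastL_lastR hz hij.1 (F.mul_mem hb hc) hca).symm
  · rw [e2]
    exact h3.symm

variable (F) in
omit hm hz in
/-- The lifts of all `T_z(φ(c))`. -/
structure IsLiftφ (z : SignedIndex (m + 1)) (f : R → F.init.StU) : Prop where
  add : ∀ {b c}, b ∈ F.ring (-z) z → c ∈ F.ring (-z) z → f (b + c) = f b * f c
  mul : ∀ {i b a}, b ∈ F.ring (-z) (up i) → a ∈ F.ring (up i) z → f (b * a) = F.liftφ z i b a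
  lift : ∀ {c}, c ∈ F.ring (-z) z → F.Lift z (O.φ c) (f c)

/-- Constructs `c ↦` a lift of `T_z(φ(c a))` by induction on `a`. As only existence is asserted at
each stage, no well-definedness over presentations of `a` as a sum has to be shown. The last clause,
commutation with every lift, is what makes the product of two such maps additive again. -/
theorem exists_isLiftφ_aux (p : Fin m) {a : R} (ha : a ∈ F.ring z z) : ∃ f : R → F.init.StU,
    (∀ {b c}, b ∈ F.ring (-z) z → c ∈ F.ring (-z) z → f (b + c) = f b * f c) ∧
    (∀ {i b c}, i.idx ≠ p → b ∈ F.ring (-z) (up i) → c ∈ F.ring (up i) z →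
      f (b * c) = F.liftφ z i b (c * a)) ∧
    ∀ {c}, c ∈ F.ring (-z) z → F.Lift z (O.φ (c * a)) (f c) ∧
      ∀ {w y}, F.Lift z w y → Commute y (f c) := by
  refine ring_induction p.castSucc (P := fun a => ∃ f : R → F.init.StU,
    (∀ {b c}, b ∈ F.ring (-z) z → c ∈ F.ring (-z) z → f (b + c) = f b * f c) ∧
    (∀ {i b c}, i.idx ≠ p → b ∈ F.ring (-z) (up i) → c ∈ F.ring (up i) z →
      f (b * c) = F.liftφ z i b (c * a)) ∧
    ∀ {c}, c ∈ F.ring (-z) z → F.Lift z (O.φ (c * a)) (f c) ∧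
      ∀ {w y}, F.Lift z w y → Commute y (f c)) ?_ ?_ ?_ ha
  · refine ⟨fun _ => 1, fun _ _ => (one_mul 1).symm, fun {i b c} _ _ _ => ?_, fun {c} _ => ?_⟩
    · rw [mul_zero, liftφ_zero_right]
    · rw [mul_zero, O.φ_zero]
      exact ⟨Lift.one, fun _ => Commute.one_right _⟩
  · rintro a a' ha ha' ⟨f, h1, h2, h3⟩ ⟨f', h1', h2', h3'⟩
    refine ⟨fun c => f c * f' c, fun {b c} hb hc => ?_, fun {i b c} hi hb hc => ?_,
      fun {c} hc => ⟨?_, fun h => ((h3 hc).2 h).mul_right ((h3' hc).2 h)⟩⟩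
    · beta_reduce
      rw [h1 hb hc, h1' hb hc, mul_assoc, ← mul_assoc (f c), ((h3' hb).2 (h3 hc).1).eq]
      group
    · beta_reduce
      rw [h2 hi hb hc, h2' hi hb hc, mul_add,
        liftφ_add_right hm hz hb (F.mul_mem hc ha) (F.mul_mem hc ha')]
    · rw [mul_add, O.φ_add]
      exact (h3 hc).1.mul (h3' hc).1
  · intro k s t hk hs ht
    obtain ⟨k, rfl⟩ | h' := exists_up_or_isLast k
    · obtain rfl : k.idx = p := Fin.castSucc_injective _ hk
      -- For `a = s t` through the pair `p` an explicit commutator serves. Its values on products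
      -- through an index `i` outside that pair follow by associativity across `i` and `k`, whence
      -- the condition `i.idx ≠ p`.
      refine ⟨fun c => F.liftφ z k (c * s) t, fun {b c} hb hc => ?_, fun {i b c} hi hb hc => ?_,
        fun {c} hc => ⟨?_, fun h => h.commute_liftφ hz (F.mul_mem hc hs) ht⟩⟩
      · beta_reduce
        rw [add_mul, add_comm, liftφ_add_left hm hz (F.mul_mem hc hs) (F.mul_mem hb hs) ht]
      · beta_reduce
        rw [mul_assoc, liftφ_assoc hm hz (apart_iff_idx.2 hi.symm) hb (F.mul_mem hc hs) ht, mul_assoc]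
      · rw [← mul_assoc]
        exact lift_liftφ hz hm (F.mul_mem hc hs) ht
    · exact absurd (h'.symm.trans hk) (Fin.castSucc_lt_last p).ne'

theorem exists_isLiftφ : ∃ f, F.IsLiftφ z f := by
  obtain ⟨f, h1, h2, h3⟩ := exists_isLiftφ_aux hm hz ⟨0, by omega⟩ (F.e_mem z)
  refine ⟨f, h1, fun {i b a} hb ha => ?_, fun {c} hc => ?_⟩
  -- For indices in the pair used for the construction the second factor is expanded through another
  -- pair, where the formula is known, and moved back by associativity.
  · by_cases hi : i.idx = ⟨0, by omega⟩
    · refine ring_induction (F := F) (Fin.castSucc ⟨1, by omega⟩)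
        (P := fun a => f (b * a) = F.liftφ z i b a) ?_ ?_ ?_ ha
      · have := h1 (zero_mem _) (zero_mem _)
        rw [add_zero, left_eq_mul] at this
        rw [mul_zero, liftφ_zero_right, this]
      · intro a a' ha ha' e e'
        rw [mul_add, h1 (F.mul_mem hb ha) (F.mul_mem hb ha'), e, e', liftφ_add_right hm hz hb ha ha']
      · intro k x y hk hx hy
        obtain ⟨k, rfl⟩ | h' := exists_up_or_isLast k
        · have hk' : k.idx = ⟨1, by omega⟩ := Fin.castSucc_injective _ hk
          have hki : Apart k i := by rw [apart_iff_idx, hk', hi]; simp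
          rw [← mul_assoc, h2 (by rw [hk']; simp) (F.mul_mem hb hx) hy, mul_e hy,
            liftφ_assoc hm hz hki hb hx hy]
        · exact absurd (h'.symm.trans hk) (Fin.castSucc_lt_last _).ne'
    · rw [h2 hi hb ha, mul_e ha]
  · have := (h3 hc).1
    rwa [mul_e hc] at this

end

section

variable {f : R → F.init.StU} (hf : F.IsLiftφ z f)

include hf

theorem IsLiftφ.zero : f 0 = 1 := by
  have := hf.add (zero_mem _) (zero_mem _)
  rwa [add_zero, left_eq_mul] at this

theorem IsLiftφ.neg {c : R} (hc : c ∈ F.ring (-z) z) : f (-c) = (f c)⁻¹ := by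
  have := hf.add (neg_mem hc) hc
  rw [neg_add_cancel, hf.zero] at this
  exact eq_inv_of_mul_eq_one_left this.symm

/-- Every `f c` is a product of commutators of elements `X_{-z,k}(s)` and `X_{kz}(t)`, with which
any lift commutes. -/
theorem IsLiftφ.commute (hm : 2 ≤ m) (hz : IsLast z) {w : Δ} {y : F.init.StU} (h : F.Lift z w y)
    {c : R} (hc : c ∈ F.ring (-z) z) : Commute y (f c) := by
  refine ring_induction (F := F) (Fin.castSucc ⟨0, by omega⟩) (P := fun c => Commute y (f c))
    ?_ ?_ ?_ hc
  · rw [hf.zero]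
    exact Commute.one_right _
  · intro a b ha hb h1 h2
    rw [hf.add ha hb]
    exact h1.mul_right h2
  · intro k s t hk hs ht
    obtain ⟨k, rfl⟩ | h' := exists_up_or_isLast k
    · rw [hf.mul hs ht]
      exact h.commute_liftφ hz hs ht
    · exact absurd (h'.symm.trans hk) (Fin.castSucc_lt_last _).ne'

theorem IsLiftφ.star_eq (hm : 2 ≤ m) {c : R} (hc : c ∈ F.ring (-z) z) :
    f (star c) = (f c)⁻¹ := by
  have hs : ∀ {c}, c ∈ F.ring (-z) z → star c ∈ F.ring (-z) z := fun h => star_mem_right h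
  refine ring_induction (F := F) (Fin.castSucc ⟨0, by omega⟩) (P := fun c => f (star c) = (f c)⁻¹)
    ?_ ?_ ?_ hc
  · rw [star_zero, hf.zero, inv_one]
  · intro a b ha hb h1 h2
    rw [star_add, add_comm, hf.add (hs hb) (hs ha), h1, h2, ← mul_inv_rev, hf.add ha hb]
  · intro k s t hk hs ht
    obtain ⟨k, rfl⟩ | h' := exists_up_or_isLast k
    · have ha : -star t ∈ F.ring (-z) (up (-k)) := neg_mem (F.star_mem ht)
      have hb : -star s ∈ F.ring (up (-k)) z := by
        have := neg_mem (F.star_mem hs)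
        rwa [neg_neg] at this
      rw [hf.mul hs ht, star_mul, ← neg_mul_neg, hf.mul ha hb, liftφ_star]
    · exact absurd (h'.symm.trans hk) (Fin.castSucc_lt_last _).ne'

end

/-! ### Lifts of `T_z(u · a)` -/

variable (F) in
/-- The lift of `T_z(u · a)` expressed by the relation for `[X_i(u), X_{iz}(-a)]`. -/
noncomputable def liftAct (z : SignedIndex (m + 1)) (i : SignedIndex m) (u : Δ) (a : R) :
    F.init.StU :=
  ⁅F.init.S1 i u, F.lastR i z (-a)⁆⁻¹ * F.lastR (-i) z (-(O.ρ u * a))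

end OrthogonalHyperbolicFamily

end OddFormRing

namespace OddFormRing

variable {R : Type u} {Δ : Type v} [NonUnitalRing R] [StarRing R] [AddGroup Δ]

namespace OrthogonalHyperbolicFamily

open SignedIndex
open scoped commutatorElement

variable {O : OddFormRing R Δ} {m : ℕ} {F : O.OrthogonalHyperbolicFamily (m + 1)}
  {z : SignedIndex (m + 1)}

theorem liftAct_zero_left (i : SignedIndex m) (a : R) : F.liftAct z i 0 a = 1 := by
  rw [liftAct, S1_zero, commutatorElement_one_left, O.ρ_zero, zero_mul, neg_zero, lastR_zero,
    inv_one, one_mul]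

theorem liftAct_zero_right (i : SignedIndex m) (u : Δ) : F.liftAct z i u 0 = 1 := by
  rw [liftAct, mul_zero, neg_zero, lastR_zero, lastR_zero, commutatorElement_one_right,
    inv_one, one_mul]

theorem ρ_mul_mem_up {i : SignedIndex m} {u : Δ} {a : R} {k : SignedIndex (m + 1)}
    (hu : u ∈ F.form (up i)) (ha : a ∈ F.ring (up i) k) : O.ρ u * a ∈ F.ring (up (-i)) k :=
  F.mul_mem (F.ρ_mem hu) ha

section

variable (hm : 2 ≤ m) (hz : IsLast z)

include hm hz

theorem lift_liftAct {i : SignedIndex m} {u : Δ} {a : R} (hu : u ∈ F.form (up i))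
    (ha : a ∈ F.ring (up i) z) : F.Lift z (O.act u a) (F.liftAct z i u a) := by
  have hr := ρ_mul_mem_up hu ha
  refine Lift.of_mem hm hz (F.act_mem hu ha) ?_ (i := i) ?_
  · have h8 := F.rels_T.r8 (hz.apart' i) hu (neg_mem ha)
    have hr' : -(O.ρ u * a) ∈ F.ring (-up i) z := neg_mem hr
    rw [mul_neg, neg_neg, T_neg (form_mem_unip (F.act_mem hu ha))] at h8
    have e : F.init.st (F.init.S1 i u) = F.T (up i) u := st_S1 (form_le_init i hu)
    rw [liftAct, map_mul, map_inv, map_commutatorElement, e, st_lastR hz (neg_mem ha),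
      st_lastR hz (neg_mem hr), h8]
    simp [up_neg]
  · have h1 := Subgroup.mem_sup_left (T := F.init.root1 (-i)) (S1_mem (form_le_init i hu))
    have h2 := Subgroup.mem_sup_right (S := F.init.root1 i) (lastR_mem_root1 hz (neg_mem ha))
    have h3 := lastR_mem_root1 hz (neg_mem hr)
    rw [neg_neg] at h3
    exact MulMemClass.mul_mem (inv_mem (MulMemClass.mul_mem (MulMemClass.mul_mem
      (MulMemClass.mul_mem h1 h2) (inv_mem h1)) (inv_mem h2))) (Subgroup.mem_sup_left h3)

/-- Expanding `[X_i(u) X_i(u'), ·]` conjugates the lift of `u'·a` by `X_i(u)`. The resulting factor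
`Q` is known from `commutator_form`, and it cancels the cross term `star (π u) * π u'` of `ρ (u +
u')`. -/
theorem liftAct_add_left {i : SignedIndex m} {u u' : Δ} {a : R} (hu : u ∈ F.form (up i))
    (hu' : u' ∈ F.form (up i)) (ha : a ∈ F.ring (up i) z) :
    F.liftAct z i (u + u') a = F.liftAct z i u a * F.liftAct z i u' a := by
  have hr := ρ_mul_mem_up hu ha
  have hr' := ρ_mul_mem_up hu' ha
  have hs : star (O.π u) * O.π u' * a ∈ F.ring (up (-i)) z :=
    F.mul_mem (F.star_π_mul_π_mem hu hu') ha
  have hC := lift_liftAct hm hz hu' ha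
  have e1 := hC.commutator_form hz hu
  rw [lastL_eq_lastR, O.π_act] at e1
  have e1' : - star (-(star (O.π u' * a) * O.π u)) = star (O.π u) * O.π u' * a := by
    simp [mul_assoc]
  rw [e1'] at e1
  have e2 : (⁅F.init.S1 i u', F.lastR i z (-a)⁆)⁻¹
      = F.liftAct z i u' a * F.lastR (-i) z (O.ρ u' * a) := by
    rw [liftAct, lastR_neg hz hr', inv_mul_cancel_right]
  have c1 : Commute (F.init.S1 i u) (F.lastR (-i) z (O.ρ u' * a)) :=
    S1_lastR hz (ne_neg_self i) hu hr'
  have c2 := hC.commute_lastR hz hr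
  have c3 := hC.commute_lastR hz hr'
  have c4 := hC.commute_lastR hz hs
  have c5 := lastR_lastR hz (by rw [neg_neg]; exact neg_ne_self i) hr hs
  have c6 := lastR_lastR hz (by rw [neg_neg]; exact neg_ne_self i) hr hr'
  have c7 := lastR_lastR hz (by rw [neg_neg]; exact neg_ne_self i) hr' hs
  have e3 : F.lastR (-i) z (-(O.ρ (u + u') * a)) = (F.lastR (-i) z (O.ρ u * a))⁻¹ *
      F.lastR (-i) z (star (O.π u) * O.π u' * a) * (F.lastR (-i) z (O.ρ u' * a))⁻¹ := by
    rw [← lastR_neg hz hr, ← lastR_neg hz hr', ← lastR_add hz (neg_mem hr) hs,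
      ← lastR_add hz (add_mem (neg_mem hr) hs) (neg_mem hr'), O.ρ_add]
    congr 1
    noncomm_ring
  have e4 : F.liftAct z i u a = ⁅F.init.S1 i u, F.lastR i z (-a)⁆⁻¹ *
      (F.lastR (-i) z (O.ρ u * a))⁻¹ := by rw [liftAct, lastR_neg hz hr]
  rw [liftAct, S1_add (form_le_init i hu) (form_le_init i hu'), e3, e4,
    commutatorElement_mul_left_eq_conj_mul]
  generalize F.liftAct z i u' a = C at *
  generalize F.lastR (-i) z (O.ρ u * a) = P at *
  generalize F.lastR (-i) z (O.ρ u' * a) = P' at *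
  generalize F.lastR (-i) z (star (O.π u) * O.π u' * a) = Q at *
  generalize F.init.S1 i u = x at *
  have e5 : x * C * x⁻¹ = Q⁻¹ * C := by rw [← e1, commutatorElement_def]; group
  have e6 : (x * ⁅F.init.S1 i u', F.lastR i z (-a)⁆ * x⁻¹)⁻¹ = Q⁻¹ * C * P' := by
    calc _ = x * ⁅F.init.S1 i u', F.lastR i z (-a)⁆⁻¹ * x⁻¹ := by group
      _ = x * C * (P' * x⁻¹) := by rw [e2]; group
      _ = x * C * x⁻¹ * P' := by rw [← c1.inv_left.eq]; group
      _ = _ := by rw [e5]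
  rw [mul_inv_rev, e6]
  have e7 : P' * P⁻¹ * Q * P'⁻¹ = Q * P⁻¹ := by
    rw [← c6.inv_left.eq, mul_assoc P⁻¹, c7.eq, ← mul_assoc, mul_inv_cancel_right, c5.inv_left.eq]
  calc _ = ⁅x, F.lastR i z (-a)⁆⁻¹ * (Q⁻¹ * (C * (P' * P⁻¹ * Q * P'⁻¹))) := by group
    _ = ⁅x, F.lastR i z (-a)⁆⁻¹ * (Q⁻¹ * (C * (Q * P⁻¹))) := by
      rw [e7]
    _ = ⁅x, F.lastR i z (-a)⁆⁻¹ * (Q⁻¹ * (Q * P⁻¹ * C)) := by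
      rw [(c4.mul_right c2.inv_right).eq]
    _ = _ := by group

/-- Conjugation by `y` fixes the two `lastR`-factors and multiplies `X_i(u)` by some `X_{-z,i}(c)`.
So the answer is a commutator of the latter with `X_{iz}(-a)`, up to inversion, that is, a value of
`f`. -/
theorem commutator_liftAct {f : R → F.init.StU} (hf : F.IsLiftφ z f) {w : Δ} {y : F.init.StU}
    (h : F.Lift z w y) {i : SignedIndex m} {u : Δ} {a : R} (hu : u ∈ F.form (up i))
    (ha : a ∈ F.ring (up i) z) :
    ⁅y, F.liftAct z i u a⁆ = f (-(star (O.π w) * O.π u * a)) := by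
  have hr := ρ_mul_mem_up hu ha
  have hC := lift_liftAct hm hz hu ha
  have hc : -(star (O.π w) * O.π u) ∈ F.ring (-z) (up i) :=
    neg_mem (F.star_π_mul_π_mem h.1 hu)
  have e1 := h.commutator_form hz hu
  have c1 := h.commute_lastR hz (neg_mem ha)
  have c2 := h.commute_lastR hz (neg_mem hr)
  have c3 := hC.commute_lastL hz hc
  have c4 : Commute (F.lastL (-z) i (-(star (O.π w) * O.π u)))
      (F.lastR (-i) z (-(O.ρ u * a))) := lastL_lastR hz (ne_neg_self i) hc (neg_mem hr)
  have e2 : ⁅F.lastL (-z) i (-(star (O.π w) * O.π u)), F.lastR i z (-a)⁆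
      = (f (-(star (O.π w) * O.π u * a)))⁻¹ := by
    have m1 : -(star (O.π w) * O.π u * a) ∈ F.ring (-z) z := by
      rw [← neg_mul]
      exact F.mul_mem hc ha
    have e2 := hf.mul hc (neg_mem ha)
    rw [neg_mul_neg] at e2
    rw [← hf.neg m1, neg_neg, e2]
    rfl
  rw [liftAct] at c3 ⊢
  generalize f (-(star (O.π w) * O.π u * a)) = ε at *
  generalize F.lastL (-z) i (-(star (O.π w) * O.π u)) = g at *
  generalize F.init.S1 i u = x at *
  generalize F.lastR i z (-a) = r at *
  generalize F.lastR (-i) z (-(O.ρ u * a)) = X at *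
  have c5 : Commute ⁅x, r⁆ g := by
    have := c3.mul_left c4.symm.inv_left
    rw [mul_inv_cancel_right] at this
    simpa using this.inv_left
  have e3 : y * x * y⁻¹ = g * x := by rw [← e1, commutatorElement_def]; group
  have e4 : y * r * y⁻¹ = r := by rw [c1.eq]; group
  have e5 : y * X * y⁻¹ = X := by rw [c2.eq]; group
  have e6 : y * (⁅x, r⁆⁻¹ * X) * y⁻¹ = ε * (⁅x, r⁆⁻¹ * X) := by
    calc _ = ⁅y * x * y⁻¹, y * r * y⁻¹⁆⁻¹ * (y * X * y⁻¹) := by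
          simp only [commutatorElement_def]; group
      _ = (⁅x, r⁆ * ε⁻¹)⁻¹ * X := by
          rw [e3, e4, e5, commutatorElement_mul_left_of_commute c5.symm, e2]
      _ = _ := by group
  rw [commutatorElement_def, e6]
  group

/-- The middle term arises as the commutator of `X_{iz}(-a')` with `X_{-i,z}(ρ(u) a)`, which meet
when the expanded commutator is regrouped. It imitates the `φ`-term in `u·(a + a')`. -/
theorem liftAct_add_right {f : R → F.init.StU} (hf : F.IsLiftφ z f) {i : SignedIndex m} {u : Δ}
    {a a' : R} (hu : u ∈ F.form (up i)) (ha : a ∈ F.ring (up i) z) (ha' : a' ∈ F.ring (up i) z) :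
    F.liftAct z i u (a + a') =
      F.liftAct z i u a * f (star a' * O.ρ u * a) * F.liftAct z i u a' := by
  rw [add_comm a]
  have hr := ρ_mul_mem_up hu ha
  have hr' := ρ_mul_mem_up hu ha'
  have hC := lift_liftAct hm hz hu ha
  have hC' := lift_liftAct hm hz hu ha'
  have e1 : ⁅F.lastR i z (-a'), F.lastR (-i) z (O.ρ u * a)⁆ = f (star a' * O.ρ u * a) := by
    have h1 : star a' ∈ F.ring (-z) (up (-i)) := F.star_mem ha'
    rw [mul_assoc, hf.mul h1 hr, liftφ, lastL_eq_lastR, star_star, neg_neg]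
  have e2 : F.lastR (-i) z (-(O.ρ u * (a' + a))) =
      (F.lastR (-i) z (O.ρ u * a'))⁻¹ * (F.lastR (-i) z (O.ρ u * a))⁻¹ := by
    rw [← lastR_neg hz hr, ← lastR_neg hz hr', ← lastR_add hz (neg_mem hr') (neg_mem hr), mul_add,
      neg_add]
  have c1 := hC.commute_lastR hz (neg_mem ha')
  have c2 := hC'.commute_lastR hz hr
  have c3 := lastR_lastR hz (by rw [neg_neg]; exact neg_ne_self i) hr hr'
  have e3 : (⁅F.init.S1 i u, F.lastR i z (-a)⁆)⁻¹
      = F.liftAct z i u a * F.lastR (-i) z (O.ρ u * a) := by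
    rw [liftAct, lastR_neg hz hr, inv_mul_cancel_right]
  have e4 : (⁅F.init.S1 i u, F.lastR i z (-a')⁆)⁻¹
      = F.liftAct z i u a' * F.lastR (-i) z (O.ρ u * a') := by
    rw [liftAct, lastR_neg hz hr', inv_mul_cancel_right]
  rw [liftAct, neg_add, lastR_add hz (neg_mem ha') (neg_mem ha), e2,
    commutatorElement_mul_right_eq_mul_conj, ← e1]
  generalize F.lastR (-i) z (O.ρ u * a) = P at *
  generalize F.lastR (-i) z (O.ρ u * a') = P' at *
  generalize F.liftAct z i u a = C at *
  generalize F.liftAct z i u a' = C' at *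
  generalize F.init.S1 i u = x at *
  generalize F.lastR i z (-a) = r at *
  generalize F.lastR i z (-a') = r' at *
  calc _ = r' * ⁅x, r⁆⁻¹ * r'⁻¹ * ⁅x, r'⁆⁻¹ * (P'⁻¹ * P⁻¹) := by group
    _ = (r' * C) * P * r'⁻¹ * C' * P' * P'⁻¹ * P⁻¹ := by rw [e3, e4]; group
    _ = C * ⁅r', P⁆ * (P * C') * P⁻¹ := by rw [← c1.eq, commutatorElement_def]; group
    _ = _ := by rw [← c2.eq]; group

/-- Expanding `h = x y` through a second index `k` turns `X_i(φ(h))` into `[X_{-i,k}(x),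
X_{ki}(y)]`, and conjugation by `X_{iz}(-a)` can be computed on the two factors. -/
theorem liftAct_φ {f : R → F.init.StU} (hf : F.IsLiftφ z f) {i : SignedIndex m}
    {h a : R} (hh : h ∈ F.ring (up (-i)) (up i)) (ha : a ∈ F.ring (up i) z) :
    F.liftAct z i (O.φ h) a = f (star a * h * a) := by
  have hsa : star a ∈ F.ring (-z) (up (-i)) := F.star_mem ha
  obtain ⟨j, hj⟩ := exists_apart hm i
  refine ring_induction (F := F.init) j.idx
    (P := fun h => F.liftAct z i (O.φ h) a = f (star a * h * a)) ?_ ?_ ?_ (i := -i) (j := i) hh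
  · rw [O.φ_zero, liftAct_zero_left, mul_zero, zero_mul, hf.zero]
  · intro h h' hh hh' h1 h2
    rw [O.φ_add, liftAct_add_left hm hz (φ_mem_form hh) (φ_mem_form hh') ha, h1, h2, mul_add,
      add_mul, hf.add (F.mul_mem (F.mul_mem hsa hh) ha) (F.mul_mem (F.mul_mem hsa hh') ha)]
  intro k x y hk hx hy
  have hik : Apart i k := by rw [apart_iff_idx, hk]; exact apart_iff_idx.1 hj
  clear hj hk j
  have hx' : x ∈ F.ring (up (-i)) (up k) := hx
  have hy' : y ∈ F.ring (up k) (up i) := hy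
  have hxs : star x ∈ F.ring (up (-k)) (up i) := by
    have := F.star_mem hx'
    rwa [up_neg, neg_neg] at this
  have hys : star y ∈ F.ring (up (-i)) (up (-k)) := F.star_mem hy'
  have mB := F.mul_mem hy' ha
  have mA := neg_mem (F.mul_mem hxs ha)
  have mD := F.mul_mem hx' mB
  have mD' := F.mul_mem hys (F.mul_mem hxs ha)
  have hf1 : O.φ (x * y) ∈ F.form (up i) := φ_mem_form (F.mul_mem hx' hy')
  have hS : ⁅F.init.S2 (-i) k x, F.init.S2 k i y⁆ = F.init.S1 i (O.φ (x * y)) := by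
    have := F.init.rels_S.r5 hik.neg_left hx (b := y) (by rwa [neg_neg])
    rwa [neg_neg] at this
  have ep : ⁅F.init.S2 (-i) k x, F.lastR i z (-a)⁆ = (F.lastR (-k) z (-(star x * a)))⁻¹ := by
    rw [S2_swap hx, neg_neg, S2_lastR hz hik.symm.neg_left (neg_mem hxs) (neg_mem ha),
      ← lastR_neg hz mA, neg_mul_neg, neg_neg]
  have eq : ⁅F.init.S2 k i y, F.lastR i z (-a)⁆ = (F.lastR k z (y * a))⁻¹ := by
    rw [S2_lastR hz hik.symm hy' (neg_mem ha), mul_neg, lastR_neg hz mB]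
  have eB : ⁅F.init.S2 (-i) k x, F.lastR k z (y * a)⁆ = F.lastR (-i) z (x * (y * a)) :=
    S2_lastR hz hik.neg_left hx' mB
  have eA : ⁅F.init.S2 k i y, F.lastR (-k) z (-(star x * a))⁆
      = F.lastR (-i) z (star y * (star x * a)) := by
    rw [S2_swap hy, S2_lastR hz hik.neg_neg (neg_mem hys) mA, neg_mul_neg]
  have eAB : ⁅F.lastR (-k) z (-(star x * a)), F.lastR k z (y * a)⁆ = f (star a * (x * y) * a) := by
    have h1 : star a * x ∈ F.ring (-z) (up k) := F.mul_mem hsa hx'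
    rw [← mul_assoc, mul_assoc (star a * x), hf.mul h1 mB, liftφ, lastL_eq_lastR, star_mul,
      star_star]
  have cSA : Commute (F.init.S1 i (O.φ (x * y))) (F.lastR (-k) z (-(star x * a))) :=
    S1_lastR hz hik.2 hf1 mA
  have cSB : Commute (F.init.S1 i (O.φ (x * y))) (F.lastR k z (y * a)) :=
    S1_lastR hz hik.1 hf1 mB
  have cSD : Commute (F.init.S1 i (O.φ (x * y))) (F.lastR (-i) z (x * (y * a))) :=
    S1_lastR hz (ne_neg_self i) hf1 mD
  have cSD' : Commute (F.init.S1 i (O.φ (x * y))) (F.lastR (-i) z (star y * (star x * a))) :=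
    S1_lastR hz (ne_neg_self i) hf1 mD'
  have cAD : Commute (F.lastR (-k) z (-(star x * a))) (F.lastR (-i) z (x * (y * a))) :=
    lastR_lastR hz (by rw [neg_neg]; exact hik.symm.neg_left.1) mA mD
  have cBD' : Commute (F.lastR k z (y * a)) (F.lastR (-i) z (star y * (star x * a))) :=
    lastR_lastR hz (by rw [neg_neg]; exact hik.symm.1) mB mD'
  have cBD : Commute (F.lastR k z (y * a)) (F.lastR (-i) z (x * (y * a))) :=
    lastR_lastR hz (by rw [neg_neg]; exact hik.symm.1) mB mD
  have eρ : F.lastR (-i) z (-(O.ρ (O.φ (x * y)) * a)) =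
      F.lastR (-i) z (star y * (star x * a)) * (F.lastR (-i) z (x * (y * a)))⁻¹ := by
    rw [← lastR_neg hz mD, ← lastR_add hz mD' (neg_mem mD), O.ρ_φ]
    congr 1
    rw [star_mul]
    noncomm_ring
  rw [liftAct, eρ, ← eAB]
  generalize F.lastR (-k) z (-(star x * a)) = A at *
  generalize F.lastR k z (y * a) = B at *
  generalize F.lastR (-i) z (x * (y * a)) = D at *
  generalize F.lastR (-i) z (star y * (star x * a)) = D' at *
  generalize F.init.S1 i (O.φ (x * y)) = S at *
  generalize F.init.S2 (-i) k x = p at *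
  generalize F.init.S2 k i y = q at *
  generalize F.lastR i z (-a) = w at *
  have e1 : w * p * w⁻¹ = A * p := by
    rw [eq_comm, ← inv_inv A, ← ep, commutatorElement_def]; group
  have e2 : w * q * w⁻¹ = B * q := by
    rw [eq_comm, ← inv_inv B, ← eq, commutatorElement_def]; group
  have e3 : p * B = D * B * p := by rw [← eB, commutatorElement_def]; group
  have e4 : q * A⁻¹ * q⁻¹ = A⁻¹ * D'⁻¹ := by rw [← eA, commutatorElement_def]; group
  -- The factors `p` and `q` of `S = [p, q]` acquire `A` and `B` under conjugation by `w`.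
  -- Collecting these leaves `D`, `D'`, which encode `ρ (φ h)`, and `[A, B]`, which is the required
  -- value of `f`.
  have e5 : w * S * w⁻¹ = S * (D * ⁅A, B⁆ * D'⁻¹) := by
    calc w * S * w⁻¹ = ⁅w * p * w⁻¹, w * q * w⁻¹⁆ := by
          rw [← hS]; simp only [commutatorElement_def]; group
      _ = A * (p * B) * q * p⁻¹ * A⁻¹ * q⁻¹ * B⁻¹ := by
          rw [e1, e2, commutatorElement_def]; group
      _ = A * D * B * ⁅p, q⁆ * (q * A⁻¹ * q⁻¹) * B⁻¹ := by
          rw [e3, commutatorElement_def]; group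
      _ = A * D * (B * S) * A⁻¹ * (D'⁻¹ * B⁻¹) := by rw [hS, e4]; group
      _ = A * D * S * B * A⁻¹ * B⁻¹ * D'⁻¹ := by
          rw [← cSB.eq, ← cBD'.inv_inv.eq]; group
      _ = (D * A) * S * B * A⁻¹ * B⁻¹ * D'⁻¹ := by rw [cAD.eq]
      _ = D * (S * A) * B * A⁻¹ * B⁻¹ * D'⁻¹ := by rw [cSA.eq]; group
      _ = (S * D) * A * B * A⁻¹ * B⁻¹ * D'⁻¹ := by rw [cSD.eq]; group
      _ = _ := by rw [commutatorElement_def]; group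
  have cε : Commute S ⁅A, B⁆ :=
    ((cSA.mul_right cSB).mul_right cSA.inv_right).mul_right cSB.inv_right
  have e6 : ⁅S, w⁆⁻¹ = D * ⁅A, B⁆ * D'⁻¹ := by
    calc _ = w * S * w⁻¹ * S⁻¹ := by rw [commutatorElement_def]; group
      _ = _ := by
        rw [e5, ((cSD.mul_right cε).mul_right cSD'.inv_right).eq]; group
  have cDε : Commute ⁅A, B⁆ D := ((cAD.mul_left cBD).mul_left cAD.inv_left).mul_left cBD.inv_left
  rw [e6, ← cDε.eq]
  group

/-- Conjugating `k = [y, w]` by `x`, where `x` commutes with `w` and `[x, y] = P Q`, expresses `[x,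
k]` through the commutators of `P` and `Q` with `w`. The factor `Q = X_j(-u·(-a))` contributes the
lift of its action on `b`, and the `φ`-correction `e7` changes `-u·(-a)` into `u·a`. -/
theorem liftAct_mul {f : R → F.init.StU} (hf : F.IsLiftφ z f) {i j : SignedIndex m}
    (hij : Apart i j) {u : Δ} {a b : R} (hu : u ∈ F.form (up i)) (ha : a ∈ F.ring (up i) (up j))
    (hb : b ∈ F.ring (up j) z) : F.liftAct z i u (a * b) = F.liftAct z j (O.act u a) b := by
  have hsa : star a ∈ F.ring (up (-j)) (up (-i)) := F.star_mem ha
  have hsb : star b ∈ F.ring (-z) (up (-j)) := F.star_mem hb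
  have hab := F.mul_mem ha hb
  have hsab : star (a * b) ∈ F.ring (-z) (up (-i)) := F.star_mem hab
  have hρ : O.ρ u ∈ F.ring (up (-i)) (up i) := F.ρ_mem hu
  have hρa : O.ρ u * a ∈ F.ring (up (-i)) (up j) := F.mul_mem hρ ha
  have hρab : O.ρ u * (a * b) ∈ F.ring (up (-i)) z := F.mul_mem hρ hab
  have hsρa : star (O.ρ u * a) ∈ F.ring (up (-j)) (up i) := by
    have := F.star_mem hρa
    rwa [up_neg i, neg_neg] at this
  have haρa : star a * O.ρ u * a ∈ F.ring (up (-j)) (up j) := F.mul_mem (F.mul_mem hsa hρ) ha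
  have hZ := F.mul_mem hsρa hab
  have hv := neg_mem (F.act_mem hu (neg_mem ha))
  have hCv := lift_liftAct hm hz hv hb
  have hε : star (a * b) * (O.ρ u * (a * b)) ∈ F.ring (-z) z := F.mul_mem hsab hρab
  have eu : O.act u a = -O.act u (-a) + O.φ (star a * O.ρ u * a) := by
    rw [O.neg_act_neg, neg_add_cancel_right]
  have e1 : ⁅F.init.S1 i u, F.init.S2 i j a⁆
      = F.init.S2 (-i) j (O.ρ u * a) * F.init.S1 j (-O.act u (-a)) :=
    F.init.rels_S.r8 hij (form_le_init i hu) ha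
  have e2 : ⁅F.init.S2 i j a, F.lastR j z (-b)⁆ = F.lastR i z (-(a * b)) := by
    rw [S2_lastR hz hij ha (neg_mem hb), mul_neg]
  have e3 : ⁅F.init.S2 (-i) j (O.ρ u * a), F.lastR j z (-b)⁆
      = (F.lastR (-i) z (O.ρ u * (a * b)))⁻¹ := by
    rw [S2_lastR hz hij.neg_left hρa (neg_mem hb), mul_neg, ← lastR_neg hz hρab, mul_assoc]
  have e4 : ⁅F.init.S2 (-i) j (O.ρ u * a), F.lastR i z (-(a * b))⁆
      = F.lastR (-j) z (star (O.ρ u * a) * (a * b)) := by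
    have hρa' : O.ρ u * a ∈ F.init.ring (-i) j := hρa
    rw [S2_swap hρa', neg_neg, S2_lastR hz hij.symm.neg_left (neg_mem hsρa) (neg_mem hab),
      neg_mul_neg]
  have e5 : ⁅F.init.S1 j (-O.act u (-a)), F.lastR j z (-b)⁆ =
      (F.liftAct z j (-O.act u (-a)) b * F.lastR (-j) z (star (O.ρ u * a) * (a * b)))⁻¹ := by
    have : O.ρ (-O.act u (-a)) * b = star (O.ρ u * a) * (a * b) := by
      rw [O.ρ_neg, O.ρ_act]
      simp [mul_assoc]
    rw [liftAct, this, lastR_neg hz hZ, inv_mul_cancel_right, inv_inv]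
  have e6 : ⁅F.lastR i z (-(a * b)), (F.lastR (-i) z (O.ρ u * (a * b)))⁻¹⁆
      = (f (star (a * b) * (O.ρ u * (a * b))))⁻¹ := by
    have := hf.mul hsab (neg_mem hρab)
    rw [← hf.neg hε, ← mul_neg (star (a * b)), this, liftφ, lastL_eq_lastR, star_star, neg_neg, lastR_neg hz hρab]
  have e7 : F.liftAct z j (O.act u a) b
      = F.liftAct z j (-O.act u (-a)) b * f (star (a * b) * (O.ρ u * (a * b))) := by
    rw [eu, liftAct_add_left hm hz hv (φ_mem_form haρa) hb, liftAct_φ hm hz hf haρa hb, star_mul]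
    simp only [mul_assoc]
  have c1 : Commute (F.init.S1 i u) (F.lastR j z (-b)) := S1_lastR hz hij.1 hu (neg_mem hb)
  have c2 : Commute (F.liftAct z j (-O.act u (-a)) b) (F.init.S2 (-i) j (O.ρ u * a)) :=
    hCv.commute_S2 hz hij.neg_left hρa
  have c3 : Commute (F.init.S2 (-i) j (O.ρ u * a))
      (F.lastR (-j) z (star (O.ρ u * a) * (a * b))) :=
    S2_lastR_comm hz (ne_neg_self j) (by rw [neg_neg]; exact hij.neg_left.1) hρa hZ
  have c4 : Commute (F.init.S1 j (-O.act u (-a))) (F.lastR i z (-(a * b))) :=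
    S1_lastR hz hij.1.symm hv (neg_mem hab)
  have c5 := hCv.commute_lastR hz (neg_mem hab)
  have c6 : Commute (F.lastR i z (-(a * b))) (F.lastR (-j) z (star (O.ρ u * a) * (a * b))) :=
    lastR_lastR hz (by rw [neg_neg]; exact hij.1) (neg_mem hab) hZ
  have c7 := hCv.commute_lastR hz hρab
  have c8 := hf.commute hm hz hCv hε
  have c9 := (hf.lift hε).commute_lastR hz hρab
  rw [liftAct, lastR_neg hz hρab, e7]
  generalize f (star (a * b) * (O.ρ u * (a * b))) = ε at *
  generalize F.liftAct z j (-O.act u (-a)) b = C at *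
  generalize F.lastR (-j) z (star (O.ρ u * a) * (a * b)) = Z at *
  generalize F.lastR (-i) z (O.ρ u * (a * b)) = X at *
  generalize F.init.S2 (-i) j (O.ρ u * a) = P at *
  generalize F.init.S1 j (-O.act u (-a)) = Q at *
  generalize F.lastR i z (-(a * b)) = k at *
  generalize F.lastR j z (-b) = w at *
  generalize F.init.S1 i u = x at *
  generalize F.init.S2 i j a = y at *
  have g1 : x * y * x⁻¹ = P * Q * y := by rw [← e1, commutatorElement_def]; group
  have g2 : x * w * x⁻¹ = w := by rw [c1.eq]; group
  have g3 : Q * k * Q⁻¹ = k := by rw [c4.eq]; group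
  have g4 : P * k * P⁻¹ = Z * k := by rw [← e4, commutatorElement_def]; group
  have g5 : Commute P (C * Z)⁻¹ := (c2.symm.mul_right c3).inv_right
  have g6 : ⁅P * Q, w⁆ = (C * Z)⁻¹ * X⁻¹ := by
    rw [commutatorElement_mul_left_eq_conj_mul, e5, e3, g5.eq, mul_inv_cancel_right]
  have g7 : Commute k (C * Z)⁻¹ := (c5.symm.mul_right c6).inv_right
  have g8 : ⁅x, k⁆ = C⁻¹ * ε⁻¹ * X⁻¹ := by
    calc ⁅x, k⁆ = ⁅x * y * x⁻¹, x * w * x⁻¹⁆ * k⁻¹ := by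
          rw [← e2]; simp only [commutatorElement_def]; group
      _ = P * (Q * k * Q⁻¹) * P⁻¹ * ((C * Z)⁻¹ * X⁻¹) * k⁻¹ := by
          rw [g1, g2, commutatorElement_mul_left_eq_conj_mul, e2, g6]; group
      _ = Z * (k * (C * Z)⁻¹) * X⁻¹ * k⁻¹ := by rw [g3, g4]; group
      _ = Z * (C * Z)⁻¹ * ⁅k, X⁻¹⁆ * X⁻¹ := by rw [g7.eq, commutatorElement_def]; group
      _ = _ := by rw [e6]; group
  rw [g8]
  calc _ = X * ε * (C * X⁻¹) := by group
    _ = X * (ε * X⁻¹) * C := by rw [c7.inv_right.eq]; group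
    _ = ε * C := by rw [c9.inv_right.eq]; group
    _ = _ := c8.eq.symm

end

end OrthogonalHyperbolicFamily

end OddFormRing

/-! ### Lifts of the whole ultrashort root subgroup of the last pair -/

namespace OddFormRing

variable {R : Type u} {Δ : Type v} [NonUnitalRing R] [StarRing R] [AddGroup Δ]

namespace OrthogonalHyperbolicFamily

open SignedIndex
open scoped commutatorElement

variable {O : OddFormRing R Δ} {m : ℕ} {F : O.OrthogonalHyperbolicFamily (m + 1)}
  {z : SignedIndex (m + 1)}

variable (F) in
/-- The lifts of all `T_z(w)`. -/
structure IsLiftForm (z : SignedIndex (m + 1)) (Y : Δ → F.init.StU) : Prop where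
  add : ∀ {w w'}, w ∈ F.form z → w' ∈ F.form z → Y (w + w') = Y w * Y w'
  act : ∀ {i u a}, u ∈ F.form (up i) → a ∈ F.ring (up i) z → Y (O.act u a) = F.liftAct z i u a
  φ : ∀ {i b a}, b ∈ F.ring (-z) (up i) → a ∈ F.ring (up i) z →
    Y (O.φ (b * a)) = F.liftφ z i b a
  lift : ∀ {w}, w ∈ F.form z → F.Lift z w (Y w)

variable (F) in
/-- A partially constructed lift of `w ↦ T_z(w · a)`. -/
structure IsPartialLift (z : SignedIndex (m + 1)) (f : R → F.init.StU) (p : Fin m) (a : R)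
    (Y : Δ → F.init.StU) : Prop where
  add : ∀ {w w'}, w ∈ F.form z → w' ∈ F.form z → Y (w + w') = Y w * Y w'
  act : ∀ {i u b}, i.idx ≠ p → u ∈ F.form (up i) → b ∈ F.ring (up i) z →
    Y (O.act u b) = F.liftAct z i u (b * a)
  φ : ∀ {c}, c ∈ F.ring (-z) z → Y (O.φ c) = f (star a * c * a)
  lift : ∀ {w}, w ∈ F.form z → F.Lift z (O.act w a) (Y w)
  comm : ∀ {w w' y}, F.Lift z w' y → w ∈ F.form z →
    ⁅y, Y w⁆ = f (-(star (O.π w') * O.π w * a))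

section

variable (hm : 2 ≤ m) (hz : IsLast z) {f : R → F.init.StU} (hf : F.IsLiftφ z f)

include hm hz hf

omit hm hz in
theorem IsPartialLift.zero (p : Fin m) : F.IsPartialLift z f p 0 (fun _ => 1) where
  add _ _ := (one_mul 1).symm
  act _ _ _ := by rw [mul_zero, liftAct_zero_right]
  φ _ := by rw [mul_zero, hf.zero]
  lift _ := by rw [O.act_zero]; exact Lift.one
  comm _ _ := by rw [mul_zero, neg_zero, hf.zero, commutatorElement_one_right]

theorem IsPartialLift.mul {k : SignedIndex m} {s t : R} (hs : s ∈ F.ring z (up k))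
    (ht : t ∈ F.ring (up k) z) :
    F.IsPartialLift z f k.idx (s * t) (fun w => F.liftAct z k (O.act w s) t) where
  add hw hw' := by
    rw [O.add_act, liftAct_add_left hm hz (F.act_mem hw hs) (F.act_mem hw' hs) ht]
  act hi hu hb := by
    rw [← O.act_mul, ← mul_assoc,
      liftAct_mul hm hz hf (apart_iff_idx.2 hi) hu (F.mul_mem hb hs) ht]
  φ hc := by
    have hs' : star s ∈ F.ring (up (-k)) (-z) := F.star_mem hs
    rw [O.φ_act, liftAct_φ hm hz hf (F.mul_mem (F.mul_mem hs' hc) hs) ht, star_mul]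
    simp only [mul_assoc]
  lift hw := by
    rw [O.act_mul]
    exact lift_liftAct hm hz (F.act_mem hw hs) ht
  comm h hw := by
    rw [commutator_liftAct hm hz hf h (F.act_mem hw hs) ht, O.π_act]
    simp only [mul_assoc]

/-- The product imitates `w·(a + a') = w·a + φ(ā' ρ(w) a) + w·a'`. It is additive in `w` because the
field `comm` identifies the commutator of `Y w'` with `Y' w`, and this matches the cross term of `ρ
(w + w')`. This is why `comm` is carried along the induction. -/
theorem IsPartialLift.sum {p : Fin m} {a a' : R} (ha : a ∈ F.ring z z) (ha' : a' ∈ F.ring z z)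
    {Y Y' : Δ → F.init.StU} (h : F.IsPartialLift z f p a Y) (h' : F.IsPartialLift z f p a' Y') :
    F.IsPartialLift z f p (a + a') (fun w => Y w * f (star a' * O.ρ w * a) * Y' w) where
  add {w w'} hw hw' := by
    have sa := F.star_mem ha
    have sa' := F.star_mem ha'
    have m1 := F.mul_mem (F.mul_mem sa' (F.ρ_mem hw)) ha
    have m2 := F.mul_mem (F.mul_mem sa' (F.ρ_mem hw')) ha
    have m3 := neg_mem (F.mul_mem (F.mul_mem sa' (F.star_π_mul_π_mem hw hw')) ha)
    have e1 : f (star a' * O.ρ (w + w') * a) = f (star a' * O.ρ w * a) *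
        f (-(star a' * (star (O.π w) * O.π w') * a)) * f (star a' * O.ρ w' * a) := by
      rw [← hf.add m1 m3, ← hf.add (add_mem m1 m3) m2, O.ρ_add]
      congr 1
      noncomm_ring
    have e2 : ⁅Y w', Y' w⁆ = (f (-(star a' * (star (O.π w) * O.π w') * a)))⁻¹ := by
      rw [h'.comm (h.lift hw') hw, ← hf.star_eq hm m3, O.π_act]
      simp [mul_assoc]
    have c1 := hf.commute hm hz (h.lift hw') m1
    have c2 := hf.commute hm hz (h.lift hw') m3
    have c3 := hf.commute hm hz (h'.lift hw) m2
    have c4 := hf.commute hm hz (h'.lift hw) m3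
    rw [h.add hw hw', h'.add hw hw', e1]
    generalize f (star a' * O.ρ w * a) = A at *
    generalize f (star a' * O.ρ w' * a) = B at *
    generalize f (-(star a' * (star (O.π w) * O.π w') * a)) = D at *
    have e3 : Y w' * Y' w = D⁻¹ * Y' w * Y w' := by rw [← e2, commutatorElement_def]; group
    calc _ = Y w * (Y w' * (A * D)) * B * Y' w * Y' w' := by group
      _ = Y w * A * D * Y w' * (B * Y' w) * Y' w' := by rw [(c1.mul_right c2).eq]; group
      _ = Y w * A * D * (Y w' * Y' w) * B * Y' w' := by rw [← c3.eq]; group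
      _ = Y w * A * Y' w * (Y w' * B) * Y' w' := by rw [e3]; group
      _ = _ := by group
  act {i u b} hi hu hb := by
    rw [h.act hi hu hb, h'.act hi hu hb, mul_add,
      liftAct_add_right hm hz hf hu (F.mul_mem hb ha) (F.mul_mem hb ha'), O.ρ_act, star_mul]
    simp only [mul_assoc]
  φ {c} hc := by
    have sa := F.star_mem ha
    have sa' := F.star_mem ha'
    have sc : star c ∈ F.ring (-z) z := star_mem_right hc
    have m0 := F.mul_mem (F.mul_mem sa hc) ha
    have m1 := F.mul_mem (F.mul_mem sa' hc) ha
    have m2 := F.mul_mem (F.mul_mem sa hc) ha'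
    have m2' := F.mul_mem (F.mul_mem sa' sc) ha
    have m3 := F.mul_mem (F.mul_mem sa' hc) ha'
    have e1 : f (star a' * O.ρ (O.φ c) * a) =
        f (star a' * c * a) * f (star a * c * a') := by
      have : star (star a * c * a') = star a' * star c * a := by simp [mul_assoc]
      have h2 := hf.star_eq hm m2
      rw [this] at h2
      rw [← inv_inv (f (star a * c * a')), ← h2, ← hf.neg m2', ← hf.add m1 (neg_mem m2'), O.ρ_φ]
      congr 1
      noncomm_ring
    rw [h.φ hc, h'.φ hc, e1, ← hf.add m1 m2, ← hf.add m0 (add_mem m1 m2),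
      ← hf.add (add_mem m0 (add_mem m1 m2)) m3, star_add]
    congr 1
    noncomm_ring
  lift {w} hw := by
    rw [O.act_add]
    exact ((h.lift hw).mul (hf.lift (F.mul_mem (F.mul_mem (F.star_mem ha') (F.ρ_mem hw)) ha))).mul
      (h'.lift hw)
  comm {w w' y} hy hw := by
    have m1 := F.mul_mem (F.mul_mem (F.star_mem ha') (F.ρ_mem hw)) ha
    have m2 := neg_mem (F.mul_mem (F.star_π_mul_π_mem hy.1 hw) ha)
    have m3 := neg_mem (F.mul_mem (F.star_π_mul_π_mem hy.1 hw) ha')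
    have c1 := hf.commute hm hz hy m1
    have c2 := hf.commute hm hz (h.lift hw) m3
    have c3 := hf.commute hm hz (hf.lift m1) m3
    have e1 : ⁅y, f (star a' * O.ρ w * a)⁆ = 1 := commutatorElement_eq_one_iff_commute.2 c1
    have e2 : ⁅y, Y w * f (star a' * O.ρ w * a)⁆ = ⁅y, Y w⁆ := by
      rw [commutatorElement_mul_right_eq_mul_conj, e1]; group
    rw [commutatorElement_mul_right_of_commute, e2, h.comm hy hw, h'.comm hy hw, ← hf.add m2 m3]
    · congr 1
      noncomm_ring
    · rw [h'.comm hy hw]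
      exact c2.mul_left c3

theorem exists_isPartialLift (p : Fin m) {a : R} (ha : a ∈ F.ring z z) :
    ∃ Y, F.IsPartialLift z f p a Y := by
  refine ring_induction p.castSucc (P := fun a => ∃ Y, F.IsPartialLift z f p a Y) ?_ ?_ ?_ ha
  · exact ⟨_, IsPartialLift.zero hf p⟩
  · rintro a a' ha ha' ⟨Y, h⟩ ⟨Y', h'⟩
    exact ⟨_, IsPartialLift.sum hm hz hf ha ha' h h'⟩
  · intro k s t hk hs ht
    obtain ⟨k, rfl⟩ | h' := exists_up_or_isLast k
    · obtain rfl : k.idx = p := Fin.castSucc_injective _ hk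
      exact ⟨_, IsPartialLift.mul hm hz hf hs ht⟩
    · exact absurd (h'.symm.trans hk) (Fin.castSucc_lt_last _).ne'

/-- The partial lift for `a = e_z` lifts all of `T_z`. As with `f`, the formula for indices in the
pair 0 used in the construction is recovered by passing through the pair 1. -/
theorem exists_isLiftForm : ∃ Y, F.IsLiftForm z Y := by
  obtain ⟨Y, h⟩ := exists_isPartialLift hm hz hf ⟨0, by omega⟩ (F.e_mem z)
  have hlift : ∀ {w}, w ∈ F.form z → F.Lift z w (Y w) := fun {w} hw => by
    have := h.lift hw
    rwa [form_act hw] at this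
  have hφ : ∀ {c}, c ∈ F.ring (-z) z → Y (O.φ c) = f c := fun {c} hc => by
    rw [h.φ hc, F.star_e, e_mul hc, mul_e hc]
  refine ⟨Y, h.add, fun {i u a} hu ha => ?_, fun {i b a} hb ha => ?_, hlift⟩
  · by_cases hi : i.idx = ⟨0, by omega⟩
    · refine ring_induction (F := F) (Fin.castSucc ⟨1, by omega⟩)
        (P := fun a => Y (O.act u a) = F.liftAct z i u a) ?_ ?_ ?_ ha
      · have := h.add (zero_mem _) (zero_mem _)
        rw [add_zero, left_eq_mul] at this
        rw [O.act_zero, liftAct_zero_right, this]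
      · intro a a' ha ha' e e'
        have hsa : star a' ∈ F.ring (-z) (-up i) := F.star_mem ha'
        have hc := F.mul_mem (F.mul_mem hsa (F.ρ_mem hu)) ha
        rw [O.act_add, h.add (add_mem (F.act_mem hu ha) (φ_mem_form hc)) (F.act_mem hu ha'),
          h.add (F.act_mem hu ha) (φ_mem_form hc), e, e', hφ hc,
          liftAct_add_right hm hz hf hu ha ha']
      · intro k x y hk hx hy
        obtain ⟨k, rfl⟩ | h' := exists_up_or_isLast k
        · have hk' : k.idx = ⟨1, by omega⟩ := Fin.castSucc_injective _ hk
          have hki : Apart i k := by rw [apart_iff_idx, hk', hi]; simp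
          rw [O.act_mul, h.act (by rw [hk']; simp) (F.act_mem hu hx) hy, mul_e hy,
            liftAct_mul hm hz hf hki hu hx hy]
        · exact absurd (h'.symm.trans hk) (Fin.castSucc_lt_last _).ne'
    · rw [h.act hi hu ha, mul_e ha]
  · rw [hφ (F.mul_mem hb ha), hf.mul hb ha]

end

end OrthogonalHyperbolicFamily

end OddFormRing

/-! ### The homomorphism to the Steinberg group of the smaller family -/

namespace OddFormRing

variable {R : Type u} {Δ : Type v} [NonUnitalRing R] [StarRing R] [AddGroup Δ]

namespace OrthogonalHyperbolicFamily

open SignedIndex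
open scoped commutatorElement

theorem S1_commutator_same {O : OddFormRing R Δ} {n : ℕ} {F : O.OrthogonalHyperbolicFamily n}
    {i : SignedIndex n} {u v : Δ} (hu : u ∈ F.form i) (hv : v ∈ F.form i) :
    ⁅F.S1 i u, F.S1 i v⁆ = F.S1 i (O.φ (-(star (O.π u) * O.π v))) := by
  rw [← O.commutator, S1_add (add_mem (add_mem hu hv) (neg_mem hu)) (neg_mem hv),
    S1_add (add_mem hu hv) (neg_mem hu), S1_add hu hv, S1_neg hu, S1_neg hv, commutatorElement_def]

variable {O : OddFormRing R Δ} {m : ℕ} (F : O.OrthogonalHyperbolicFamily (m + 1))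

/-- The images of the generators `X_i(u)` under the homomorphism to the Steinberg group of the
smaller family. -/
noncomputable def down1 (Y : SignedIndex (m + 1) → Δ → F.init.StU) (i : SignedIndex (m + 1))
    (u : Δ) : F.init.StU :=
  match down? i with
  | some i => F.init.S1 i u
  | none => Y i u

/-- The images of the generators `X_{ij}(a)` under the homomorphism to the Steinberg group of the
smaller family. -/
noncomputable def down2 (i j : SignedIndex (m + 1)) (a : R) : F.init.StU :=
  match down? i, down? j with
  | some i, some j => F.init.S2 i j a
  | none, some j' => F.lastL i j' a
  | some i', none => F.lastR i' j a
  | none, none => 1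

variable {F} {Y : SignedIndex (m + 1) → Δ → F.init.StU}

theorem down1_up (i : SignedIndex m) (u : Δ) : F.down1 Y (up i) u = F.init.S1 i u := by
  simp [down1, down?_up]

theorem down1_last {i : SignedIndex (m + 1)} (h : IsLast i) (u : Δ) : F.down1 Y i u = Y i u := by
  simp [down1, h.down?]

theorem down2_up_up (i j : SignedIndex m) (a : R) :
    F.down2 (up i) (up j) a = F.init.S2 i j a := by
  simp [down2, down?_up]

theorem down2_last_up {z : SignedIndex (m + 1)} (hz : IsLast z) (j : SignedIndex m) (a : R) :
    F.down2 z (up j) a = F.lastL z j a := by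
  simp [down2, down?_up, hz.down?]

theorem down2_up_last {z : SignedIndex (m + 1)} (hz : IsLast z) (i : SignedIndex m) (a : R) :
    F.down2 (up i) z a = F.lastR i z a := by
  simp [down2, down?_up, hz.down?]

theorem IsLast.not_apart {k l : SignedIndex (m + 1)} (h : IsLast k) (h' : IsLast l) :
    ¬Apart k l := fun h1 => (h.eq_or h').elim h1.1 h1.2

theorem down2_swap {i j : SignedIndex (m + 1)} (hij : Apart i j) {a : R} (ha : a ∈ F.ring i j) :
    F.down2 i j a = F.down2 (-j) (-i) (-star a) := by
  obtain ⟨i, rfl⟩ | hi := exists_up_or_isLast i <;> obtain ⟨j, rfl⟩ | hj := exists_up_or_isLast j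
  · rw [← up_neg, ← up_neg, down2_up_up, down2_up_up]
    exact F.init.rels_S.r0 (up_apart_iff.1 hij) ha
  · rw [← up_neg, down2_up_last hj, down2_last_up hj.neg]
    rfl
  · rw [← up_neg, down2_last_up hi, down2_up_last hi.neg, lastR]
    simp
  · exact absurd hij (IsLast.not_apart hi hj)

theorem down2_commute {i k : SignedIndex (m + 1)} {j l : SignedIndex m} (hij : Apart i (up j))
    (hkl : Apart k (up l)) (h1 : i ≠ up l) (h2 : l ≠ -j) (h3 : up j ≠ k) (h4 : -k ≠ i) {a b : R}
    (ha : a ∈ F.ring i (up j)) (hb : b ∈ F.ring k (up l)) :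
    Commute (F.down2 i (up j) a) (F.down2 k (up l) b) := by
  have h2' : j ≠ -l := fun h => h2 (by rw [h, neg_neg])
  obtain ⟨i, rfl⟩ | hi := exists_up_or_isLast i <;> obtain ⟨k, rfl⟩ | hk := exists_up_or_isLast k
  · rw [down2_up_up, down2_up_up]
    exact commutatorElement_eq_one_iff_commute.1 (F.init.rels_S.r3 (up_apart_iff.1 hij)
      (up_apart_iff.1 hkl) (fun h => h1 (congrArg up h)) h2 (fun h => h3 (congrArg up h))
      (fun h => h4 (congrArg up h)) ha hb)
  · rw [down2_up_up, down2_last_up hk]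
    exact (lastL_S2_comm hk (fun h => h1 (congrArg up h)) h2 hb ha).symm
  · rw [down2_last_up hi, down2_up_up]
    exact lastL_S2_comm hi (fun h => h3 (congrArg up h).symm) h2' ha hb
  · rw [down2_last_up hi, down2_last_up hk]
    obtain rfl | rfl := hi.eq_or hk
    · exact lastL_lastL hi h2' ha hb
    · exact absurd rfl h4

theorem down1_commute (hY : ∀ z, IsLast z → F.IsLiftForm z (Y z)) {i j : SignedIndex (m + 1)}
    {k : SignedIndex m} (hjk : Apart j (up k)) (h1 : j ≠ i) (h2 : i ≠ -up k) {u : Δ} {a : R}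
    (hu : u ∈ F.form i) (ha : a ∈ F.ring j (up k)) :
    Commute (F.down1 Y i u) (F.down2 j (up k) a) := by
  obtain ⟨i, rfl⟩ | hi := exists_up_or_isLast i <;> obtain ⟨j, rfl⟩ | hj := exists_up_or_isLast j
  · rw [down1_up, down2_up_up]
    exact S1_S2_comm (fun h => h1 (congrArg up h)) (fun h => h2 (congrArg up h)) (form_le_init i hu) ha
  · rw [down1_up, down2_last_up hj]
    exact S1_lastL hj (fun h => h2 (congrArg up h)) hu ha
  · rw [down1_last hi, down2_up_up]
    exact ((hY i hi).lift hu).commute_S2 hi (up_apart_iff.1 hjk) ha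
  · rw [down1_last hi, down2_last_up hj]
    obtain rfl | rfl := hj.eq_or hi
    · exact absurd rfl h1
    · exact ((hY i hi).lift hu).commute_lastL hi ha

/-- Case analysis on which indices belong to the last pair. Without last indices the relations are
those of the smaller family; with them they are the properties of `lastL`, `lastR` and of the lifts
`Y`. Two last indices are never apart, so no `X_{ij}` joins them. -/
theorem rels_down (hY : ∀ z, IsLast z → F.IsLiftForm z (Y z)) : F.Rels (F.down1 Y) F.down2 where
  r0 h ha := down2_swap h ha
  r1 {i j a b} hij ha hb := by
    obtain ⟨i, rfl⟩ | hi := exists_up_or_isLast i <;> obtain ⟨j, rfl⟩ | hj := exists_up_or_isLast j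
    · simp only [down2_up_up]
      exact S2_add (F := F.init) ha hb
    · simp only [down2_up_last hj]
      exact lastR_add hj ha hb
    · simp only [down2_last_up hi]
      exact lastL_add hi ha hb
    · exact absurd hij (IsLast.not_apart hi hj)
  r2 {i u v} hu hv := by
    obtain ⟨i, rfl⟩ | hi := exists_up_or_isLast i
    · simp only [down1_up]
      exact S1_add (form_le_init i hu) (form_le_init i hv)
    · simp only [down1_last hi]
      exact (hY i hi).add hu hv
  r3 {i j k l a b} hij hkl h1 h2 h3 h4 ha hb := by
    apply commutatorElement_eq_one_iff_commute.2
    have key : ∀ {i k : SignedIndex (m + 1)} {j : SignedIndex m} {l a b}, Apart i (up j) →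
        Apart k l → i ≠ l → l ≠ -up j → up j ≠ k → -k ≠ i → a ∈ F.ring i (up j) → b ∈ F.ring k l →
        Commute (F.down2 i (up j) a) (F.down2 k l b) := by
      intro i k j l a b hij hkl h1 h2 h3 h4 ha hb
      obtain ⟨l, rfl⟩ | hl := exists_up_or_isLast l
      · exact down2_commute hij hkl h1 (fun h => h2 (congrArg up h)) h3 h4 ha hb
      · obtain ⟨k, rfl⟩ | hk := exists_up_or_isLast k
        · rw [down2_swap hkl hb]
          refine down2_commute (l := -k) hij hkl.swap h4.symm ?_ ?_ ?_ ha (neg_mem (F.star_mem hb))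
          · exact fun h => h3 (congrArg up (neg_injective h)).symm
          · exact fun h => h2 (by rw [h, neg_neg])
          · rw [neg_neg]; exact h1.symm
        · exact absurd hkl (IsLast.not_apart hk hl)
    obtain ⟨j, rfl⟩ | hj := exists_up_or_isLast j
    · exact key hij hkl h1 h2 h3 h4 ha hb
    · obtain ⟨i, rfl⟩ | hi := exists_up_or_isLast i
      · rw [down2_swap hij ha]
        refine key (j := -i) hij.swap hkl h2.symm ?_ ?_ ?_ (neg_mem (F.star_mem ha)) hb
        · rw [up_neg, neg_neg]; exact h1.symm
        · exact fun h => h4 (by rw [← h, up_neg, neg_neg])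
        · exact fun h => h3 (neg_injective h).symm
      · exact absurd hij (IsLast.not_apart hi hj)
  r4 {i j k a b} hij hjk hik ha hb := by
    obtain ⟨i, rfl⟩ | hi := exists_up_or_isLast i <;> obtain ⟨j, rfl⟩ | hj := exists_up_or_isLast j
      <;> obtain ⟨k, rfl⟩ | hk := exists_up_or_isLast k
    · simp only [down2_up_up]
      exact F.init.rels_S.r4 (up_apart_iff.1 hij) (up_apart_iff.1 hjk) (up_apart_iff.1 hik) ha hb
    · simp only [down2_up_up, down2_up_last hk]
      exact S2_lastR hk (up_apart_iff.1 hij) ha hb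
    · simp only [down2_up_up, down2_up_last hj, down2_last_up hj]
      have ha' := lastR_mem ha
      have h6 := F.init.rels_S.r6 (i := -i) (j := k) (up_apart_iff.1 hik).neg_left
        (q_act_mem_init hj.neg ha') (q_act_mem_init hj hb)
      rw [π_q_act ha', π_q_act hb, neg_neg, star_neg, star_star, neg_mul, neg_neg] at h6
      exact h6
    · exact absurd hjk (IsLast.not_apart hj hk)
    · simp only [down2_up_up, down2_last_up hi]
      exact lastL_S2 hi (up_apart_iff.1 hjk) ha hb
    · exact absurd hik (IsLast.not_apart hi hk)
    · exact absurd hij (IsLast.not_apart hi hj)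
    · exact absurd hij (IsLast.not_apart hi hj)
  r5 {i j a b} hij ha hb := by
    obtain ⟨i, rfl⟩ | hi := exists_up_or_isLast i <;> obtain ⟨j, rfl⟩ | hj := exists_up_or_isLast j
    · simp only [← up_neg, down2_up_up, down1_up]
      exact F.init.rels_S.r5 (up_apart_iff.1 hij) ha hb
    · simp only [← up_neg, down2_up_last hj, down2_last_up hj, down1_up]
      have ha' := lastR_mem ha
      have h6 := S1_commutator_same (q_act_mem_init hj.neg ha')
        (q_act_mem_init (i := -i) hj hb)
      rw [π_q_act ha', π_q_act (i := j) (j := up (-i)) hb, star_neg, star_star, neg_mul,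
        neg_neg] at h6
      exact h6
    · have ha' : a ∈ F.ring (- -i) (up j) := by rwa [neg_neg]
      rw [down2_last_up hi, down2_up_last hi.neg, down1_last hi.neg, (hY _ hi.neg).φ ha' hb, liftφ,
        neg_neg]
    · exact absurd hij (IsLast.not_apart hi hj)
  r6 {i j u v} hij hu hv := by
    obtain ⟨i, rfl⟩ | hi := exists_up_or_isLast i <;> obtain ⟨j, rfl⟩ | hj := exists_up_or_isLast j
    · simp only [← up_neg, down2_up_up, down1_up]
      exact F.init.rels_S.r6 (up_apart_iff.1 hij) (form_le_init i hu) (form_le_init j hv)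
    · rw [← up_neg, down2_up_last hj, down1_up, down1_last hj, ← commutatorElement_inv,
        ((hY j hj).lift hv).commutator_form hj hu,
        ← lastL_neg hj.neg (neg_mem (F.star_π_mul_π_mem hv hu)), lastR, neg_neg]
      simp
    · rw [down1_last hi, down1_up, down2_last_up hi.neg]
      exact ((hY i hi).lift hu).commutator_form hi hv
    · exact absurd hij (IsLast.not_apart hi hj)
  r7 {i j k u a} hjk h1 h2 hu ha := by
    apply commutatorElement_eq_one_iff_commute.2
    obtain ⟨k, rfl⟩ | hk := exists_up_or_isLast k
    · exact down1_commute hY hjk h1 h2 hu ha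
    · obtain ⟨j, rfl⟩ | hj := exists_up_or_isLast j
      · rw [down2_swap hjk ha]
        refine down1_commute (k := -j) hY hjk.swap h2.symm ?_ hu (neg_mem (F.star_mem ha))
        rw [up_neg, neg_neg]; exact h1.symm
      · exact absurd hjk (IsLast.not_apart hj hk)
  r8 {i j u a} hij hu ha := by
    obtain ⟨i, rfl⟩ | hi := exists_up_or_isLast i <;> obtain ⟨j, rfl⟩ | hj := exists_up_or_isLast j
    · simp only [← up_neg, down2_up_up, down1_up]
      exact F.init.rels_S.r8 (up_apart_iff.1 hij) (form_le_init i hu) ha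
    · have m1 := F.act_mem hu (neg_mem ha)
      have e1 : Y j (-O.act u (-a)) = (Y j (O.act u (-a)))⁻¹ := by
        have h0 := (hY j hj).add (zero_mem _) (zero_mem _)
        rw [add_zero, left_eq_mul] at h0
        have := (hY j hj).add (neg_mem m1) m1
        rw [neg_add_cancel, h0] at this
        exact eq_inv_of_mul_eq_one_left this.symm
      rw [← up_neg, down1_up, down2_up_last hj, down2_up_last hj, down1_last hj, e1,
        (hY j hj).act hu (neg_mem ha), liftAct, mul_neg, neg_neg, neg_neg]
      group
    · have hb := F.mul_mem (F.ρ_mem hu) ha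
      rw [down1_last hi, down2_last_up hi, down2_last_up hi.neg, down1_up, lastL,
        ((hY i hi).lift hu).commutator_S1 hi (q_act_mem_init hi ha), π_q_act ha,
        act_T_γ (form_mem_unip hu), star_π_mul hu ha, sub_zero, mul_add, mul_π hu (F.star_mem ha),
        add_zero, O.neg_act_neg, O.add_comm_of_star_π_mul_π (u := O.act u a), add_assoc, lastL,
        S1_add (q_act_mem_init hi.neg hb)]
      · have := form_le_init j (neg_mem (F.act_mem hu (neg_mem ha)))
        rwa [O.neg_act_neg] at this
      · rw [π_q_act hb, O.π_act, star_mul, mul_assoc, star_π_mul hu hb, mul_zero]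
    · exact absurd hij (IsLast.not_apart hi hj)

variable (F) in
/-- **Elimination of the last pair**: the Steinberg groups of the family and of the family without
the last pair are isomorphic over the unitary group. -/
theorem exists_equiv_init (hm : 2 ≤ m) :
    ∃ Φ : F.init.StU ≃* F.StU, ∀ x, F.st (Φ x) = F.init.st x := by
  -- The lifts for `z` and `-z` may be chosen independently, since no Steinberg relation involves
  -- both `X_z` and `X_{-z}`. Outside the last pair the value is irrelevant.
  have h1 : ∀ z : SignedIndex (m + 1), ∃ Y, IsLast z → F.IsLiftForm z Y := by
    intro z
    by_cases hz : IsLast z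
    · obtain ⟨f, hf⟩ := exists_isLiftφ (F := F) hm hz
      obtain ⟨Y, hY⟩ := exists_isLiftForm hm hz hf
      exact ⟨Y, fun _ => hY⟩
    · exact ⟨fun _ => 1, fun h => absurd h hz⟩
  choose Y hY using h1
  have hz : IsLast (⟨Fin.last m, true⟩ : SignedIndex (m + 1)) := rfl
  generalize (⟨Fin.last m, true⟩ : SignedIndex (m + 1)) = z at hz
  have hf := rels_init (F := F) hz
  have hb := rels_down hY
  have e1 : hb.lift.comp hf.lift = MonoidHom.id _ := by
    apply hom_ext
    · intro i u hu
      have hu' := hu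
      rw [init_form hz] at hu'
      have a1 := e_mul_π_mem hu' z
      have a2 := e_mul_π_mem hu' (-z)
      have a3 := res_mem hu'
      rw [MonoidHom.comp_apply, hf.lift_S1 hu, Sc, map_mul, map_mul,
        hb.lift_S2 (hz.apart i) a1, hb.lift_S2 (hz.neg.apart i) a2, hb.lift_S1 a3,
        down2_last_up hz, down2_last_up hz.neg, down1_up, MonoidHom.id_apply, lastL, lastL,
        ← S1_add (q_act_mem_init hz a1) (q_act_mem_init hz.neg a2),
        ← S1_add (add_mem (q_act_mem_init hz a1) (q_act_mem_init hz.neg a2)) (form_le_init i a3),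
        ← eq_add_res]
    · intro i j a hij ha
      rw [MonoidHom.comp_apply, hf.lift_S2 hij ha, hb.lift_S2 hij.up ha, down2_up_up]
      rfl
  have fL : ∀ {z : SignedIndex (m + 1)} {i a}, IsLast z → a ∈ F.ring z (up i) →
      hf.lift (F.lastL z i a) = F.S2 z (up i) a := by
    intro z' i a hz' ha
    rw [lastL, hf.lift_S1 (q_act_mem_init hz' ha)]
    obtain rfl | rfl := hz'.eq_or hz
    · rw [Sc_q_act ha]
    · rw [Sc_q_neg_act ha]
  have e2 : hf.lift.comp hb.lift = MonoidHom.id _ := by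
    -- The generators `X_{±z}(w)`, whose images `Y` are not explicit, need not be compared: the
    -- remaining generators already generate the group.
    have htop : MonoidHom.eqLocus (hf.lift.comp hb.lift) (MonoidHom.id _) = ⊤ := by
      apply eq_top_of_apart (hz.apart ⟨⟨0, by omega⟩, true⟩)
      · rintro k hk _ ⟨u, hu, rfl⟩
        obtain ⟨k, rfl⟩ | hk' := exists_up_or_isLast k
        · change hf.lift (hb.lift (F.S1 (up k) u)) = _
          rw [hb.lift_S1 hu, down1_up, hf.lift_S1 (form_le_init k hu), Sc_form hu]
          rfl
        · exact absurd hk (IsLast.not_apart hz hk')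
      · rintro k l hkl _ ⟨a, ha, rfl⟩
        change hf.lift (hb.lift (F.S2 k l a)) = F.S2 k l a
        rw [hb.lift_S2 hkl ha]
        obtain ⟨k, rfl⟩ | hk := exists_up_or_isLast k <;>
          obtain ⟨l, rfl⟩ | hl := exists_up_or_isLast l
        · rw [down2_up_up, hf.lift_S2 (up_apart_iff.1 hkl) ha]
        · rw [down2_up_last hl, lastR, fL hl.neg (lastR_mem ha), S2_swap ha]
          rfl
        · rw [down2_last_up hk, fL hk ha]
        · exact absurd hkl (IsLast.not_apart hk hl)
    exact MonoidHom.ext fun x => htop.ge (Subgroup.mem_top x)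
  have e3 : F.st.comp hf.lift = F.init.st := by
    apply hom_ext
    · intro i u hu
      have hu' := hu
      rw [init_form hz] at hu'
      rw [MonoidHom.comp_apply, hf.lift_S1 hu, st_Sc (hz.apart i) hu', st_S1 hu]
      rfl
    · intro i j a hij ha
      rw [MonoidHom.comp_apply, hf.lift_S2 hij ha, st_S2 hij.up ha, st_S2 hij ha]
      rfl
  exact ⟨MonoidHom.toMulEquiv _ _ e1 e2, fun x => DFunLike.congr_fun e3 x⟩

end OrthogonalHyperbolicFamily

end OddFormRing

/-! ### Semi-local rings -/

section

variable {S : Type*} [Ring S] [IsSemisimpleRing S]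

/-- Von Neumann regularity. Let `N` be a complement of the left ideal `S a` and `1 = w a + n` with
`n ∈ N`; then `a n = a - a w a` lies in both summands, so it vanishes. -/
theorem IsSemisimpleRing.exists_mul_mul_self (a : S) : ∃ w, a * w * a = a := by
  obtain ⟨N, hN⟩ := exists_isCompl (Submodule.span S {a})
  have h1 : (1 : S) ∈ Submodule.span S {a} ⊔ N := hN.sup_eq_top ▸ Submodule.mem_top
  obtain ⟨x, hx, n, hn, h⟩ := Submodule.mem_sup.1 h1
  obtain ⟨w, rfl⟩ := Submodule.mem_span_singleton.1 hx
  refine ⟨w, ?_⟩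
  have h2 : a * n = a - a * w * a := by
    rw [eq_sub_iff_add_eq, add_comm]
    calc a * w * a + a * n = a * (w • a + n) := by rw [mul_add, smul_eq_mul, mul_assoc]
      _ = a := by rw [h, mul_one]
  have h3 : a * n ∈ Submodule.span S {a} := by
    rw [h2]
    exact sub_mem (Submodule.mem_span_singleton_self a)
      (Submodule.smul_mem _ (a * w) (Submodule.mem_span_singleton_self a))
  have h4 : a * n = 0 := by
    have : a * n ∈ Submodule.span S {a} ⊓ N := ⟨h3, Submodule.smul_mem _ a hn⟩
    rwa [hN.inf_eq_bot, Submodule.mem_bot] at this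
  rw [h4, eq_comm, sub_eq_zero] at h2
  exact h2.symm

/-- Right multiplication by `a` is a surjective endomorphism of a noetherian module, hence
injective. -/
theorem IsSemisimpleRing.mul_eq_one_symm {a w : S} (h : w * a = 1) : a * w = 1 := by
  have h1 : Function.Surjective (LinearMap.toSpanSingleton S S a) := fun x =>
    ⟨x * w, by rw [LinearMap.toSpanSingleton_apply, smul_eq_mul, mul_assoc, h, mul_one]⟩
  have h2 := IsNoetherian.injective_of_surjective_endomorphism _ h1
  apply h2
  simp [mul_assoc, h]

/-- If `a` kills `d ≠ 0`, then the cokernel of `a` in a corner has a common constituent with the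
left module generated by `d`. -/
theorem IsSemisimpleRing.exists_sub_mul_mul_ne_zero {e a w d : S} (ha : e * a = a) (hae : a * e = a) (hd : d ≠ 0)
    (hed : e * d = d) (had : a * d = 0) : ∃ s, (e - a * w) * s * d ≠ 0 := by
  by_contra! h
  -- On the right submodule `e S d S`, left multiplication by `a` would be surjective, because `e s
  -- d = a w s d`, and hence injective by noetherianity. But it kills `d`.
  let M : Submodule Sᵐᵒᵖ S := Submodule.span Sᵐᵒᵖ {x | ∃ s, x = e * s * d}
  let L : S →ₗ[Sᵐᵒᵖ] S :=
    { toFun := fun x => a * x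
      map_add' := mul_add a
      map_smul' := fun r x => by simp [mul_assoc] }
  have hM : ∀ s, e * s * d ∈ M := fun s => Submodule.subset_span ⟨s, rfl⟩
  have hL : ∀ x ∈ M, L x ∈ M := by
    intro x hx
    refine Submodule.span_induction ?_ ?_ ?_ ?_ hx
    · rintro _ ⟨s, rfl⟩
      have : L (e * s * d) = e * (a * e * s) * d := by
        change a * (e * s * d) = _
        simp only [← mul_assoc, ha]
      rw [this]
      exact hM _
    · rw [map_zero]; exact zero_mem _
    · intro x y _ _ h1 h2
      rw [map_add]; exact add_mem h1 h2
    · intro r x _ h1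
      rw [map_smul]; exact M.smul_mem r h1
  have hs : Function.Surjective (L.restrict hL) := by
    rintro ⟨x, hx⟩
    have : ∃ y ∈ M, L y = x := by
      refine Submodule.span_induction ?_ ?_ ?_ ?_ hx
      · rintro _ ⟨s, rfl⟩
        refine ⟨e * (w * s) * d, hM _, ?_⟩
        change a * (e * (w * s) * d) = e * s * d
        have h1 := h s
        rw [sub_mul, sub_mul, sub_eq_zero] at h1
        rw [h1]
        simp only [← mul_assoc, hae]
      · exact ⟨0, zero_mem _, map_zero _⟩
      · rintro x y _ _ ⟨x', h1, rfl⟩ ⟨y', h2, rfl⟩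
        exact ⟨x' + y', add_mem h1 h2, map_add _ _ _⟩
      · rintro r x _ ⟨x', h1, rfl⟩
        exact ⟨r • x', M.smul_mem r h1, map_smul _ _ _⟩
    obtain ⟨y, hy, e⟩ := this
    exact ⟨⟨y, hy⟩, Subtype.ext e⟩
  have : IsNoetherian Sᵐᵒᵖ S := isNoetherian_of_surjective
    (LinearMap.toSpanSingleton Sᵐᵒᵖ S (1 : S)) (LinearMap.range_eq_top.2 fun x =>
      ⟨MulOpposite.op x, by simp⟩)
  have hi := IsNoetherian.injective_of_surjective_endomorphism _ hs
  have hdM : d ∈ M := by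
    have := hM 1
    rwa [mul_one, hed] at this
  have : (⟨d, hdM⟩ : M) = 0 := hi (Subtype.ext (by rw [map_zero]; exact had))
  exact hd (congrArg Subtype.val this)

/-- A set of elements of a corner contains an invertible element if the image of every
non-invertible element can be enlarged within the set. -/
theorem IsSemisimpleRing.exists_mul_eq {e : S} (he : e * e = e) {A : Set S} (hA : A.Nonempty)
    (hmem : ∀ a ∈ A, e * a = a ∧ a * e = a)
    (step : ∀ a ∈ A, ∀ w, e * w = w → w * e = w → a * w * a = a → ∀ d, d ≠ 0 → e * d = d →
      a * d = 0 → ∃ a' ∈ A, ∃ s, a' = a + (e - a * w) * s ∧ (e - a * w) * s * d ≠ 0) :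
    ∃ a ∈ A, ∃ b, e * b = b ∧ b * e = b ∧ a * b = e ∧ b * a = e := by
  -- Take `a` in the set with the left ideal `S a` maximal. If `a` kills some `d ≠ 0` in `e S`, the
  -- enlarged `a'` satisfies `a w a' = a`, so `S a ⊆ S a'`, and `a' d ≠ 0` makes the inclusion
  -- strict.
  obtain ⟨I, ⟨a, ha, rfl⟩, hmax⟩ := set_has_maximal_iff_noetherian.2
    (inferInstance : IsNoetherian S S) ((fun a => Submodule.span S {a}) '' A) (hA.image _)
  obtain ⟨h1, h2⟩ := hmem a ha
  obtain ⟨w, hw, hw', haw⟩ : ∃ w, e * w = w ∧ w * e = w ∧ a * w * a = a := by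
    obtain ⟨w, hw⟩ := IsSemisimpleRing.exists_mul_mul_self a
    refine ⟨e * w * e, ?_, ?_, ?_⟩
    · simp only [← mul_assoc, he]
    · rw [mul_assoc, he]
    · calc a * (e * w * e) * a = (a * e) * w * (e * a) := by simp only [mul_assoc]
        _ = a := by rw [h1, h2, hw]
  have hinj : ∀ d, e * d = d → a * d = 0 → d = 0 := by
    intro d hd had
    by_contra hd0
    obtain ⟨a', ha', s, hs, hs0⟩ := step a ha w hw hw' haw d hd0 hd had
    refine hmax _ ⟨a', ha', rfl⟩ (lt_of_le_of_ne ?_ fun h => hs0 ?_)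
    · rw [Submodule.span_singleton_le_iff_mem]
      refine Submodule.mem_span_singleton.2 ⟨a * w, ?_⟩
      have h3 : a * w * e = a * w := by rw [mul_assoc, hw']
      rw [smul_eq_mul, hs, mul_add, haw, ← mul_assoc, mul_sub, h3, ← mul_assoc, haw, sub_self,
        zero_mul, add_zero]
    · have h3 : a' ∈ Submodule.span S {a} := by
        change Submodule.span S {a} = Submodule.span S {a'} at h
        rw [h]
        exact Submodule.mem_span_singleton_self a'
      obtain ⟨c, hc⟩ := Submodule.mem_span_singleton.1 h3
      have h4 : (e - a * w) * s * d = a' * d := by rw [hs, add_mul, had, zero_add]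
      rw [h4, ← hc, smul_eq_mul, mul_assoc, had, mul_zero]
  have hwa : w * a = e := by
    have := hinj (e - w * a) (by rw [mul_sub, he, ← mul_assoc, hw])
      (by rw [mul_sub, h2, ← mul_assoc, haw, sub_self])
    exact (sub_eq_zero.1 this).symm
  refine ⟨a, ha, w, hw, hw', ?_, hwa⟩
  -- Adding `1 - e` turns a one-sided inverse in the corner into one in the whole ring, where it is
  -- two-sided.
  have h3 : (w + (1 - e)) * (a + (1 - e)) = 1 := by
    have h5 : w * (1 - e) = 0 := by rw [mul_sub, mul_one, hw', sub_self]
    have h6 : (1 - e) * a = 0 := by rw [sub_mul, one_mul, h1, sub_self]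
    have h7 : (1 - e) * (1 - e) = 1 - e := by rw [mul_sub, mul_one, sub_mul, he, one_mul]; simp
    rw [add_mul, mul_add, mul_add, hwa, h5, h6, h7]
    abel
  have h4 := IsSemisimpleRing.mul_eq_one_symm h3
  have h6 : e * (1 - e) = 0 := by rw [mul_sub, mul_one, he, sub_self]
  have h7 : a * (1 - e) = 0 := by rw [mul_sub, mul_one, h2, sub_self]
  calc a * w = e * (a + (1 - e)) * (w + (1 - e)) := by
        rw [mul_add e, h1, h6, add_zero, mul_add, h7, add_zero]
    _ = e := by rw [mul_assoc, h4, mul_one]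

end

/-- Invertibility in a corner lifts modulo the Jacobson radical. -/
theorem exists_corner_inverse {R S : Type*} [NonUnitalRing R] [Ring S] {f : R →ₙ+* S}
    (hf : Function.Surjective f) (hJ : ∀ a, f a = 0 → a ∈ jacobsonRadical R) {e a : R}
    (he : e * e = e) (h1 : e * a = a) (h2 : a * e = a) {b : S} (hab : f a * b = f e)
    (hba : b * f a = f e) : ∃ c, e * c = c ∧ c * e = c ∧ a * c = e ∧ c * a = e := by
  obtain ⟨b, rfl⟩ := hf b
  -- An element `e - j` of the corner with `j` in the radical is invertible there: its inverse is `e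
  -- + y` for `y` the quasi-inverse of `-j`. It is applied below to `a b` and to `b a`, with `b` cut
  -- down to the corner.
  have hq : ∀ j, f j = 0 → e * j = j → j * e = j → ∃ y, e * y = y ∧ y * e = y ∧
      (e - j) * y = e ∧ y * (e - j) = e := by
    intro j hj h1 h2
    have h3 : IsQuasiregular (-j) := hJ (-j) (by rw [map_neg, hj, neg_zero]) _
      (TwoSidedIdeal.subset_span rfl)
    obtain ⟨y, h4, h5⟩ := isQuasiregular_iff.1 h3
    have h6 : y = j + j * y := by rw [← sub_eq_zero, ← h4, neg_mul]; abel
    have h7 : y = j + y * j := by rw [← sub_eq_zero, ← h5, mul_neg]; abel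
    have h8 : e * y = y := by rw [h6, mul_add, ← mul_assoc, h1]
    have h9 : y * e = y := by rw [h7, add_mul, mul_assoc, h2]
    refine ⟨e + y, by rw [mul_add, he, h8], by rw [add_mul, he, h9], ?_, ?_⟩
    · rw [sub_mul, mul_add, he, h8, mul_add, h2]
      nth_rw 1 [h6]
      abel
    · rw [mul_sub, add_mul, he, h9, add_mul, h1]
      nth_rw 1 [h7]
      abel
  obtain ⟨y, -, hy, h3, -⟩ := hq (e - a * (e * b * e))
    (by simp only [map_sub, map_mul]
        rw [← mul_assoc, ← mul_assoc, ← map_mul, h2, hab, ← map_mul, he, sub_self])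
    (by rw [mul_sub, he, ← mul_assoc e a, h1])
    (by rw [sub_mul, he, mul_assoc, mul_assoc (e * b), he])
  obtain ⟨y', hy', -, -, h4⟩ := hq (e - e * b * e * a)
    (by simp only [map_sub, map_mul]
        rw [mul_assoc _ (f e) (f a), ← map_mul f e a, h1, mul_assoc, hba, ← map_mul, he, sub_self])
    (by rw [mul_sub, he, ← mul_assoc e, ← mul_assoc e, ← mul_assoc e, he])
    (by rw [sub_mul, he, mul_assoc _ a e, h2])
  rw [sub_sub_cancel] at h3 h4
  have h5 : e * b * e * y = y' * (e * b * e) := by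
    calc e * b * e * y = (y' * (e * b * e * a)) * (e * b * e * y) := by
          rw [h4]; simp only [← mul_assoc, he]
      _ = y' * (e * b * e) * (a * (e * b * e) * y) := by simp only [mul_assoc]
      _ = y' * (e * b * e) := by rw [h3, mul_assoc, mul_assoc (e * b), he]
  refine ⟨e * b * e * y, ?_, ?_, ?_, ?_⟩
  · simp only [← mul_assoc, he]
  · rw [mul_assoc, hy]
  · rw [← mul_assoc, h3]
  · rw [h5, mul_assoc, h4]

/-- A set of elements of a corner of a semi-local ring contains an invertible element if, modulo
the radical, every non-invertible element can be enlarged within the set. -/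
theorem exists_corner_unit {R S : Type*} [NonUnitalRing R] [Ring S] [IsSemisimpleRing S]
    {f : R →ₙ+* S} (hf : Function.Surjective f) (hJ : ∀ a, f a = 0 → a ∈ jacobsonRadical R) {e : R}
    (he : e * e = e) {A : Set R} (hA : A.Nonempty) (hmem : ∀ a ∈ A, e * a = a ∧ a * e = a)
    (step : ∀ a ∈ A, ∀ w, e * w = w → w * e = w → ∀ d, f e * d = d → f a * d = 0 →
      f ((e - a * w) * a) = 0 → (∃ r, f ((e - a * w) * r) * d ≠ 0) →
      ∃ a' ∈ A, ∃ s, f a' = f a + f ((e - a * w) * s) ∧ f ((e - a * w) * s) * d ≠ 0) :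
    ∃ a ∈ A, ∃ b, e * b = b ∧ b * e = b ∧ a * b = e ∧ b * a = e := by
  obtain ⟨_, ⟨a, ha, rfl⟩, b, -, -, hab, hba⟩ := IsSemisimpleRing.exists_mul_eq (e := f e)
    (by rw [← map_mul, he]) (A := f '' A) (hA.image f)
    (by
      rintro _ ⟨a, ha, rfl⟩
      rw [← map_mul, ← map_mul, (hmem a ha).1, (hmem a ha).2]
      exact ⟨rfl, rfl⟩)
    (by
      rintro _ ⟨a, ha, rfl⟩ w' hw hw' haw d hd0 hd had
      obtain ⟨w, rfl⟩ := hf w'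
      have h1 : f (e * w * e) = f w := by rw [map_mul, map_mul, hw, hw']
      obtain ⟨s', hs⟩ := IsSemisimpleRing.exists_sub_mul_mul_ne_zero (w := f w)
        (by rw [← map_mul, (hmem a ha).1]) (by rw [← map_mul, (hmem a ha).2]) hd0 hd had
      obtain ⟨r, rfl⟩ := hf s'
      obtain ⟨a', ha', s, h2, h3⟩ := step a ha (e * w * e) (by simp only [← mul_assoc, he])
        (by rw [mul_assoc, he]) d hd had
        (by rw [sub_mul, map_sub, map_mul, map_mul, map_mul, h1, haw, ← map_mul, (hmem a ha).1, sub_self])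
        ⟨r, by rwa [map_mul, map_sub, map_mul, h1]⟩
      refine ⟨f a', ⟨a', ha', rfl⟩, f s, ?_, ?_⟩
      · rw [h2, map_mul, map_sub, map_mul, h1]
      · rwa [map_mul, map_sub, map_mul, h1] at h3)
  obtain ⟨c, h1, h2, h3, h4⟩ := exists_corner_inverse hf hJ he (hmem a ha).1 (hmem a ha).2 hab hba
  exact ⟨a, ha, c, h1, h2, h3, h4⟩

/-! ### Big cells over a semi-local ring -/

namespace OddFormRing

variable {R : Type u} {Δ : Type v} [NonUnitalRing R] [StarRing R] [AddGroup Δ]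

namespace OrthogonalHyperbolicFamily

open SignedIndex
open scoped commutatorElement

variable {O : OddFormRing R Δ} {n : ℕ} {F : O.OrthogonalHyperbolicFamily n}

/-! ### The big cell for ultrashort roots -/

theorem T_app_q_of_coarse {z i k : SignedIndex n} (hz : Apart z i) (hik : Apart i k)
    (hzk : Apart z k) {u : Δ} (hu : u ∈ F.coarse z i) : (F.T i u).app (F.q k) = F.q k := by
  apply T_app_of_mul (coarse_mem_unip hz hu)
  · rw [π_q, F.e_mul_e hik.1]
  · rw [π_q, ← star_star (F.e k), ← star_mul, F.star_e, hu.2 _ hzk.neg_right, star_zero]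

theorem app_q_act_e (g : O.Unitary) (i : SignedIndex n) :
    O.act (g.app (F.q i)) (F.e i) = g.app (F.q i) := by
  rw [← g.app_act, F.q_act_e]

theorem ρ_app_q (g : O.Unitary) (i : SignedIndex n) : O.ρ (g.app (F.q i)) = 0 := by
  rw [g.ρ_app, F.ρ_q]

/-- The effect of a lower transvection on the diagonal coefficient. This is how that coefficient can
be altered without leaving the coset of `g`. -/
theorem e_mul_π_app_T {z i : SignedIndex n} (hz : Apart z i) {t : Δ} (ht : t ∈ F.coarse z (-i))
    (g : O.Unitary) : F.e i * O.π ((F.T (-i) t * g).app (F.q i))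
      = F.e i * O.π (g.app (F.q i)) + (O.ρ t * O.π (g.app (F.q i))
        - star (O.π t) * O.π (g.app (F.q i))) := by
  have h1 := coarse_mem_unip hz.neg_right ht
  have h2 : F.e i * O.ρ t = O.ρ t := by
    have := HyperbolicPair.e'_mul_ρ h1
    rwa [e'_η, neg_neg] at this
  have h3 : F.e i * star (O.π t) = star (O.π t) := by
    have := HyperbolicPair.e'_mul_star_π h1
    rwa [e'_η, neg_neg] at this
  have h4 : F.e i * O.π t = 0 := ht.2 i hz
  have h5 : (F.T (-i) t).β = O.ρ t + O.π t - star (O.π t) := HyperbolicPair.tr_β h1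
  rw [Unitary.app_mul, Unitary.π_app, h5, mul_add, ← mul_assoc, mul_sub, mul_add, h2, h3, h4]
  noncomm_ring

/-- As `g` preserves the lines of all indices apart from `i` and `z`, the column `g.app (q j)` has
components only along the pairs of `i` and `z` and orthogonally to the family; removing the first
leaves a coarse parameter. -/
theorem res_app_q_mem {z i j : SignedIndex n} (hij : ¬ Apart i j) {g : O.Unitary}
    (hg : ∀ k, Apart i k → Apart z k → F.LeviAt g k) :
    F.res i (g.app (F.q j)) ∈ F.coarse z j ∧ O.π (F.res i (g.app (F.q j)))
      = O.π (g.app (F.q j)) - F.e i * O.π (g.app (F.q j)) - F.e (-i) * O.π (g.app (F.q j)) := by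
  have hπ : O.π (F.res i (g.app (F.q j)))
      = O.π (g.app (F.q j)) - F.e i * O.π (g.app (F.q j)) - F.e (-i) * O.π (g.app (F.q j)) := by
    rw [res, O.π_add, O.π_add, O.π_neg, O.π_neg, O.π_act, O.π_act, π_q, π_q, ← mul_assoc,
      ← mul_assoc, F.e_idem, F.e_idem]
    abel
  refine ⟨⟨?_, fun k hk => ?_⟩, hπ⟩
  · rw [res, O.add_act, O.add_act, O.neg_act, O.neg_act, app_q_act_e, ← O.act_mul, ← O.act_mul,
      mul_assoc, mul_assoc, ← O.π_act, app_q_act_e]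
  · rw [hπ, mul_sub, mul_sub, ← mul_assoc, ← mul_assoc]
    by_cases hik : Apart i k
    · rw [F.e_mul_e hik.symm.1, F.e_mul_e hik.symm.neg_right.1]
      have hjk : Apart j k := by
        rcases eq_or_eq_neg hij with rfl | rfl
        · exact hik
        · simpa using hik.neg_left
      rw [LeviAt.e_mul_π_app (hg _ hik.neg_right hk.neg_right)
        (by rw [π_q, F.e_mul_e hjk.symm.1])]
      simp
    · rcases eq_or_eq_neg hik with rfl | rfl
      · rw [F.e_idem, F.e_mul_e (ne_neg_self i)]; simp
      · rw [F.e_mul_e (ne_neg_self k), neg_neg, F.e_idem]; simp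

/-- The columns of elements of the unitary group can be enlarged by transvections modulo the
Jacobson radical. -/
theorem exists_coarse_enlarge {S : Type*} [Ring S] (f : R →ₙ+* S) {z i : SignedIndex n}
    (hz : Apart z i) {g : O.Unitary} (hg : ∀ k, Apart i k → Apart z k → F.LeviAt g k) {w : R}
    (hw : w ∈ F.ring i i) {d : S} (hd : f (F.e i) * d = d)
    (had : f (F.e i * O.π (g.app (F.q i))) * d = 0)
    (hr : ∃ r, f ((F.e i - F.e i * O.π (g.app (F.q i)) * w) * r) * d ≠ 0) :
    ∃ t ∈ F.coarse z (-i), ∃ s, F.e i * O.π ((F.T (-i) t * g).app (F.q i))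
      = F.e i * O.π (g.app (F.q i)) + (F.e i - F.e i * O.π (g.app (F.q i)) * w) * s ∧
      f ((F.e i - F.e i * O.π (g.app (F.q i)) * w) * s) * d ≠ 0 := by
  by_contra! hc
  obtain ⟨w1, m1⟩ := res_app_q_mem (F := F) (z := z) (j := i) (i := i) (fun h => h.1 rfl) hg
  obtain ⟨w2, m2⟩ := res_app_q_mem (F := F) (z := z) (j := -i) (i := i)
    (fun h => h.2 (neg_neg i).symm) hg
  have hxy := g.star_π_app_mul_π_app (F.q (-i)) (F.q i)
  rw [π_q, π_q, F.star_e, neg_neg, F.e_idem] at hxy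
  have hyy := O.ρ_add_star (g.app (F.q i))
  rw [ρ_app_q, star_zero, add_zero, zero_add] at hyy
  have hye : O.π (g.app (F.q i)) * F.e i = O.π (g.app (F.q i)) := by rw [← O.π_act, app_q_act_e]
  have hA := fun t (ht : t ∈ F.coarse z (-i)) => e_mul_π_app_T hz ht g
  generalize O.π (g.app (F.q i)) = y at *
  generalize O.π (g.app (F.q (-i))) = x at *
  generalize F.res i (g.app (F.q i)) = u1 at *
  generalize F.res i (g.app (F.q (-i))) = u2 at *
  set a := F.e i * y with ha
  have ha' : a ∈ F.ring i i := ⟨y, by rw [mul_assoc, hye]⟩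
  set P := F.e i - a * w with hP
  have hP' : P ∈ F.ring i i := sub_mem (e_mem i) (F.mul_mem ha' hw)
  have hPs := F.star_mem hP'
  -- Suppose no transvection enlarges the coefficient. The group `Z` of all `s` with `f(P s) d = 0`
  -- is then shown to contain `e_i r e_i`, against the choice of `r`.
  let Z : AddSubgroup R := (AddMonoidHom.mulRight d).comp (f.toAddMonoidHom.comp
    (AddMonoidHom.mulLeft P)) |>.ker
  have mZ : ∀ s, s ∈ Z ↔ f (P * s) * d = 0 := fun s => Iff.rfl
  -- The parameter `t·P̄` is tested in place of `t`: it changes the coefficient by a left multiple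
  -- of `P`, since `ρ(t·P̄) = P ρ(t) P̄`.
  have h1 : ∀ t ∈ F.coarse z (-i), O.ρ t * star P * y - star (O.π t) * y ∈ Z := by
    intro t ht
    refine hc _ (act_mem_coarse ht hPs) _ ?_
    rw [hA _ (act_mem_coarse ht hPs), O.ρ_act, O.π_act, star_star, star_mul, star_star]
    noncomm_ring
  have h2 : ∀ t ∈ F.coarse z (-i), ∀ t' ∈ F.coarse z (-i),
      star (O.π t) * O.π t' * (star P * y) ∈ Z := by
    intro t ht t' ht'
    have := sub_mem (sub_mem (h1 _ ht) (h1 _ (add_mem ht ht'))) (neg_mem (h1 _ ht'))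
    rw [O.ρ_add, O.π_add, star_add] at this
    convert this using 1
    noncomm_ring
  -- The spare pair `z` is used here: by Morita equivalence the products `star (π t) * π t'` with
  -- `t`, `t'` multiples of `q_{±z}` span `R_{i,-i}`, so the polarized statement `h2` covers all of
  -- it.
  have h3 : ∀ c ∈ F.ring i (-i), c * (star P * y) ∈ Z := by
    intro c hc'
    refine ring_induction z.idx (P := fun c => c * (star P * y) ∈ Z) ?_ ?_ ?_ hc'
    · rw [zero_mul]; exact zero_mem _
    · intro a b _ _ h1 h2
      rw [add_mul]; exact add_mem h1 h2
    · intro k b c hk hb hc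
      have hk' : k = z ∨ k = -z := eq_or_eq_neg fun h => apart_iff_idx.1 h hk
      have hq : ∀ {b}, b ∈ F.ring k (-i) → O.act (F.q k) b ∈ F.coarse z (-i) := by
        intro b hb
        rcases hk' with rfl | rfl
        · exact q_act_mem_coarse hb
        · exact q_neg_act_mem_coarse hb
      have hq' : ∀ {b}, b ∈ F.ring (-k) (-i) → O.act (F.q (-k)) b ∈ F.coarse z (-i) := by
        intro b hb
        rcases hk' with rfl | rfl
        · exact q_neg_act_mem_coarse hb
        · rw [neg_neg] at hb ⊢
          exact q_act_mem_coarse hb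
      have := h2 _ (hq' (F.star_mem hb)) _ (hq hc)
      rwa [π_q_act (F.star_mem hb), π_q_act hc, star_star] at this
  have h4 : ∀ t ∈ F.coarse z (-i), star (O.π t) * y ∈ Z := by
    intro t ht
    have hρ : O.ρ t ∈ F.ring i (-i) := by
      refine ⟨O.ρ t, ?_⟩
      have := congrArg O.ρ ht.1
      rwa [O.ρ_act, F.star_e, neg_neg, eq_comm] at this
    have := sub_mem (h3 _ hρ) (h1 t ht)
    convert this using 1
    noncomm_ring
  have h5 : ∀ c, c * a ∈ Z := by
    intro c
    rw [mZ, ← mul_assoc, map_mul, mul_assoc, had, mul_zero]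
  -- Since `ρ(g q_i) = 0`, the column is isotropic, `star y * y = 0`. This rewrites the extra term
  -- produced by `star P` through `a`, which kills `d`, and through the coarse component `u1`
  -- treated in `h4`.
  have h6 : ∀ c ∈ F.ring i (-i), c * (F.e (-i) * y) ∈ Z := by
    intro c hc
    have e1 : star P = F.e (-i) - star w * (star y * F.e (-i)) := by
      rw [hP, star_sub, star_mul, ha, star_mul, F.star_e]
    have e2 : star y * F.e (-i) * y = -(star y * a) - star (O.π u1) * y := by
      rw [m1, star_sub, star_sub, star_mul, star_mul, F.star_e, F.star_e, neg_neg, sub_mul,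
        sub_mul, hyy, ha]
      noncomm_ring
    have e3 : c * (F.e (-i) * y) = c * (star P * y)
        + (-(c * star w * star y * a) - star (O.π u1 * star (c * star w)) * y) := by
      calc c * (F.e (-i) * y) = c * (star P * y) + c * star w * (star y * F.e (-i) * y) := by
            rw [e1]; noncomm_ring
        _ = _ := by
            rw [e2, star_mul (O.π u1), star_star]; noncomm_ring
    have hcw := F.star_mem (F.mul_mem hc (F.star_mem hw))
    rw [neg_neg] at hcw
    rw [e3]
    refine add_mem (h3 c hc) (sub_mem (neg_mem (h5 _)) ?_)
    have := h4 _ (act_mem_coarse w1 hcw)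
    rwa [O.π_act] at this
  obtain ⟨r, hr⟩ := hr
  apply hr
  have hr' : F.e i * r * F.e i ∈ F.ring i i := ⟨r, rfl⟩
  have hx : star x = star (O.π u2) + star x * F.e i + star x * F.e (-i) := by
    rw [m2, star_sub, star_sub, star_mul, star_mul, F.star_e, F.star_e, neg_neg]
    abel
  -- The column is unimodular: `star x * y = e_i`. Splitting `x` along `e_i`, `e_{-i}` and the rest
  -- puts each summand of `e_i r e_i` into `Z`, by `h5`, `h6` and `h4` respectively.
  have e4 : F.e i * r * F.e i = F.e i * r * F.e i * star x * F.e (-i) * (F.e (-i) * y)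
      + (F.e i * r * F.e i * star x * a + star (O.π u2 * star (F.e i * r * F.e i)) * y) := by
    calc F.e i * r * F.e i = F.e i * r * F.e i * (star x * y) := by rw [hxy, mul_e hr']
      _ = F.e i * r * F.e i * ((star (O.π u2) + star x * F.e i
            + star x * (F.e (-i) * F.e (-i))) * y) := by rw [F.e_idem, ← hx]
      _ = _ := by rw [star_mul (O.π u2), star_star, ha]; noncomm_ring
  have e5 : f (P * r) * d = f (P * (F.e i * r * F.e i)) * d := by
    rw [← mul_assoc, ← mul_assoc, mul_e hP', map_mul _ _ (F.e i), mul_assoc, hd]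
  rw [e5, ← mZ, e4]
  refine add_mem (h6 _ ⟨F.e i * r * F.e i * star x, ?_⟩) (add_mem (h5 _) ?_)
  · simp only [← mul_assoc, F.e_idem]
  · have := h4 _ (act_mem_coarse w2 (F.star_mem hr'))
    rwa [O.π_act] at this

/-- An element with an invertible diagonal coefficient lies in the big cell. -/
theorem exists_big_cell_of_inverse {z i : SignedIndex n} (hz : Apart z i) {g : O.Unitary}
    (hg : ∀ k, Apart i k → Apart z k → F.LeviAt g k) {b : R} (hb : b ∈ F.ring i i)
    (h1 : F.e i * O.π (g.app (F.q i)) * b = F.e i)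
    (h2 : b * (F.e i * O.π (g.app (F.q i))) = F.e i) :
    ∃ u ∈ F.coarse z i, ∃ v ∈ F.coarse z (-i), ∃ l, (∀ k, Apart z k → F.LeviAt l k) ∧
      g = F.T i u * F.T (-i) v * l := by
  set y := O.π (g.app (F.q i)) with hy
  have hye : y * F.e i = y := by rw [hy, ← O.π_act, app_q_act_e]
  have ha : F.e i * y ∈ F.ring i i := ⟨y, by rw [mul_assoc, hye]⟩
  have hbs := F.star_mem hb
  have has := F.star_mem ha
  -- After normalization by `b`, the image of `q_i` is an isotropic vector with diagonal coefficient
  -- `e_i`, hence of the form `T_i(u) q_i`.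
  obtain ⟨u, hu, hu1, hu2⟩ := HyperbolicPair.exists_tr_app_q (η := F.η i)
    (x := O.act (g.app (F.q i)) b) (by rw [e_η, ← O.act_mul, mul_e hb])
    (by rw [e_η, O.π_act, ← mul_assoc, h1]) (by rw [O.ρ_act, ρ_app_q, mul_zero, zero_mul])
  have hperp : ∀ j, ¬ Apart i j → ∀ k, Apart i k → Apart z k →
      F.e k * O.π (g.app (F.q j)) = 0 := by
    intro j hij k hik hzk
    have hjk : Apart j k := by
      rcases eq_or_eq_neg hij with rfl | rfl
      · exact hik
      · simpa using hik.neg_left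
    exact LeviAt.e_mul_π_app (hg _ hik.neg_right hzk.neg_right)
      (by rw [π_q, F.e_mul_e hjk.symm.1])
  have mu : u ∈ F.coarse z i := by
    refine ⟨HyperbolicPair.act_e hu, fun k hk => ?_⟩
    by_cases hik : Apart i k
    · rw [hu2, e_η, e'_η, O.π_act, mul_sub, mul_sub, ← mul_assoc, hperp i (fun h => h.1 rfl) k hik hk,
        F.e_mul_e hik.symm.1, ← mul_assoc, F.e_mul_e hik.symm.neg_right.1]
      simp
    · rcases eq_or_eq_neg hik with rfl | rfl
      · exact HyperbolicPair.e_mul_π hu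
      · have := HyperbolicPair.e'_mul_π hu
        rwa [e'_η, neg_neg] at this
  rw [q_η] at hu1
  change (F.T i u).app (F.q i) = _ at hu1
  have hg1 : ((F.T i u)⁻¹ * g).app (F.q i) = O.act (F.q i) (F.e i * y) := by
    apply (F.T i u).app_injective
    rw [Unitary.app_mul, Unitary.app_app_inv, Unitary.app_act, hu1, ← O.act_mul, h2, app_q_act_e]
  have hL1 : ∀ k, Apart i k → Apart z k → F.LeviAt ((F.T i u)⁻¹ * g) k := fun k hik hzk =>
    (LeviAt.of_fix (T_app_q_of_coarse hz hik hzk mu)).inv.mul (hg k hik hzk)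
  set g1 := (F.T i u)⁻¹ * g with hg1'
  have hb1 : star b * star (F.e i * y) = F.e (-i) := by rw [← star_mul, h1, F.star_e]
  have hb2 : star (F.e i * y) * star b = F.e (-i) := by rw [← star_mul, h2, F.star_e]
  -- Once `g1` preserves the line of `q_i`, invariance of the pairing makes the opposite diagonal
  -- coefficient equal to `star b`, so the argument repeats with `-i`; the new transvection fixes
  -- `q_i`.
  have h3 := g1.star_π_app_mul_π_app (F.q i) (F.q (-i))
  rw [hg1, π_q_act ha, π_q, π_q, F.star_e, F.e_idem] at h3
  have hx2 : F.e (-i) * O.π (g1.app (F.q (-i))) = star b := by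
    rw [← hb1, mul_assoc, h3, mul_e hbs]
  obtain ⟨v, hv, hv1, hv2⟩ := HyperbolicPair.exists_tr_app_q (η := F.η (-i))
    (x := O.act (g1.app (F.q (-i))) (star (F.e i * y)))
    (by rw [e_η, ← O.act_mul, mul_e has])
    (by rw [e_η, O.π_act, ← mul_assoc, hx2, hb1])
    (by rw [O.ρ_act, ρ_app_q, mul_zero, zero_mul])
  have hperp' : ∀ k, Apart i k → Apart z k → F.e k * O.π (g1.app (F.q (-i))) = 0 := by
    intro k hik hzk
    exact LeviAt.e_mul_π_app (hL1 _ hik.neg_right hzk.neg_right)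
      (by rw [π_q, F.e_mul_e hik.neg_left.symm.1])
  have mv : v ∈ F.coarse z (-i) := by
    refine ⟨HyperbolicPair.act_e hv, fun k hk => ?_⟩
    by_cases hik : Apart i k
    · rw [hv2, e_η, e'_η, O.π_act, mul_sub, mul_sub, ← mul_assoc, hperp' k hik hk,
        F.e_mul_e hik.neg_left.symm.1, ← mul_assoc, neg_neg, F.e_mul_e hik.symm.1]
      simp
    · rcases eq_or_eq_neg hik with rfl | rfl
      · have := HyperbolicPair.e'_mul_π hv
        rwa [e'_η, neg_neg] at this
      · have := HyperbolicPair.e_mul_π hv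
        rwa [e_η, neg_neg] at this
  rw [q_η] at hv1
  change (F.T (-i) v).app (F.q (-i)) = _ at hv1
  refine ⟨u, mu, v, mv, (F.T (-i) v)⁻¹ * g1, fun k hk => ?_, by rw [hg1']; group⟩
  by_cases hik : Apart i k
  · exact (LeviAt.of_fix (T_app_q_of_coarse hz.neg_right hik.neg_left hk mv)).inv.mul (hL1 k hik hk)
  · have h4 := T_app_q_neg hv
    rw [neg_neg] at h4
    rcases eq_or_eq_neg hik with rfl | hik
    · exact (LeviAt.of_fix h4).inv.mul ⟨_, ha, _, hb, h1, h2, hg1⟩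
    · obtain rfl : k = -i := by rw [hik, neg_neg]
      refine ⟨star b, hbs, _, has, hb1, hb2, ?_⟩
      apply (F.T (-i) v).app_injective
      rw [Unitary.app_mul, Unitary.app_app_inv, Unitary.app_act, hv1, ← O.act_mul, hb2, app_q_act_e]

/-- Over a semi-local ring a transvection moves every element into the big cell. -/
theorem exists_big_cell {S : Type*} [Ring S] [IsSemisimpleRing S] {f : R →ₙ+* S}
    (hf : Function.Surjective f) (hJ : ∀ a, f a = 0 → a ∈ jacobsonRadical R) {z i : SignedIndex n}
    (hz : Apart z i) {g : O.Unitary} (hg : ∀ k, Apart i k → Apart z k → F.LeviAt g k) :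
    ∃ t ∈ F.coarse z (-i), ∃ u ∈ F.coarse z i, ∃ v ∈ F.coarse z (-i), ∃ l,
      (∀ k, Apart z k → F.LeviAt l k) ∧ F.T (-i) t * g = F.T i u * F.T (-i) v * l := by
  have hL : ∀ t ∈ F.coarse z (-i), ∀ k, Apart i k → Apart z k → F.LeviAt (F.T (-i) t * g) k :=
    fun t ht k hik hzk =>
      (LeviAt.of_fix (T_app_q_of_coarse hz.neg_right hik.neg_left hzk ht)).mul (hg k hik hzk)
  -- The set considered consists of the diagonal coefficients of all `T_{-i}(t) g`. It is closed
  -- under the enlargement step because transvections multiply by adding parameters.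
  obtain ⟨_, ⟨t, ht, rfl⟩, b, hb1, hb2, h1, h2⟩ := exists_corner_unit hf hJ (F.e_idem i)
    (A := {a | ∃ t ∈ F.coarse z (-i), a = F.e i * O.π ((F.T (-i) t * g).app (F.q i))})
    ⟨_, 0, zero_mem _, rfl⟩
    (by
      rintro _ ⟨t, -, rfl⟩
      rw [← mul_assoc, F.e_idem, mul_assoc, ← O.π_act, app_q_act_e]
      exact ⟨rfl, rfl⟩)
    (by
      rintro _ ⟨t, ht, rfl⟩ w hw hw' d hd had - hr
      obtain ⟨t', ht', s, h1, h2⟩ := exists_coarse_enlarge f hz (hL t ht) (F.mem_ring.2 ⟨hw, hw'⟩)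
        hd had hr
      refine ⟨_, ⟨t' + t, add_mem ht' ht, rfl⟩, s, ?_, h2⟩
      rw [T_add (coarse_mem_unip hz.neg_right ht') (coarse_mem_unip hz.neg_right ht), mul_assoc, h1,
        map_add])
  obtain ⟨u, hu, v, hv, l, hl, h⟩ := exists_big_cell_of_inverse hz (hL t ht)
    (F.mem_ring.2 ⟨hb1, hb2⟩) h1 h2
  exact ⟨t, ht, u, hu, v, hv, l, hl, h⟩

end OrthogonalHyperbolicFamily

end OddFormRing

namespace OddFormRing

variable {R : Type u} {Δ : Type v} [NonUnitalRing R] [StarRing R] [AddGroup Δ]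

namespace OrthogonalHyperbolicFamily

open SignedIndex
open scoped commutatorElement

variable {O : OddFormRing R Δ} {n : ℕ} {F : O.OrthogonalHyperbolicFamily n}

/-! ### The big cell for short roots -/

variable (F) in
/-- The `R`-submodule generated by `q_i` and `q_j`. -/
def qSpan (i j : SignedIndex n) : Set Δ :=
  {u | u = O.act (F.q i) (F.e i * O.π u) + O.act (F.q j) (F.e j * O.π u)}

theorem q_act_comm {i j : SignedIndex n} (hij : Apart i j) (a b : R) :
    O.act (F.q i) a + O.act (F.q j) b = O.act (F.q j) b + O.act (F.q i) a := by
  apply O.add_comm_of_star_π_mul_π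
  rw [O.π_act, O.π_act, π_q, π_q, star_mul, F.star_e, mul_assoc, ← mul_assoc (F.e (-i)),
    F.e_mul_e hij.neg_left.1]
  simp

theorem act_q_mul (i : SignedIndex n) (a : R) : O.act (F.q i) (F.e i * a) = O.act (F.q i) a := by
  rw [O.act_mul, q_act_e]

theorem mem_qSpan {i j : SignedIndex n} (hij : Apart i j) {u : Δ} (a b : R)
    (h : u = O.act (F.q i) a + O.act (F.q j) b) : u ∈ F.qSpan i j := by
  have h1 : F.e i * O.π u = F.e i * a := by
    rw [h, O.π_add, O.π_act, O.π_act, π_q, π_q, mul_add, ← mul_assoc, ← mul_assoc, F.e_idem,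
      F.e_mul_e hij.1, zero_mul, add_zero]
  have h2 : F.e j * O.π u = F.e j * b := by
    rw [h, O.π_add, O.π_act, O.π_act, π_q, π_q, mul_add, ← mul_assoc, ← mul_assoc, F.e_idem,
      F.e_mul_e hij.symm.1, zero_mul, zero_add]
  change u = _
  rw [h1, h2, act_q_mul, act_q_mul, h]

theorem qSpan_comm {i j : SignedIndex n} (hij : Apart i j) : F.qSpan i j = F.qSpan j i := by
  ext u
  change _ = _ ↔ _ = _
  rw [q_act_comm hij]

theorem app_of_mem_qSpan {i j : SignedIndex n} {u : Δ} (hu : u ∈ F.qSpan i j) (h : O.Unitary) :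
    h.app u = O.act (h.app (F.q i)) (F.e i * O.π u) + O.act (h.app (F.q j)) (F.e j * O.π u) := by
  conv_lhs => rw [show u = _ from hu]
  rw [h.app_add, h.app_act, h.app_act]

theorem π_app_of_mem_qSpan {i j : SignedIndex n} {u : Δ} (hu : u ∈ F.qSpan i j) (h : O.Unitary) :
    O.π (h.app u) = O.π (h.app (F.q i)) * (F.e i * O.π u)
      + O.π (h.app (F.q j)) * (F.e j * O.π u) := by
  rw [app_of_mem_qSpan hu, O.π_add, O.π_act, O.π_act]

theorem q_mem_qSpan {i j : SignedIndex n} (hij : Apart i j) : F.q i ∈ F.qSpan i j :=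
  mem_qSpan hij (F.e i) 0 (by rw [q_act_e, O.act_zero, add_zero])

theorem q_mem_qSpan' {i j : SignedIndex n} (hij : Apart i j) : F.q j ∈ F.qSpan i j :=
  mem_qSpan hij 0 (F.e j) (by rw [q_act_e, O.act_zero, zero_add])

theorem t2_app_q_right {i j : SignedIndex n} (h : Apart i j) {a : R} (ha : a ∈ F.ring i j) :
    (F.t2 i j a).app (F.q j) = O.act (F.q i) a + F.q j := by
  have := HyperbolicPair.tr_app_q (η := F.η j) (q_act_unip h ha)
  rw [ρ_q_act, O.act_zero, O.φ_zero, neg_zero, add_zero, add_zero] at this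
  exact this

variable (F) in
/-- The stabilizer of the submodule generated by `q_i` and `q_j`. -/
def qStab (i j : SignedIndex n) : Subgroup O.Unitary where
  carrier := {g | ∀ u, g.app u ∈ F.qSpan i j ↔ u ∈ F.qSpan i j}
  one_mem' := fun u => by rw [Unitary.app_one]
  mul_mem' := fun {g h} hg hh u => by rw [Unitary.app_mul, hg, hh]
  inv_mem' := fun {g} hg u => by rw [← hg, Unitary.app_app_inv]

theorem qStab_comm {i j : SignedIndex n} (hij : Apart i j) : F.qStab i j = F.qStab j i := by
  ext g
  change (∀ u, _) ↔ (∀ u, _)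
  rw [qSpan_comm hij]

theorem t2_mem_qStab {i j : SignedIndex n} (h : Apart i j) {a : R} (ha : a ∈ F.ring i j) :
    F.t2 i j a ∈ F.qStab i j := by
  have key : ∀ a ∈ F.ring i j, ∀ u ∈ F.qSpan i j, (F.t2 i j a).app u ∈ F.qSpan i j := by
    intro a ha u hu
    rw [app_of_mem_qSpan hu, t2_app_q h ha h.symm.1 (neg_ne_self i), t2_app_q_right h ha, O.add_act,
      ← O.act_mul, ← add_assoc, ← O.act_add_of_ρ_eq_zero (F.ρ_q i)]
    exact mem_qSpan h _ _ rfl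
  intro u
  refine ⟨fun hu => ?_, key a ha u⟩
  have h1 := key (-a) (neg_mem ha) _ hu
  have h2 : F.t2 i j (-a) = (F.t2 i j a)⁻¹ := by
    rw [t2, O.act_neg_of_ρ_eq_zero (F.ρ_q i), T_neg (q_act_unip h ha), t2]
  rwa [h2, Unitary.app_inv_app] at h1

theorem t2_swap {i j : SignedIndex n} (h : Apart i j) {a : R} (ha : a ∈ F.ring i j) :
    F.t2 i j a = F.t2 (-j) (-i) (-star a) := F.rels_T.r0 h ha

variable (F) in
/-- The elements preserving the submodules generated by `q_{±i}` and `q_{±j}` and fixing all other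
`q_k`. -/
def qLinear (i j : SignedIndex n) : Subgroup O.Unitary :=
  F.qStab i j ⊓ F.qStab (-i) (-j) ⊓
    { carrier := {g | ∀ k, Apart i k → Apart j k → g.app (F.q k) = F.q k}
      one_mem' := fun k _ _ => Unitary.app_one _
      mul_mem' := fun {g h} hg hh k h1 h2 => by rw [Unitary.app_mul, hh k h1 h2, hg k h1 h2]
      inv_mem' := fun {g} hg k h1 h2 => by
        apply g.app_injective
        rw [Unitary.app_app_inv, hg k h1 h2] }

theorem qLinear_comm {i j : SignedIndex n} (hij : Apart i j) : F.qLinear i j = F.qLinear j i := by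
  ext g
  rw [qLinear, qLinear, qStab_comm hij, qStab_comm hij.neg_neg]
  exact and_congr_right fun _ => forall_congr' fun k =>
    ⟨fun h h1 h2 => h h2 h1, fun h h1 h2 => h h2 h1⟩

theorem t2_mem_qLinear {i j : SignedIndex n} (h : Apart i j) {a : R} (ha : a ∈ F.ring i j) :
    F.t2 i j a ∈ F.qLinear i j := by
  refine ⟨⟨t2_mem_qStab h ha, ?_⟩, fun k hik hjk => ?_⟩
  · rw [SetLike.mem_coe, t2_swap h ha, qStab_comm h.neg_neg]
    exact t2_mem_qStab h.swap (neg_mem (F.star_mem ha))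
  · exact t2_app_q h ha hjk.1 hik.neg_left.1

theorem t2_mem_qLinear' {i j : SignedIndex n} (h : Apart i j) {a : R} (ha : a ∈ F.ring j i) :
    F.t2 j i a ∈ F.qLinear i j := by
  rw [qLinear_comm h]
  exact t2_mem_qLinear h.symm ha

theorem coeff_mem {i j : SignedIndex n} (g : O.Unitary) :
    F.e i * O.π (g.app (F.q j)) ∈ F.ring i j :=
  ⟨O.π (g.app (F.q j)), by rw [mul_assoc, ← O.π_act, app_q_act_e]⟩

/-- Invertibility of the coefficient is automatic: the pairing with `q_{-k}` is preserved, and the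
line of `q_{-k}` already has an invertible coefficient. -/
theorem LeviAt.of_neg {g : O.Unitary} {k : SignedIndex n} (h : F.LeviAt g (-k)) {r : R}
    (hr : r ∈ F.ring k k) (hk : g.app (F.q k) = O.act (F.q k) r) : F.LeviAt g k := by
  obtain ⟨a, ha, b, hb, h1, h2, h3⟩ := h
  have h4 := g.star_π_app_mul_π_app (F.q (-k)) (F.q k)
  rw [h3, hk, π_q_act ha, π_q_act hr, π_q, π_q, F.star_e, neg_neg, F.e_idem] at h4
  have has := F.star_mem ha
  have hbs := F.star_mem hb
  rw [neg_neg] at has hbs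
  have h5 : star b * star a = F.e k := by rw [← star_mul, h1, F.star_e, neg_neg]
  have h6 : star a * star b = F.e k := by rw [← star_mul, h2, F.star_e, neg_neg]
  have h7 : r = star b := by rw [← e_mul hr, ← h5, mul_assoc, h4, mul_e hbs]
  exact ⟨_, hr, _, has, by rw [h7, h5], h4, hk⟩

/-- On the span of `q_i`, `q_j` the element `g` is triangular, since it preserves the line of `q_j`;
so the diagonal coefficients at `i` multiply. -/
theorem coeff_mul_inv {i j : SignedIndex n} (hij : Apart i j) {g : O.Unitary}
    (hg : g ∈ F.qStab i j) (hj : F.LeviAt g j) :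
    F.e i * O.π (g.app (F.q i)) * (F.e i * O.π (g⁻¹.app (F.q i))) = F.e i := by
  obtain ⟨a, ha, b, hb, h1, h2, h3⟩ := hj
  have h4 := π_app_of_mem_qSpan ((inv_mem hg (F.q i)).2 (q_mem_qSpan hij)) g
  rw [Unitary.app_app_inv, h3, π_q_act ha, π_q] at h4
  have h5 := congrArg (F.e i * ·) h4
  simp only [mul_add, ← mul_assoc] at h5
  rw [e_mul_eq_zero ha hij.1, F.e_idem, zero_mul, zero_mul, add_zero] at h5
  rw [← mul_assoc, ← h5]

/-- An element of the short linear group with an invertible coefficient lies in the big cell. -/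
theorem exists_short_cell_of_inverse {i j : SignedIndex n} (hij : Apart i j) {g : O.Unitary}
    (hg : g ∈ F.qLinear i j) {b : R} (hb : b ∈ F.ring j j)
    (h1 : F.e j * O.π (g.app (F.q j)) * b = F.e j)
    (h2 : b * (F.e j * O.π (g.app (F.q j))) = F.e j) :
    ∃ x ∈ F.ring i j, ∃ y ∈ F.ring j i, ∃ l ∈ F.levi, g = F.t2 i j x * F.t2 j i y * l := by
  have hx := F.mul_mem (coeff_mem (F := F) (i := i) (j := j) g) hb
  have hm1 := MulMemClass.mul_mem (inv_mem (t2_mem_qLinear hij hx)) hg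
  -- The first factor `T_{ij}(x)` clears the `i`-component of `g q_j`; the next one, `T_{ji}(y)`,
  -- clears the `j`-component of `g1 q_i`.
  have hg1 : ((F.t2 i j (F.e i * O.π (g.app (F.q j)) * b))⁻¹ * g).app (F.q j)
      = O.act (F.q j) (F.e j * O.π (g.app (F.q j))) := by
    apply (F.t2 i j (F.e i * O.π (g.app (F.q j)) * b)).app_injective
    rw [Unitary.app_mul, Unitary.app_app_inv, Unitary.app_act, t2_app_q_right hij hx, O.add_act,
      ← O.act_mul, mul_assoc, h2, mul_assoc, ← O.π_act, app_q_act_e]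
    exact (hg.1.1 _).2 (q_mem_qSpan' hij)
  generalize hg1' : (F.t2 i j (F.e i * O.π (g.app (F.q j)) * b))⁻¹ * g = g1 at *
  have hl1 : F.LeviAt g1 j := ⟨_, coeff_mem g, b, hb, h1, h2, hg1⟩
  have h3 := coeff_mul_inv hij hm1.1.1 hl1
  have h4 := coeff_mul_inv hij (inv_mem hm1.1.1) hl1.inv
  rw [inv_inv] at h4
  set z := F.e i * O.π (g1.app (F.q i)) with hz
  set z' := F.e i * O.π (g1⁻¹.app (F.q i)) with hz'
  have mz : z ∈ F.ring i i := coeff_mem g1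
  have mz' : z' ∈ F.ring i i := coeff_mem g1⁻¹
  have hy := F.mul_mem (coeff_mem (F := F) (i := j) (j := i) g1) mz'
  have hm2 := MulMemClass.mul_mem (inv_mem (t2_mem_qLinear' hij hy)) hm1
  refine ⟨_, hx, _, hy, (F.t2 j i (F.e j * O.π (g1.app (F.q i)) * z'))⁻¹ * g1, ?_,
    by rw [← hg1']; group⟩
  have hli : F.LeviAt ((F.t2 j i (F.e j * O.π (g1.app (F.q i)) * z'))⁻¹ * g1) i := by
    refine ⟨z, mz, z', mz', h3, h4, ?_⟩
    apply (F.t2 j i (F.e j * O.π (g1.app (F.q i)) * z')).app_injective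
    rw [Unitary.app_mul, Unitary.app_app_inv, Unitary.app_act, t2_app_q_right hij.symm hy, O.add_act,
      ← O.act_mul, mul_assoc, h4, mul_assoc, ← O.π_act, app_q_act_e, q_act_comm hij.symm]
    exact (hm1.1.1 _).2 (q_mem_qSpan hij)
  have hlj : F.LeviAt ((F.t2 j i (F.e j * O.π (g1.app (F.q i)) * z'))⁻¹ * g1) j :=
    (LeviAt.of_fix (t2_app_q hij.symm hy hij.1 (neg_ne_self j))).inv.mul hl1
  generalize (F.t2 j i (F.e j * O.π (g1.app (F.q i)) * z'))⁻¹ * g1 = l at *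
  -- The image of `q_{-i}` is in the span of `q_{-i}`, `q_{-j}`, and its `-j`-component vanishes by
  -- orthogonality to the preserved line of `q_j`.
  have hni : F.LeviAt l (-i) := by
    refine LeviAt.of_neg (by rwa [neg_neg]) (coeff_mem l) ?_
    have h5 := (hm2.1.2 _).2 (q_mem_qSpan hij.neg_neg)
    have h6 : F.e (-j) * O.π (l.app (F.q (-i))) = 0 :=
      LeviAt.e_mul_π_app (by rwa [neg_neg]) (by rw [π_q, F.e_mul_e hij.symm.neg_neg.1])
    conv_lhs => rw [show l.app (F.q (-i)) = _ from h5]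
    rw [h6, O.act_zero, add_zero]
  have hnj : F.LeviAt l (-j) := by
    refine LeviAt.of_neg (by rwa [neg_neg]) (coeff_mem l) ?_
    have h5 := (hm2.1.2 _).2 (q_mem_qSpan' hij.neg_neg)
    have h6 : F.e (-i) * O.π (l.app (F.q (-j))) = 0 :=
      LeviAt.e_mul_π_app (by rwa [neg_neg]) (by rw [π_q, F.e_mul_e hij.neg_neg.1])
    conv_lhs => rw [show l.app (F.q (-j)) = _ from h5]
    rw [h6, O.act_zero, zero_add]
  intro k
  by_cases hik : Apart i k
  · by_cases hjk : Apart j k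
    · exact LeviAt.of_fix (hm2.2 k hik hjk)
    · rcases eq_or_eq_neg hjk with rfl | rfl
      · exact hlj
      · rwa [neg_neg] at hnj
  · rcases eq_or_eq_neg hik with rfl | rfl
    · exact hli
    · rwa [neg_neg] at hni

/-- Over a semi-local ring an elementary transvection moves every element of the short linear group
into the big cell. -/
theorem exists_short_cell {S : Type*} [Ring S] [IsSemisimpleRing S] {f : R →ₙ+* S}
    (hf : Function.Surjective f) (hJ : ∀ a, f a = 0 → a ∈ jacobsonRadical R) {i j : SignedIndex n}
    (hij : Apart i j) {g : O.Unitary} (hg : g ∈ F.qLinear i j) :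
    ∃ d ∈ F.ring j i, ∃ x ∈ F.ring i j, ∃ y ∈ F.ring j i, ∃ l ∈ F.levi,
      F.t2 j i d * g = F.t2 i j x * F.t2 j i y * l := by
  have hspan := (hg.1.1 _).2 (q_mem_qSpan' hij)
  have hA : ∀ d ∈ F.ring j i, F.e j * O.π ((F.t2 j i d * g).app (F.q j))
      = F.e j * O.π (g.app (F.q j)) + d * (F.e i * O.π (g.app (F.q j))) := by
    intro d hd
    rw [Unitary.app_mul, π_app_of_mem_qSpan hspan, t2_app_q hij.symm hd hij.1 (neg_ne_self j),
      t2_app_q_right hij.symm hd, O.π_add, π_q_act hd, π_q, π_q, mul_add, ← mul_assoc, mul_add,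
      e_mul hd, F.e_mul_e hij.symm.1, add_zero, ← mul_assoc (F.e j), F.e_idem, ← mul_assoc (F.e j),
      F.e_idem, add_comm]
  -- Unimodularity of the column `(y_i, y_j)`: it is multiplied to `e_j` by a row of `g⁻¹`.
  have huni : F.e j * O.π (g⁻¹.app (F.q i)) * (F.e i * O.π (g.app (F.q j)))
      + F.e j * O.π (g⁻¹.app (F.q j)) * (F.e j * O.π (g.app (F.q j))) = F.e j := by
    rw [mul_assoc, mul_assoc, ← mul_add, ← π_app_of_mem_qSpan hspan, Unitary.app_inv_app, π_q,
      F.e_idem]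
  have my := fun k => coeff_mem (F := F) (i := k) (j := j) g
  obtain ⟨_, ⟨d, hd, rfl⟩, b, hb1, hb2, h1, h2⟩ := exists_corner_unit hf hJ (F.e_idem j)
    (A := {a | ∃ d ∈ F.ring j i, a = F.e j * O.π ((F.t2 j i d * g).app (F.q j))})
    ⟨_, 0, zero_mem _, rfl⟩
    (by
      rintro _ ⟨t, -, rfl⟩
      rw [← mul_assoc, F.e_idem, mul_assoc, ← O.π_act, app_q_act_e]
      exact ⟨rfl, rfl⟩)
    (by
      rintro _ ⟨d, hd, rfl⟩ w hw hw' δ hδ had - ⟨r, hr⟩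
      have hc := coeff_mem (F := F) (i := j) (j := j) (F.t2 j i d * g)
      rw [hA d hd] at *
      have hP := sub_mem (e_mem j) (F.mul_mem hc (F.mem_ring.2 ⟨hw, hw'⟩))
      have hxi := coeff_mem (F := F) (i := j) (j := i) g⁻¹
      have hxj := coeff_mem (F := F) (i := j) (j := j) g⁻¹
      generalize F.e j * O.π (g⁻¹.app (F.q i)) = xi at *
      generalize F.e j * O.π (g⁻¹.app (F.q j)) = xj at *
      have my1 := my i
      have my2 := my j
      generalize F.e i * O.π (g.app (F.q j)) = yi at *
      generalize F.e j * O.π (g.app (F.q j)) = yj at *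
      set P := F.e j - (yj + d * yi) * w with hPd
      have hr' : F.e j * r * F.e j ∈ F.ring j j := ⟨r, rfl⟩
      -- The increment of `d` comes from `x_i y_i + x_j y_j = e_j`, rewritten as `(x_i - x_j d) y_i
      -- + x_j (y_j + d y_i) = e_j`. The second summand kills `δ`, so the first one carries the
      -- non-vanishing of `f(P r) δ`.
      have hs : F.e j * r * F.e j * (xi - xj * d) ∈ F.ring j i :=
        F.mul_mem hr' (sub_mem hxi (F.mul_mem hxj hd))
      refine ⟨_, ⟨d + P * (F.e j * r * F.e j * (xi - xj * d)), add_mem hd (F.mul_mem hP hs), rfl⟩,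
        F.e j * r * F.e j * (xi - xj * d) * yi, ?_, ?_⟩
      · rw [hA _ (add_mem hd (F.mul_mem hP hs)), ← map_add]
        congr 1
        noncomm_ring
      · have e1 : P * r * F.e j = P * (F.e j * r * F.e j * (xi - xj * d) * yi)
            + P * (F.e j * r * F.e j) * xj * (yj + d * yi) := by
          calc P * r * F.e j = P * (F.e j * r * F.e j) * (xi * yi + xj * yj) := by
                rw [huni, mul_assoc P (F.e j * r * F.e j), mul_e hr', ← mul_assoc P (F.e j * r),
                  ← mul_assoc P (F.e j), mul_e hP]
            _ = _ := by noncomm_ring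
        have e2 : f (P * r) * δ = f (P * (F.e j * r * F.e j * (xi - xj * d) * yi)) * δ := by
          calc f (P * r) * δ = f (P * r * F.e j) * δ := by rw [map_mul _ _ (F.e j), mul_assoc, hδ]
            _ = _ := by
              rw [e1, map_add, add_mul, map_mul _ (P * (F.e j * r * F.e j) * xj),
                mul_assoc (f _) (f _) δ, had, mul_zero, add_zero]
        rwa [← e2])
  obtain ⟨x, hx, y, hy, l, hl, h⟩ := exists_short_cell_of_inverse hij
    (MulMemClass.mul_mem (t2_mem_qLinear' hij hd) hg) (F.mem_ring.2 ⟨hb1, hb2⟩) h1 h2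
  exact ⟨d, hd, x, hx, y, hy, l, hl, h⟩

end OrthogonalHyperbolicFamily

end OddFormRing

/-! ### Gauss decomposition in rank two -/

/-- The exchange step in the Gauss decomposition. -/
theorem Subgroup.exists_mul_exchange {G : Type*} [Group G] {A B M M' H : Subgroup G}
    (hAM : A ≤ Subgroup.normalizer (M : Set G))
    (hAM' : A ≤ Subgroup.normalizer (M' : Set G)) (hBM' : B ≤ Subgroup.normalizer (M' : Set G))
    (hHM : H ≤ Subgroup.normalizer (M : Set G)) (hHM' : H ≤ Subgroup.normalizer (M' : Set G))
    (hAB : ∀ a ∈ A, ∀ b ∈ B, ∀ c ∈ A, ∃ a' ∈ B, ∃ b' ∈ A, ∃ c' ∈ B, ∃ h ∈ H,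
      a * b * c = a' * b' * c' * h)
    {x y z h : G} (hx : x ∈ A ⊔ M) (hy : y ∈ B ⊔ M') (hz : z ∈ A ⊔ M) (hh : h ∈ H) :
    ∃ x' ∈ B ⊔ M, ∃ y' ∈ A ⊔ M', ∃ z' ∈ B ⊔ M, ∃ h' ∈ H, x * y * z * h = x' * y' * z' * h' := by
  have key : ∀ {C N : Subgroup G} {c n : G}, C ≤ Subgroup.normalizer (N : Set G) → c ∈ C → n ∈ N →
      c * n * c⁻¹ ∈ N ∧ c⁻¹ * n * c ∈ N := fun hC hc hn =>
    ⟨conj_mem_of_le_normalizer hC hc hn, by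
      have := conj_mem_of_le_normalizer hC (inv_mem hc) hn
      rwa [inv_inv] at this⟩
  obtain ⟨a, ha, m, hm, rfl⟩ := exists_mul_of_mem_sup hAM hx
  obtain ⟨b, hb, n, hn, rfl⟩ := exists_mul_of_mem_sup hBM' hy
  obtain ⟨c, hc, p, hp, rfl⟩ := exists_mul_of_mem_sup hAM hz
  -- Only `a b c` is exchanged. The radical part `m` is moved to the left past `a`; the part `n`
  -- travels right past `c`, then past `k` and back past `c'` to join `b'`; the part `p` is moved
  -- past `k`.
  obtain ⟨a', ha', b', hb', c', hc', k, hk, e⟩ := hAB a ha b hb c hc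
  have m1 := (key hAM ha hm).1
  have n1 := (key hAM' hc hn).2
  have n2 := (key hHM' hk n1).1
  have n3 := (key hBM' hc' n2).1
  have p1 := (key hHM hk hp).1
  refine ⟨(a * m * a⁻¹) * a', mul_mem (le_sup_right (a := B) m1) (le_sup_left (b := M) ha'),
    b' * (c' * (k * (c⁻¹ * n * c) * k⁻¹) * c'⁻¹),
    mul_mem (le_sup_left (b := M') hb') (le_sup_right (a := A) n3),
    c' * (k * p * k⁻¹), mul_mem (le_sup_left (b := M) hc') (le_sup_right (a := B) p1), k * h,
    mul_mem hk hh, ?_⟩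
  have e' : a' * b' * c' = a * b * c * k⁻¹ := by rw [e]; group
  calc a * m * (b * n) * (c * p) * h
      = (a * m * a⁻¹) * (a * b * c * k⁻¹) * k * (c⁻¹ * n * c) * p * h := by group
    _ = _ := by rw [← e']; group

namespace OddFormRing

variable {R : Type u} {Δ : Type v} [NonUnitalRing R] [StarRing R] [AddGroup Δ]

namespace OrthogonalHyperbolicFamily

open SignedIndex
open scoped commutatorElement

variable {O : OddFormRing R Δ} {n : ℕ} {F : O.OrthogonalHyperbolicFamily n}

/-! ### Maximal unipotent subgroups in rank two -/

variable (F) in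
/-- The group generated by `X_i`, `X_j`, and `X_{-i,j}`. -/
def shortRadical (i j : SignedIndex n) : Subgroup F.StU :=
  F.root1 i ⊔ F.root1 j ⊔ F.root2 (-i) j

theorem shortRadical_comm (i j : SignedIndex n) : F.shortRadical i j = F.shortRadical j i := by
  rw [shortRadical, shortRadical, root2_swap (-i) j, neg_neg, sup_comm (F.root1 i)]

variable (F) in
/-- The group generated by `X_i`, `X_j`, `X_{ij}`, and `X_{-i,j}`. -/
def borel (i j : SignedIndex n) : Subgroup F.StU :=
  F.root2 i j ⊔ F.shortRadical i j

/-- The same Borel subgroup seen from its two simple roots: the short root `ij` with radical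
`shortRadical`, and the ultrashort root `i` with radical `radical h`. -/
theorem borel_eq {i j : SignedIndex n} (h : Apart i j) :
    F.borel i j = F.root1 i ⊔ radical h := by
  rw [borel, shortRadical, radical_eq_sup]
  apply le_antisymm <;> simp only [sup_le_iff]
  · exact ⟨(le_sup_right.trans le_sup_left).trans le_sup_right, ⟨le_sup_left,
      (le_sup_left.trans le_sup_left).trans le_sup_right⟩, le_sup_right.trans le_sup_right⟩
  · exact ⟨(le_sup_left.trans le_sup_left).trans le_sup_right,
      ⟨(le_sup_right.trans le_sup_left).trans le_sup_right, le_sup_left⟩,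
      le_sup_right.trans le_sup_right⟩

theorem root2_le_normalizer_shortRadical {i j : SignedIndex n} (h : Apart i j) :
    F.root2 i j ≤ Subgroup.normalizer (F.shortRadical i j : Set F.StU) := by
  apply Subgroup.le_normalizer_of_conj_mem
  rintro _ ⟨a, ha, rfl⟩ x hx
  suffices F.shortRadical i j ≤ (F.shortRadical i j).comap (MulAut.conj (F.S2 i j a)).toMonoidHom
    from this hx
  have l1 : F.root1 i ≤ F.shortRadical i j := le_sup_left.trans le_sup_left
  have l2 : F.root1 j ≤ F.shortRadical i j := le_sup_right.trans le_sup_left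
  have l3 : F.root2 (-i) j ≤ F.shortRadical i j := le_sup_right
  have key : ∀ y, y ∈ F.shortRadical i j → ⁅F.S2 i j a, y⁆ ∈ F.shortRadical i j →
      y ∈ (F.shortRadical i j).comap (MulAut.conj (F.S2 i j a)).toMonoidHom := by
    intro y hy hy2
    have := MulMemClass.mul_mem hy2 hy
    rwa [commutatorElement_def, inv_mul_cancel_right] at this
  refine sup_le (sup_le ?_ ?_) ?_
  · rintro _ ⟨u, hu, rfl⟩
    refine key _ (l1 (S1_mem hu)) ?_
    rw [← inv_mem_iff, commutatorElement_inv, F.rels_S.r8 h hu ha]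
    exact MulMemClass.mul_mem (l3 (S2_mem (F.mul_mem (F.ρ_mem hu) ha)))
      (l2 (S1_mem (neg_mem (F.act_mem hu (neg_mem ha)))))
  · rintro _ ⟨u, hu, rfl⟩
    refine key _ (l2 (S1_mem hu)) ?_
    rw [commutatorElement_eq_one_iff_mul_comm.2 (S1_S2_comm h.1 (ne_neg_self j) hu ha).symm]
    exact one_mem _
  · rintro _ ⟨b, hb, rfl⟩
    refine key _ (l3 (S2_mem hb)) ?_
    rw [← inv_mem_iff, commutatorElement_inv, S2_S2_same h ha hb]
    refine l2 (S1_mem (φ_mem_form (neg_mem ?_)))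
    exact F.mul_mem (star_mem_right hb) ha

/-- Uniqueness of the Gauss decomposition. -/
theorem eq_one_of_st_eq {i j : SignedIndex n} (h : Apart i j) {x y : F.StU}
    (hx : x ∈ F.borel (-i) (-j)) (hy : y ∈ F.borel i j) {l : O.Unitary} (hl : l ∈ F.levi)
    (e : F.st x = l * F.st y) : x = 1 ∧ y = 1 := by
  rw [borel_eq h] at hy
  rw [borel_eq h.neg_neg] at hx
  obtain ⟨_, ⟨u, hu, rfl⟩, r, hr, rfl⟩ :=
    Subgroup.exists_mul_of_mem_sup (root1_le_normalizer_radical h) hy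
  obtain ⟨_, ⟨s, hs, rfl⟩, r', hr', rfl⟩ :=
    Subgroup.exists_mul_of_mem_sup (root1_le_normalizer_radical h.neg_neg) hx
  obtain ⟨w, hw, rfl⟩ := id hr
  obtain ⟨w', hw', rfl⟩ := id hr'
  have cw := coarse_mem_unip h hw
  have cw' := coarse_mem_unip h.neg_neg hw'
  rw [map_mul, map_mul, st_S1 hu, st_S1 hs, st_Sc h hw, st_Sc h.neg_neg hw'] at e
  -- The parameters are killed one at a time. The other side preserves, up to a factor fixing it,
  -- the line of the vector `q` moved by the transvection, so that transvection sends `q` to a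
  -- multiple of itself and is trivial.
  have hw0 : w = 0 := by
    obtain ⟨a, ha, b, hb, h1, h2, h3⟩ := hl j
    refine HyperbolicPair.eq_zero_of_tr_app_q cw (a := b) ?_
    change (F.T j w).app (F.q j) = O.act (F.q j) b
    have e1 := congrArg (fun g => g.app (F.q j)) e
    have h4 := T_app_q_neg cw'
    rw [neg_neg] at h4
    simp only [Unitary.app_mul, h4, T_app_q_of_form hs h.neg_left.1] at e1
    apply (F.T i u).app_injective
    apply l.app_injective
    rw [← e1, Unitary.app_act, Unitary.app_act, T_app_q_of_form hu h.1, h3, ← O.act_mul, h1, q_act_e]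
  subst hw0
  rw [Sc_zero, mul_one]
  rw [T_zero, mul_one] at e
  have hw0 : w' = 0 := by
    obtain ⟨a, ha, b, hb, h1, h2, h3⟩ := hl (-j)
    refine HyperbolicPair.eq_zero_of_tr_app_q cw' (a := a) ?_
    change (F.T (-j) w').app (F.q (-j)) = O.act (F.q (-j)) a
    have e1 := congrArg (fun g => g.app (F.q (-j))) e
    simp only [Unitary.app_mul, T_app_q_of_form hu h.neg_right.1, h3] at e1
    apply (F.T (-i) s).app_injective
    rw [e1, Unitary.app_act, T_app_q_of_form hs h.neg_neg.1]
  subst hw0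
  rw [Sc_zero, mul_one]
  rw [T_zero, mul_one] at e
  have hu0 : u = 0 := by
    obtain ⟨a, ha, b, hb, h1, h2, h3⟩ := hl i
    refine HyperbolicPair.eq_zero_of_tr_app_q (form_mem_unip hu) (a := b) ?_
    change (F.T i u).app (F.q i) = O.act (F.q i) b
    have e1 := congrArg (fun g => g.app (F.q i)) e
    simp only [Unitary.app_mul, T_app_q_of_form hs (neg_ne_self i)] at e1
    apply l.app_injective
    rw [← e1, Unitary.app_act, h3, ← O.act_mul, h1, q_act_e]
  subst hu0
  rw [T_zero, mul_one] at e
  have hs0 : s = 0 := by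
    obtain ⟨a, ha, b, hb, h1, h2, h3⟩ := hl (-i)
    refine HyperbolicPair.eq_zero_of_tr_app_q (form_mem_unip hs) (a := a) ?_
    change (F.T (-i) s).app (F.q (-i)) = O.act (F.q (-i)) a
    rw [e, h3]
  subst hs0
  exact ⟨S1_zero _, S1_zero _⟩

theorem leviAd_sup (g : F.levi) {M N : Subgroup F.StU} (hM : ∀ x ∈ M, F.leviAd g x ∈ M)
    (hN : ∀ x ∈ N, F.leviAd g x ∈ N) {x : F.StU} (hx : x ∈ M ⊔ N) : F.leviAd g x ∈ M ⊔ N := by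
  suffices M ⊔ N ≤ (M ⊔ N).comap (F.leviAd g).toMonoidHom from this hx
  exact sup_le (fun x hx => le_sup_left (a := M) (hM x hx))
    (fun x hx => le_sup_right (a := M) (hN x hx))

theorem leviAd_shortRadical (g : F.levi) {i j : SignedIndex n} {x : F.StU}
    (hx : x ∈ F.shortRadical i j) : F.leviAd g x ∈ F.shortRadical i j :=
  leviAd_sup g (fun _ hx => leviAd_sup g (fun _ => leviAd_root1 g) (fun _ => leviAd_root1 g) hx)
    (fun _ => leviAd_root2 g) hx

theorem leviAd_borel (g : F.levi) {i j : SignedIndex n} {x : F.StU}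
    (hx : x ∈ F.borel i j) : F.leviAd g x ∈ F.borel i j :=
  leviAd_sup g (fun _ => leviAd_root2 g) (fun _ => leviAd_shortRadical g) hx

theorem nice_le_normalizer {N : Subgroup F.StU} (h : ∀ g, ∀ x ∈ N, F.leviAd g x ∈ N) :
    F.nice ≤ Subgroup.normalizer (N : Set F.StU) :=
  Subgroup.le_normalizer_of_conj_mem fun _ ha _ hx => nice_conj ha h hx

/-- An element with a Gauss decomposition and with the image in the Levi subgroup is trivial. -/
theorem eq_one_of_mem_borel {i j : SignedIndex n} (h : Apart i j) {x y z : F.StU}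
    (hx : x ∈ F.borel i j) (hy : y ∈ F.borel (-i) (-j)) (hz : z ∈ F.borel i j)
    (hl : F.st (x * y * z) ∈ F.levi) : x * y * z = 1 := by
  set l : F.levi := ⟨F.st (x * y * z), hl⟩ with hl'
  -- Moving `l` to the left past the image of `x` replaces `x` by its Levi translate, which remains
  -- in the same Borel subgroup; so `y` and a Borel element have images differing by `l`.
  have e1 : F.st y = l * F.st (F.leviAd l⁻¹ x⁻¹ * z⁻¹) := by
    rw [map_mul, st_leviAd, hl']
    simp only [map_mul, map_inv, InvMemClass.coe_inv]
    group
  obtain ⟨rfl, -⟩ := eq_one_of_st_eq h hy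
    (MulMemClass.mul_mem (leviAd_borel _ (inv_mem hx)) (inv_mem hz)) hl e1
  have e2 : F.st (1 : F.StU) = (l : O.Unitary)⁻¹ * F.st (x * 1 * z) := by
    rw [hl', map_one, inv_mul_cancel]
  rw [mul_one] at e2 ⊢
  exact (eq_one_of_st_eq h (one_mem _) (MulMemClass.mul_mem hx hz) (inv_mem hl) e2).2

end OrthogonalHyperbolicFamily

end OddFormRing

namespace OddFormRing

variable {R : Type u} {Δ : Type v} [NonUnitalRing R] [StarRing R] [AddGroup Δ]

theorem SignedIndex.not_apart_or_not_apart {i j : SignedIndex 2} (h : SignedIndex.Apart i j)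
    (k : SignedIndex 2) : ¬ SignedIndex.Apart i k ∨ ¬ SignedIndex.Apart j k := by
  simp only [SignedIndex.apart_iff_idx, ne_eq, not_not] at *
  omega

namespace OrthogonalHyperbolicFamily

open SignedIndex
open scoped commutatorElement

/-! ### Gauss decomposition in rank two -/

variable {O : OddFormRing R Δ}

theorem init_levi_iff {m : ℕ} {F : O.OrthogonalHyperbolicFamily (m + 1)} {g : O.Unitary} :
    g ∈ F.init.levi ↔ ∀ k, F.LeviAt g (up k) := Iff.rfl

/-- The big cell in U for the ambient family, with `z` as spare pair, gives the identity up to a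
Levi element. Its lift lies in the group generated by `X_i` and `X_{-i}` and has image in the Levi
subgroup, so it is in `nice`. -/
theorem exists_mul_exchange_root1 {m : ℕ} {F : O.OrthogonalHyperbolicFamily (m + 1)}
    {S : Type*} [Ring S] [IsSemisimpleRing S] {f : R →ₙ+* S}
    (hf : Function.Surjective f) (hJ : ∀ a, f a = 0 → a ∈ jacobsonRadical R)
    {i j : SignedIndex m} (hij : Apart i j) {a b c : F.init.StU} (ha : a ∈ F.init.root1 i)
    (hb : b ∈ F.init.root1 (-i)) (hc : c ∈ F.init.root1 i) :
    ∃ a' ∈ F.init.root1 (-i), ∃ b' ∈ F.init.root1 i, ∃ c' ∈ F.init.root1 (-i), ∃ h ∈ F.init.nice,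
      a * b * c = a' * b' * c' * h := by
  have hz : IsLast (⟨Fin.last m, true⟩ : SignedIndex (m + 1)) := rfl
  generalize (⟨Fin.last m, true⟩ : SignedIndex (m + 1)) = z at hz
  have hfix : ∀ {i k : SignedIndex m} {x}, Apart i k → x ∈ F.init.root1 i →
      F.LeviAt (F.init.st x) (up k) := by
    rintro i k _ hik ⟨u, hu, rfl⟩
    rw [st_S1 hu]
    exact LeviAt.of_fix (T_app_q_of_form (F := F.init) hu hik.1)
  obtain ⟨t, ht, u, hu, v, hv, l, hl, e⟩ := exists_big_cell hf hJ (F := F) (hz.apart i)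
    (g := F.init.st (a * b * c)) (by
      intro k hik hzk
      rcases exists_up_or_isLast k with ⟨k, rfl⟩ | hk
      · rw [up_apart_iff] at hik
        rw [map_mul, map_mul]
        exact ((hfix hik ha).mul (hfix hik.neg_left hb)).mul (hfix hik hc)
      · exact absurd hzk (IsLast.not_apart hz hk))
  rw [← up_neg, ← init_form hz] at ht hv
  rw [← init_form hz] at hu
  have e' : F.init.st (F.init.S1 (-i) t * (a * b * c))
      = F.init.st (F.init.S1 i u * F.init.S1 (-i) v) * l := by
    rw [map_mul _ _ (a * b * c), map_mul _ (F.init.S1 i u), st_S1 ht, st_S1 hu, st_S1 hv]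
    exact e
  refine ⟨F.init.S1 (-i) (-t), S1_mem (neg_mem ht), _, S1_mem hu, _, S1_mem hv,
    (F.init.S1 i u * F.init.S1 (-i) v)⁻¹ * (F.init.S1 (-i) t * (a * b * c)), ?_, ?_⟩
  · apply mem_nice_of_mem_sup_root1 hij
    · rw [map_mul, map_inv, e', inv_mul_cancel_left]
      exact fun k => hl _ (hz.apart k)
    · have l1 : F.init.root1 i ≤ F.init.root1 i ⊔ F.init.root1 (-i) := le_sup_left
      have l2 : F.init.root1 (-i) ≤ F.init.root1 i ⊔ F.init.root1 (-i) := le_sup_right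
      exact MulMemClass.mul_mem (inv_mem (MulMemClass.mul_mem (l1 (S1_mem hu)) (l2 (S1_mem hv))))
        (MulMemClass.mul_mem (l2 (S1_mem ht))
          (MulMemClass.mul_mem (MulMemClass.mul_mem (l1 ha) (l2 hb)) (l1 hc)))
  · rw [S1_neg ht]; group

variable {F : O.OrthogonalHyperbolicFamily (2 + 1)}

/-- The short radicals of `(i, j)` and `(-i, -j)` are normalized by `h`, are embedded by `st`, and
in rank two contain all ultrashort root subgroups. The short root subgroups then follow, being
generated by commutators of ultrashort elements `X_{±z,·}` through the forgotten pair. -/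
theorem mem_nice_of_mem_sup_root2 {i j : SignedIndex 2} (hij : Apart i j) {h : F.init.StU}
    (hh : F.init.st h ∈ F.init.levi) (hm : h ∈ F.init.root2 i j ⊔ F.init.root2 j i) :
    h ∈ F.init.nice := by
  apply mem_nice_of_eq_top hh
  have hz : IsLast (⟨Fin.last 2, true⟩ : SignedIndex (2 + 1)) := rfl
  generalize (⟨Fin.last 2, true⟩ : SignedIndex (2 + 1)) = z at hz
  have key : ∀ {i j}, Apart i j → h ∈ F.init.root2 i j ⊔ F.init.root2 j i →
      F.init.shortRadical i j ≤ niceLocus hh := by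
    intro i j hij hm
    apply le_niceLocus
    · intro x hx h1
      refine (eq_one_of_st_eq (l := 1) hij (one_mem _) (le_sup_right (a := F.init.root2 i j) hx)
        (one_mem _) ?_).2
      rw [map_one, h1, one_mul]
    · have h1 : F.init.root2 i j ⊔ F.init.root2 j i
          ≤ Subgroup.normalizer (F.init.shortRadical i j : Set F.init.StU) := by
        refine sup_le (root2_le_normalizer_shortRadical hij) ?_
        rw [shortRadical_comm]
        exact root2_le_normalizer_shortRadical hij.symm
      exact fun x hx => Subgroup.conj_mem_of_le_normalizer h1 hm hx
    · exact fun g x => leviAd_shortRadical g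
  have k1 := key hij hm
  have k2 := key hij.neg_neg (by rwa [← root2_swap, ← root2_swap, sup_comm])
  have l1 : ∀ k, F.init.root1 k ≤ niceLocus hh := by
    intro k
    rcases not_apart_or_not_apart hij k with hk | hk
    · rcases eq_or_eq_neg hk with rfl | rfl
      · exact (le_sup_left.trans le_sup_left).trans k1
      · rw [neg_neg] at k2
        exact (le_sup_left.trans le_sup_left).trans k2
    · rcases eq_or_eq_neg hk with rfl | rfl
      · exact (le_sup_right.trans le_sup_left).trans k1
      · rw [neg_neg] at k2
        exact (le_sup_right.trans le_sup_left).trans k2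
  apply eq_top_of_generators
  · exact fun {i u} hu => l1 i (S1_mem hu)
  · intro i j a hij ha
    refine ring_induction (F := F) (i := up i) (j := up j) z.idx (P := fun a => F.init.S2 i j a ∈ niceLocus hh ∧
      a ∈ F.init.ring i j) ?_ ?_ ?_ ha |>.1
    · exact ⟨by rw [S2_zero]; exact one_mem _, zero_mem _⟩
    · rintro a b - - ⟨ha, ha'⟩ ⟨hb, hb'⟩
      exact ⟨by rw [S2_add ha' hb']; exact MulMemClass.mul_mem ha hb, add_mem ha' hb'⟩
    · intro k x y hk hx hy
      have hk' : IsLast k := hk.trans hz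
      refine ⟨?_, F.mul_mem hx hy⟩
      have hx' := neg_mem (F.star_mem hx)
      have hu := q_act_mem_init hk'.neg (i := -i) hx'
      have hv := q_act_mem_init hk' hy
      have h6 := F.init.rels_S.r6 hij.neg_left hu hv
      rw [π_q_act hx', π_q_act hy, star_neg, star_star, neg_mul, neg_neg, neg_neg] at h6
      rw [← h6]
      have m1 := l1 _ (S1_mem hu)
      have m2 := l1 _ (S1_mem hv)
      exact MulMemClass.mul_mem (MulMemClass.mul_mem (MulMemClass.mul_mem m1 m2) (inv_mem m1))
        (inv_mem m2)

theorem exists_mul_exchange_root2 {S : Type*} [Ring S] [IsSemisimpleRing S] {f : R →ₙ+* S}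
    (hf : Function.Surjective f) (hJ : ∀ a, f a = 0 → a ∈ jacobsonRadical R)
    {i j : SignedIndex 2} (hij : Apart i j) {a b c : F.init.StU} (ha : a ∈ F.init.root2 i j)
    (hb : b ∈ F.init.root2 j i) (hc : c ∈ F.init.root2 i j) :
    ∃ a' ∈ F.init.root2 j i, ∃ b' ∈ F.init.root2 i j, ∃ c' ∈ F.init.root2 j i, ∃ h ∈ F.init.nice,
      a * b * c = a' * b' * c' * h := by
  have hq : ∀ {i j : SignedIndex 2} {x}, Apart i j → x ∈ F.init.root2 i j →
      F.init.st x ∈ F.init.qLinear i j := by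
    rintro i j _ hij ⟨u, hu, rfl⟩
    rw [st_S2 hij hu]
    exact t2_mem_qLinear hij hu
  have hb' := hq hij.symm hb
  rw [qLinear_comm hij.symm] at hb'
  obtain ⟨t, ht, u, hu, v, hv, l, hl, e⟩ := exists_short_cell hf hJ (F := F.init) hij
    (g := F.init.st (a * b * c)) (by
      rw [map_mul, map_mul]
      exact MulMemClass.mul_mem (MulMemClass.mul_mem (hq hij ha) hb') (hq hij hc))
  have e' : F.init.st (F.init.S2 j i t * (a * b * c))
      = F.init.st (F.init.S2 i j u * F.init.S2 j i v) * l := by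
    rw [map_mul _ _ (a * b * c), map_mul _ (F.init.S2 i j u), st_S2 hij.symm ht, st_S2 hij hu, st_S2 hij.symm hv]
    exact e
  refine ⟨F.init.S2 j i (-t), S2_mem (neg_mem ht), _, S2_mem hu, _, S2_mem hv,
    (F.init.S2 i j u * F.init.S2 j i v)⁻¹ * (F.init.S2 j i t * (a * b * c)), ?_, ?_⟩
  · apply mem_nice_of_mem_sup_root2 hij
    · rw [map_mul, map_inv, e', inv_mul_cancel_left]
      exact hl
    · have l1 : F.init.root2 i j ≤ F.init.root2 i j ⊔ F.init.root2 j i := le_sup_left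
      have l2 : F.init.root2 j i ≤ F.init.root2 i j ⊔ F.init.root2 j i := le_sup_right
      exact MulMemClass.mul_mem (inv_mem (MulMemClass.mul_mem (l1 (S2_mem hu)) (l2 (S2_mem hv))))
        (MulMemClass.mul_mem (l2 (S2_mem ht))
          (MulMemClass.mul_mem (MulMemClass.mul_mem (l1 ha) (l2 hb)) (l1 hc)))
  · rw [S2_neg ht]; group

/-- The elements with the Gauss decomposition with respect to `F.borel i j`. -/
def gaussCell {n : ℕ} (F : O.OrthogonalHyperbolicFamily n) (i j : SignedIndex n) : Set F.StU :=
  {x | ∃ u ∈ F.borel i j, ∃ v ∈ F.borel (-i) (-j), ∃ w ∈ F.borel i j, ∃ h ∈ F.nice,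
    x = u * v * w * h}

/-- Reflection in the ultrashort simple root: the radical of `(i, j)` is unchanged and the roles of
`X_i` and `X_{-i}` are exchanged. -/
theorem gaussCell_subset_neg {S : Type*} [Ring S] [IsSemisimpleRing S] {f : R →ₙ+* S}
    (hf : Function.Surjective f) (hJ : ∀ a, f a = 0 → a ∈ jacobsonRadical R)
    {i j : SignedIndex 2} (hij : Apart i j) :
    F.init.gaussCell i j ⊆ F.init.gaussCell (-i) j := by
  rintro _ ⟨u, hu, v, hv, w, hw, h, hh, rfl⟩
  rw [borel_eq hij] at hu hw
  rw [borel_eq hij.neg_neg, radical_neg hij.neg_right] at hv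
  have := Subgroup.exists_mul_exchange (root1_le_normalizer_radical hij)
    (root1_le_normalizer_radical hij.neg_right) (root1_neg_le_normalizer_radical hij.neg_right)
    (nice_le_normalizer fun g x => leviAd_radical g hij)
    (nice_le_normalizer fun g x => leviAd_radical g hij.neg_right)
    (fun a ha b hb c hc => exists_mul_exchange_root1 hf hJ hij ha hb hc) hu hv hw hh
  obtain ⟨x, hx, y, hy, z, hz, h', hh', e⟩ := this
  refine ⟨x, ?_, y, ?_, z, ?_, h', hh', e⟩
  · rwa [borel_eq hij.neg_left, radical_neg hij]
  · rw [neg_neg, borel_eq hij.neg_right]; exact hy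
  · rwa [borel_eq hij.neg_left, radical_neg hij]

/-- Reflection in the short simple root, with the short radicals in the role of the unchanged part.
-/
theorem gaussCell_subset_swap {S : Type*} [Ring S] [IsSemisimpleRing S] {f : R →ₙ+* S}
    (hf : Function.Surjective f) (hJ : ∀ a, f a = 0 → a ∈ jacobsonRadical R)
    {i j : SignedIndex 2} (hij : Apart i j) :
    F.init.gaussCell i j ⊆ F.init.gaussCell j i := by
  rintro _ ⟨u, hu, v, hv, w, hw, h, hh, rfl⟩
  have n1 := root2_le_normalizer_shortRadical (F := F.init) hij.neg_neg
  have n2 := root2_le_normalizer_shortRadical (F := F.init) hij.symm.neg_neg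
  rw [← root2_swap] at n1 n2
  rw [shortRadical_comm] at n2
  rw [borel, ← root2_swap] at hv
  have := Subgroup.exists_mul_exchange (root2_le_normalizer_shortRadical hij) n2 n1
    (nice_le_normalizer fun g x => leviAd_shortRadical g)
    (nice_le_normalizer fun g x => leviAd_shortRadical g)
    (fun a ha b hb c hc => exists_mul_exchange_root2 hf hJ hij ha hb hc) hu hv hw hh
  obtain ⟨x, hx, y, hy, z, hz, h', hh', e⟩ := this
  refine ⟨x, ?_, y, ?_, z, ?_, h', hh', e⟩
  · rwa [borel, shortRadical_comm]
  · rwa [borel, shortRadical_comm, ← root2_swap]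
  · rwa [borel, shortRadical_comm]

/-- **Gauss decomposition.** -/
theorem mem_gaussCell {S : Type*} [Ring S] [IsSemisimpleRing S] {f : R →ₙ+* S}
    (hf : Function.Surjective f) (hJ : ∀ a, f a = 0 → a ∈ jacobsonRadical R)
    {i j : SignedIndex 2} (hij : Apart i j) (x : F.init.StU) : x ∈ F.init.gaussCell i j := by
  have hneg : ∀ {i j : SignedIndex 2}, Apart i j →
      F.init.gaussCell (-i) j = F.init.gaussCell i j := fun {i j} hij =>
    Set.Subset.antisymm (by simpa using gaussCell_subset_neg hf hJ (F := F) hij.neg_left)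
      (gaussCell_subset_neg hf hJ hij)
  have hswap : ∀ {i j : SignedIndex 2}, Apart i j →
      F.init.gaussCell j i = F.init.gaussCell i j := fun {i j} hij =>
    Set.Subset.antisymm (gaussCell_subset_swap hf hJ hij.symm) (gaussCell_subset_swap hf hJ hij)
  have hneg' : ∀ {i j : SignedIndex 2}, Apart i j →
      F.init.gaussCell i (-j) = F.init.gaussCell i j := fun {i j} hij => by
    rw [hswap hij.symm.neg_left, hneg hij.symm, hswap hij]
  have key : ∀ {i j k l : SignedIndex 2}, Apart i j → Apart k l → ¬ Apart i k →
      F.init.gaussCell k l = F.init.gaussCell i j := by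
    intro i j k l hij hkl hik
    have hjl : ¬ Apart j l := by
      simp only [apart_iff_idx, ne_eq, not_not] at *
      omega
    rcases eq_or_eq_neg hik with rfl | rfl <;> rcases eq_or_eq_neg hjl with rfl | rfl
    · rfl
    · exact (hneg' hkl).symm
    · exact (hneg hkl).symm
    · rw [hneg hkl.neg_right, hneg' hkl]
  -- Changes of sign and transpositions connect all Borel subgroups `borel k l`, so they have one
  -- common cell.
  have all : ∀ {i j k l : SignedIndex 2}, Apart i j → Apart k l →
      F.init.gaussCell k l = F.init.gaussCell i j := by
    intro i j k l hij hkl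
    rcases not_apart_or_not_apart hij k with hk | hk
    · exact key hij hkl hk
    · rw [key hij.symm hkl hk, hswap hij]
  -- The stabilizer of the cell under left multiplication. It contains each `borel k l`, because the
  -- cell begins with a factor from it, and these contain all generators.
  let P : Subgroup F.init.StU :=
    { carrier := {x | ∀ y, x * y ∈ F.init.gaussCell i j ↔ y ∈ F.init.gaussCell i j}
      one_mem' := fun y => by rw [one_mul]
      mul_mem' := fun {a b} ha hb y => by rw [mul_assoc, ha, hb]
      inv_mem' := fun {a} ha y => by rw [← ha, mul_inv_cancel_left] }
  have hb : ∀ {k l : SignedIndex 2}, Apart k l → F.init.borel k l ≤ P := by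
    intro k l hkl
    have h1 : ∀ x ∈ F.init.borel k l, ∀ y ∈ F.init.gaussCell i j, x * y ∈ F.init.gaussCell i j := by
      rw [← all hij hkl]
      rintro x hx _ ⟨u, hu, v, hv, w, hw, h, hh, rfl⟩
      exact ⟨x * u, MulMemClass.mul_mem hx hu, v, hv, w, hw, h, hh, by simp only [mul_assoc]⟩
    exact fun x hx y => ⟨fun h => by simpa using h1 _ (inv_mem hx) _ h, h1 x hx y⟩
  have hP : P = ⊤ := by
    apply eq_top_of_generators
    · intro k u hu
      obtain ⟨l, hkl⟩ := SignedIndex.exists_apart le_rfl k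
      exact hb hkl (le_sup_right (a := F.init.root2 k l) ((le_sup_left.trans le_sup_left :
        F.init.root1 k ≤ F.init.shortRadical k l) (S1_mem hu)))
    · exact fun {k l a} hkl ha =>
        hb hkl (le_sup_left (b := F.init.shortRadical k l) (S2_mem ha))
  have hx : x ∈ P := hP ▸ Subgroup.mem_top x
  have := (hx 1).2 ⟨1, one_mem _, 1, one_mem _, 1, one_mem _, 1, one_mem _, by simp⟩
  rwa [mul_one] at this

/-- Fact (b). The factor in `nice` also maps to the Levi subgroup, so the unipotent part of the
Gauss decomposition does, and is therefore trivial. -/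
theorem mem_nice_of_st_mem_levi {S : Type*} [Ring S] [IsSemisimpleRing S] {f : R →ₙ+* S}
    (hf : Function.Surjective f) (hJ : ∀ a, f a = 0 → a ∈ jacobsonRadical R) {x : F.init.StU}
    (hx : F.init.st x ∈ F.init.levi) : x ∈ F.init.nice := by
  obtain ⟨j, hij⟩ := SignedIndex.exists_apart (le_refl 2) ⟨0, true⟩
  obtain ⟨u, hu, v, hv, w, hw, h, hh, rfl⟩ := mem_gaussCell hf hJ hij x
  obtain ⟨h1, -⟩ := id hh
  rw [map_mul] at hx
  have h2 := MulMemClass.mul_mem hx (inv_mem h1)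
  rw [mul_inv_cancel_right] at h2
  rw [eq_one_of_mem_borel hij hu hv hw h2, one_mul]
  exact hh

/-- The unitary group is generated by the image of the Steinberg group and by the Levi subgroup. -/
theorem exists_eq_st_mul {S : Type*} [Ring S] [IsSemisimpleRing S] {f : R →ₙ+* S}
    (hf : Function.Surjective f) (hJ : ∀ a, f a = 0 → a ∈ jacobsonRadical R) (g : O.Unitary) :
    ∃ x : F.init.StU, ∃ l : F.init.levi, g = F.init.st x * l := by
  obtain ⟨j, hij⟩ := SignedIndex.exists_apart (le_refl 2) ⟨0, true⟩
  generalize (⟨0, true⟩ : SignedIndex 2) = i at hij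
  -- Two big cells in succession. The first, in the rank two family with `j` as spare pair, has no
  -- hypothesis to check and yields `l` preserving the lines of `q_{±i}`. The second, at `j` in the
  -- ambient family with the forgotten pair as spare, also straightens the lines of `q_{±j}`.
  obtain ⟨t, ht, u, hu, v, hv, l, hl, e⟩ := exists_big_cell hf hJ (F := F.init) hij.symm (g := g)
    (fun k h1 h2 => by rcases not_apart_or_not_apart hij k with h | h <;> contradiction)
  have hz : IsLast (⟨Fin.last 2, true⟩ : SignedIndex (2 + 1)) := rfl
  generalize (⟨Fin.last 2, true⟩ : SignedIndex (2 + 1)) = z at hz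
  obtain ⟨t', ht', u', hu', v', hv', l', hl', e'⟩ := exists_big_cell hf hJ (F := F)
    (hz.apart j) (g := l) (fun k h1 h2 => by
      rcases exists_up_or_isLast k with ⟨k, rfl⟩ | hk
      · exact hl k (up_apart_iff.1 h1)
      · exact absurd h2 (IsLast.not_apart hz hk))
  rw [← up_neg, ← init_form hz] at ht' hv'
  rw [← init_form hz] at hu'
  refine ⟨(F.init.Sc j (-i) t)⁻¹ * (F.init.Sc j i u * F.init.Sc j (-i) v)
    * (F.init.S1 (-j) t')⁻¹ * (F.init.S1 j u' * F.init.S1 (-j) v'),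
    ⟨l', init_levi_iff.2 fun k => hl' _ (hz.apart k)⟩, ?_⟩
  simp only [map_mul, map_inv, st_S1 ht', st_S1 hu', st_S1 hv', st_Sc hij.symm.neg_right ht,
    st_Sc hij.symm hu, st_Sc hij.symm.neg_right hv]
  have e2 : l = (F.init.T (-j) t')⁻¹ * (F.init.T j u' * F.init.T (-j) v' * l') := by
    rw [eq_inv_mul_iff_mul_eq]; exact e'
  rw [← eq_inv_mul_iff_mul_eq, e2] at e
  rw [e]
  group

end OrthogonalHyperbolicFamily

end OddFormRing

/-! ### Crossed modules -/

open scoped commutatorElement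

/-- Construction of a crossed module from a group `H` acted on by a subgroup of `G`. -/
theorem exists_isCrossedModule {G H : Type*} [Group G] [Group H] {d : H →* G} {L : Subgroup G}
    (ad : L →* MulAut H) (h1 : ∀ l x, d (ad l x) = l * d x * (l : G)⁻¹)
    (h2 : ∀ x (hx : d x ∈ L), ad ⟨d x, hx⟩ = MulAut.conj x)
    (h3 : ∀ g, ∃ x, ∃ l : L, g = d x * l) :
    ∃ act : G →* MulAut H, IsCrossedModule d act := by
  -- Independence of the presentation `g = d x * l`: two of them differ by `y⁻¹ x`, whose image is
  -- in `L`, and `h2` says that it acts correctly.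
  have key : ∀ (x y : H) (l m : L), d x * l = d y * m →
      MulAut.conj x * ad l = MulAut.conj y * ad m := by
    intro x y l m h
    have h4 : d (y⁻¹ * x) = (m * l⁻¹ : L) := by
      rw [map_mul, map_inv, Subgroup.coe_mul, inv_mul_eq_iff_eq_mul, ← mul_assoc, ← h]
      simp
    have h5 := h2 (y⁻¹ * x) (by rw [h4]; exact (m * l⁻¹).2)
    have h6 : (⟨d (y⁻¹ * x), by rw [h4]; exact (m * l⁻¹).2⟩ : L) = m * l⁻¹ := Subtype.ext h4
    rw [h6, map_mul, map_mul, map_inv, map_inv, mul_inv_eq_iff_eq_mul, mul_assoc,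
      eq_inv_mul_iff_mul_eq] at h5
    exact h5.symm
  choose s t hst using h3
  have hact : ∀ (x : H) (l : L), MulAut.conj (s (d x * l)) * ad (t (d x * l))
      = MulAut.conj x * ad l := fun x l => key _ _ _ _ (hst _).symm
  have hconj : ∀ (l : L) (x : H), MulAut.conj (ad l x) = ad l * MulAut.conj x * (ad l)⁻¹ := by
    intro l x
    ext y
    simp [MulAut.mul_apply]
  let act : G →* MulAut H := MonoidHom.mk' (fun g => MulAut.conj (s g) * ad (t g)) (by
    intro g g'
    have h4 : g * g' = d (s g * ad (t g) (s g')) * (t g * t g' : L) := by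
      conv_lhs => rw [hst g, hst g']
      rw [map_mul, h1, Subgroup.coe_mul]
      group
    change MulAut.conj (s (g * g')) * ad (t (g * g')) = _
    rw [h4, hact, map_mul, hconj, map_mul]
    group)
  refine ⟨act, fun g x => ?_, fun x y => ?_⟩
  · conv_rhs => rw [hst g]
    change d (s g * ad (t g) x * (s g)⁻¹) = _
    rw [map_mul, map_mul, h1, map_inv]
    group
  · have := hact x 1
    rw [Subgroup.coe_one, mul_one, map_one, mul_one] at this
    change (MulAut.conj (s (d x)) * ad (t (d x))) y = _
    rw [this]
    rfl

theorem IsCrossedModule.transport {G H K : Type*} [Group G] [Group H] [Group K] {d : H →* G}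
    {act : G →* MulAut H} (h : IsCrossedModule d act) (Φ : H ≃* K) {d' : K →* G}
    (hd : ∀ x, d' (Φ x) = d x) : ∃ act' : G →* MulAut K, IsCrossedModule d' act' := by
  refine ⟨(MulAut.congr Φ).toMonoidHom.comp act, fun g k => ?_, fun k k' => ?_⟩
  · obtain ⟨x, rfl⟩ := Φ.surjective k
    change d' (Φ (act g (Φ.symm (Φ x)))) = _
    rw [hd, MulEquiv.symm_apply_apply, h.1, hd]
  · obtain ⟨x, rfl⟩ := Φ.surjective k
    obtain ⟨y, rfl⟩ := Φ.surjective k'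
    change Φ (act (d' (Φ x)) (Φ.symm (Φ y))) = _
    rw [hd, MulEquiv.symm_apply_apply, h.2, map_mul, map_mul, map_inv]

/-- Homomorphisms from a perfect group to a crossed module are determined by their images. -/
theorem IsCrossedModule.hom_ext {G H K : Type*} [Group G] [Group H] [Group K] {d : H →* G}
    {act : G →* MulAut H} (h : IsCrossedModule d act) (hK : commutator K = ⊤) {α β : K →* H}
    (hd : ∀ x, d (α x) = d (β x)) : α = β := by
  -- The Peiffer identity makes the kernel of `d` central. The values of `α` and `β` differ by
  -- kernel elements, which cancel in commutators.
  have hc : ∀ z, d z = 1 → ∀ y, z * y = y * z := by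
    intro z hz y
    have := h.2 z y
    rw [hz, map_one, MulAut.one_apply, eq_mul_inv_iff_mul_eq] at this
    exact this.symm
  suffices H : commutator K ≤ α.eqLocus β from
    MonoidHom.eq_of_eqOn_top fun x _ => H (hK ▸ Subgroup.mem_top x)
  rw [commutator_def, Subgroup.commutator_le]
  intro x _ y _
  change α ⁅x, y⁆ = β ⁅x, y⁆
  obtain ⟨z, hz, ex⟩ : ∃ z, d z = 1 ∧ α x = z * β x :=
    ⟨α x * (β x)⁻¹, by rw [map_mul, map_inv, hd, mul_inv_cancel], by group⟩
  obtain ⟨w, hw, ey⟩ : ∃ w, d w = 1 ∧ α y = w * β y :=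
    ⟨α y * (β y)⁻¹, by rw [map_mul, map_inv, hd, mul_inv_cancel], by group⟩
  rw [map_commutatorElement, map_commutatorElement, ex, ey, commutatorElement_def,
    commutatorElement_def]
  calc z * β x * (w * β y) * (z * β x)⁻¹ * (w * β y)⁻¹
      = z * (β x * w) * β y * (β x)⁻¹ * (z⁻¹ * (β y)⁻¹) * w⁻¹ := by group
    _ = z * (w * β x) * β y * (β x)⁻¹ * ((β y)⁻¹ * z⁻¹) * w⁻¹ := by
        rw [hc w hw, hc z⁻¹ (by rw [map_inv, hz, inv_one])]
    _ = z * w * (β x * β y * (β x)⁻¹ * (β y)⁻¹) * (z⁻¹ * w⁻¹) := by group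
    _ = (β x * β y * (β x)⁻¹ * (β y)⁻¹) * (z * w * (z⁻¹ * w⁻¹)) := by
        rw [hc (z * w) (by rw [map_mul, hz, hw, one_mul]), mul_assoc]
    _ = _ := by rw [hc z⁻¹ (by rw [map_inv, hz, inv_one])]; group

namespace OddFormRing

variable {R : Type u} {Δ : Type v} [NonUnitalRing R] [StarRing R] [AddGroup Δ]

namespace OrthogonalHyperbolicFamily

open SignedIndex
open scoped commutatorElement

variable {O : OddFormRing R Δ}

/-! ### The crossed module -/

theorem exists_crossedModule_of_three (F : O.OrthogonalHyperbolicFamily (2 + 1)) {S : Type*}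
    [Ring S] [IsSemisimpleRing S] {f : R →ₙ+* S} (hf : Function.Surjective f)
    (hJ : ∀ a, f a = 0 → a ∈ jacobsonRadical R) :
    ∃ act : O.Unitary →* MulAut F.init.StU, IsCrossedModule F.init.st act := by
  refine exists_isCrossedModule F.init.leviAd st_leviAd (fun x hx => ?_) (exists_eq_st_mul hf hJ)
  obtain ⟨h1, h2⟩ := mem_nice_of_st_mem_levi hf hJ hx
  ext y
  exact h2 y

/-- Each step passes to the family without the last pair, whose Steinberg group is isomorphic over
the same unitary group. In the base case this smaller family has rank two, where the Gauss
decomposition was proved. -/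
theorem exists_crossedModule {S : Type*} [Ring S] [IsSemisimpleRing S] {f : R →ₙ+* S}
    (hf : Function.Surjective f) (hJ : ∀ a, f a = 0 → a ∈ jacobsonRadical R) {n : ℕ} (hn : 3 ≤ n)
    (F : O.OrthogonalHyperbolicFamily n) :
    ∃ act : O.Unitary →* MulAut F.StU, IsCrossedModule F.st act := by
  induction n, hn using Nat.le_induction with
  | base =>
    obtain ⟨act, h⟩ := exists_crossedModule_of_three F hf hJ
    obtain ⟨Φ, hΦ⟩ := F.exists_equiv_init le_rfl
    exact h.transport Φ hΦ
  | succ m hm ih =>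
    obtain ⟨act, h⟩ := ih F.init
    obtain ⟨Φ, hΦ⟩ := F.exists_equiv_init (by omega)
    exact h.transport Φ hΦ

variable {n : ℕ} {F : O.OrthogonalHyperbolicFamily n}

theorem _root_.OddFormRing.SignedIndex.exists_apart_apart (hn : 3 ≤ n) (i j : SignedIndex n) :
    ∃ k, Apart i k ∧ Apart j k := by
  obtain ⟨k, h1, h2⟩ := Fin.exists_ne_and_ne_of_two_lt i.idx j.idx hn
  exact ⟨⟨k, true⟩, apart_iff_idx.2 h1.symm, apart_iff_idx.2 h2.symm⟩

/-- The Steinberg group is perfect. -/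
theorem commutator_StU (hn : 3 ≤ n) : _root_.commutator F.StU = ⊤ := by
  have hc : ∀ x y : F.StU, ⁅x, y⁆ ∈ _root_.commutator F.StU := fun x y =>
    Subgroup.commutator_mem_commutator (Subgroup.mem_top x) (Subgroup.mem_top y)
  have h2 : ∀ {i j a}, Apart i j → a ∈ F.ring i j → F.S2 i j a ∈ _root_.commutator F.StU := by
    intro i j a hij ha
    -- Rank at least three supplies a third pair, through which every element of `R_{ij}` is a sum
    -- of products, so that `X_{ij}` consists of products of commutators.
    obtain ⟨p, hip, hjp⟩ := SignedIndex.exists_apart_apart hn i j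
    refine ring_induction p.idx (P := fun a => F.S2 i j a ∈ _root_.commutator F.StU ∧ a ∈ F.ring i j)
      ?_ ?_ ?_ ha |>.1
    · exact ⟨by rw [S2_zero]; exact one_mem _, zero_mem _⟩
    · rintro a b - - ⟨ha, ha'⟩ ⟨hb, hb'⟩
      exact ⟨by rw [S2_add ha' hb']; exact MulMemClass.mul_mem ha hb, add_mem ha' hb'⟩
    · intro k x y hk hx hy
      rw [apart_iff_idx, ← hk, ← apart_iff_idx] at hip hjp
      exact ⟨by rw [← F.rels_S.r4 hip hjp.symm hij hx hy]; exact hc _ _, F.mul_mem hx hy⟩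
  apply eq_top_of_generators
  · intro i u hu
    obtain ⟨p, hip, -⟩ := SignedIndex.exists_apart_apart hn i i
    let Q : AddSubgroup Δ :=
      { carrier := {u | u ∈ F.form i ∧ F.S1 i u ∈ _root_.commutator F.StU}
        zero_mem' := ⟨zero_mem _, by rw [S1_zero]; exact one_mem _⟩
        add_mem' := by
          rintro u v ⟨hu, hu'⟩ ⟨hv, hv'⟩
          exact ⟨add_mem hu hv, by rw [S1_add hu hv]; exact MulMemClass.mul_mem hu' hv'⟩
        neg_mem' := by
          rintro u ⟨hu, hu'⟩
          exact ⟨neg_mem hu, by rw [S1_neg hu]; exact inv_mem hu'⟩ }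
    suffices h : F.form i ≤ Q from (h hu).2
    apply form_le_of_act p.idx
    · intro c hc'
      refine ring_induction p.idx (P := fun c => O.φ c ∈ Q) ?_ ?_ ?_ hc'
      · rw [O.φ_zero]; exact zero_mem _
      · intro a b _ _ ha hb
        rw [O.φ_add]; exact add_mem ha hb
      · intro k x y hk hx hy
        rw [apart_iff_idx, ← hk, ← apart_iff_idx] at hip
        have h5 := F.rels_S.r5 hip.neg_left hx (b := y) (by rwa [neg_neg])
        rw [neg_neg] at h5
        exact ⟨φ_mem_form (F.mul_mem hx hy), by rw [← h5]; exact hc _ _⟩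
    · intro k u a hk hu ha
      rw [apart_iff_idx, ← hk, ← apart_iff_idx] at hip
      have m := F.act_mem hu ha
      have h8 := F.rels_S.r8 hip.symm hu (neg_mem ha)
      rw [neg_neg, S1_neg m, eq_mul_inv_iff_mul_eq, ← eq_inv_mul_iff_mul_eq] at h8
      refine ⟨m, ?_⟩
      rw [h8]
      exact MulMemClass.mul_mem (inv_mem (hc _ _))
        (h2 hip.symm.neg_left (F.mul_mem (F.ρ_mem hu) (neg_mem ha)))
  · exact h2

/-- A crossed module over `st` is compatible with the action of the Levi subgroup. -/
theorem act_levi {act : O.Unitary →* MulAut F.StU} (h : IsCrossedModule F.st act) (hn : 3 ≤ n)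
    (l : F.levi) : act l = F.leviAd l := by
  have := h.hom_ext (commutator_StU hn) (α := (act l).toMonoidHom) (β := (F.leviAd l).toMonoidHom)
    (fun x => (h.1 l x).trans (st_leviAd l x).symm)
  ext x
  exact DFunLike.congr_fun this x

theorem act_unique {act act' : O.Unitary →* MulAut F.StU} (h : IsCrossedModule F.st act)
    (h' : IsCrossedModule F.st act') (hn : 3 ≤ n) : act' = act := by
  ext g x
  have := h.hom_ext (commutator_StU hn) (α := (act' g).toMonoidHom) (β := (act g).toMonoidHom)
    (fun x => (h'.1 g x).trans (h.1 g x).symm)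
  exact DFunLike.congr_fun this x

end OrthogonalHyperbolicFamily

end OddFormRing

/-! ### The diagonal action and the main theorem -/

namespace OddFormRing

variable {R : Type u} {Δ : Type v} [NonUnitalRing R] [StarRing R] [AddGroup Δ]

namespace OrthogonalHyperbolicFamily

open SignedIndex
open scoped commutatorElement

variable {O : OddFormRing R Δ} {n : ℕ} {F : O.OrthogonalHyperbolicFamily n}

/-! ### The diagonal subgroup -/

theorem corner_inv_mem (i : SignedIndex n) (a : ((F.η i).idem.Corner)ˣ) :
    a.1.1 ∈ F.ring i i ∧ (a⁻¹).1.1 ∈ F.ring i i ∧ a.1.1 * (a⁻¹).1.1 = F.e i ∧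
      (a⁻¹).1.1 * a.1.1 = F.e i :=
  ⟨F.val_mem_ring i a, F.val_mem_ring i (a⁻¹).1, congrArg Subtype.val a.mul_inv,
    congrArg Subtype.val a.inv_mul⟩

theorem D_γ (i : SignedIndex n) (a : ((F.η i).idem.Corner)ˣ) :
    (F.D i a).γ = O.act (F.q (-i)) (star (a⁻¹).1.1 - F.e (-i)) + O.act (F.q i) (a.1.1 - F.e i)
      + -O.φ (a.1.1 - F.e i) := by
  rw [← q'_η, ← e'_η]; rfl

theorem D_app (i : SignedIndex n) (a : ((F.η i).idem.Corner)ˣ) (x : Δ) :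
    (F.D i a).app x = O.act (F.q (-i)) ((star (a⁻¹).1.1 - F.e (-i)) * (F.e (-i) * O.π x))
      + O.act (F.q i) ((a.1.1 - F.e i) * (F.e i * O.π x))
      + -O.φ (star (F.e (-i) * O.π x) * (a.1.1 - F.e i) * (F.e i * O.π x)) + x := by
  obtain ⟨h1, h2, -, -⟩ := corner_inv_mem i a
  have h3 : star (a⁻¹).1.1 - F.e (-i) = (star (a⁻¹).1.1 - F.e (-i)) * F.e (-i) := by
    rw [sub_mul, F.e_idem, mul_e (F.star_mem h2)]
  have h4 : a.1.1 - F.e i = (a.1.1 - F.e i) * F.e i := by rw [sub_mul, F.e_idem, mul_e h1]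
  have h5 : a.1.1 - F.e i = F.e i * ((a.1.1 - F.e i) * F.e i) := by
    rw [← h4, mul_sub, F.e_idem, e_mul h1]
  rw [Unitary.app, D_γ, O.add_act, O.add_act, O.neg_act, O.φ_act, ← O.act_mul, ← O.act_mul]
  rw [← mul_assoc _ (F.e (-i)) (O.π x), ← h3, ← mul_assoc _ (F.e i) (O.π x), ← h4,
    star_mul, F.star_e, neg_neg, ← mul_assoc _ (F.e i) (O.π x), mul_assoc _ _ (F.e i), mul_assoc _ (F.e i), ← h5]

theorem D_app_of_mul (i : SignedIndex n) (a : ((F.η i).idem.Corner)ˣ) {x : Δ}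
    (h1 : F.e i * O.π x = 0) (h2 : F.e (-i) * O.π x = 0) : (F.D i a).app x = x := by
  rw [D_app, h1, h2]
  simp [O.act_zero, O.φ_zero]

theorem D_app_q (i : SignedIndex n) (a : ((F.η i).idem.Corner)ˣ) :
    (F.D i a).app (F.q i) = O.act (F.q i) a.1.1 := by
  obtain ⟨h1, -, -, -⟩ := corner_inv_mem i a
  rw [D_app, π_q, F.e_mul_e (neg_ne_self i), F.e_idem, sub_mul a.1.1, mul_e h1, F.e_idem, mul_zero,
    O.act_zero, star_zero, zero_mul, zero_mul, O.φ_zero, neg_zero, add_zero, zero_add]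
  conv_lhs => rhs; rw [← F.q_act_e]
  rw [← O.act_add_of_ρ_eq_zero (F.ρ_q i), sub_add_cancel]

theorem D_app_q_neg (i : SignedIndex n) (a : ((F.η i).idem.Corner)ˣ) :
    (F.D i a).app (F.q (-i)) = O.act (F.q (-i)) (star (a⁻¹).1.1) := by
  obtain ⟨-, h1, -, -⟩ := corner_inv_mem i a
  rw [D_app, π_q, F.e_mul_e (ne_neg_self i), F.e_idem, sub_mul, mul_e (F.star_mem h1), F.e_idem,
    mul_zero, mul_zero, O.act_zero, O.φ_zero, neg_zero, add_zero, add_zero]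
  conv_lhs => rhs; rw [← F.q_act_e]
  rw [← O.act_add_of_ρ_eq_zero (F.ρ_q _), sub_add_cancel]

theorem D_app_q_of_apart {i k : SignedIndex n} (h : Apart i k) (a : ((F.η i).idem.Corner)ˣ) :
    (F.D i a).app (F.q k) = F.q k :=
  D_app_of_mul i a (by rw [π_q, F.e_mul_e h.1]) (by rw [π_q, F.e_mul_e h.neg_left.1])

theorem D_mem_levi (i : SignedIndex n) (a : ((F.η i).idem.Corner)ˣ) : F.D i a ∈ F.levi := by
  obtain ⟨h1, h2, h3, h4⟩ := corner_inv_mem i a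
  have hi : F.LeviAt (F.D i a) i := ⟨_, h1, _, h2, h3, h4, D_app_q i a⟩
  intro k
  by_cases hik : Apart i k
  · exact LeviAt.of_fix (D_app_q_of_apart hik a)
  · rcases eq_or_eq_neg hik with h | h
    · rwa [← h]
    · have hk : k = -i := by rw [h, neg_neg]
      rw [hk]
      exact LeviAt.of_neg (by rwa [neg_neg]) (F.star_mem h2) (D_app_q_neg i a)

theorem star_eTot : star F.eTot = F.eTot := by
  rw [eTot_eq, star_sum]
  refine Finset.sum_congr rfl fun k _ => ?_
  rw [star_add, F.star_e, F.star_e, add_comm]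
  rfl

theorem eTot_mul_e (k : SignedIndex n) : F.eTot * F.e k = F.e k := by
  have := congrArg star (F.e_mul_eTot (-k))
  rwa [star_mul, star_eTot, F.star_e, neg_neg] at this

theorem D0_app_q {g : O.Unitary} (hg : g ∈ F.D0) (k : SignedIndex n) :
    g.app (F.q k) = F.q k := by
  rw [Unitary.app, π_q, ← F.eTot_mul_e k, O.act_mul, hg.2.2, O.zero_act, zero_add]

theorem D0_subset_levi : F.D0 ⊆ F.levi := fun _ hg k => LeviAt.of_fix (D0_app_q hg k)

theorem diag_le_levi : F.diag ≤ F.levi := by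
  rw [diag, Subgroup.closure_le]
  rintro _ (⟨i, a, rfl⟩ | h)
  · exact D_mem_levi i a
  · exact D0_subset_levi h

/-- By construction `leviAd` transports parameters, so each formula is a conjugation of
transvections in U, read off from the action of `D_i(a)` and of `D_0` on the vectors `q_k` and on
`Δ⁰_k`. -/
theorem isDiagonalAction_leviAd :
    F.IsDiagonalAction (F.leviAd.comp (Subgroup.inclusion diag_le_levi)) where
  ad1 i j k hjk a b hji hik := by
    rw [X2_eq]
    refine leviAd_S2 _ hjk b.2 b.2 ?_
    change F.D i a * F.t2 j k b * (F.D i a)⁻¹ = _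
    rw [t2, (T_conj_of_fix (D_app_q_of_apart hik a) (D_app_q_of_apart hik.neg_right a)
      (q_act_unip hjk b.2)).2, Unitary.app_act, D_app_q_of_apart hji.symm]
  ad2 g hg i j hij a := by
    rw [X2_eq]
    refine leviAd_S2 _ hij a.2 a.2 ?_
    change g * F.t2 i j a * g⁻¹ = _
    rw [t2, (T_conj_of_fix (D0_app_q hg j) (D0_app_q hg _) (q_act_unip hij a.2)).2,
      Unitary.app_act, D0_app_q hg]
  ad3 i j hij a b := by
    rw [X2_eq, X2_eq]
    refine leviAd_S2 _ hij b.2 (F.mul_mem (F.val_mem_ring i a) b.2) ?_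
    change F.D i a * F.t2 i j b * (F.D i a)⁻¹ = _
    rw [t2, (T_conj_of_fix (D_app_q_of_apart hij a) (D_app_q_of_apart hij.neg_right a)
      (q_act_unip hij b.2)).2, Unitary.app_act, D_app_q, ← O.act_mul, t2]
  ad4 i j a u hij := by
    rw [X1_eq]
    refine leviAd_S1 _ u.2 u.2 ?_
    change F.D i a * F.T j u * (F.D i a)⁻¹ = _
    rw [(T_conj_of_fix (D_app_q_of_apart hij a) (D_app_q_of_apart hij.neg_right a)
      (form_mem_unip u.2)).2, D_app_of_mul i a (e_mul_π u.2 _) (e_mul_π u.2 _)]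
  ad5 g hg i u := by
    rw [X1_eq, X1_eq]
    refine leviAd_S1 _ u.2 (F.D0_mem_form hg u.2) ?_
    exact (T_conj_of_fix (D0_app_q hg i) (D0_app_q hg _) (form_mem_unip u.2)).2
  ad6 i a u := by
    obtain ⟨h1, h2, h3, h4⟩ := corner_inv_mem i a
    rw [X1_eq, X1_eq]
    refine leviAd_S1 _ u.2 (F.act_mem u.2 h2) ?_
    change F.D i a * F.T i u * (F.D i a)⁻¹ = _
    rw [(T_conj h2 h3 (D_app_q i a) (D_app_q_neg i a) (form_mem_unip u.2)).2,
      D_app_of_mul i a (e_mul_π u.2 _) (e_mul_π u.2 _)]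

end OrthogonalHyperbolicFamily

end OddFormRing

theorem mainTheorem3 {R : Type u} {Δ : Type v} [NonUnitalRing R] [StarRing R] [AddGroup Δ]
    (O : OddFormRing R Δ) (n : ℕ) (hn : 3 ≤ n) (F : O.OrthogonalHyperbolicFamily n)
    (hR : IsSemiLocalNonUnital R) :
    ∃ st : F.StU →* O.Unitary, F.IsCanonicalMap st ∧
      ∃ ad : F.diag →* MulAut F.StU, F.IsDiagonalAction ad ∧
        ∃ act : O.Unitary →* MulAut F.StU,
          IsCrossedModule st act ∧
          (∀ p : F.StU ⋊[ad] F.diag,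
            act (st p.left * p.right) = MulAut.conj p.left * ad p.right) ∧
          ∀ act' : O.Unitary →* MulAut F.StU, IsCrossedModule st act' → act' = act := by
  obtain ⟨S, _, _, f, hf, hJ⟩ := hR
  obtain ⟨act, h⟩ := OddFormRing.OrthogonalHyperbolicFamily.exists_crossedModule hf
    (fun a => (hJ a).1) hn F
  refine ⟨F.st, F.isCanonicalMap_st, _,
    OddFormRing.OrthogonalHyperbolicFamily.isDiagonalAction_leviAd, act, h, fun p => ?_,
    fun act' h' => OddFormRing.OrthogonalHyperbolicFamily.act_unique h h' hn⟩
  -- The first factor acts by conjugation by the Peiffer identity; the second acts through `leviAd`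
  -- by perfectness of the Steinberg group.
  rw [map_mul]
  congr 1
  · ext x
    exact h.2 p.left x
  · exact OddFormRing.OrthogonalHyperbolicFamily.act_levi h hn
      ⟨p.right, OddFormRing.OrthogonalHyperbolicFamily.diag_le_levi p.right.2⟩
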